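/- **Setting.** Let $N\ge 0$ be an integer and let $q,c_0,c_1,c_2,c_3,c_4\in\mathbb C$ be non-zero. Fix square roots $\sqrt q,\sqrt{c_0},\dots,\sqrt{c_4}$ such that $$(\sqrt q)^{2N+3}\sqrt{c_0}\sqrt{c_1}\sqrt{c_2}\sqrt{c_3}\sqrt{c_4}=1 ,$$ so that $q^{2N+3}c_0c_1c_2c_3c_4=1$; all half-integer powers below are computed from these roots, e.g. $\sqrt{qc_i}=\sqrt q\sqrt{c_i}$, $(c_i/c_j)^{n/2}=(\sqrt{c_i}/\sqrt{c_j})^n$, $\sqrt{q^{2N+2}c_ic_jc_k}=q^{N+1}\sqrt{c_i}\sqrt{c_j}\sqrt{c_k}$. Assume $q^2\ne1$, $q,q^2,\dots,q^N\neq 1$ and $c_0,\dots,c_4\notin\{q^{-1},\dots,q^{-N}\}$. To each of five labels attach two products: $A:(c_1c_2,\,c_4c_0)$; $B:(c_4c_0,\,c_2c_3)$; $C:(c_2c_3,\,c_0c_1)$; $D:(c_0c_1,\,c_3c_4)$; $E:(c_3c_4,\,c_1c_2)$. Call a label *admissible* if its two products are not in $\{q^{-2},q^{-3},\dots,q^{-2N}\}$.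 **Coefficients.** In this paragraph and the next the parameters are arbitrary placeholders $a,b,c,d$. Put $(x;q)_n=\prod_{l=0}^{n-1}(1-xq^l)$, $\lambda(x;c)=-(1-q^{-x})(1-cq^{x+1})$ and $\xi_n(a,b)=\frac{(qa;q)_n}{(qb;q)_n}(b/a)^{n/2}$. For integers $M,n$ put $$\Phi^+(n;a,b,c;M)=\tfrac{-bq^{n-M}(1-q^n)(1-aq^{M-n+1})(1-bcq^{n+M+1})(1-cq^n)}{(1-bcq^{2n})(1-bcq^{2n+1})},\qquad \Phi^-(n;a,b,c;M)=\tfrac{(1-q^{n-M})(1-abcq^{n+M+2})(1-bq^{n+1})(1-bcq^{n+1})}{(1-bcq^{2n+1})(1-bcq^{2n+2})},$$ $\Phi^0=-\Phi^+-\Phi^-$; $$\Phi_+^+=-\sqrt{qb}\,b\,q^{2n-M-1}\tfrac{(1-q^n)(1-aq^{M-n+1})(1-aq^{M+2-n})(1-cq^n)}{(1-bcq^{2n})(1-bcq^{2n+1})},\qquad \Phi_+^-=-\tfrac{(1-abcq^{n+M+2})(1-abcq^{n+M+3})(1-bq^{n+1})(1-bcq^{n+1})}{cq^{M+1}\sqrt{qb}(1-bcq^{2n+1})(1-bcq^{2n+2})},$$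 $$\Phi_+^0=-\Phi_+^+-\Phi_+^--\tfrac{(1-abq^{M+2})(1-abcq^{M+2})}{cq^{M+1}\sqrt{qb}};$$ $$\Phi_-^+=-\sqrt{qb}\,\tfrac{(1-q^n)(1-cq^n)(1-bcq^{n+M})(1-bcq^{n+M+1})}{q^M(1-bcq^{2n})(1-bcq^{2n+1})},\qquad \Phi_-^-=-c\sqrt{qb}\,q^M\tfrac{(1-q^{n-M})(1-q^{n-M+1})(1-bq^{n+1})(1-bcq^{n+1})}{(1-bcq^{2n+1})(1-bcq^{2n+2})},$$ $$\Phi_-^0=-\Phi_-^+-\Phi_-^--\sqrt{qb}(1-cq^M)(q^{-M}-1)$$ (arguments $(n;a,b,c;M)$ throughout). Put $$F_x^-(a,b)=abq^{x+1}\tfrac{(1-bq^{x+1})(1-abq^{x+1})}{(1-abq^{2x+1})(1-abq^{2x+2})},\qquad F_x^+(a,b)=ab^2q^{x+1}\tfrac{(1-aq^x)(1-q^x)}{(1-abq^{2x})(1-abq^{2x+1})}.$$ With the fifth parameter $e$ defined by $q^{2N+3}abcde=1$, put, at arguments $(a,b,c,d;N)$, $$A_{i,j}^{\varepsilon,\pm}=-cq^{N+1}F_j^{\pm}(d,e)\,\Phi_{\pm}^{\varepsilon}(i;a,b,c;N-j)\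 (\varepsilon=0,\pm1),\qquad A_{i,j}^{\varepsilon,0}=cq^{N+1}\big(F_j^+(d,e)+F_j^-(d,e)\big)\Phi^\varepsilon(i;a,b,c;N-j)\ (\varepsilon=\pm1),$$ $$A^{0,0}_{i,j}=-\tfrac{(1-cq^{N+1-j})\sqrt{qb}}{1-abq^{N+2-j}}\sum_{\varepsilon=0,\pm1}A^{\varepsilon,+}_{i,j}-\tfrac{1-abq^{N+1-j}}{(1-cq^{N-j})\sqrt{qb}}\sum_{\varepsilon=0,\pm1}A^{\varepsilon,-}_{i,j}-\sum_{\varepsilon=\pm1}A^{\varepsilon,0}_{i,j}.$$ **$q$-Racah polynomials.** For $0\le n,x\le M$ let $p_n(x;a,b,c;M)=\Omega_n\cdot{}_4\phi_3\!\left({q^{-n},\,bcq^{n+1},\,q^{-x},\,abq^{x+1}\atop qb,\,abcq^{M+2},\,q^{-M}};q,q\right)$, where $$\Omega_n=\frac{(q;q)_M}{(q;q)_n(q;q)_{M-n}}\cdot\frac{(1-bcq^{2n+1})(qb;q)_n(abcq^{M+2};q)_n(qa;q)_{M-n}}{(\sqrt{qb})^{2n-M}(bcq^{n+1};q)_{M+1}(qc;q)_n}.$$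 In all these formulas removable singularities (apparent poles, in which a vanishing denominator cancels, possibly after using $q^{2N+3}abcde=1$) are understood to be removed. **The five sets of matrices.** Rows and columns are indexed by pairs $(i,j)$ of non-negative integers with $i+j\le N$. For labels $\alpha,\beta,\gamma,\delta\in\{0,\dots,4\}$ define matrices whose only non-zero entries, for $\varepsilon,\varepsilon'\in\{0,\pm1\}$, are - $\Delta^{1}(\alpha\beta)$: $\lambda(i;c_\alpha c_\beta)$ at $(i,j);(i,j)$; $\quad\Delta^{2}(\alpha\beta)$: $\lambda(j;c_\alpha c_\beta)$ at $(i,j);(i,j)$; - $T^{2}(\alpha\beta\gamma)$: $\Phi^{\varepsilon}(j;c_\alpha,c_\beta,c_\gamma;N-i)$ at $(i,j-\varepsilon);(i,j)$; - $T^{1}(\alpha\beta\gamma|\delta)$: $\Phi^{\varepsilon'}(i;c_\alpha,c_\beta,c_\gamma;N-j)\,(c_\alpha/c_\delta)^{\varepsilon'/2}\,\xi_i(c_\beta,c_\gamma)/\xi_{i-\varepsilon'}(c_\beta,c_\gamma)$ at $(i-\varepsilon',j);(i,j)$; - $Z(\alpha\beta\gamma\delta)$: $A_{j,i}^{\varepsilon,\varepsilon'}(c_\alpha,c_\beta,c_\gamma,c_\delta;N)$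 at $(i-\varepsilon',j-\varepsilon);(i,j)$ (the fifth parameter is then the remaining $c$). The five sets are - $A_{12}=\Delta^1(12)$, $A_{123}=\Delta^2(40)$, $A_{34}=T^2(340)$, $A_{23}=T^1(321|0)$, $A_{234}=Z(3402)$; - $B_{123}=\Delta^1(40)$, $B_{23}=\Delta^2(23)$, $B_{12}=T^2(123)$, $B_{234}=T^1(104|3)$, $B_{34}=Z(1230)$; - $C_{23}=\Delta^1(23)$, $C_{234}=\Delta^2(01)$, $C_{123}=T^2(401)$, $C_{34}=T^1(432|1)$, $C_{12}=Z(4013)$; - $D_{234}=\Delta^1(01)$, $D_{34}=\Delta^2(34)$, $D_{23}=T^2(234)$, $D_{12}=T^1(210|4)$, $D_{123}=Z(2341)$; - $E_{34}=\Delta^1(34)$, $E_{12}=\Delta^2(12)$, $E_{234}=T^2(012)$, $E_{123}=T^1(043|2)$, $E_{23}=Z(0124)$. **The algebra.** With $[Y,Z]_{\mathsf q}=\mathsf qYZ-\mathsf q^{-1}ZY$, the algebra $\mathbf{aw}(4)$ with parameter $\mathsf q$ is the unital associative $\mathbb C$-algebra generated by $C_I$, $I\in\{1,2,3,4,12,23,34,123,234,1234\}$.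 For $(I,J,K)$ in $$\mathcal S=\{(1,2,3),(2,3,4),(1,23,4),(12,3,4),(1,2,34),(3,2,1),(4,3,2),(4,23,1),(4,3,12),(34,2,1)\}$$ put $C_{IK}=-\frac{[C_{IJ},C_{JK}]_{\mathsf q}}{\mathsf q^2-\mathsf q^{-2}}+\frac{C_IC_K+C_JC_{IJK}}{\mathsf q+\mathsf q^{-1}}$, where the order inside the indices $IJ,JK,IJK$ is irrelevant while $C_{13}\ne C_{31}$, etc. The relations are: (i) $[C_I,C_J]=0$ if $I\cap J=\emptyset$ or $I\subset J$; (ii) $C_{IJ}=-\frac{[C_{JK},C_{IK}]_{\mathsf q}}{\mathsf q^2-\mathsf q^{-2}}+\frac{C_IC_J+C_KC_{IJK}}{\mathsf q+\mathsf q^{-1}}$ for $(I,J,K)\in\mathcal S$; (iii) $C_{14}=-\frac{[C_{13},C_{34}]_{\mathsf q}}{\mathsf q^2-\mathsf q^{-2}}+\frac{C_1C_4+C_3C_{134}}{\mathsf q+\mathsf q^{-1}}$ and $C_{41}=-\frac{[C_{42},C_{12}]_{\mathsf q}}{\mathsf q^2-\mathsf q^{-2}}+\frac{C_1C_4+C_2C_{412}}{\mathsf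 q+\mathsf q^{-1}}$. **Claims.** 0. The matrices have size $\binom{N+2}{2}$. 1. For every admissible label $X\in\{A,B,C,D,E\}$ there is a unique homomorphism of unital algebras from $\mathbf{aw}(4)$ with parameter $\mathsf q=\sqrt q$ to the $\binom{N+2}2\times\binom{N+2}2$ matrices with $C_i\mapsto\sqrt{c_i}+\frac1{\sqrt{c_i}}$ ($1\le i\le4$), $C_{1234}\mapsto\sqrt{c_0}+\frac1{\sqrt{c_0}}$ (multiples of the identity), $C_{ij}\mapsto\frac1{\sqrt{qc_ic_j}}X_{ij}+\sqrt{qc_ic_j}+\frac1{\sqrt{qc_ic_j}}$ for $ij=12,23,34$, and $C_{ijk}\mapsto\sqrt{q^{2N+2}c_ic_jc_k}\,X_{ijk}+\sqrt{q^{2N+2}c_ic_jc_k}+\frac1{\sqrt{q^{2N+2}c_ic_jc_k}}$ for $ijk=123,234$. This representation is irreducible. 2. Define, at row $(i_1,i_2)$ and column $(j_1,j_2)$, $U(\alpha\beta\gamma|\delta)=\delta_{i_2,j_1}(c_\delta/c_\alpha)^{i_1/2}\,\xi_{i_1}(c_\gamma,c_\beta)\,p_{i_1}(j_2;c_\alpha,c_\beta,c_\gamma;N-i_2)$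 and $V(\alpha\beta\gamma|\delta)=\delta_{i_1,j_2}(c_\gamma/c_\delta)^{j_1/2}\,\xi_{j_1}(c_\beta,c_\alpha)\,p_{i_2}(j_1;c_\alpha,c_\beta,c_\gamma;N-j_2)$, and put $P_{AB}=U(321|0)$, $P_{BC}=U(104|3)$, $P_{CD}=U(432|1)$, $P_{DE}=U(210|4)$, $P_{EA}=U(043|2)$, $P_{BA}=V(123|0)$, $P_{CB}=V(401|3)$, $P_{DC}=V(234|1)$, $P_{ED}=V(012|4)$, $P_{AE}=V(340|2)$. For cyclically consecutive admissible labels $X,Y$ (that is, $XY=AB,BC,CD,DE,EA$), $P_{XY}P_{YX}=P_{YX}P_{XY}=1$ and $P_{XY}Y_I=X_IP_{XY}$ for $I\in\{12,23,34,123,234\}$. 3. The representations attached to any two admissible labels are equivalent: they are intertwined by an invertible matrix. -/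

import Mathlib

noncomputable section

namespace QRacahAW4

/-! ### Univariate `q`-Racah polynomials and their structure coefficients

Half-integer powers are never left to a branch convention: a function in which the square root
of `q c₂` occurs takes that root as an argument `r`. -/

/-- The `q`-Pochhammer symbol `(a;q)_n`. -/
def qPoch (q a : ℂ) (n : ℕ) : ℂ := ∏ l ∈ Finset.range n, (1 - a * q ^ l)

/-- The `q`-binomial coefficient, zero for `n > N`. -/
def qBinom (q : ℂ) (N n : ℕ) : ℂ :=
  if n ≤ N then qPoch q q N / (qPoch q q n * qPoch q q (N - n)) else 0

/-- The terminating series `₄φ₃(q^{-n}, a₂, a₃, a₄; b₁, b₂, b₃; q, z)`. -/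
def phi43 (q : ℂ) (n : ℕ) (a₂ a₃ a₄ b₁ b₂ b₃ z : ℂ) : ℂ :=
  ∑ k ∈ Finset.range (n + 1),
    (qPoch q (q ^ (-(n : ℤ))) k * qPoch q a₂ k * qPoch q a₃ k * qPoch q a₄ k) /
      (qPoch q b₁ k * qPoch q b₂ k * qPoch q b₃ k) * (z ^ k / qPoch q q k)

/-- The quotient `(1 - c q^a) / (1 - c q^b)`, read as `1` when the two factors are literally the
same. It implements the cancellation of the apparent poles of the coefficients below. -/
def cancelRatio (q c : ℂ) (a b : ℤ) : ℂ :=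
  if a = b then 1 else (1 - c * q ^ a) / (1 - c * q ^ b)

theorem cancelRatio_eq {q c : ℂ} {a b : ℤ} (h : 1 - c * q ^ b ≠ 0) :
    cancelRatio q c a b = (1 - c * q ^ a) / (1 - c * q ^ b) := by
  unfold cancelRatio
  split_ifs with hab
  · subst hab; exact (div_self h).symm
  · rfl

/-- The normalization `Ω(n; c₁, c₂, c₃; N)`, with `r = √(q c₂)`. The quotient
`(1 - c₂c₃q^{2n+1}) / (c₂c₃q^{n+1};q)_{N+1}` is written with its common factor cancelled
(see `racahOmega_eq`). -/
def racahOmega (q r c₁ c₂ c₃ : ℂ) (N n : ℕ) : ℂ :=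
  qBinom q N n * (qPoch q (q * c₂) n * qPoch q (c₁ * c₂ * c₃ * q ^ (N + 2)) n *
      qPoch q (q * c₁) (N - n)) /
    (r ^ (2 * (n : ℤ) - N) *
      (∏ l ∈ (Finset.range (N + 1)).erase n, (1 - c₂ * c₃ * q ^ (n + 1) * q ^ l)) *
      qPoch q (q * c₃) n)

/-- The normalized `q`-Racah polynomial `p_n(x; c₁, c₂, c₃; N)`, with `r = √(q c₂)`; it is zero
for `n > N` or `x > N`. -/
def racahP (q r c₁ c₂ c₃ : ℂ) (N n x : ℕ) : ℂ :=
  if n ≤ N ∧ x ≤ N then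
    racahOmega q r c₁ c₂ c₃ N n *
      phi43 q n (c₂ * c₃ * q ^ (n + 1)) (q ^ (-(x : ℤ))) (c₁ * c₂ * q ^ (x + 1))
        (q * c₂) (c₁ * c₂ * c₃ * q ^ (N + 2)) (q ^ (-(N : ℤ))) q
  else 0

/-- `λ(x; c) = -(1 - q^{-x})(1 - c q^{x+1})`. -/
def lam (q c : ℂ) (x : ℤ) : ℂ := -(1 - q ^ (-x)) * (1 - c * q ^ (x + 1))

/-- `Φ⁺(n; c₁, c₂, c₃; N)`. -/
def PhiPlus (q c₁ c₂ c₃ : ℂ) (N n : ℤ) : ℂ :=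
  -c₂ * q ^ (n - N) * (1 - q ^ n) * (1 - c₁ * q ^ (N - n + 1)) * (1 - c₃ * q ^ n) /
      (1 - c₂ * c₃ * q ^ (2 * n)) *
    cancelRatio q (c₂ * c₃) (n + N + 1) (2 * n + 1)

/-- `Φ⁻(n; c₁, c₂, c₃; N)`. -/
def PhiMinus (q c₁ c₂ c₃ : ℂ) (N n : ℤ) : ℂ :=
  (1 - q ^ (n - N)) * (1 - c₁ * c₂ * c₃ * q ^ (n + N + 2)) * (1 - c₂ * q ^ (n + 1)) /
      (1 - c₂ * c₃ * q ^ (2 * n + 2)) *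
    cancelRatio q (c₂ * c₃) (n + 1) (2 * n + 1)

/-- `Φ^ε(n; c₁, c₂, c₃; N)` for `ε ∈ {1, 0, -1}` (and zero for other integers `ε`). -/
def Phi (ε : ℤ) (q c₁ c₂ c₃ : ℂ) (N n : ℤ) : ℂ :=
  if ε = 1 then PhiPlus q c₁ c₂ c₃ N n
  else if ε = -1 then PhiMinus q c₁ c₂ c₃ N n
  else if ε = 0 then -PhiPlus q c₁ c₂ c₃ N n - PhiMinus q c₁ c₂ c₃ N n
  else 0

/-- `Φ₊⁺(n; c₁, c₂, c₃; N)`, with `r = √(q c₂)`. The functions `Φ₊^ε`, `Φ₋^ε` are the coefficients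
of the contiguity relations between `N` and `N ± 1`. -/
def PhiUpPlus (q r c₁ c₂ c₃ : ℂ) (N n : ℤ) : ℂ :=
  -r * c₂ * q ^ (2 * n - N - 1) *
    ((1 - q ^ n) * (1 - c₁ * q ^ (N - n + 1)) * (1 - c₁ * q ^ (N + 2 - n)) * (1 - c₃ * q ^ n)) /
    ((1 - c₂ * c₃ * q ^ (2 * n)) * (1 - c₂ * c₃ * q ^ (2 * n + 1)))

/-- `Φ₊⁻(n; c₁, c₂, c₃; N)`, with `r = √(q c₂)`. -/
def PhiUpMinus (q r c₁ c₂ c₃ : ℂ) (N n : ℤ) : ℂ :=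
  -((1 - c₁ * c₂ * c₃ * q ^ (n + N + 2)) * (1 - c₁ * c₂ * c₃ * q ^ (n + N + 3)) *
      (1 - c₂ * q ^ (n + 1))) /
      (c₃ * q ^ (N + 1) * r * (1 - c₂ * c₃ * q ^ (2 * n + 2))) *
    cancelRatio q (c₂ * c₃) (n + 1) (2 * n + 1)

/-- `Φ₊^ε(n; c₁, c₂, c₃; N)`, with `r = √(q c₂)`. -/
def PhiUp (ε : ℤ) (q r c₁ c₂ c₃ : ℂ) (N n : ℤ) : ℂ :=
  if ε = 1 then PhiUpPlus q r c₁ c₂ c₃ N n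
  else if ε = -1 then PhiUpMinus q r c₁ c₂ c₃ N n
  else if ε = 0 then
    -PhiUpPlus q r c₁ c₂ c₃ N n - PhiUpMinus q r c₁ c₂ c₃ N n -
      (1 - c₁ * c₂ * q ^ (N + 2)) * (1 - c₁ * c₂ * c₃ * q ^ (N + 2)) / (c₃ * q ^ (N + 1) * r)
  else 0

/-- `Φ₋⁺(n; c₁, c₂, c₃; N)` (independent of `c₁`), with `r = √(q c₂)`. -/
def PhiDownPlus (q r c₂ c₃ : ℂ) (N n : ℤ) : ℂ :=
  -r * ((1 - q ^ n) * (1 - c₃ * q ^ n) * (1 - c₂ * c₃ * q ^ (n + N))) /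
      (q ^ N * (1 - c₂ * c₃ * q ^ (2 * n))) *
    cancelRatio q (c₂ * c₃) (n + N + 1) (2 * n + 1)

/-- `Φ₋⁻(n; c₁, c₂, c₃; N)` (independent of `c₁`), with `r = √(q c₂)`. -/
def PhiDownMinus (q r c₂ c₃ : ℂ) (N n : ℤ) : ℂ :=
  -c₃ * r * q ^ N *
      ((1 - q ^ (n - N)) * (1 - q ^ (n - N + 1)) * (1 - c₂ * q ^ (n + 1))) /
      (1 - c₂ * c₃ * q ^ (2 * n + 2)) *
    cancelRatio q (c₂ * c₃) (n + 1) (2 * n + 1)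

/-- `Φ₋^ε(n; c₁, c₂, c₃; N)`, with `r = √(q c₂)`. -/
def PhiDown (ε : ℤ) (q r _c₁ c₂ c₃ : ℂ) (N n : ℤ) : ℂ :=
  if ε = 1 then PhiDownPlus q r c₂ c₃ N n
  else if ε = -1 then PhiDownMinus q r c₂ c₃ N n
  else if ε = 0 then
    -PhiDownPlus q r c₂ c₃ N n - PhiDownMinus q r c₂ c₃ N n -
      r * (1 - c₃ * q ^ N) * (q ^ (-N) - 1)
  else 0

/-- `F⁻_x(c₁, c₂)`. -/
def FMinus (q c₁ c₂ : ℂ) (x : ℤ) : ℂ :=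
  c₁ * c₂ * q ^ (x + 1) * (1 - c₂ * q ^ (x + 1)) / (1 - c₁ * c₂ * q ^ (2 * x + 2)) *
    cancelRatio q (c₁ * c₂) (x + 1) (2 * x + 1)

/-- `F⁺_x(c₁, c₂)`. -/
def FPlus (q c₁ c₂ : ℂ) (x : ℤ) : ℂ :=
  c₁ * c₂ ^ 2 * q ^ (x + 1) * ((1 - c₁ * q ^ x) * (1 - q ^ x)) /
    ((1 - c₁ * c₂ * q ^ (2 * x)) * (1 - c₁ * c₂ * q ^ (2 * x + 1)))

/-- The product `F⁺_N(c₄, c₀) Φ₊^ε(0; c₁, c₂, c₃; 0)` with its common factor cancelled: the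
denominator of `F⁺_N(c₄, c₀)` contains `1 - c₀c₄q^{2N+1}`, which by `q^{2N+3}c₀c₁c₂c₃c₄ = 1`
is a multiple of the factor `1 - c₁c₂c₃q²` of `Φ₊^ε(0; c₁, c₂, c₃; 0)`
(see `cornerProd_eq`). -/
def cornerProd (ε : ℤ) (q r c₁ c₂ c₃ c₄ c₀ : ℂ) (N : ℤ) : ℂ :=
  -c₀ * q ^ (-N) * ((1 - c₄ * q ^ N) * (1 - q ^ N)) / (1 - c₄ * c₀ * q ^ (2 * N)) *
    (if ε = -1 then
      -((1 - c₁ * c₂ * c₃ * q ^ 3) * (1 - c₂ * q)) / (c₃ * q * r * (1 - c₂ * c₃ * q ^ 2))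
    else if ε = 0 then
      (1 - c₁ * c₂ * c₃ * q ^ 3) * (1 - c₂ * q) / (c₃ * q * r * (1 - c₂ * c₃ * q ^ 2)) -
        (1 - c₁ * c₂ * q ^ 2) / (c₃ * q * r)
    else 0)

/-- `A_{i,j}^{ε,+}(c₁, c₂, c₃, c₄; N) = -c₃ q^{N+1} F⁺_j(c₄, c₀) Φ₊^ε(i; c₁, c₂, c₃; N - j)`. In
these coefficients `c₀` is the fifth parameter, given by `q^{2N+3}c₀c₁c₂c₃c₄ = 1`, and
`r = √(q c₂)`. -/
def coefAPlus (ε : ℤ) (q r c₁ c₂ c₃ c₄ c₀ : ℂ) (N i j : ℤ) : ℂ :=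
  -c₃ * q ^ (N + 1) *
    (if j = N then cornerProd ε q r c₁ c₂ c₃ c₄ c₀ N
    else FPlus q c₄ c₀ j * PhiUp ε q r c₁ c₂ c₃ (N - j) i)

/-- `A_{i,j}^{ε,-}(c₁, c₂, c₃, c₄; N)`. -/
def coefAMinus (ε : ℤ) (q r c₁ c₂ c₃ c₄ c₀ : ℂ) (N i j : ℤ) : ℂ :=
  -c₃ * q ^ (N + 1) * (FMinus q c₄ c₀ j * PhiDown ε q r c₁ c₂ c₃ (N - j) i)

/-- `A_{i,j}^{ε,0}(c₁, c₂, c₃, c₄; N)` for `ε = ±1`. -/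
def coefAZero (ε : ℤ) (q c₁ c₂ c₃ c₄ c₀ : ℂ) (N i j : ℤ) : ℂ :=
  c₃ * q ^ (N + 1) * (FPlus q c₄ c₀ j + FMinus q c₄ c₀ j) * Phi ε q c₁ c₂ c₃ (N - j) i

/-- `A_{i,j}^{ε,ε'}(c₁, c₂, c₃, c₄; N)`. The coefficient for `ε = ε' = 0` is written with the
apparent poles cancelled; `coefA_zero_zero` gives the equivalent expression
`-(1 - c₃q^{N+1-j})√(qc₂)/(1 - c₁c₂q^{N+2-j}) ∑_ε A_{i,j}^{ε,+}
 - (1 - c₁c₂q^{N+1-j})/((1 - c₃q^{N-j})√(qc₂)) ∑_ε A_{i,j}^{ε,-} - ∑_{ε=±} A_{i,j}^{ε,0}`. -/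
def coefA (ε ε' : ℤ) (q r c₁ c₂ c₃ c₄ c₀ : ℂ) (N i j : ℤ) : ℂ :=
  if ε' = 1 then coefAPlus ε q r c₁ c₂ c₃ c₄ c₀ N i j
  else if ε' = -1 then coefAMinus ε q r c₁ c₂ c₃ c₄ c₀ N i j
  else if ε' = 0 then
    if ε = 0 then
      Phi 0 q c₃ c₀ c₄ N j -
        coefAZero 1 q c₁ c₂ c₃ c₄ c₀ N i j - coefAZero (-1) q c₁ c₂ c₃ c₄ c₀ N i j
    else coefAZero ε q c₁ c₂ c₃ c₄ c₀ N i j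
  else 0

/-- `ξ_n(c₁, c₂) = (q c₁;q)_n / (q c₂;q)_n (c₂/c₁)^{n/2}` with `c₁ = u₁²`, `c₂ = u₂²` and
`√(c₂/c₁) = u₂/u₁`. -/
def xi (q u₁ u₂ : ℂ) (n : ℕ) : ℂ :=
  qPoch q (q * u₁ ^ 2) n / qPoch q (q * u₂ ^ 2) n * (u₂ / u₁) ^ n

/-! ### The five sets of matrices

`p = √q` and `s i = √(c_i)`, so that `q = p²`, `c_i = (s i)²`. In the templates below the
arguments `a b c d e : Fin 5` are the labels of the parameters in use. An entry in row `(k,l)`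
and column `(i,j)` has `ε' = i - k` and `ε = j - l`. -/

/-- The index set `{(i,j) | i, j ≥ 0, i + j ≤ N}`. -/
abbrev Idx (N : ℕ) : Type := {x : Fin (N + 1) × Fin (N + 1) // (x.1 : ℕ) + (x.2 : ℕ) ≤ N}

/-- First coordinate of an index. -/
def Idx.fst {N : ℕ} (x : Idx N) : ℕ := (x.1.1 : ℕ)

/-- Second coordinate of an index. -/
def Idx.snd {N : ℕ} (x : Idx N) : ℕ := (x.1.2 : ℕ)

abbrev Mat (N : ℕ) : Type := Matrix (Idx N) (Idx N) ℂ

/-- Diagonal matrix with entries `λ(i; c_a c_b)`. -/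
def diagFst (N : ℕ) (p : ℂ) (s : Fin 5 → ℂ) (a b : Fin 5) : Mat N :=
  Matrix.diagonal fun x => lam (p ^ 2) (s a ^ 2 * s b ^ 2) x.fst

/-- Diagonal matrix with entries `λ(j; c_a c_b)`. -/
def diagSnd (N : ℕ) (p : ℂ) (s : Fin 5 → ℂ) (a b : Fin 5) : Mat N :=
  Matrix.diagonal fun x => lam (p ^ 2) (s a ^ 2 * s b ^ 2) x.snd

/-- Entries `Φ^ε(j; c_a, c_b, c_c; N - i)` at `(i, j-ε); (i, j)`. -/
def triSnd (N : ℕ) (p : ℂ) (s : Fin 5 → ℂ) (a b c : Fin 5) : Mat N :=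
  Matrix.of fun y x =>
    if y.fst = x.fst then
      Phi ((x.snd : ℤ) - y.snd) (p ^ 2) (s a ^ 2) (s b ^ 2) (s c ^ 2) ((N : ℤ) - x.fst) x.snd
    else 0

/-- Entries `Φ^{ε'}(i; c_a, c_b, c_c; N - j) (c_a/c_d)^{ε'/2} ξ_i(c_b, c_c) / ξ_{i-ε'}(c_b, c_c)`
at `(i-ε', j); (i, j)`. -/
def triFst (N : ℕ) (p : ℂ) (s : Fin 5 → ℂ) (a b c d : Fin 5) : Mat N :=
  Matrix.of fun y x =>
    if y.snd = x.snd then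
      Phi ((x.fst : ℤ) - y.fst) (p ^ 2) (s a ^ 2) (s b ^ 2) (s c ^ 2) ((N : ℤ) - x.snd) x.fst *
        (s a / s d) ^ ((x.fst : ℤ) - y.fst) *
        (xi (p ^ 2) (s b) (s c) x.fst / xi (p ^ 2) (s b) (s c) y.fst)
    else 0

/-- Entries `A_{j,i}^{ε,ε'}(c_a, c_b, c_c, c_d; N)` at `(i-ε', j-ε); (i, j)`, where `e` is the
label of the fifth parameter. -/
def nineDiag (N : ℕ) (p : ℂ) (s : Fin 5 → ℂ) (a b c d e : Fin 5) : Mat N :=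
  Matrix.of fun y x =>
    if |(x.fst : ℤ) - y.fst| ≤ 1 ∧ |(x.snd : ℤ) - y.snd| ≤ 1 then
      coefA ((x.snd : ℤ) - y.snd) ((x.fst : ℤ) - y.fst) (p ^ 2) (p * s b)
        (s a ^ 2) (s b ^ 2) (s c ^ 2) (s d ^ 2) (s e ^ 2) N x.snd x.fst
    else 0

/-- The five labels `12, 23, 34, 123, 234`. -/
inductive Mid where
  | m12 | m23 | m34 | m123 | m234

/-- The matrices `A_I`. -/
def matA (N : ℕ) (p : ℂ) (s : Fin 5 → ℂ) : Mid → Mat N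
  | .m12 => diagFst N p s 1 2
  | .m123 => diagSnd N p s 4 0
  | .m34 => triSnd N p s 3 4 0
  | .m23 => triFst N p s 3 2 1 0
  | .m234 => nineDiag N p s 3 4 0 2 1

/-- The matrices `B_I`. -/
def matB (N : ℕ) (p : ℂ) (s : Fin 5 → ℂ) : Mid → Mat N
  | .m123 => diagFst N p s 4 0
  | .m23 => diagSnd N p s 2 3
  | .m12 => triSnd N p s 1 2 3
  | .m234 => triFst N p s 1 0 4 3
  | .m34 => nineDiag N p s 1 2 3 0 4

/-- The matrices `C_I`. -/
def matC (N : ℕ) (p : ℂ) (s : Fin 5 → ℂ) : Mid → Mat N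
  | .m23 => diagFst N p s 2 3
  | .m234 => diagSnd N p s 0 1
  | .m123 => triSnd N p s 4 0 1
  | .m34 => triFst N p s 4 3 2 1
  | .m12 => nineDiag N p s 4 0 1 3 2

/-- The matrices `D_I`. -/
def matD (N : ℕ) (p : ℂ) (s : Fin 5 → ℂ) : Mid → Mat N
  | .m234 => diagFst N p s 0 1
  | .m34 => diagSnd N p s 3 4
  | .m23 => triSnd N p s 2 3 4
  | .m12 => triFst N p s 2 1 0 4
  | .m123 => nineDiag N p s 2 3 4 1 0

/-- The matrices `E_I`. -/
def matE (N : ℕ) (p : ℂ) (s : Fin 5 → ℂ) : Mid → Mat N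
  | .m34 => diagFst N p s 3 4
  | .m12 => diagSnd N p s 1 2
  | .m234 => triSnd N p s 0 1 2
  | .m123 => triFst N p s 0 4 3 2
  | .m23 => nineDiag N p s 0 1 2 4 3

/-- Names of the five sets of matrices. -/
inductive Label where
  | A | B | C | D | E

/-- The matrices `X_I` for `X = A, B, C, D, E`. -/
def mat (N : ℕ) (p : ℂ) (s : Fin 5 → ℂ) : Label → Mid → Mat N
  | .A => matA N p s
  | .B => matB N p s
  | .C => matC N p s
  | .D => matD N p s
  | .E => matE N p s

/-- The cyclic successor `A → B → C → D → E → A`. -/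
def Label.next : Label → Label
  | .A => .B
  | .B => .C
  | .C => .D
  | .D => .E
  | .E => .A

/-! ### Change-of-basis matrices -/

/-- Entries `δ_{i₂,j₁} (c_d/c_a)^{i₁/2} ξ_{i₁}(c_c, c_b) p_{i₁}(j₂; c_a, c_b, c_c; N - i₂)` at
`(i₁,i₂); (j₁,j₂)`. -/
def chgUp (N : ℕ) (p : ℂ) (s : Fin 5 → ℂ) (a b c d : Fin 5) : Mat N :=
  Matrix.of fun x y =>
    if x.snd = y.fst then
      (s d / s a) ^ x.fst * xi (p ^ 2) (s c) (s b) x.fst *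
        racahP (p ^ 2) (p * s b) (s a ^ 2) (s b ^ 2) (s c ^ 2) (N - x.snd) x.fst y.snd
    else 0

/-- Entries `δ_{i₁,j₂} (c_c/c_d)^{j₁/2} ξ_{j₁}(c_b, c_a) p_{i₂}(j₁; c_a, c_b, c_c; N - j₂)` at
`(i₁,i₂); (j₁,j₂)`. -/
def chgDown (N : ℕ) (p : ℂ) (s : Fin 5 → ℂ) (a b c d : Fin 5) : Mat N :=
  Matrix.of fun x y =>
    if x.fst = y.snd then
      (s c / s d) ^ y.fst * xi (p ^ 2) (s b) (s a) y.fst *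
        racahP (p ^ 2) (p * s b) (s a ^ 2) (s b ^ 2) (s c ^ 2) (N - y.snd) x.snd y.fst
    else 0

/-- `P_{AB}, P_{BC}, P_{CD}, P_{DE}, P_{EA}` (the label is the first index). -/
def chg (N : ℕ) (p : ℂ) (s : Fin 5 → ℂ) : Label → Mat N
  | .A => chgUp N p s 3 2 1 0
  | .B => chgUp N p s 1 0 4 3
  | .C => chgUp N p s 4 3 2 1
  | .D => chgUp N p s 2 1 0 4
  | .E => chgUp N p s 0 4 3 2

/-- `P_{BA}, P_{CB}, P_{DC}, P_{ED}, P_{AE}` (the label is the second index). -/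
def chgInv (N : ℕ) (p : ℂ) (s : Fin 5 → ℂ) : Label → Mat N
  | .A => chgDown N p s 1 2 3 0
  | .B => chgDown N p s 4 0 1 3
  | .C => chgDown N p s 2 3 4 1
  | .D => chgDown N p s 0 1 2 4
  | .E => chgDown N p s 3 4 0 2

/-! ### The rank 2 Askey–Wilson algebra -/

/-- The connected sequences labelling the generators `C_I`. -/
inductive Gen where
  | g1 | g2 | g3 | g4 | g12 | g23 | g34 | g123 | g234 | g1234

/-- The underlying subset of `{1, 2, 3, 4}`. -/
def Gen.supp : Gen → Finset ℕ
  | .g1 => {1}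
  | .g2 => {2}
  | .g3 => {3}
  | .g4 => {4}
  | .g12 => {1, 2}
  | .g23 => {2, 3}
  | .g34 => {3, 4}
  | .g123 => {1, 2, 3}
  | .g234 => {2, 3, 4}
  | .g1234 => {1, 2, 3, 4}

/-- `-[Y, Z]_𝔮 / (𝔮² - 𝔮⁻²) + (U₁ U₂ + V₁ V₂) / (𝔮 + 𝔮⁻¹)`, where
`[Y, Z]_𝔮 = 𝔮 Y Z - 𝔮⁻¹ Z Y`. -/
def awExpr {R : Type*} [Ring R] [Algebra ℂ R] (𝔮 : ℂ) (Y Z U₁ U₂ V₁ V₂ : R) : R :=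
  -((1 / (𝔮 ^ 2 - (𝔮 ^ 2)⁻¹)) • (𝔮 • (Y * Z) - 𝔮⁻¹ • (Z * Y))) +
    (1 / (𝔮 + 𝔮⁻¹)) • (U₁ * U₂ + V₁ * V₂)

/-- The free generators. -/
abbrev gen (I : Gen) : FreeAlgebra ℂ Gen := FreeAlgebra.ι ℂ I

/-- The element `C_{IK}` attached to `(I, J, K)`; the arguments are
`I, J, K, IJ, JK, IJK`. -/
def outer (𝔮 : ℂ) (I J K IJ JK IJK : Gen) : FreeAlgebra ℂ Gen :=
  awExpr 𝔮 (gen IJ) (gen JK) (gen I) (gen K) (gen J) (gen IJK)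

/-- The ten triples `(I, J, K)` of the set `S`, each with the unions `IJ, JK, IJK`. -/
inductive Triple : Gen → Gen → Gen → Gen → Gen → Gen → Prop
  | t1_2_3 : Triple .g1 .g2 .g3 .g12 .g23 .g123
  | t2_3_4 : Triple .g2 .g3 .g4 .g23 .g34 .g234
  | t1_23_4 : Triple .g1 .g23 .g4 .g123 .g234 .g1234
  | t12_3_4 : Triple .g12 .g3 .g4 .g123 .g34 .g1234
  | t1_2_34 : Triple .g1 .g2 .g34 .g12 .g234 .g1234
  | t3_2_1 : Triple .g3 .g2 .g1 .g23 .g12 .g123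
  | t4_3_2 : Triple .g4 .g3 .g2 .g34 .g23 .g234
  | t4_23_1 : Triple .g4 .g23 .g1 .g234 .g123 .g1234
  | t4_3_12 : Triple .g4 .g3 .g12 .g34 .g123 .g1234
  | t34_2_1 : Triple .g34 .g2 .g1 .g234 .g12 .g1234

def C13 (𝔮 : ℂ) : FreeAlgebra ℂ Gen := outer 𝔮 .g1 .g2 .g3 .g12 .g23 .g123
def C14 (𝔮 : ℂ) : FreeAlgebra ℂ Gen := outer 𝔮 .g1 .g23 .g4 .g123 .g234 .g1234
def C134 (𝔮 : ℂ) : FreeAlgebra ℂ Gen := outer 𝔮 .g1 .g2 .g34 .g12 .g234 .g1234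
def C42 (𝔮 : ℂ) : FreeAlgebra ℂ Gen := outer 𝔮 .g4 .g3 .g2 .g34 .g23 .g234
def C41 (𝔮 : ℂ) : FreeAlgebra ℂ Gen := outer 𝔮 .g4 .g23 .g1 .g234 .g123 .g1234
def C412 (𝔮 : ℂ) : FreeAlgebra ℂ Gen := outer 𝔮 .g4 .g3 .g12 .g34 .g123 .g1234

/-- The defining relations of `aw(4)` with parameter `𝔮`. -/
inductive Rel (𝔮 : ℂ) : FreeAlgebra ℂ Gen → FreeAlgebra ℂ Gen → Prop
  | comm (I J : Gen) (h : Disjoint I.supp J.supp ∨ I.supp ⊆ J.supp) :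
      Rel 𝔮 (gen I * gen J) (gen J * gen I)
  | triple (I J K IJ JK IJK : Gen) (h : Triple I J K IJ JK IJK) :
      Rel 𝔮 (gen IJ)
        (awExpr 𝔮 (gen JK) (outer 𝔮 I J K IJ JK IJK) (gen I) (gen J) (gen K) (gen IJK))
  | c14 : Rel 𝔮 (C14 𝔮) (awExpr 𝔮 (C13 𝔮) (gen .g34) (gen .g1) (gen .g4) (gen .g3) (C134 𝔮))
  | c41 : Rel 𝔮 (C41 𝔮) (awExpr 𝔮 (C42 𝔮) (gen .g12) (gen .g1) (gen .g4) (gen .g2) (C412 𝔮))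

/-- The rank 2 Askey–Wilson algebra `aw(4)` with parameter `𝔮`. -/
abbrev AW4 (𝔮 : ℂ) : Type := RingQuot (Rel 𝔮)

/-- The generator `C_I` of `aw(4)`. -/
def AW4.C (𝔮 : ℂ) (I : Gen) : AW4 𝔮 := RingQuot.mkAlgHom ℂ (Rel 𝔮) (gen I)

/-! ### Representations -/

/-- The image of the generator `C_I` attached to a family of matrices `X_I`, with `p = √q` and
`s i = √(c_i)`; `p^{2N+2} s_i s_j s_k` is the square root of `q^{2N+2} c_i c_j c_k`. -/
def genImage (N : ℕ) (p : ℂ) (s : Fin 5 → ℂ) (X : Mid → Mat N) : Gen → Mat N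
  | .g1 => (s 1 + 1 / s 1) • 1
  | .g2 => (s 2 + 1 / s 2) • 1
  | .g3 => (s 3 + 1 / s 3) • 1
  | .g4 => (s 4 + 1 / s 4) • 1
  | .g12 => (1 / (p * s 1 * s 2)) • X .m12 + (p * s 1 * s 2 + 1 / (p * s 1 * s 2)) • 1
  | .g23 => (1 / (p * s 2 * s 3)) • X .m23 + (p * s 2 * s 3 + 1 / (p * s 2 * s 3)) • 1
  | .g34 => (1 / (p * s 3 * s 4)) • X .m34 + (p * s 3 * s 4 + 1 / (p * s 3 * s 4)) • 1
  | .g123 => (p ^ (2 * N + 2) * s 1 * s 2 * s 3) • X .m123 +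
      (p ^ (2 * N + 2) * s 1 * s 2 * s 3 + 1 / (p ^ (2 * N + 2) * s 1 * s 2 * s 3)) • 1
  | .g234 => (p ^ (2 * N + 2) * s 2 * s 3 * s 4) • X .m234 +
      (p ^ (2 * N + 2) * s 2 * s 3 * s 4 + 1 / (p ^ (2 * N + 2) * s 2 * s 3 * s 4)) • 1
  | .g1234 => (s 0 + 1 / s 0) • 1

/-- The algebra homomorphism `ρ` is the representation of `aw(4)` attached to the set of matrices
named `X`. -/
def IsRep (N : ℕ) (p : ℂ) (s : Fin 5 → ℂ) (X : Label) (ρ : AW4 p →ₐ[ℂ] Mat N) : Prop :=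
  ∀ I : Gen, ρ (AW4.C p I) = genImage N p s (mat N p s X) I

/-- A matrix representation is irreducible: the space is nonzero and the only invariant subspaces
are the trivial ones. -/
def IsIrreducibleRep {R ι : Type*} [Ring R] [Algebra ℂ R] [Fintype ι] [DecidableEq ι]
    (ρ : R →ₐ[ℂ] Matrix ι ι ℂ) : Prop :=
  Nonempty ι ∧ ∀ W : Submodule ℂ (ι → ℂ),
    (∀ a : R, ∀ v ∈ W, (ρ a).mulVec v ∈ W) → W = ⊥ ∨ W = ⊤

/-- `x ∉ {q^{-2}, q^{-3}, …, q^{-2N}}`. -/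
def PairOK (N : ℕ) (q x : ℂ) : Prop := ∀ k : ℕ, 2 ≤ k → k ≤ 2 * N → x ≠ (q ^ k)⁻¹

/-- The constraints on products of two parameters under which the set of matrices named `X` has
non-vanishing denominators: those for the two diagonal matrices of the set. -/
def LabelOK (N : ℕ) (q : ℂ) (c : Fin 5 → ℂ) : Label → Prop
  | .A => PairOK N q (c 1 * c 2) ∧ PairOK N q (c 4 * c 0)
  | .B => PairOK N q (c 4 * c 0) ∧ PairOK N q (c 2 * c 3)
  | .C => PairOK N q (c 2 * c 3) ∧ PairOK N q (c 0 * c 1)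
  | .D => PairOK N q (c 0 * c 1) ∧ PairOK N q (c 3 * c 4)
  | .E => PairOK N q (c 3 * c 4) ∧ PairOK N q (c 1 * c 2)

/-! ### The cancelled forms agree with the plain quotients -/

theorem racahOmega_eq (q r c₁ c₂ c₃ : ℂ) (N n : ℕ) (hn : n ≤ N)
    (h : 1 - c₂ * c₃ * q ^ (2 * n + 1) ≠ 0) :
    racahOmega q r c₁ c₂ c₃ N n =
      qBinom q N n * ((1 - c₂ * c₃ * q ^ (2 * n + 1)) * qPoch q (q * c₂) n *
        qPoch q (c₁ * c₂ * c₃ * q ^ (N + 2)) n * qPoch q (q * c₁) (N - n)) /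
      (r ^ (2 * (n : ℤ) - N) * qPoch q (c₂ * c₃ * q ^ (n + 1)) (N + 1) *
        qPoch q (q * c₃) n) := by
  have key : qPoch q (c₂ * c₃ * q ^ (n + 1)) (N + 1) = (1 - c₂ * c₃ * q ^ (2 * n + 1)) *
      ∏ l ∈ (Finset.range (N + 1)).erase n, (1 - c₂ * c₃ * q ^ (n + 1) * q ^ l) := by
    unfold qPoch
    rw [← Finset.mul_prod_erase _ _ (Finset.mem_range.2 (Nat.lt_succ_of_le hn))]
    congr 1
    rw [mul_assoc (c₂ * c₃), ← pow_add]
    congr 3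
    ring
  rw [key]
  unfold racahOmega
  rw [← mul_div_mul_left _ _ h]
  congr 1 <;> ring

theorem cornerProd_eq (ε : ℤ) (q r c₁ c₂ c₃ c₄ c₀ : ℂ) (N : ℕ) (hq : q ≠ 0)
    (hc : q ^ (2 * N + 3) * c₀ * c₁ * c₂ * c₃ * c₄ = 1)
    (h : 1 - c₄ * c₀ * q ^ (2 * N + 1) ≠ 0) :
    cornerProd ε q r c₁ c₂ c₃ c₄ c₀ N = FPlus q c₄ c₀ N * PhiUp ε q r c₁ c₂ c₃ 0 0 := by
  have hQ : q ^ N ≠ 0 := pow_ne_zero _ hq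
  have e1 : q ^ (2 * (N : ℤ)) = (q ^ N) ^ 2 := by
    rw [mul_comm, zpow_mul, zpow_natCast]; norm_cast
  have e2 : q ^ (2 * (N : ℤ) + 1) = (q ^ N) ^ 2 * q := by
    rw [zpow_add₀ hq, e1, zpow_one]
  have e3 : q ^ ((N : ℤ) + 1) = q ^ N * q := by
    rw [zpow_add₀ hq, zpow_natCast, zpow_one]
  have e4 : q ^ (2 * N + 3) = (q ^ N) ^ 2 * q ^ 3 := by ring
  have e5 : q ^ (2 * N + 1) = (q ^ N) ^ 2 * q := by ring
  rw [e4] at hc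
  rw [e5] at h
  have hF : FPlus q c₄ c₀ N * (1 - c₁ * c₂ * c₃ * q ^ 2) =
      -c₀ * q ^ (-(N : ℤ)) * ((1 - c₄ * q ^ N) * (1 - q ^ N)) /
        (1 - c₄ * c₀ * q ^ (2 * (N : ℤ))) := by
    unfold FPlus
    rw [e1, e2, e3, zpow_neg, zpow_natCast]
    set Q := q ^ N
    have hfac : (c₄ * c₀ * (Q ^ 2 * q)) * (1 - c₁ * c₂ * c₃ * q ^ 2) =
        -(1 - c₄ * c₀ * (Q ^ 2 * q)) := by linear_combination (-1 : ℂ) * hc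
    rw [← div_div, div_div, mul_comm (1 - c₄ * c₀ * Q ^ 2), ← div_div, div_mul_eq_mul_div]
    congr 1
    rw [div_mul_eq_mul_div, div_eq_iff h]
    have hQi : Q⁻¹ * Q = 1 := inv_mul_cancel₀ hQ
    linear_combination (c₀ * Q⁻¹ * (1 - c₄ * Q) * (1 - Q)) * hfac +
      (-(c₀ ^ 2 * c₄ * Q * q * (1 - c₄ * Q) * (1 - Q) * (1 - c₁ * c₂ * c₃ * q ^ 2))) * hQi
  have hm : PhiUpMinus q r c₁ c₂ c₃ 0 0 = (1 - c₁ * c₂ * c₃ * q ^ 2) *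
      (-((1 - c₁ * c₂ * c₃ * q ^ 3) * (1 - c₂ * q)) /
        (c₃ * q * r * (1 - c₂ * c₃ * q ^ 2))) := by
    have z2 : q ^ (2 : ℤ) = q ^ 2 := by norm_cast
    have z3 : q ^ (3 : ℤ) = q ^ 3 := by norm_cast
    simp [PhiUpMinus, cancelRatio, z2, z3]
    ring
  have hp : PhiUpPlus q r c₁ c₂ c₃ 0 0 = 0 := by simp [PhiUpPlus]
  unfold cornerProd
  rw [zpow_natCast q N, ← hF, mul_assoc]
  congr 1
  unfold PhiUp
  by_cases a1 : ε = 1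
  · subst a1; simp [hp]
  by_cases a2 : ε = -1
  · subst a2; simp [hm]
  by_cases a3 : ε = 0
  · subst a3
    have z2 : q ^ (2 : ℤ) = q ^ 2 := by norm_cast
    simp [hp, hm, z2]
    ring
  · simp [a1, a2, a3]

theorem coefA_zero_zero (q r c₁ c₂ c₃ c₄ c₀ : ℂ) (N i j : ℕ) (hj : j < N) (hq : q ≠ 0)
    (hr : r ≠ 0)
    (hc : q ^ (2 * N + 3) * c₀ * c₁ * c₂ * c₃ * c₄ = 1)
    (h₁ : 1 - c₁ * c₂ * q ^ ((N : ℤ) + 2 - j) ≠ 0) (h₂ : 1 - c₃ * q ^ ((N : ℤ) - j) ≠ 0)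
    (h₃ : 1 - c₄ * c₀ * q ^ (2 * (j : ℤ) + 1) ≠ 0) :
    coefA 0 0 q r c₁ c₂ c₃ c₄ c₀ N i j =
      -((1 - c₃ * q ^ ((N : ℤ) + 1 - j)) * r / (1 - c₁ * c₂ * q ^ ((N : ℤ) + 2 - j))) *
          (coefA 1 1 q r c₁ c₂ c₃ c₄ c₀ N i j + coefA 0 1 q r c₁ c₂ c₃ c₄ c₀ N i j +
            coefA (-1) 1 q r c₁ c₂ c₃ c₄ c₀ N i j)
        - (1 - c₁ * c₂ * q ^ ((N : ℤ) + 1 - j)) / ((1 - c₃ * q ^ ((N : ℤ) - j)) * r) *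
          (coefA 1 (-1) q r c₁ c₂ c₃ c₄ c₀ N i j + coefA 0 (-1) q r c₁ c₂ c₃ c₄ c₀ N i j +
            coefA (-1) (-1) q r c₁ c₂ c₃ c₄ c₀ N i j)
        - (coefA 1 0 q r c₁ c₂ c₃ c₄ c₀ N i j + coefA (-1) 0 q r c₁ c₂ c₃ c₄ c₀ N i j) := by
  have hc3 : c₃ ≠ 0 := by rintro rfl; simp at hc
  have hjN : (j : ℤ) ≠ N := by exact_mod_cast hj.ne
  have hsU : PhiUp 1 q r c₁ c₂ c₃ ((N : ℤ) - j) i + PhiUp 0 q r c₁ c₂ c₃ ((N : ℤ) - j) i +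
      PhiUp (-1) q r c₁ c₂ c₃ ((N : ℤ) - j) i =
      -((1 - c₁ * c₂ * q ^ ((N : ℤ) - j + 2)) * (1 - c₁ * c₂ * c₃ * q ^ ((N : ℤ) - j + 2)) /
        (c₃ * q ^ ((N : ℤ) - j + 1) * r)) := by
    simp [PhiUp]; ring
  have hsD : PhiDown 1 q r c₁ c₂ c₃ ((N : ℤ) - j) i + PhiDown 0 q r c₁ c₂ c₃ ((N : ℤ) - j) i +
      PhiDown (-1) q r c₁ c₂ c₃ ((N : ℤ) - j) i =
      -(r * (1 - c₃ * q ^ ((N : ℤ) - j)) * (q ^ (-((N : ℤ) - j)) - 1)) := by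
    simp [PhiDown]; ring
  have hU : coefA 1 1 q r c₁ c₂ c₃ c₄ c₀ N i j + coefA 0 1 q r c₁ c₂ c₃ c₄ c₀ N i j +
      coefA (-1) 1 q r c₁ c₂ c₃ c₄ c₀ N i j = -c₃ * q ^ ((N : ℤ) + 1) * FPlus q c₄ c₀ j *
      -((1 - c₁ * c₂ * q ^ ((N : ℤ) - j + 2)) * (1 - c₁ * c₂ * c₃ * q ^ ((N : ℤ) - j + 2)) /
        (c₃ * q ^ ((N : ℤ) - j + 1) * r)) := by
    rw [← hsU]; simp only [coefA, coefAPlus, if_neg hjN, if_true]; ring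
  have hD : coefA 1 (-1) q r c₁ c₂ c₃ c₄ c₀ N i j + coefA 0 (-1) q r c₁ c₂ c₃ c₄ c₀ N i j +
      coefA (-1) (-1) q r c₁ c₂ c₃ c₄ c₀ N i j = -c₃ * q ^ ((N : ℤ) + 1) * FMinus q c₄ c₀ j *
      -(r * (1 - c₃ * q ^ ((N : ℤ) - j)) * (q ^ (-((N : ℤ) - j)) - 1)) := by
    rw [← hsD]; simp [coefA, coefAMinus]; ring
  have hZ : coefA 0 0 q r c₁ c₂ c₃ c₄ c₀ N i j = Phi 0 q c₃ c₀ c₄ N j -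
      (coefA 1 0 q r c₁ c₂ c₃ c₄ c₀ N i j + coefA (-1) 0 q r c₁ c₂ c₃ c₄ c₀ N i j) := by
    simp [coefA]; ring
  rw [hZ, hU, hD]
  congr 1
  have hx : c₀ * c₄ = c₄ * c₀ := mul_comm _ _
  have hJ : q ^ j ≠ 0 := pow_ne_zero _ hq
  have hQ : q ^ N ≠ 0 := pow_ne_zero _ hq
  have z2 : q ^ (2 : ℤ) = q ^ 2 := by norm_cast
  have e4 : q ^ (2 * N + 3) = (q ^ N) ^ 2 * q ^ 3 := by ring
  have t2 : q ^ (2 * (j : ℤ)) = (q ^ j) ^ 2 := by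
    rw [mul_comm, zpow_mul, zpow_natCast]; norm_cast
  rw [e4] at hc
  have hP : PhiPlus q c₃ c₀ c₄ N j = FPlus q c₄ c₀ j * (1 - c₃ * q ^ ((N : ℤ) - j + 1)) *
      (q ^ j - c₁ * c₂ * c₃ * q ^ (N + 2)) := by
    unfold PhiPlus FPlus
    rw [cancelRatio_eq (by rwa [hx]), hx]
    simp only [zpow_sub₀ hq, zpow_add₀ hq, zpow_natCast, zpow_one, t2, pow_add] at h₃ ⊢
    generalize q ^ N = Q at *
    generalize q ^ j = J at *
    have num : -c₀ * (J / Q) * (1 - J) * (1 - c₃ * (Q / J * q)) * (1 - c₄ * J) *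
        (1 - c₄ * c₀ * (J * Q * q)) =
        c₄ * c₀ ^ 2 * (J * q) * ((1 - c₄ * J) * (1 - J)) * (1 - c₃ * (Q / J * q)) *
          (J - c₁ * c₂ * c₃ * (Q * q ^ 2)) := by
      have : (J / Q) * (1 - c₄ * c₀ * (J * Q * q)) =
          -(c₄ * c₀ * (J * q) * (J - c₁ * c₂ * c₃ * (Q * q ^ 2))) := by
        field_simp
        linear_combination (-1 : ℂ) * hc
      linear_combination (-c₀ * (1 - J) * (1 - c₃ * (Q / J * q)) * (1 - c₄ * J)) * this
    rw [div_mul_div_comm, num]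
    ring
  have hM : PhiMinus q c₃ c₀ c₄ N j = FMinus q c₄ c₀ j * (c₃ * (1 - q ^ ((N : ℤ) - j))) *
      (q ^ (j + 1) - c₁ * c₂ * q ^ (N + 2)) := by
    unfold PhiMinus FMinus
    rw [hx]
    simp only [zpow_sub₀ hq, zpow_add₀ hq, zpow_natCast, zpow_one, z2, pow_add, pow_one]
    generalize cancelRatio q (c₄ * c₀) _ _ = K at *
    generalize q ^ (2 * (j : ℤ)) = T at *
    generalize q ^ N = Q at *
    generalize q ^ j = J at *
    have num : (1 - J / Q) * (1 - c₃ * c₀ * c₄ * (J * Q * q ^ 2)) =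
        c₄ * c₀ * (J * q) * (c₃ * (1 - Q / J)) * (J * q - c₁ * c₂ * (Q * q ^ 2)) := by
      field_simp
      linear_combination (J - Q) * hc
    rw [num]
    ring
  have hPhi : Phi 0 q c₃ c₀ c₄ N j = -PhiPlus q c₃ c₀ c₄ N j - PhiMinus q c₃ c₀ c₄ N j := by
    simp [Phi]
  rw [hPhi, hP, hM]
  have s1 : (N : ℤ) + 2 - j = (N : ℤ) - j + 2 := by ring
  have s2 : (N : ℤ) + 1 - j = (N : ℤ) - j + 1 := by ring
  rw [s1] at h₁ ⊢
  rw [s2]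
  clear hP hM hZ hU hD hsU hsD hPhi s1 s2 h₃ t2 e4
  generalize FPlus q c₄ c₀ j = F at *
  generalize FMinus q c₄ c₀ j = G at *
  have z1 : q ^ ((N : ℤ) + 1) = q ^ ((N : ℤ) - j + 1) * q ^ j := by
    rw [← zpow_natCast q j, ← zpow_add₀ hq]; congr 1; ring
  have hR : q ^ ((N : ℤ) - j + 1) ≠ 0 := zpow_ne_zero _ hq
  have e1 : (1 - c₃ * q ^ ((N : ℤ) - j + 1)) * r / (1 - c₁ * c₂ * q ^ ((N : ℤ) - j + 2)) *
      (-c₃ * q ^ ((N : ℤ) + 1) * F *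
        -((1 - c₁ * c₂ * q ^ ((N : ℤ) - j + 2)) * (1 - c₁ * c₂ * c₃ * q ^ ((N : ℤ) - j + 2)) /
          (c₃ * q ^ ((N : ℤ) - j + 1) * r))) =
      F * (1 - c₃ * q ^ ((N : ℤ) - j + 1)) * (q ^ j - c₁ * c₂ * c₃ * q ^ (N + 2)) := by
    have w : q ^ (N + 2) = q ^ j * q ^ ((N : ℤ) - j + 2) := by
      rw [← zpow_natCast q j, ← zpow_add₀ hq, ← zpow_natCast]; congr 1; push_cast; ring
    rw [z1, w]
    generalize q ^ ((N : ℤ) - j + 1) = R at *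
    generalize q ^ ((N : ℤ) - j + 2) = S at *
    field_simp
  have e2 : (1 - c₁ * c₂ * q ^ ((N : ℤ) - j + 1)) / ((1 - c₃ * q ^ ((N : ℤ) - j)) * r) *
      (-c₃ * q ^ ((N : ℤ) + 1) * G *
        -(r * (1 - c₃ * q ^ ((N : ℤ) - j)) * (q ^ (-((N : ℤ) - j)) - 1))) =
      G * (c₃ * (1 - q ^ ((N : ℤ) - j))) * (q ^ (j + 1) - c₁ * c₂ * q ^ (N + 2)) := by
    have w : q ^ (N + 2) = q ^ (j + 1) * q ^ ((N : ℤ) - j + 1) := by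
      rw [← zpow_natCast q (j + 1), ← zpow_add₀ hq, ← zpow_natCast]; congr 1; push_cast; ring
    have w' : q ^ ((N : ℤ) + 1) = q ^ (j + 1) * q ^ ((N : ℤ) - j) := by
      rw [← zpow_natCast q (j + 1), ← zpow_add₀ hq]; congr 1; push_cast; ring
    have hT : q ^ ((N : ℤ) - j) ≠ 0 := zpow_ne_zero _ hq
    rw [w, w', zpow_neg]
    generalize q ^ ((N : ℤ) - j + 1) = R at *
    generalize q ^ ((N : ℤ) - j) = T at *
    field_simp
  linear_combination e1 + e2

end QRacahAW4

end

open QRacahAW4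

/-! Proof of the main theorem. -/


namespace QRacahAW4

/-! The five sets of matrices are one representation written in five bases. In each frame two
generators are diagonal, two are tridiagonal in one coordinate each, and the fifth moves both
coordinates by at most one. Neighbouring frames share one diagonal generator, and the change of
basis between them acts blockwise through univariate `q`-Racah polynomials. Everything reduces to
properties of these polynomials and to scalar identities between eigenvalues.

Polynomials. The series is expanded in products of two Newton bases, one in `n` and one in `x`. A
difference operator in `n` that sends each Newton element to a combination of itself and the
previous one can be moved onto the coefficients; this is `racahPhi_operator`. The recurrence and
both relations that change the block size are instances of it. Detailed balance for the
normalization (`Phi_balance_all`, `PhiUp_balance_all`) transposes them into relations for the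
normalized polynomials, and duality supplies the difference equation. Together they give
`sum_coefA_mul_racahP`, which describes how the nine-diagonal coefficients act on the polynomials.
The symmetry `coefA_swap` says that these coefficients may be read with either coordinate first.

Change of basis. The polynomial relations are the intertwining relations in matrix form.
Orthogonality is not proved directly. In `chgUp_mul_chgDown` the product of the two candidate
inverses commutes with a diagonal matrix of simple spectrum in one coordinate and with a tridiagonal
matrix without zeros beside the diagonal, so it is constant on each block. The constant is evaluated
by a Wilf-Zeilberger summation, `sum_racahOmega`.

Relations of the algebra. By transport (`freeRep_eq_all`) each relation has to be checked in one
well chosen frame only. Commuting generators are diagonal together in some frame. For a relation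
attached to a triple, a frame is used in which one of the two non-central generators is tridiagonal
and the other diagonal, so that `awExpr_tridiag` applies. The two relations for `C14` and `C41` are
verified entry by entry in frame `E`: with eigenvalues written as `x + 1/x`, `outer_entries` splits
them into four types of entries, each of which is a short identity.

Degenerate parameters. The argument above divides by many factors, so it is carried out for
`Generic` parameters. The cancelled coefficients are continuous at every admissible point, and such
a point is a limit of generic ones along a one-parameter family that preserves the constraint. All
identities therefore extend by `eq_of_generic`.

Irreducibility and equivalence. The joint spectrum of the two diagonal matrices is simple and the
tridiagonal matrices connect all basis vectors (`Adm.eq_bot_or_eq_top`). On the five-cycle two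
labels are at distance at most two, and a label between two admissible ones shares one product with
each, hence is admissible; composing neighbouring intertwiners then suffices. -/

/-- `1 - x q^k` does not vanish for `|k| ≤ K`. -/
def Reg (q : ℂ) (K : ℕ) (x : ℂ) : Prop := ∀ k : ℤ, -(K : ℤ) ≤ k → k ≤ K → 1 - x * q ^ k ≠ 0

/-! ### Integer powers and `q`-Pochhammer symbols. -/

theorem zpow_double (q : ℂ) (n : ℤ) : q ^ (2 * n) = (q ^ n) ^ 2 := by
  rw [mul_comm, zpow_mul]; norm_cast

theorem zpow_two_eq (q : ℂ) : q ^ (2 : ℤ) = q ^ 2 := by norm_cast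

theorem zpow_three_eq (q : ℂ) : q ^ (3 : ℤ) = q ^ 3 := by norm_cast

theorem qPoch_succ (q a : ℂ) (n : ℕ) : qPoch q a (n + 1) = qPoch q a n * (1 - a * q ^ n) :=
  Finset.prod_range_succ _ _

theorem qPoch_zero (q a : ℂ) : qPoch q a 0 = 1 := Finset.prod_range_zero _

theorem qPoch_succ' (q a : ℂ) (n : ℕ) : qPoch q a (n + 1) = (1 - a) * qPoch q (a * q) n := by
  unfold qPoch
  rw [Finset.prod_range_succ', mul_comm]
  congr 1
  · simp
  · exact Finset.prod_congr rfl fun l _ => by ring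

theorem qPoch_ne_zero {q a : ℂ} {n : ℕ} (h : ∀ l < n, 1 - a * q ^ l ≠ 0) : qPoch q a n ≠ 0 :=
  Finset.prod_ne_zero_iff.2 fun l hl => h l (Finset.mem_range.1 hl)

/-! ### Newton basis -/

/-- `(q^{-n};q)_k`. -/
noncomputable def newtonL (q : ℂ) (k : ℕ) (n : ℤ) : ℂ := ∏ l ∈ Finset.range k, (1 - q ^ ((l : ℤ) - n))

/-- `(C q^{n+1};q)_k`. -/
noncomputable def newtonR (q C : ℂ) (k : ℕ) (n : ℤ) : ℂ := ∏ l ∈ Finset.range k, (1 - C * q ^ (n + 1 + (l : ℤ)))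

/-- `(q^{-n}, C q^{n+1};q)_k`. -/
noncomputable def newtonB (q C : ℂ) (k : ℕ) (n : ℤ) : ℂ := newtonL q k n * newtonR q C k n

theorem newtonL_succ (q : ℂ) (k : ℕ) (n : ℤ) :
    newtonL q (k + 1) n = newtonL q k n * (1 - q ^ ((k : ℤ) - n)) := Finset.prod_range_succ _ _

theorem newtonL_succ' (q : ℂ) (k : ℕ) (n : ℤ) :
    newtonL q (k + 1) n = newtonL q k (n - 1) * (1 - q ^ (-n)) := by
  unfold newtonL
  rw [Finset.prod_range_succ']
  congr 1
  · exact Finset.prod_congr rfl fun l _ => by push_cast; ring_nf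
  · simp

theorem newtonR_succ (q C : ℂ) (k : ℕ) (n : ℤ) :
    newtonR q C (k + 1) n = newtonR q C k n * (1 - C * q ^ (n + 1 + (k : ℤ))) :=
  Finset.prod_range_succ _ _

theorem newtonR_succ' (q C : ℂ) (k : ℕ) (n : ℤ) :
    newtonR q C (k + 1) n = newtonR q C k (n + 1) * (1 - C * q ^ (n + 1)) := by
  unfold newtonR
  rw [Finset.prod_range_succ']
  congr 1
  · exact Finset.prod_congr rfl fun l _ => by push_cast; ring_nf
  · simp

theorem newtonB_zero (q C : ℂ) (n : ℤ) : newtonB q C 0 n = 1 := by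
  simp [newtonB, newtonL, newtonR]

theorem newtonB_succ (q C : ℂ) (k : ℕ) (n : ℤ) : newtonB q C (k + 1) n =
    newtonB q C k n * ((1 - q ^ ((k : ℤ) - n)) * (1 - C * q ^ (n + 1 + (k : ℤ)))) := by
  rw [newtonB, newtonB, newtonL_succ, newtonR_succ]; ring

theorem newtonL_eq_zero (q : ℂ) {k n : ℕ} (h : n < k) : newtonL q k n = 0 :=
  Finset.prod_eq_zero (Finset.mem_range.2 h) (by simp)

theorem newtonB_eq_zero (q C : ℂ) {k n : ℕ} (h : n < k) : newtonB q C k n = 0 := by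
  rw [newtonB, newtonL_eq_zero q h, zero_mul]

/-- The two values have the common factor `newtonL q k n * newtonR q C k (n + 1)`. The prefactor on
the left shifts the second product back to argument `n`; it is the factor that the coefficients of
the shift `n + 1` contain. -/
theorem newtonB_forward {q : ℂ} (C : ℂ) (hq : q ≠ 0) (k : ℕ) (n : ℤ) :
    (1 - C * q ^ (n + 1)) * (newtonB q C (k + 1) (n + 1) - newtonB q C (k + 1) n) =
      -((1 - q ^ ((k : ℤ) + 1)) * q ^ (-n - 1) * (1 - C * q ^ (2 * n + 2)) *
        (1 - C * q ^ (n + 1 + (k : ℤ)))) * newtonB q C k n := by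
  have h := (newtonR_succ q C k n).symm.trans (newtonR_succ' q C k n)
  have e : newtonB q C (k + 1) (n + 1) - newtonB q C (k + 1) n =
      newtonL q k n * newtonR q C k (n + 1) *
        ((1 - q ^ (-(n + 1))) * (1 - C * q ^ (n + 1 + 1 + (k : ℤ))) -
          (1 - q ^ ((k : ℤ) - n)) * (1 - C * q ^ (n + 1))) := by
    rw [newtonB, newtonB, newtonL_succ', newtonL_succ, newtonR_succ, newtonR_succ' q C k n,
      show n + 1 - 1 = n by ring]
    ring
  have e2 : (1 - q ^ (-(n + 1))) * (1 - C * q ^ (n + 1 + 1 + (k : ℤ))) -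
      (1 - q ^ ((k : ℤ) - n)) * (1 - C * q ^ (n + 1)) =
      -((1 - q ^ ((k : ℤ) + 1)) * q ^ (-n - 1) * (1 - C * q ^ (2 * n + 2))) := by
    simp only [zpow_add₀ hq, zpow_sub₀ hq, zpow_neg, zpow_one, zpow_double, zpow_two_eq]
    have := zpow_ne_zero n hq
    field_simp
    ring
  rw [e, e2, newtonB]
  linear_combination (newtonL q k n *
    -((1 - q ^ ((k : ℤ) + 1)) * q ^ (-n - 1) * (1 - C * q ^ (2 * n + 2)))) * -h

/-- Mirror image of the forward difference: here the first product is the one shifted, and the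
prefactor `1 - q ^ n` is supplied by the coefficients of the shift `n - 1`. -/
theorem newtonB_backward {q : ℂ} (C : ℂ) (hq : q ≠ 0) (k : ℕ) (n : ℤ) :
    (1 - q ^ n) * (newtonB q C (k + 1) (n - 1) - newtonB q C (k + 1) n) =
      -((1 - q ^ ((k : ℤ) + 1)) * (1 - C * q ^ (2 * n)) * (1 - q ^ ((k : ℤ) - n))) *
        newtonB q C k n := by
  have h := (newtonL_succ q k n).symm.trans (newtonL_succ' q k n)
  have e : newtonB q C (k + 1) (n - 1) - newtonB q C (k + 1) n =
      newtonL q k (n - 1) * newtonR q C k n *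
        ((1 - q ^ ((k : ℤ) - (n - 1))) * (1 - C * q ^ n) -
          (1 - q ^ (-n)) * (1 - C * q ^ (n + 1 + (k : ℤ)))) := by
    rw [newtonB, newtonB, newtonL_succ, newtonL_succ', newtonR_succ', newtonR_succ,
      show n - 1 + 1 = n by ring, ← newtonL_succ', newtonL_succ, h]
    ring
  have e2 : (1 - q ^ n) * ((1 - q ^ ((k : ℤ) - (n - 1))) * (1 - C * q ^ n) -
          (1 - q ^ (-n)) * (1 - C * q ^ (n + 1 + (k : ℤ)))) =
      -((1 - q ^ ((k : ℤ) + 1)) * (1 - C * q ^ (2 * n))) * (1 - q ^ (-n)) := by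
    simp only [zpow_add₀ hq, zpow_sub₀ hq, zpow_neg, zpow_one, zpow_double]
    have := zpow_ne_zero n hq
    field_simp
    ring
  rw [e, newtonB]
  linear_combination (newtonL q k (n - 1) * newtonR q C k n) * e2 + (newtonR q C k n *
    -((1 - q ^ ((k : ℤ) + 1)) * (1 - C * q ^ (2 * n)))) * -h

/-! ### The series -/

/-- The coefficients of the series in the product Newton basis. -/
noncomputable def racahW (q a b c : ℂ) (M k : ℕ) : ℂ :=
  q ^ k / (qPoch q (q * b) k * qPoch q (a * b * c * q ^ (M + 2)) k *
    qPoch q (q ^ (-(M : ℤ))) k * qPoch q q k)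

/-- The `₄φ₃` series of the `q`-Racah polynomials, as a function of two integers. -/
noncomputable def racahPhi (q a b c : ℂ) (M : ℕ) (n x : ℤ) : ℂ :=
  ∑ k ∈ Finset.range (M + 1), newtonB q (b * c) k n * newtonB q (a * b) k x * racahW q a b c M k

/-- Duality: the coefficients depend only on `b` and on the product of the three parameters, so
exchanging the outer two just exchanges the Newton bases. -/
theorem racahPhi_comm (q a b c : ℂ) (M : ℕ) (n x : ℤ) :
    racahPhi q a b c M n x = racahPhi q c b a M x n := by
  unfold racahPhi racahW
  refine Finset.sum_congr rfl fun k _ => ?_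
  rw [mul_comm c b, mul_comm b a, show b * c * a = a * b * c by ring]
  ring

/-- The series stops at `n` and the sum at `M`, but the Newton elements with index above `n` vanish
at `n`. The fixed upper limit allows difference operators in `n` to act termwise, also at arguments
outside the block. -/
theorem phi43_eq_racahPhi {q : ℂ} (hq : q ≠ 0) (a b c : ℂ) {M n : ℕ} (hn : n ≤ M) (x : ℕ) :
    phi43 q n (b * c * q ^ (n + 1)) (q ^ (-(x : ℤ))) (a * b * q ^ (x + 1))
        (q * b) (a * b * c * q ^ (M + 2)) (q ^ (-(M : ℤ))) q = racahPhi q a b c M n x := by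
  have hL : ∀ m k : ℕ, qPoch q (q ^ (-(m : ℤ))) k = newtonL q k m := fun m k =>
    Finset.prod_congr rfl fun l _ => by
      rw [sub_eq_add_neg (l : ℤ), zpow_add₀ hq, zpow_natCast]; ring
  have hR : ∀ (C : ℂ) (m k : ℕ), qPoch q (C * q ^ (m + 1)) k = newtonR q C k m := fun C m k =>
    Finset.prod_congr rfl fun l _ => by
      rw [zpow_add₀ hq, zpow_natCast, zpow_add₀ hq, zpow_natCast, zpow_one]; ring
  unfold phi43 racahPhi
  have hsub : Finset.range (n + 1) ⊆ Finset.range (M + 1) :=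
    Finset.range_subset_range.2 (by omega)
  rw [← Finset.sum_subset hsub fun k _ hk => by
    rw [newtonB_eq_zero q (b * c) (by simpa using hk)]; ring]
  refine Finset.sum_congr rfl fun k _ => ?_
  rw [hL n, hL x, hR, hR, racahW, newtonB, newtonB, div_mul_div_comm]
  ring

theorem racahP_eq {q : ℂ} (hq : q ≠ 0) (r a b c : ℂ) {M n x : ℕ} (hn : n ≤ M) (hx : x ≤ M) :
    racahP q r a b c M n x = racahOmega q r a b c M n * racahPhi q a b c M n x := by
  rw [racahP, if_pos ⟨hn, hx⟩, phi43_eq_racahPhi hq a b c hn]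

/-- Summation by parts. The operator sends the Newton element of index `k + 1` to itself and its
predecessor, so collecting the terms of equal index moves it onto the coefficients, where `hw`
recognizes a new coefficient sequence `w'`. The value on the constant element is `h0`. The top index
has no successor to contribute, which is why `hM` is a separate condition, needed only after
multiplication by the Newton elements. -/
theorem racahPhi_operator {q a b c : ℂ} {M : ℕ} {n x : ℤ} {A C e μ : ℂ} {α β w' : ℕ → ℂ}
    (h0 : e = α 0)
    (h : ∀ k, A * (newtonB q (b * c) (k + 1) (n + 1) - newtonB q (b * c) (k + 1) n) +
      C * (newtonB q (b * c) (k + 1) (n - 1) - newtonB q (b * c) (k + 1) n) +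
      e * newtonB q (b * c) (k + 1) n =
      α (k + 1) * newtonB q (b * c) (k + 1) n + β (k + 1) * newtonB q (b * c) k n)
    (hw : ∀ k < M, α k * racahW q a b c M k + β (k + 1) * racahW q a b c M (k + 1) *
      ((1 - q ^ ((k : ℤ) - x)) * (1 - a * b * q ^ (x + 1 + (k : ℤ)))) = μ * w' k)
    (hM : newtonB q (b * c) M n * newtonB q (a * b) M x * (α M * racahW q a b c M M) =
      newtonB q (b * c) M n * newtonB q (a * b) M x * (μ * w' M)) :
    A * (racahPhi q a b c M (n + 1) x - racahPhi q a b c M n x) +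
      C * (racahPhi q a b c M (n - 1) x - racahPhi q a b c M n x) +
      e * racahPhi q a b c M n x =
    μ * ∑ k ∈ Finset.range (M + 1), newtonB q (b * c) k n * newtonB q (a * b) k x * w' k := by
  have e1 : A * (racahPhi q a b c M (n + 1) x - racahPhi q a b c M n x) +
      C * (racahPhi q a b c M (n - 1) x - racahPhi q a b c M n x) +
      e * racahPhi q a b c M n x = ∑ k ∈ Finset.range (M + 1),
        (A * (newtonB q (b * c) k (n + 1) - newtonB q (b * c) k n) +
      C * (newtonB q (b * c) k (n - 1) - newtonB q (b * c) k n) +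
      e * newtonB q (b * c) k n) * (newtonB q (a * b) k x * racahW q a b c M k) := by
    simp only [racahPhi, ← Finset.sum_sub_distrib, Finset.mul_sum, ← Finset.sum_add_distrib]
    exact Finset.sum_congr rfl fun k _ => by ring
  rw [e1, Finset.sum_range_succ']
  have e2 : ∀ k, (A * (newtonB q (b * c) (k + 1) (n + 1) - newtonB q (b * c) (k + 1) n) +
      C * (newtonB q (b * c) (k + 1) (n - 1) - newtonB q (b * c) (k + 1) n) +
      e * newtonB q (b * c) (k + 1) n) * (newtonB q (a * b) (k + 1) x * racahW q a b c M (k + 1)) =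
      newtonB q (b * c) (k + 1) n * newtonB q (a * b) (k + 1) x *
        (α (k + 1) * racahW q a b c M (k + 1)) +
      newtonB q (b * c) k n * newtonB q (a * b) k x * (β (k + 1) * racahW q a b c M (k + 1) *
      ((1 - q ^ ((k : ℤ) - x)) * (1 - a * b * q ^ (x + 1 + (k : ℤ))))) := fun k => by
    rw [h, newtonB_succ q (a * b)]; ring
  simp only [e2, newtonB_zero, Finset.sum_add_distrib]
  -- Separates the term of index zero from the diagonal part; the part with `β` has already been
  -- shifted down by one.
  have e3 := Finset.sum_range_succ' (fun k => newtonB q (b * c) k n * newtonB q (a * b) k x *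
        (α k * racahW q a b c M k)) M
  simp only [newtonB_zero] at e3
  rw [Finset.mul_sum, Finset.sum_range_succ]
  have e4 : ∑ k ∈ Finset.range M, μ * (newtonB q (b * c) k n * newtonB q (a * b) k x * w' k) =
      ∑ k ∈ Finset.range M, newtonB q (b * c) k n * newtonB q (a * b) k x *
        (α k * racahW q a b c M k) + ∑ k ∈ Finset.range M, newtonB q (b * c) k n *
        newtonB q (a * b) k x * (β (k + 1) * racahW q a b c M (k + 1) *
      ((1 - q ^ ((k : ℤ) - x)) * (1 - a * b * q ^ (x + 1 + (k : ℤ))))) := by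
    rw [← Finset.sum_add_distrib]
    refine Finset.sum_congr rfl fun k hk => ?_
    rw [← mul_add, hw k (Finset.mem_range.1 hk)]; ring
  rw [e4]
  rw [Finset.sum_range_succ] at e3
  rw [h0]
  linear_combination -e3 + hM

end QRacahAW4

namespace QRacahAW4

/-! ### Rational forms of the structure coefficients -/

theorem cancelRatio_mul_div {q C : ℂ} {a b : ℤ} (h : 1 - C * q ^ b ≠ 0) (x y : ℂ) :
    x / y * cancelRatio q C a b = x * (1 - C * q ^ a) / (y * (1 - C * q ^ b)) := by
  rw [cancelRatio_eq h, div_mul_div_comm]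

/-- With `1 - b c q^{2n+1}` non-zero the cancelled ratio is an honest quotient. This form, like the
similar ones below, is rational in the atoms `q ^ n` and `q ^ M`, so that identities can be closed
by clearing denominators. -/
theorem PhiPlus_eq {q : ℂ} (hq : q ≠ 0) (a b c : ℂ) (M n : ℤ)
    (h : 1 - b * c * q ^ (2 * n + 1) ≠ 0) :
    PhiPlus q a b c M n = -b * (q ^ n / q ^ M) * (1 - q ^ n) * (1 - a * (q ^ M / q ^ n * q)) *
      (1 - c * q ^ n) * (1 - b * c * (q ^ n * q ^ M * q)) /
        ((1 - b * c * (q ^ n) ^ 2) * (1 - b * c * ((q ^ n) ^ 2 * q))) := by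
  rw [PhiPlus, cancelRatio_mul_div h]
  simp only [zpow_add₀ hq, zpow_sub₀ hq, zpow_one, zpow_double]

theorem PhiMinus_eq {q : ℂ} (hq : q ≠ 0) (a b c : ℂ) (M n : ℤ)
    (h : 1 - b * c * q ^ (2 * n + 1) ≠ 0) :
    PhiMinus q a b c M n = (1 - q ^ n / q ^ M) * (1 - a * b * c * (q ^ n * q ^ M * q ^ 2)) *
      (1 - b * (q ^ n * q)) * (1 - b * c * (q ^ n * q)) /
        ((1 - b * c * ((q ^ n) ^ 2 * q ^ 2)) * (1 - b * c * ((q ^ n) ^ 2 * q))) := by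
  rw [PhiMinus, cancelRatio_mul_div h]
  simp only [zpow_add₀ hq, zpow_sub₀ hq, zpow_one, zpow_double, zpow_two_eq]

theorem PhiUpPlus_eq {q : ℂ} (hq : q ≠ 0) (r a b c : ℂ) (M n : ℤ) :
    PhiUpPlus q r a b c M n = -r * b * ((q ^ n) ^ 2 / q ^ M / q) *
      ((1 - q ^ n) * (1 - a * (q ^ M / q ^ n * q)) * (1 - a * (q ^ M * q ^ 2 / q ^ n)) *
        (1 - c * q ^ n)) / ((1 - b * c * (q ^ n) ^ 2) * (1 - b * c * ((q ^ n) ^ 2 * q))) := by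
  rw [PhiUpPlus]
  simp only [zpow_add₀ hq, zpow_sub₀ hq, zpow_one, zpow_double, zpow_two_eq]

theorem PhiUpMinus_eq {q : ℂ} (hq : q ≠ 0) (r a b c : ℂ) (M n : ℤ)
    (h : 1 - b * c * q ^ (2 * n + 1) ≠ 0) :
    PhiUpMinus q r a b c M n = -((1 - a * b * c * (q ^ n * q ^ M * q ^ 2)) *
      (1 - a * b * c * (q ^ n * q ^ M * q ^ 3)) * (1 - b * (q ^ n * q))) *
        (1 - b * c * (q ^ n * q)) / (c * (q ^ M * q) * r *
        (1 - b * c * ((q ^ n) ^ 2 * q ^ 2)) * (1 - b * c * ((q ^ n) ^ 2 * q))) := by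
  rw [PhiUpMinus, cancelRatio_mul_div h]
  simp only [zpow_add₀ hq, zpow_one, zpow_double, zpow_two_eq, zpow_three_eq]

theorem PhiDownPlus_eq {q : ℂ} (hq : q ≠ 0) (r b c : ℂ) (M n : ℤ)
    (h : 1 - b * c * q ^ (2 * n + 1) ≠ 0) :
    PhiDownPlus q r b c M n = -r * ((1 - q ^ n) * (1 - c * q ^ n) *
      (1 - b * c * (q ^ n * q ^ M))) * (1 - b * c * (q ^ n * q ^ M * q)) /
      (q ^ M * (1 - b * c * (q ^ n) ^ 2) * (1 - b * c * ((q ^ n) ^ 2 * q))) := by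
  rw [PhiDownPlus, cancelRatio_mul_div h]
  simp only [zpow_add₀ hq, zpow_one, zpow_double]

theorem PhiDownMinus_eq {q : ℂ} (hq : q ≠ 0) (r b c : ℂ) (M n : ℤ)
    (h : 1 - b * c * q ^ (2 * n + 1) ≠ 0) :
    PhiDownMinus q r b c M n = -c * r * q ^ M *
      ((1 - q ^ n / q ^ M) * (1 - q ^ n / q ^ M * q) * (1 - b * (q ^ n * q))) *
        (1 - b * c * (q ^ n * q)) /
      ((1 - b * c * ((q ^ n) ^ 2 * q ^ 2)) * (1 - b * c * ((q ^ n) ^ 2 * q))) := by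
  rw [PhiDownMinus, cancelRatio_mul_div h]
  simp only [zpow_add₀ hq, zpow_sub₀ hq, zpow_one, zpow_double, zpow_two_eq]

theorem FMinus_eq {q : ℂ} (hq : q ≠ 0) (a b : ℂ) (n : ℤ) (h : 1 - a * b * q ^ (2 * n + 1) ≠ 0) :
    FMinus q a b n = a * b * (q ^ n * q) * (1 - b * (q ^ n * q)) * (1 - a * b * (q ^ n * q)) /
      ((1 - a * b * ((q ^ n) ^ 2 * q ^ 2)) * (1 - a * b * ((q ^ n) ^ 2 * q))) := by
  rw [FMinus, cancelRatio_mul_div h]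
  simp only [zpow_add₀ hq, zpow_one, zpow_double, zpow_two_eq]

theorem FPlus_eq {q : ℂ} (hq : q ≠ 0) (a b : ℂ) (n : ℤ) :
    FPlus q a b n = a * b ^ 2 * (q ^ n * q) * ((1 - a * q ^ n) * (1 - q ^ n)) /
      ((1 - a * b * (q ^ n) ^ 2) * (1 - a * b * ((q ^ n) ^ 2 * q))) := by
  rw [FPlus]
  simp only [zpow_add₀ hq, zpow_one, zpow_double]

theorem lam_eq {q : ℂ} (hq : q ≠ 0) (c : ℂ) (n : ℤ) :
    lam q c n = -(1 - (q ^ n)⁻¹) * (1 - c * (q ^ n * q)) := by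
  rw [lam, zpow_neg, zpow_add₀ hq, zpow_one]

/-! ### Action of difference operators on the Newton basis -/

theorem Reg.ne {q x : ℂ} {K : ℕ} (h : Reg q K x) {k : ℤ} (h1 : -(K : ℤ) ≤ k) (h2 : k ≤ K)
    {y : ℂ} (hy : x * q ^ k = y) : 1 - y ≠ 0 := hy ▸ h k h1 h2

/-- The factors `1 - C q^{n+1}` and `1 - q ^ n` in the coefficients are those required by
`newtonB_forward` and `newtonB_backward`. Both differences become multiples of `newtonB q C k n`,
and after dividing by it only the scalar identity `h` remains. -/
theorem newtonB_operator {q C : ℂ} (hq : q ≠ 0) {k : ℕ} {n : ℤ} {A' C' e α β D : ℂ}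
    (h1 : 1 - C * ((q ^ n) ^ 2 * q ^ 2) ≠ 0) (h2 : 1 - C * (q ^ n) ^ 2 ≠ 0) (hD : D ≠ 0)
    (h : -A' * (1 - q ^ k * q) * (1 - C * (q ^ n * q * q ^ k)) / (q ^ n * q) -
      C' * (1 - q ^ k * q) * (1 - q ^ k / q ^ n) +
      D * e * ((1 - q ^ k / q ^ n) * (1 - C * (q ^ n * q * q ^ k))) =
      D * (α * ((1 - q ^ k / q ^ n) * (1 - C * (q ^ n * q * q ^ k))) + β)) :
    A' * (1 - C * (q ^ n * q)) / ((1 - C * ((q ^ n) ^ 2 * q ^ 2)) * D) *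
        (newtonB q C (k + 1) (n + 1) - newtonB q C (k + 1) n) +
      C' * (1 - q ^ n) / ((1 - C * (q ^ n) ^ 2) * D) *
        (newtonB q C (k + 1) (n - 1) - newtonB q C (k + 1) n) +
      e * newtonB q C (k + 1) n = α * newtonB q C (k + 1) n + β * newtonB q C k n := by
  have f1 := newtonB_forward C hq k n
  have f2 := newtonB_backward C hq k n
  have f3 := newtonB_succ q C k n
  simp only [zpow_add₀ hq, zpow_sub₀ hq, zpow_one, zpow_double, zpow_natCast, zpow_neg,
    zpow_two_eq] at f1 f2 f3
  generalize 1 - C * ((q ^ n) ^ 2 * q ^ 2) = E₁ at *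
  generalize 1 - C * (q ^ n) ^ 2 = E₂ at *
  generalize 1 - C * (q ^ n * q * q ^ k) = E₃ at *
  have g1 : A' * (1 - C * (q ^ n * q)) / (E₁ * D) *
        (newtonB q C (k + 1) (n + 1) - newtonB q C (k + 1) n) =
      -A' * (1 - q ^ k * q) * E₃ / (q ^ n * q) / D * newtonB q C k n := by
    rw [mul_div_assoc, mul_assoc, div_mul_eq_mul_div, f1]
    field_simp
  have g2 : C' * (1 - q ^ n) / (E₂ * D) *
        (newtonB q C (k + 1) (n - 1) - newtonB q C (k + 1) n) =
      - C' * (1 - q ^ k * q) * (1 - q ^ k / q ^ n) / D * newtonB q C k n := by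
    rw [mul_div_assoc, mul_assoc, div_mul_eq_mul_div, f2]
    field_simp
  rw [g1, g2, f3]
  have h' : (-A' * (1 - q ^ k * q) * E₃ / (q ^ n * q) -
      C' * (1 - q ^ k * q) * (1 - q ^ k / q ^ n)) / D + e * ((1 - q ^ k / q ^ n) * E₃) =
      α * ((1 - q ^ k / q ^ n) * E₃) + β := by
    rw [← mul_right_inj' hD, ← h, mul_add, mul_div_cancel₀ _ hD]
    ring
  linear_combination newtonB q C k n * h'

theorem racahW_succ (q a b c : ℂ) (M k : ℕ) :
    racahW q a b c M (k + 1) = racahW q a b c M k * q / ((1 - b * (q ^ k * q)) *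
      (1 - a * b * c * (q ^ M * q ^ 2 * q ^ k)) * (1 - q ^ k / q ^ M) * (1 - q ^ k * q)) := by
  unfold racahW
  simp only [qPoch_succ]
  rw [div_mul_eq_mul_div, div_div]
  congr 1
  rw [zpow_neg, zpow_natCast]
  ring

end QRacahAW4

/-! ### Genericity within a block, and the three-term recurrence of the series. -/

namespace QRacahAW4

/-- Genericity of the parameters of a block of size `M`. -/
structure BlockReg (q r a b c : ℂ) (M : ℕ) : Prop where
  q0 : q ≠ 0
  r0 : r ≠ 0
  rq : r ^ 2 = q * b
  b0 : b ≠ 0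
  c0 : c ≠ 0
  qk : ∀ k : ℕ, 1 ≤ k → k ≤ M → 1 - q ^ k ≠ 0
  reg_a : Reg q (2 * M + 5) a
  reg_b : Reg q (2 * M + 5) b
  reg_c : Reg q (2 * M + 5) c
  reg_ab : Reg q (2 * M + 5) (a * b)
  reg_bc : Reg q (2 * M + 5) (b * c)
  reg_abc : Reg q (2 * M + 5) (a * b * c)

theorem BlockReg.pow_sub {q r a b c : ℂ} {M : ℕ} (R : BlockReg q r a b c M) {k : ℕ}
    (hk : k < M) : 1 - q ^ k / q ^ M ≠ 0 := by
  have h := R.qk (M - k) (by omega) (by omega)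
  have e : q ^ M = q ^ (M - k) * q ^ k := by rw [← pow_add]; congr 1; omega
  have h2 := pow_ne_zero k R.q0
  have h3 := pow_ne_zero (M - k) R.q0
  intro h4
  apply h
  rw [e] at h4
  field_simp at h4
  linear_combination -h4

theorem BlockReg.w_denominators {q r a b c : ℂ} {M : ℕ} (R : BlockReg q r a b c M) {k : ℕ}
    (hk : k < M) : 1 - b * (q ^ k * q) ≠ 0 ∧ 1 - a * b * c * (q ^ M * q ^ 2 * q ^ k) ≠ 0 ∧
      1 - q ^ k / q ^ M ≠ 0 ∧ 1 - q ^ k * q ≠ 0 := by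
  refine ⟨R.reg_b.ne (k := k + 1) (by push_cast; omega) (by push_cast; omega) ?_,
    R.reg_abc.ne (k := M + 2 + k) (by push_cast; omega) (by push_cast; omega) ?_, R.pow_sub hk, ?_⟩
  · rw [zpow_add₀ R.q0, zpow_natCast, zpow_one]
  · rw [zpow_add₀ R.q0, zpow_add₀ R.q0, zpow_natCast, zpow_natCast, zpow_two_eq]
  · rw [← pow_succ]; exact R.qk _ (by omega) (by omega)

theorem newtonB_eq_zero_or (q C : ℂ) {M x : ℕ} (hx : x ≤ M) : newtonB q C M x = 0 ∨ x = M := by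
  rcases hx.lt_or_eq with h | h
  · exact Or.inl (newtonB_eq_zero q C h)
  · exact Or.inr h

/-- In the Newton basis the operator has diagonal entries `lam q (a * b) k`, and its subdiagonal
entries `β` are such that `β (k + 1)` times the next series coefficient is minus the current one
divided by `q ^ k`. The remaining identity is the Newton interpolation step from the node `k` to `x`
for the eigenvalue. -/
theorem racahPhi_recurrence {q r a b c : ℂ} {M : ℕ} (R : BlockReg q r a b c M) {n x : ℕ}
    (hn : n ≤ M) (hx : x ≤ M) :
    PhiMinus q a b c M n * racahPhi q a b c M ((n : ℤ) + 1) x +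
      Phi 0 q a b c M n * racahPhi q a b c M n x +
      PhiPlus q a b c M n * racahPhi q a b c M ((n : ℤ) - 1) x =
    lam q (a * b) x * racahPhi q a b c M n x := by
  have hq := R.q0
  have hD : 1 - b * c * q ^ (2 * (n : ℤ) + 1) ≠ 0 := R.reg_bc _ (by push_cast; omega) (by push_cast; omega)
  have hE1 : 1 - b * c * ((q ^ (n : ℤ)) ^ 2 * q ^ 2) ≠ 0 :=
    R.reg_bc.ne (k := 2 * n + 2) (by push_cast; omega) (by push_cast; omega)
      (by simp only [zpow_add₀ hq, zpow_double, zpow_two_eq])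
  have hE2 : 1 - b * c * (q ^ (n : ℤ)) ^ 2 ≠ 0 :=
    R.reg_bc.ne (k := 2 * n) (by push_cast; omega) (by push_cast; omega)
      (by simp only [zpow_double])
  have key := racahPhi_operator (q := q) (a := a) (b := b) (c := c) (M := M) (n := n) (x := x)
    (A := PhiMinus q a b c M n) (C := PhiPlus q a b c M n) (e := 0) (μ := lam q (a * b) x)
    (α := fun k => lam q (a * b) k) (β := fun k => -((q ^ k)⁻¹ * (1 - b * q ^ k) *
      (1 - a * b * c * (q ^ M * q * q ^ k)) * (1 - q ^ k / (q ^ M * q)) * (1 - q ^ k)))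
    (w' := racahW q a b c M) (by simp [lam]) ?_ ?_ ?_
  · rw [show (∑ k ∈ Finset.range (M + 1), newtonB q (b * c) k n * newtonB q (a * b) k x *
      racahW q a b c M k) = racahPhi q a b c M n x from rfl] at key
    rw [← key, Phi]
    simp only [if_neg (show ¬ (0 : ℤ) = 1 by norm_num), if_neg (show ¬ (0 : ℤ) = -1 by norm_num),
      if_true]
    ring
  · intro k
    rw [PhiMinus_eq hq _ _ _ _ _ hD, PhiPlus_eq hq _ _ _ _ _ hD]
    have hD' : 1 - b * c * ((q ^ (n : ℤ)) ^ 2 * q) ≠ 0 := by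
      simpa only [zpow_add₀ hq, zpow_double, zpow_one] using hD
    refine (?_ : _ = _).trans (newtonB_operator hq (A' := (1 - q ^ (n : ℤ) / q ^ (M : ℤ)) *
      (1 - a * b * c * (q ^ (n : ℤ) * q ^ (M : ℤ) * q ^ 2)) * (1 - b * (q ^ (n : ℤ) * q)))
      (C' := -b * (q ^ (n : ℤ) / q ^ (M : ℤ)) * (1 - a * (q ^ (M : ℤ) / q ^ (n : ℤ) * q)) *
      (1 - c * q ^ (n : ℤ)) * (1 - b * c * (q ^ (n : ℤ) * q ^ (M : ℤ) * q))) (e := 0) hE1 hE2 hD' ?_)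
    · ring
    · rw [lam_eq hq]
      simp only [zpow_natCast, pow_succ q k]
      have h1 : q ^ n ≠ 0 := pow_ne_zero _ hq
      have h2 : q ^ M ≠ 0 := pow_ne_zero _ hq
      have h3 : q ^ k ≠ 0 := pow_ne_zero _ hq
      field_simp
      ring
  · intro k hk
    obtain ⟨h1, h2, h3, h4⟩ := R.w_denominators hk
    rw [racahW_succ, lam_eq hq, lam_eq hq]
    simp only [zpow_natCast, pow_succ q k, zpow_add₀ hq, zpow_sub₀ hq, zpow_one]
    have g1 : q ^ x ≠ 0 := pow_ne_zero _ hq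
    have g2 : q ^ M ≠ 0 := pow_ne_zero _ hq
    have g3 : q ^ k ≠ 0 := pow_ne_zero _ hq
    generalize racahW q a b c M k = w
    have e : (q ^ k * q)⁻¹ * (1 - b * (q ^ k * q)) * (1 - a * b * c * (q ^ M * q * (q ^ k * q))) *
        (1 - q ^ k * q / (q ^ M * q)) * (1 - q ^ k * q) * (w * q / ((1 - b * (q ^ k * q)) *
      (1 - a * b * c * (q ^ M * q ^ 2 * q ^ k)) * (1 - q ^ k / q ^ M) * (1 - q ^ k * q))) =
        w / q ^ k := by
      rw [show q ^ M * q * (q ^ k * q) = q ^ M * q ^ 2 * q ^ k by ring,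
        mul_div_mul_right _ _ hq]
      generalize 1 - b * (q ^ k * q) = E1 at *
      generalize 1 - a * b * c * (q ^ M * q ^ 2 * q ^ k) = E2 at *
      generalize 1 - q ^ k / q ^ M = E3 at *
      generalize 1 - q ^ k * q = E4 at *
      field_simp
    rw [neg_mul ((q ^ k * q)⁻¹ * _ * _ * _ * _), e]
    field_simp
    ring
  -- At the top index the second Newton element vanishes unless `x = M`, and then `α M` is the
  -- eigenvalue itself.
  · rcases newtonB_eq_zero_or q (a * b) hx with h | h
    · rw [h]; ring
    · rw [h]

theorem qPoch_shift (q x : ℂ) (k : ℕ) :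
    qPoch q (x * q) k * (1 - x) = qPoch q x k * (1 - x * q ^ k) := by
  rw [mul_comm, ← qPoch_succ', qPoch_succ]

/-- Only two of the Pochhammer symbols depend on the block size. Their bases move by one power of
`q`, which changes each product at its two ends only. -/
theorem racahW_block {q a b c : ℂ} (hq : q ≠ 0) {M k : ℕ} (h1 : 1 - a * b * c * (q ^ M * q ^ 2) ≠ 0)
    (h2 : 1 - a * b * c * (q ^ M * q ^ 2 * q ^ k) ≠ 0) (h3 : 1 - q ^ (M + 1) ≠ 0)
    (h4 : 1 - q ^ k / (q ^ M * q) ≠ 0) :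
    racahW q a b c (M + 1) k = racahW q a b c M k * ((1 - a * b * c * (q ^ M * q ^ 2)) *
      (1 - q ^ k / (q ^ M * q))) / ((1 - a * b * c * (q ^ M * q ^ 2 * q ^ k)) *
      (1 - (q ^ M * q)⁻¹)) := by
  have e1 := qPoch_shift q (a * b * c * (q ^ M * q ^ 2)) k
  have e2 := qPoch_shift q (q ^ M * q)⁻¹ k
  have hM : q ^ M ≠ 0 := pow_ne_zero _ hq
  have h5 : 1 - (q ^ M * q)⁻¹ ≠ 0 := by
    intro h
    apply h3
    rw [pow_succ]
    field_simp at h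
    linear_combination -h
  rw [mul_inv, inv_mul_cancel_right₀ hq, ← mul_inv, inv_mul_eq_div] at e2
  rw [mul_assoc] at e1
  unfold racahW
  rw [show a * b * c * q ^ (M + 1 + 2) = a * b * c * (q ^ M * q ^ 2 * q) by ring,
    show a * b * c * q ^ (M + 2) = a * b * c * (q ^ M * q ^ 2) by ring,
    show q ^ (-((M + 1 : ℕ) : ℤ)) = (q ^ M * q)⁻¹ by
      rw [zpow_neg, zpow_natCast, pow_succ],
    show q ^ (-(M : ℤ)) = (q ^ M)⁻¹ by rw [zpow_neg, zpow_natCast]]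
  rw [mul_assoc (a * b * c)] at e1
  generalize 1 - a * b * c * (q ^ M * q ^ 2) = E1 at *
  generalize 1 - a * b * c * (q ^ M * q ^ 2 * q ^ k) = E2 at *
  generalize 1 - q ^ k / (q ^ M * q) = E4 at *
  generalize 1 - (q ^ M * q)⁻¹ = E5 at *
  rw [← eq_div_iff h1] at e1
  rw [← eq_div_iff h5] at e2
  rw [e1, e2]
  generalize qPoch q _ k = A1
  generalize qPoch q _ k = A2
  generalize qPoch q _ k = A3
  generalize qPoch q _ k = A4
  field_simp

end QRacahAW4

/-! ### Relations between the series of blocks of sizes `M` and `M + 1`. -/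

namespace QRacahAW4

/-- Same mechanism as the recurrence, except that the coefficients reproduced by the operator are
those of the larger block. The index `n = M + 1`, which does not belong to the smaller block, is
allowed. -/
theorem racahPhi_up {q r a b c : ℂ} {M : ℕ} (R : BlockReg q r a b c M)
    (hM1 : 1 - q ^ (M + 1) ≠ 0) {n x : ℕ} (hn : n ≤ M + 1) (hx : x ≤ M) :
    PhiDown (-1) q r a b c ((M : ℤ) + 1) n * racahPhi q a b c M ((n : ℤ) + 1) x +
      PhiDown 0 q r a b c ((M : ℤ) + 1) n * racahPhi q a b c M n x +
      PhiDown 1 q r a b c ((M : ℤ) + 1) n * racahPhi q a b c M ((n : ℤ) - 1) x =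
    -((1 - c * (q ^ M * q / q ^ x)) * (1 - a * b * c * (q ^ M * q ^ x * q ^ 2)) *
      (1 - q ^ M * q) * r / (q ^ M * q * (1 - a * b * c * (q ^ M * q ^ 2)))) *
      racahPhi q a b c (M + 1) n x := by
  have hq := R.q0
  have g2 : q ^ M ≠ 0 := pow_ne_zero _ hq
  have hD : 1 - b * c * q ^ (2 * (n : ℤ) + 1) ≠ 0 := R.reg_bc _ (by push_cast; omega) (by push_cast; omega)
  have hE1 : 1 - b * c * ((q ^ (n : ℤ)) ^ 2 * q ^ 2) ≠ 0 :=
    R.reg_bc.ne (k := 2 * n + 2) (by push_cast; omega) (by push_cast; omega)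
      (by simp only [zpow_add₀ hq, zpow_double, zpow_two_eq])
  have hE2 : 1 - b * c * (q ^ (n : ℤ)) ^ 2 ≠ 0 :=
    R.reg_bc.ne (k := 2 * n) (by push_cast; omega) (by push_cast; omega)
      (by simp only [zpow_double])
  have hT : 1 - a * b * c * (q ^ M * q ^ 2) ≠ 0 :=
    R.reg_abc.ne (k := M + 2) (by push_cast; omega) (by push_cast; omega)
      (by simp only [zpow_add₀ hq, zpow_natCast, zpow_two_eq])
  have hT' : ∀ k ≤ M, 1 - a * b * c * (q ^ M * q ^ 2 * q ^ k) ≠ 0 := fun k hk =>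
    R.reg_abc.ne (k := M + 2 + k) (by push_cast; omega) (by push_cast; omega)
      (by simp only [zpow_add₀ hq, zpow_natCast, zpow_two_eq])
  -- For `k = 0` the exponent is `M + 1`, beyond the range controlled by the block of size `M`; this
  -- is where `hM1` enters.
  have hS : ∀ k ≤ M, 1 - q ^ k / (q ^ M * q) ≠ 0 := fun k hk => by
    have e : q ^ M * q = q ^ (M + 1 - k) * q ^ k := by rw [← pow_succ, ← pow_add]; congr 1; omega
    have h2 := pow_ne_zero k hq
    have h3 := pow_ne_zero (M + 1 - k) hq
    have h : 1 - q ^ (M + 1 - k) ≠ 0 := by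
      rcases Nat.eq_zero_or_pos k with rfl | hk0
      · exact hM1
      · exact R.qk _ (by omega) (by omega)
    intro h4
    apply h
    rw [e] at h4
    field_simp at h4
    linear_combination -h4
  set μ := -((1 - c * (q ^ M * q / q ^ x)) * (1 - a * b * c * (q ^ M * q ^ x * q ^ 2)) *
      (1 - q ^ M * q) * r / (q ^ M * q * (1 - a * b * c * (q ^ M * q ^ 2)))) with hμ
  have key := racahPhi_operator (q := q) (a := a) (b := b) (c := c) (M := M) (n := n) (x := x)
    (A := PhiDownMinus q r b c ((M : ℤ) + 1) n) (C := PhiDownPlus q r b c ((M : ℤ) + 1) n)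
    (e := -r * (1 - c * (q ^ M * q)) * ((q ^ M * q)⁻¹ - 1)) (μ := μ)
    (α := fun k => r * (1 - c * (q ^ M * q / q ^ k)) * (1 - q ^ k / (q ^ M * q)))
    (β := fun k => (q ^ k)⁻¹ * c * r * (q ^ M * q) * (1 - q ^ k / (q ^ M * q ^ 2)) *
      (1 - b * q ^ k) * (1 - q ^ k / (q ^ M * q)) * (1 - q ^ k))
    (w' := racahW q a b c (M + 1)) (by simp; ring) ?_ ?_ ?_
  -- The extra term of the larger series vanishes because `x ≤ M`.
  · have hs : racahPhi q a b c (M + 1) n x = ∑ k ∈ Finset.range (M + 1),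
        newtonB q (b * c) k n * newtonB q (a * b) k x * racahW q a b c (M + 1) k := by
      rw [racahPhi, Finset.sum_range_succ, newtonB_eq_zero q (a * b) (by omega : x < M + 1)]
      ring
    rw [← hs] at key
    rw [← key]
    simp only [PhiDown, if_neg (show ¬ (0 : ℤ) = 1 by norm_num),
      if_neg (show ¬ (-1 : ℤ) = 1 by norm_num), if_neg (show ¬ (0 : ℤ) = -1 by norm_num),
      if_true, zpow_neg, zpow_add₀ hq, zpow_natCast, zpow_one]
    ring
  · intro k
    rw [PhiDownMinus_eq hq _ _ _ _ _ hD, PhiDownPlus_eq hq _ _ _ _ _ hD]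
    have hD' : 1 - b * c * ((q ^ (n : ℤ)) ^ 2 * q) ≠ 0 := by
      simpa only [zpow_add₀ hq, zpow_double, zpow_one] using hD
    refine (?_ : _ = _).trans (newtonB_operator hq (A' := -c * r * (q ^ M * q) *
      ((1 - q ^ (n : ℤ) / (q ^ M * q)) * (1 - q ^ (n : ℤ) / (q ^ M * q) * q) *
        (1 - b * (q ^ (n : ℤ) * q))))
      (C' := -r * ((1 - c * q ^ (n : ℤ)) *
      (1 - b * c * (q ^ (n : ℤ) * (q ^ M * q)))) * (1 - b * c * (q ^ (n : ℤ) * (q ^ M * q) * q)) /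
      (q ^ M * q)) (e := -r * (1 - c * (q ^ M * q)) * ((q ^ M * q)⁻¹ - 1)) hE1 hE2 hD' ?_)
    · simp only [zpow_add₀ hq, zpow_natCast, zpow_one]
      generalize 1 - b * c * (q ^ n) ^ 2 = E1
      generalize 1 - b * c * ((q ^ n) ^ 2 * q) = E2
      ring
    · simp only [zpow_natCast, pow_succ q k]
      have h1 : q ^ n ≠ 0 := pow_ne_zero _ hq
      have h3 : q ^ k ≠ 0 := pow_ne_zero _ hq
      field_simp
      ring
  · intro k hk
    obtain ⟨h1, h2, h3, h4⟩ := R.w_denominators hk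
    have h5 := hS k hk.le
    have h6 := hS 0 (Nat.zero_le _)
    rw [racahW_succ, racahW_block hq hT (hT' k hk.le) hM1 (hS k hk.le), hμ]
    simp only [zpow_natCast, pow_succ q k, zpow_add₀ hq, zpow_sub₀ hq, zpow_one]
    rw [pow_zero, one_div] at h6
    have g1 : q ^ x ≠ 0 := pow_ne_zero _ hq
    have g3 : q ^ k ≠ 0 := pow_ne_zero _ hq
    generalize racahW q a b c M k = w
    have e1 : (q ^ k * q)⁻¹ * c * r * (q ^ M * q) * (1 - q ^ k * q / (q ^ M * q ^ 2)) *
        (1 - b * (q ^ k * q)) * (1 - q ^ k * q / (q ^ M * q)) * (1 - q ^ k * q) *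
        (w * q / ((1 - b * (q ^ k * q)) *
      (1 - a * b * c * (q ^ M * q ^ 2 * q ^ k)) * (1 - q ^ k / q ^ M) * (1 - q ^ k * q))) =
        (q ^ k)⁻¹ * c * r * (q ^ M * q) * (1 - q ^ k / (q ^ M * q)) * w /
        (1 - a * b * c * (q ^ M * q ^ 2 * q ^ k)) := by
      rw [show q ^ k * q / (q ^ M * q ^ 2) = q ^ k / (q ^ M * q) by field_simp,
        mul_div_mul_right _ _ hq]
      generalize 1 - b * (q ^ k * q) = E1 at *
      generalize 1 - a * b * c * (q ^ M * q ^ 2 * q ^ k) = E2 at *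
      generalize 1 - q ^ k / q ^ M = E3 at *
      generalize 1 - q ^ k * q = E4 at *
      generalize 1 - q ^ k / (q ^ M * q) = E5 at *
      field_simp
    rw [e1]
    have e2 : 1 - q ^ M * q = -(q ^ M * q) * (1 - (q ^ M * q)⁻¹) := by field_simp; ring
    rw [e2]
    have e3 : r * (1 - c * (q ^ M * q / q ^ k)) * (1 - q ^ k / (q ^ M * q)) * w =
      r * (1 - c * (q ^ M * q / q ^ k)) * (1 - a * b * c * (q ^ M * q ^ 2 * q ^ k)) *
        (1 - q ^ k / (q ^ M * q)) * w / (1 - a * b * c * (q ^ M * q ^ 2 * q ^ k)) := by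
      generalize 1 - a * b * c * (q ^ M * q ^ 2 * q ^ k) = E2 at *
      field_simp
    rw [e3]
    obtain ⟨E2, hE2⟩ : ∃ y, y = 1 - a * b * c * (q ^ M * q ^ 2 * q ^ k) := ⟨_, rfl⟩
    rw [← hE2] at h2 ⊢
    generalize 1 - a * b * c * (q ^ M * q ^ 2) = E1 at *
    generalize 1 - (q ^ M * q)⁻¹ = E3 at *
    generalize 1 - q ^ k / (q ^ M * q) = E4 at *
    field_simp
    rw [hE2]
    ring
  -- Top term: it is present only for `x = M`, where the ratio of the coefficients of the two blocks
  -- matches `μ`.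
  · rcases newtonB_eq_zero_or q (a * b) hx with h | h
    · rw [h]; ring
    · have h2 := hT' M le_rfl
      have h5 := hS M le_rfl
      have h6 := hS 0 (Nat.zero_le _)
      rw [racahW_block hq hT h2 hM1 h5, hμ, h]
      rw [pow_zero, one_div] at h6
      congr 1
      generalize racahW q a b c M M = w
      have e2 : 1 - q ^ M * q = -(q ^ M * q) * (1 - (q ^ M * q)⁻¹) := by field_simp; ring
      have e3 : q ^ M * q ^ M * q ^ 2 = q ^ M * q ^ 2 * q ^ M := by ring
      rw [e2, e3]
      generalize 1 - a * b * c * (q ^ M * q ^ 2 * q ^ M) = E2 at *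
      generalize 1 - a * b * c * (q ^ M * q ^ 2) = E1 at *
      generalize 1 - (q ^ M * q)⁻¹ = E3 at *
      generalize 1 - q ^ M / (q ^ M * q) = E4 at *
      field_simp

/-- Here the operator acts on the larger series and reproduces the coefficients of the smaller one.
No bound on `x` is needed, since the surplus top term is killed by the Newton element in `n`. -/
theorem racahPhi_down {q r a b c : ℂ} {M : ℕ} (R : BlockReg q r a b c (M + 1)) {n x : ℕ}
    (hn : n ≤ M) :
    PhiUp (-1) q r a b c M n * racahPhi q a b c (M + 1) ((n : ℤ) + 1) x +
      PhiUp 0 q r a b c M n * racahPhi q a b c (M + 1) n x +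
      PhiUp 1 q r a b c M n * racahPhi q a b c (M + 1) ((n : ℤ) - 1) x =
    -((1 - a * b * c * (q ^ M * q ^ 2)) * (1 - q ^ x / (q ^ M * q)) *
      (1 - a * b * (q ^ M * q ^ x * q ^ 2)) /
      (q ^ x * c * (q ^ M * q) * r * (1 - (q ^ M * q)⁻¹))) *
      racahPhi q a b c M n x := by
  have hq := R.q0
  have hr := R.r0
  have hc := R.c0
  have g2 : q ^ M ≠ 0 := pow_ne_zero _ hq
  have g1 : q ^ x ≠ 0 := pow_ne_zero _ hq
  have hD : 1 - b * c * q ^ (2 * (n : ℤ) + 1) ≠ 0 := R.reg_bc _ (by push_cast; omega) (by push_cast; omega)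
  have hE1 : 1 - b * c * ((q ^ (n : ℤ)) ^ 2 * q ^ 2) ≠ 0 :=
    R.reg_bc.ne (k := 2 * n + 2) (by push_cast; omega) (by push_cast; omega)
      (by simp only [zpow_add₀ hq, zpow_double, zpow_two_eq])
  have hE2 : 1 - b * c * (q ^ (n : ℤ)) ^ 2 ≠ 0 :=
    R.reg_bc.ne (k := 2 * n) (by push_cast; omega) (by push_cast; omega)
      (by simp only [zpow_double])
  have hT : 1 - a * b * c * (q ^ M * q ^ 2) ≠ 0 :=
    R.reg_abc.ne (k := M + 2) (by push_cast; omega) (by push_cast; omega)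
      (by simp only [zpow_add₀ hq, zpow_natCast, zpow_two_eq])
  set μ := -((1 - a * b * c * (q ^ M * q ^ 2)) * (1 - q ^ x / (q ^ M * q)) *
      (1 - a * b * (q ^ M * q ^ x * q ^ 2)) /
      (q ^ x * c * (q ^ M * q) * r * (1 - (q ^ M * q)⁻¹))) with hμ
  have key := racahPhi_operator (q := q) (a := a) (b := b) (c := c) (M := M + 1) (n := n) (x := x)
    (A := PhiUpMinus q r a b c M n) (C := PhiUpPlus q r a b c M n)
    (e := -((1 - a * b * (q ^ M * q ^ 2)) * (1 - a * b * c * (q ^ M * q ^ 2)) /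
      (c * (q ^ M * q) * r))) (μ := μ)
    (α := fun k => -((1 - a * b * c * (q ^ M * q ^ 2 * q ^ k)) *
      (1 - a * b * (q ^ M * q ^ 2 * q ^ k)) / (q ^ k * c * (q ^ M * q) * r)))
    (β := fun k => (1 - a * b * c * (q ^ M * q * q ^ k)) * (1 - b * q ^ k) *
      (1 - a * b * c * (q ^ M * q ^ 2 * q ^ k)) * (1 - q ^ k) / (q ^ k * c * (q ^ M * q) * r))
    (w' := racahW q a b c M) (by simp; ring) ?_ ?_ ?_
  · have hs : racahPhi q a b c M n x = ∑ k ∈ Finset.range (M + 1 + 1),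
        newtonB q (b * c) k n * newtonB q (a * b) k x * racahW q a b c M k := by
      rw [racahPhi, Finset.sum_range_succ _ (M + 1),
        newtonB_eq_zero q (b * c) (by omega : n < M + 1)]
      ring
    rw [← hs] at key
    rw [← key]
    simp only [PhiUp, if_neg (show ¬ (0 : ℤ) = 1 by norm_num),
      if_neg (show ¬ (-1 : ℤ) = 1 by norm_num), if_neg (show ¬ (0 : ℤ) = -1 by norm_num),
      if_true, zpow_add₀ hq, zpow_natCast, zpow_one, zpow_two_eq]
    ring
  · intro k
    rw [PhiUpMinus_eq hq _ _ _ _ _ _ hD, PhiUpPlus_eq hq]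
    have hD' : 1 - b * c * ((q ^ (n : ℤ)) ^ 2 * q) ≠ 0 := by
      simpa only [zpow_add₀ hq, zpow_double, zpow_one] using hD
    refine (?_ : _ = _).trans (newtonB_operator hq (A' := -((1 - a * b * c * (q ^ (n : ℤ) * q ^ M * q ^ 2)) *
      (1 - a * b * c * (q ^ (n : ℤ) * q ^ M * q ^ 3)) * (1 - b * (q ^ (n : ℤ) * q))) / (c * (q ^ M * q) * r))
      (C' := -r * b * ((q ^ (n : ℤ)) ^ 2 / q ^ M / q) *
      ((1 - a * (q ^ M / q ^ (n : ℤ) * q)) * (1 - a * (q ^ M * q ^ 2 / q ^ (n : ℤ))) *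
        (1 - c * q ^ (n : ℤ)))) (e := -((1 - a * b * (q ^ M * q ^ 2)) * (1 - a * b * c * (q ^ M * q ^ 2)) /
      (c * (q ^ M * q) * r))) hE1 hE2 hD' ?_)
    · simp only [zpow_natCast]
      generalize 1 - b * c * (q ^ n) ^ 2 = E1
      generalize 1 - b * c * ((q ^ n) ^ 2 * q) = E2
      generalize 1 - b * c * ((q ^ n) ^ 2 * q ^ 2) = E3
      ring
    · simp only [zpow_natCast, pow_succ q k]
      have h1 : q ^ n ≠ 0 := pow_ne_zero _ hq
      have h3 : q ^ k ≠ 0 := pow_ne_zero _ hq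
      -- The relation `r ^ 2 = q * b` gives all terms the same power of the root.
      have h4 : r * b = q * b ^ 2 / r := by
        rw [eq_div_iff hr]; linear_combination b * R.rq
      rw [neg_mul r b, h4]
      field_simp
      ring
  · intro k hk
    obtain ⟨h1, h2, h3, h4⟩ := R.w_denominators hk
    have h6 := R.pow_sub (Nat.succ_pos M)
    have h2' : 1 - a * b * c * (q ^ M * q ^ 2 * q ^ k) ≠ 0 :=
      R.reg_abc.ne (k := M + 2 + k) (by push_cast; omega) (by push_cast; omega)
        (by simp only [zpow_add₀ hq, zpow_natCast, zpow_two_eq])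
    have hM1 := R.qk (M + 1) (by omega) le_rfl
    rw [pow_succ] at h3 h2
    have hb := racahW_block (a := a) (b := b) (c := c) hq hT h2' hM1 h3
    rw [racahW_succ, hb, hμ]
    simp only [zpow_natCast, pow_succ q k, zpow_add₀ hq, zpow_sub₀ hq, zpow_one, pow_succ q M]
    rw [pow_zero, pow_succ q M, one_div] at h6
    have g3 : q ^ k ≠ 0 := pow_ne_zero _ hq
    generalize racahW q a b c M k = w
    rw [show q ^ M * q * (q ^ k * q) = q ^ M * q ^ 2 * q ^ k by ring,
      show q ^ M * q ^ 2 * (q ^ k * q) = q ^ M * q * q ^ 2 * q ^ k by ring]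
    generalize 1 - b * (q ^ k * q) = E1 at *
    generalize 1 - a * b * c * (q ^ M * q * q ^ 2 * q ^ k) = E2 at *
    generalize 1 - a * b * c * (q ^ M * q ^ 2 * q ^ k) = E2' at *
    generalize 1 - q ^ k * q = E4 at *
    generalize 1 - a * b * c * (q ^ M * q ^ 2) = E5 at *
    generalize 1 - (q ^ M * q)⁻¹ = E6 at *
    obtain ⟨E3, hE3⟩ : ∃ y, y = 1 - q ^ k / (q ^ M * q) := ⟨_, rfl⟩
    rw [← hE3] at h3 ⊢
    -- The abstracted factor contains `q ^ k`, which also occurs by itself; this equation eliminates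
    -- the latter once the denominators are gone.
    have : E3 * (q ^ M * q) = q ^ M * q - q ^ k := by rw [hE3]; field_simp
    field_simp
    have hE : q ^ k = q ^ M * q - E3 * (q ^ M * q) := by rw [this]; ring
    simp only [hE]
    ring
  · rw [newtonB_eq_zero q (b * c) (by omega : n < M + 1)]
    ring

end QRacahAW4

namespace QRacahAW4

/-! ### The normalization -/

theorem racahOmega_form {q r a b c : ℂ} {n d : ℕ} (h : 1 - b * c * q ^ (2 * n + 1) ≠ 0) :
    racahOmega q r a b c (n + d) n = qPoch q q (n + d) / (qPoch q q n * qPoch q q d) *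
      ((1 - b * c * q ^ (2 * n + 1)) * qPoch q (q * b) n *
        qPoch q (a * b * c * q ^ (n + d + 2)) n * qPoch q (q * a) d) /
      (r ^ ((n : ℤ) - d) * qPoch q (b * c * q ^ (n + 1)) (n + d + 1) * qPoch q (q * c) n) := by
  rw [racahOmega_eq q r a b c (n + d) n (Nat.le_add_right _ _) h, qBinom,
    if_pos (Nat.le_add_right _ _), Nat.add_sub_cancel_left]
  push_cast
  rw [show 2 * (n : ℤ) - (n + d) = n - d by ring]

/-- Writing the block size as `n + 1 + d` makes every Pochhammer symbol change by end factors only,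
with no natural subtraction left. -/
theorem racahOmega_succ_left {q r a b c : ℂ} {n d : ℕ} (R : BlockReg q r a b c (n + 1 + d)) :
    racahOmega q r a b c (n + 1 + d) (n + 1) = racahOmega q r a b c (n + 1 + d) n *
      ((1 - q ^ d * q) * (1 - b * c * ((q ^ n) ^ 2 * q ^ 3)) * (1 - b * (q ^ n * q)) *
        (1 - a * b * c * ((q ^ n) ^ 2 * q ^ d * q ^ 3)) * (1 - b * c * (q ^ n * q))) /
      ((1 - q ^ n * q) * (1 - b * c * ((q ^ n) ^ 2 * q)) * (1 - a * (q ^ d * q)) * (q * b) *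
        (1 - b * c * ((q ^ n) ^ 2 * q ^ d * q ^ 3)) * (1 - c * (q ^ n * q))) := by
  have hq := R.q0
  have hr := R.r0
  have h1 : 1 - b * c * q ^ (2 * n + 1) ≠ 0 :=
    R.reg_bc.ne (k := (2 * n + 1 : ℕ)) (by push_cast; omega) (by push_cast; omega) (by rw [zpow_natCast])
  have h2 : 1 - b * c * q ^ (2 * (n + 1) + 1) ≠ 0 :=
    R.reg_bc.ne (k := (2 * (n + 1) + 1 : ℕ)) (by push_cast; omega) (by push_cast; omega) (by rw [zpow_natCast])
  have h3 : qPoch q q n ≠ 0 := qPoch_ne_zero fun l hl => by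
    rw [← pow_succ']; exact R.qk _ (by omega) (by omega)
  have h4 : qPoch q q d ≠ 0 := qPoch_ne_zero fun l hl => by
    rw [← pow_succ']; exact R.qk _ (by omega) (by omega)
  have h5 : qPoch q (q * c) n ≠ 0 := qPoch_ne_zero fun l hl =>
    R.reg_c.ne (k := (l + 1 : ℕ)) (by push_cast; omega) (by push_cast; omega)
      (by rw [zpow_natCast]; ring)
  have h6 : qPoch q (b * c * q ^ (n + 1 + 1)) (n + d + 1) ≠ 0 := qPoch_ne_zero fun l hl =>
    R.reg_bc.ne (k := (n + 1 + 1 + l : ℕ)) (by push_cast; omega) (by push_cast; omega)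
      (by rw [zpow_natCast]; ring)
  have g1 : 1 - q ^ n * q ≠ 0 := by rw [← pow_succ]; exact R.qk _ (by omega) (by omega)
  have g1' : 1 - q ^ d * q ≠ 0 := by rw [← pow_succ]; exact R.qk _ (by omega) (by omega)
  have g2 : 1 - a * (q ^ d * q) ≠ 0 := R.reg_a.ne (k := (d + 1 : ℕ)) (by push_cast; omega)
    (by push_cast; omega) (by rw [zpow_natCast]; ring)
  have g3 : 1 - c * (q ^ n * q) ≠ 0 := R.reg_c.ne (k := (n + 1 : ℕ)) (by push_cast; omega)
    (by push_cast; omega) (by rw [zpow_natCast]; ring)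
  have g4 : 1 - b * c * ((q ^ n) ^ 2 * q ^ d * q ^ 3) ≠ 0 :=
    R.reg_bc.ne (k := (2 * n + d + 3 : ℕ)) (by push_cast; omega)
    (by push_cast; omega) (by rw [zpow_natCast]; ring)
  have g5 : 1 - b * c * (q ^ n * q) ≠ 0 :=
    R.reg_bc.ne (k := (n + 1 : ℕ)) (by push_cast; omega)
    (by push_cast; omega) (by rw [zpow_natCast]; ring)
  have e1 : racahOmega q r a b c (n + 1 + d) n = racahOmega q r a b c (n + (d + 1)) n := by
    rw [show n + 1 + d = n + (d + 1) by ring]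
  rw [e1, racahOmega_form h1, racahOmega_form h2]
  have k1 : qPoch q (b * c * q ^ (n + 1)) (n + (d + 1) + 1) =
      (1 - b * c * (q ^ n * q)) * qPoch q (b * c * q ^ (n + 1 + 1)) (n + d + 1) := by
    rw [show n + (d + 1) + 1 = n + d + 1 + 1 by ring, qPoch_succ']
    ring_nf
  have k2 : qPoch q (b * c * q ^ (n + 1 + 1)) (n + 1 + d + 1) =
      qPoch q (b * c * q ^ (n + 1 + 1)) (n + d + 1) *
        (1 - b * c * ((q ^ n) ^ 2 * q ^ d * q ^ 3)) := by
    rw [show n + 1 + d + 1 = n + d + 1 + 1 by ring, qPoch_succ]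
    ring_nf
  have k3 : r ^ (((n + 1 : ℕ) : ℤ) - d) = r ^ ((n : ℤ) - (d + 1 : ℕ)) * (q * b) := by
    rw [← R.rq, ← zpow_natCast r 2, ← zpow_add₀ hr]
    congr 1; push_cast; ring
  have k4 : qPoch q (a * b * c * q ^ (n + 1 + d + 2)) (n + 1) =
      qPoch q (a * b * c * q ^ (n + (d + 1) + 2)) n *
        (1 - a * b * c * ((q ^ n) ^ 2 * q ^ d * q ^ 3)) := by
    rw [qPoch_succ]
    ring_nf
  have k5 : qPoch q (q * b) (n + 1) = qPoch q (q * b) n * (1 - b * (q ^ n * q)) := by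
    rw [qPoch_succ]; ring
  have k6 : qPoch q (q * c) (n + 1) = qPoch q (q * c) n * (1 - c * (q ^ n * q)) := by
    rw [qPoch_succ]; ring
  have k7 : qPoch q (q * a) (d + 1) = qPoch q (q * a) d * (1 - a * (q ^ d * q)) := by
    rw [qPoch_succ]; ring
  have k8 : qPoch q q (n + 1) = qPoch q q n * (1 - q ^ n * q) := by
    rw [qPoch_succ]; ring
  have k9 : qPoch q q (d + 1) = qPoch q q d * (1 - q ^ d * q) := by
    rw [qPoch_succ]; ring
  have k10 : q ^ (2 * n + 1) = (q ^ n) ^ 2 * q := by ring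
  have k11 : q ^ (2 * (n + 1) + 1) = (q ^ n) ^ 2 * q ^ 3 := by ring
  have hb := R.b0
  have hz : r ^ ((n : ℤ) - (d + 1 : ℕ)) ≠ 0 := zpow_ne_zero _ hr
  rw [k10] at h1
  rw [k1, k2, k3, k4, k5, k6, k7, k8, k9, k10, k11, show n + (d + 1) = n + 1 + d by ring]
  generalize 1 - b * c * ((q ^ n) ^ 2 * q) = E1 at *
  generalize 1 - b * c * ((q ^ n) ^ 2 * q ^ 3) = E2 at *
  generalize 1 - q ^ n * q = E3 at *
  generalize 1 - q ^ d * q = E4 at *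
  generalize 1 - a * (q ^ d * q) = E5 at *
  generalize 1 - c * (q ^ n * q) = E6 at *
  generalize 1 - b * c * (q ^ n * q) = E7 at *
  generalize 1 - b * (q ^ n * q) = E8 at *
  generalize 1 - b * c * ((q ^ n) ^ 2 * q ^ d * q ^ 3) = E9 at *
  generalize 1 - a * b * c * ((q ^ n) ^ 2 * q ^ d * q ^ 3) = E10 at *
  generalize r ^ ((n : ℤ) - (d + 1 : ℕ)) = E11 at *
  generalize qPoch q (a * b * c * q ^ (n + 1 + d + 2)) n = Q1 at *
  generalize qPoch q (b * c * q ^ (n + 1 + 1)) (n + d + 1) = Q2 at *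
  generalize qPoch q q n = Q3 at *
  generalize qPoch q q d = Q4 at *
  generalize qPoch q q (n + 1 + d) = Q5 at *
  generalize qPoch q (q * b) n = Q6 at *
  generalize qPoch q (q * a) d = Q7 at *
  generalize qPoch q (q * c) n = Q8 at *
  field_simp

theorem racahOmega_succ_block {q r a b c : ℂ} {n d : ℕ} (R : BlockReg q r a b c (n + d))
    (hM1 : 1 - q ^ (n + d + 1) ≠ 0) :
    racahOmega q r a b c (n + d + 1) n = racahOmega q r a b c (n + d) n *
      ((1 - q ^ n * q ^ d * q) * (1 - a * b * c * ((q ^ n) ^ 2 * q ^ d * q ^ 2)) *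
        (1 - a * (q ^ d * q)) * r) /
      ((1 - q ^ d * q) * (1 - a * b * c * (q ^ n * q ^ d * q ^ 2)) *
        (1 - b * c * ((q ^ n) ^ 2 * q ^ d * q ^ 2))) := by
  have hq := R.q0
  have hr := R.r0
  have h1 : 1 - b * c * q ^ (2 * n + 1) ≠ 0 :=
    R.reg_bc.ne (k := (2 * n + 1 : ℕ)) (by push_cast; omega) (by push_cast; omega) (by rw [zpow_natCast])
  have h3 : qPoch q q n ≠ 0 := qPoch_ne_zero fun l hl => by
    rw [← pow_succ']; exact R.qk _ (by omega) (by omega)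
  have h4 : qPoch q q d ≠ 0 := qPoch_ne_zero fun l hl => by
    rw [← pow_succ']; exact R.qk _ (by omega) (by omega)
  have h5 : qPoch q (q * c) n ≠ 0 := qPoch_ne_zero fun l hl =>
    R.reg_c.ne (k := (l + 1 : ℕ)) (by push_cast; omega) (by push_cast; omega)
      (by rw [zpow_natCast]; ring)
  have h6 : qPoch q (b * c * q ^ (n + 1)) (n + d + 1) ≠ 0 := qPoch_ne_zero fun l hl =>
    R.reg_bc.ne (k := (n + 1 + l : ℕ)) (by push_cast; omega) (by push_cast; omega)
      (by rw [zpow_natCast]; ring)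
  have g1' : 1 - q ^ d * q ≠ 0 := by
    rw [← pow_succ]
    rcases Nat.eq_zero_or_pos n with rfl | h0
    · simpa using hM1
    · exact R.qk _ (by omega) (by omega)
  have g2 : 1 - b * c * ((q ^ n) ^ 2 * q ^ d * q ^ 2) ≠ 0 :=
    R.reg_bc.ne (k := (2 * n + d + 2 : ℕ)) (by push_cast; omega)
    (by push_cast; omega) (by rw [zpow_natCast]; ring)
  have g3 : 1 - a * b * c * (q ^ n * q ^ d * q ^ 2) ≠ 0 :=
    R.reg_abc.ne (k := (n + d + 2 : ℕ)) (by push_cast; omega)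
    (by push_cast; omega) (by rw [zpow_natCast]; ring)
  rw [show n + d + 1 = n + (d + 1) by ring, racahOmega_form h1, racahOmega_form h1]
  have k2 : qPoch q (b * c * q ^ (n + 1)) (n + (d + 1) + 1) =
      qPoch q (b * c * q ^ (n + 1)) (n + d + 1) *
        (1 - b * c * ((q ^ n) ^ 2 * q ^ d * q ^ 2)) := by
    rw [show n + (d + 1) + 1 = n + d + 1 + 1 by ring, qPoch_succ]
    ring_nf
  have k3 : r ^ ((n : ℤ) - d) = r ^ ((n : ℤ) - (d + 1 : ℕ)) * r := by
    rw [← zpow_add_one₀ hr]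
    congr 1; push_cast; ring
  -- This base depends on the block size: the length is unchanged but the starting point moves, so
  -- one factor enters and one leaves.
  have k4 : qPoch q (a * b * c * q ^ (n + (d + 1) + 2)) n =
      qPoch q (a * b * c * q ^ (n + d + 2)) n *
        (1 - a * b * c * ((q ^ n) ^ 2 * q ^ d * q ^ 2)) /
        (1 - a * b * c * (q ^ n * q ^ d * q ^ 2)) := by
    rw [eq_div_iff g3]
    have := qPoch_shift q (a * b * c * q ^ (n + d + 2)) n
    convert this using 2 <;> ring_nf
  have k7 : qPoch q (q * a) (d + 1) = qPoch q (q * a) d * (1 - a * (q ^ d * q)) := by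
    rw [qPoch_succ]; ring
  have k8 : qPoch q q (n + (d + 1)) = qPoch q q (n + d) * (1 - q ^ n * q ^ d * q) := by
    rw [← add_assoc, qPoch_succ]; ring
  have k9 : qPoch q q (d + 1) = qPoch q q d * (1 - q ^ d * q) := by
    rw [qPoch_succ]; ring
  have hz : r ^ ((n : ℤ) - (d + 1 : ℕ)) ≠ 0 := zpow_ne_zero _ hr
  rw [k2, k3, k4, k7, k8, k9]
  generalize 1 - b * c * q ^ (2 * n + 1) = E1 at *
  generalize 1 - q ^ n * q ^ d * q = E3 at *
  generalize 1 - q ^ d * q = E4 at *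
  generalize 1 - a * (q ^ d * q) = E5 at *
  generalize 1 - b * c * ((q ^ n) ^ 2 * q ^ d * q ^ 2) = E9 at *
  generalize 1 - a * b * c * ((q ^ n) ^ 2 * q ^ d * q ^ 2) = E10 at *
  generalize 1 - a * b * c * (q ^ n * q ^ d * q ^ 2) = E2 at *
  generalize r ^ ((n : ℤ) - (d + 1 : ℕ)) = E11 at *
  generalize qPoch q (a * b * c * q ^ (n + d + 2)) n = Q1 at *
  generalize qPoch q (b * c * q ^ (n + 1)) (n + d + 1) = Q2 at *
  generalize qPoch q q n = Q3 at *
  generalize qPoch q q d = Q4 at *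
  generalize qPoch q q (n + d) = Q5 at *
  generalize qPoch q (q * b) n = Q6 at *
  generalize qPoch q (q * a) d = Q7 at *
  generalize qPoch q (q * c) n = Q8 at *
  field_simp

end QRacahAW4

namespace QRacahAW4

/-! ### Detailed balance -/

theorem BlockReg.mono {q r a b c : ℂ} {M M' : ℕ} (R : BlockReg q r a b c M) (h : M' ≤ M) :
    BlockReg q r a b c M' :=
  ⟨R.q0, R.r0, R.rq, R.b0, R.c0, fun k h1 h2 => R.qk k h1 (h2.trans h),
    fun k h1 h2 => R.reg_a k (by omega) (by omega), fun k h1 h2 => R.reg_b k (by omega) (by omega),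
    fun k h1 h2 => R.reg_c k (by omega) (by omega), fun k h1 h2 => R.reg_ab k (by omega) (by omega),
    fun k h1 h2 => R.reg_bc k (by omega) (by omega),
    fun k h1 h2 => R.reg_abc k (by omega) (by omega)⟩

/-- The ratio of consecutive normalizations matches the ratio of the two transition coefficients.
The tridiagonal operator is thus symmetric for the weight `racahOmega`, which converts the
recurrence of the series into one for the normalized polynomials with the coefficients read along
the other index. -/
theorem Phi_balance {q r a b c : ℂ} {n d : ℕ} (R : BlockReg q r a b c (n + 1 + d)) :
    PhiPlus q a b c ((n + 1 + d : ℕ) : ℤ) ((n + 1 : ℕ) : ℤ) *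
        racahOmega q r a b c (n + 1 + d) (n + 1) =
      PhiMinus q a b c ((n + 1 + d : ℕ) : ℤ) n * racahOmega q r a b c (n + 1 + d) n := by
  have hq := R.q0
  have hb := R.b0
  have hD : ∀ m : ℕ, m ≤ 2 * n + 4 → 1 - b * c * q ^ (m : ℤ) ≠ 0 := fun m hm =>
    R.reg_bc _ (by push_cast; omega) (by push_cast; omega)
  have h1 := hD (2 * n + 1) (by omega)
  have h2 := hD (2 * n + 3) (by omega)
  have h3 := hD (2 * n + 2) (by omega)
  have g1 : 1 - q ^ n * q ≠ 0 := by rw [← pow_succ]; exact R.qk _ (by omega) (by omega)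
  have g2 : 1 - a * (q ^ d * q) ≠ 0 := R.reg_a.ne (k := (d + 1 : ℕ)) (by push_cast; omega)
    (by push_cast; omega) (by rw [zpow_natCast]; ring)
  have g3 : 1 - c * (q ^ n * q) ≠ 0 := R.reg_c.ne (k := (n + 1 : ℕ)) (by push_cast; omega)
    (by push_cast; omega) (by rw [zpow_natCast]; ring)
  have g4 : 1 - b * c * ((q ^ n) ^ 2 * q ^ d * q ^ 3) ≠ 0 :=
    R.reg_bc.ne (k := (2 * n + d + 3 : ℕ)) (by push_cast; omega)
    (by push_cast; omega) (by rw [zpow_natCast]; ring)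
  rw [racahOmega_succ_left R, PhiPlus_eq hq _ _ _ _ _ (by push_cast at h2 ⊢; convert h2 using 4; ring),
    PhiMinus_eq hq _ _ _ _ _ (by exact_mod_cast h1)]
  simp only [zpow_natCast, pow_succ q n, pow_add q _ d] at h1 h2 h3 ⊢
  have hX : q ^ n ≠ 0 := pow_ne_zero _ hq
  have hY : q ^ d ≠ 0 := pow_ne_zero _ hq
  rw [show q ^ (2 * n + 1) = (q ^ n) ^ 2 * q by ring] at h1
  rw [show q ^ (2 * n + 3) = (q ^ n) ^ 2 * q ^ 3 by ring] at h2
  rw [show q ^ (2 * n + 2) = (q ^ n) ^ 2 * q ^ 2 by ring] at h3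
  generalize racahOmega q r a b c (n + 1 + d) n = w
  rw [show (q ^ n * q) ^ 2 * q = (q ^ n) ^ 2 * q ^ 3 by ring,
    show (q ^ n * q) ^ 2 = (q ^ n) ^ 2 * q ^ 2 by ring,
    show q ^ n * q * (q ^ n * q * q ^ d) * q = (q ^ n) ^ 2 * q ^ d * q ^ 3 by ring,
    show q ^ n * (q ^ n * q * q ^ d) * q ^ 2 = (q ^ n) ^ 2 * q ^ d * q ^ 3 by ring,
    show q ^ n * q * q ^ d / (q ^ n * q) * q = q ^ d * q by field_simp,
    show q ^ n * q / (q ^ n * q * q ^ d) = 1 / q ^ d by field_simp,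
    show q ^ n / (q ^ n * q * q ^ d) = 1 / (q ^ d * q) by field_simp]
  generalize 1 - b * c * ((q ^ n) ^ 2 * q) = E1 at *
  generalize 1 - b * c * ((q ^ n) ^ 2 * q ^ 2) = E2 at *
  generalize 1 - b * c * ((q ^ n) ^ 2 * q ^ 3) = E3 at *
  generalize 1 - b * c * ((q ^ n) ^ 2 * q ^ d * q ^ 3) = E4 at *
  generalize 1 - q ^ n * q = E5 at *
  generalize 1 - a * (q ^ d * q) = E6 at *
  generalize 1 - c * (q ^ n * q) = E7 at *
  field_simp
  ring

/-- The constant in the balance between blocks of sizes `M` and `M + 1`. -/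
noncomputable def balanceConst (q r a b c : ℂ) (M : ℕ) : ℂ :=
  (1 - a * b * c * (q ^ M * q ^ 2)) / ((1 - q ^ M * q) * c * r)

/-- Balance between different blocks: the two families of contiguity coefficients are transposes of
each other for the two weights, up to `balanceConst`. The three lemmas treat the three offsets of
the index. -/
theorem PhiUp_balance_one {q r a b c : ℂ} {n d : ℕ} (R : BlockReg q r a b c (n + 1 + d))
    (hM1 : 1 - q ^ (n + 1 + d + 1) ≠ 0) :
    PhiUpPlus q r a b c ((n + 1 + d : ℕ) : ℤ) ((n + 1 : ℕ) : ℤ) *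
        racahOmega q r a b c (n + 1 + d) (n + 1) =
      balanceConst q r a b c (n + 1 + d) *
      PhiDownMinus q r b c (((n + 1 + d : ℕ) : ℤ) + 1) n *
        racahOmega q r a b c (n + 1 + d + 1) n := by
  have hq := R.q0
  have hb := R.b0
  have hr := R.r0
  have hc := R.c0
  have hD : ∀ m : ℕ, m ≤ 2 * n + 4 → 1 - b * c * q ^ (m : ℤ) ≠ 0 := fun m hm =>
    R.reg_bc _ (by push_cast; omega) (by push_cast; omega)
  have h1 := hD (2 * n + 1) (by omega)
  have h2 := hD (2 * n + 3) (by omega)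
  have h3 := hD (2 * n + 2) (by omega)
  have g1 : 1 - q ^ n * q ≠ 0 := by rw [← pow_succ]; exact R.qk _ (by omega) (by omega)
  have g2 : 1 - a * (q ^ d * q) ≠ 0 := R.reg_a.ne (k := (d + 1 : ℕ)) (by push_cast; omega)
    (by push_cast; omega) (by rw [zpow_natCast]; ring)
  have g3 : 1 - c * (q ^ n * q) ≠ 0 := R.reg_c.ne (k := (n + 1 : ℕ)) (by push_cast; omega)
    (by push_cast; omega) (by rw [zpow_natCast]; ring)
  have g4 : 1 - b * c * ((q ^ n) ^ 2 * q ^ d * q ^ 3) ≠ 0 :=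
    R.reg_bc.ne (k := (2 * n + d + 3 : ℕ)) (by push_cast; omega)
    (by push_cast; omega) (by rw [zpow_natCast]; ring)
  have g5 : 1 - a * b * c * (q ^ n * q ^ d * q ^ 3) ≠ 0 :=
    R.reg_abc.ne (k := (n + d + 3 : ℕ)) (by push_cast; omega)
    (by push_cast; omega) (by rw [zpow_natCast]; ring)
  have g6 : 1 - q ^ d * q ^ 2 ≠ 0 := by
    rw [← pow_add]
    rcases Nat.eq_zero_or_pos n with rfl | h0
    · convert hM1 using 3; ring
    · exact R.qk _ (by omega) (by omega)
  have g7 : 1 - q ^ n * q ^ d * q ^ 2 ≠ 0 := by convert hM1 using 2; ring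
  have e1 := racahOmega_succ_block (n := n) (d := d + 1) (R.mono (by omega))
    (by convert hM1 using 3; ring)
  rw [show n + (d + 1) = n + 1 + d by ring] at e1
  rw [racahOmega_succ_left R, e1, PhiUpPlus_eq hq,
    PhiDownMinus_eq hq _ _ _ _ _ (by exact_mod_cast h1), balanceConst]
  simp only [zpow_natCast, pow_succ q n, pow_succ q d, pow_add q _ d, zpow_add₀ hq, zpow_one]
    at h1 h2 h3 ⊢
  have hX : q ^ n ≠ 0 := pow_ne_zero _ hq
  have hY : q ^ d ≠ 0 := pow_ne_zero _ hq
  rw [show q ^ (2 * n + 1) = (q ^ n) ^ 2 * q by ring] at h1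
  rw [show q ^ (2 * n + 3) = (q ^ n) ^ 2 * q ^ 3 by ring] at h2
  rw [show q ^ (2 * n + 2) = (q ^ n) ^ 2 * q ^ 2 by ring] at h3
  generalize racahOmega q r a b c (n + 1 + d) n = w
  rw [show (q ^ n * q) ^ 2 * q = (q ^ n) ^ 2 * q ^ 3 by ring,
    show (q ^ n * q) ^ 2 = (q ^ n) ^ 2 * q ^ 2 by ring,
    show q ^ n * q * q ^ d * q ^ 2 = q ^ n * q ^ d * q ^ 3 by ring,
    show q ^ n * (q ^ d * q) * q ^ 2 = q ^ n * q ^ d * q ^ 3 by ring,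
    show q ^ n * q * q ^ d * q = q ^ n * q ^ d * q ^ 2 by ring,
    show q ^ n * (q ^ d * q) * q = q ^ n * q ^ d * q ^ 2 by ring,
    show (q ^ n) ^ 2 * (q ^ d * q) * q ^ 2 = (q ^ n) ^ 2 * q ^ d * q ^ 3 by ring,
    show q ^ d * q * q = q ^ d * q ^ 2 by ring,
    show q ^ n * q * q ^ d / (q ^ n * q) * q = q ^ d * q by field_simp,
    show q ^ n * q ^ d * q ^ 3 / (q ^ n * q) = q ^ d * q ^ 2 by field_simp,
    show q ^ n / (q ^ n * q ^ d * q ^ 2) = 1 / (q ^ d * q ^ 2) by field_simp]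
  generalize 1 - b * c * ((q ^ n) ^ 2 * q) = E1 at *
  generalize 1 - b * c * ((q ^ n) ^ 2 * q ^ 2) = E2 at *
  generalize 1 - b * c * ((q ^ n) ^ 2 * q ^ 3) = E3 at *
  generalize 1 - b * c * ((q ^ n) ^ 2 * q ^ d * q ^ 3) = E4 at *
  generalize 1 - q ^ n * q = E5 at *
  generalize 1 - a * (q ^ d * q) = E6 at *
  generalize 1 - c * (q ^ n * q) = E7 at *
  generalize 1 - a * b * c * (q ^ n * q ^ d * q ^ 3) = E8 at *
  generalize 1 - q ^ n * q ^ d * q ^ 2 = E9 at *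
  -- This factor must stay opaque as a denominator and yet be expanded afterwards, because `q ^ d`
  -- also occurs in a numerator.
  obtain ⟨E10, hE⟩ : ∃ y, y = 1 - q ^ d * q ^ 2 := ⟨_, rfl⟩
  rw [← hE] at g6 ⊢
  field_simp
  rw [hE]
  ring

/-- Unlike the two off-diagonal cases this is not a comparison of products: the middle coefficients
are sums of three terms, so all denominators are cleared and the polynomials expanded. -/
theorem PhiUp_balance_zero {q r a b c : ℂ} {n d : ℕ} (R : BlockReg q r a b c (n + d))
    (hM1 : 1 - q ^ (n + d + 1) ≠ 0) :
    PhiUp 0 q r a b c ((n + d : ℕ) : ℤ) n * racahOmega q r a b c (n + d) n =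
      balanceConst q r a b c (n + d) *
      PhiDown 0 q r a b c (((n + d : ℕ) : ℤ) + 1) n * racahOmega q r a b c (n + d + 1) n := by
  have hq := R.q0
  have hb := R.b0
  have hr := R.r0
  have hc := R.c0
  have hD : ∀ m : ℕ, m ≤ 2 * n + 4 → 1 - b * c * q ^ (m : ℤ) ≠ 0 := fun m hm =>
    R.reg_bc _ (by push_cast; omega) (by push_cast; omega)
  have h1 := hD (2 * n + 1) (by omega)
  have h2 := hD (2 * n) (by omega)
  have h3 := hD (2 * n + 2) (by omega)
  have g4 : 1 - b * c * ((q ^ n) ^ 2 * q ^ d * q ^ 2) ≠ 0 :=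
    R.reg_bc.ne (k := (2 * n + d + 2 : ℕ)) (by push_cast; omega)
    (by push_cast; omega) (by rw [zpow_natCast]; ring)
  have g5 : 1 - a * b * c * (q ^ n * q ^ d * q ^ 2) ≠ 0 :=
    R.reg_abc.ne (k := (n + d + 2 : ℕ)) (by push_cast; omega)
    (by push_cast; omega) (by rw [zpow_natCast]; ring)
  have g6 : 1 - q ^ d * q ≠ 0 := by
    rw [← pow_succ]
    rcases Nat.eq_zero_or_pos n with rfl | h0
    · simpa using hM1
    · exact R.qk _ (by omega) (by omega)
  have g7 : 1 - q ^ n * q ^ d * q ≠ 0 := by convert hM1 using 2; ring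
  rw [racahOmega_succ_block R hM1]
  simp only [PhiUp, PhiDown, if_neg (show ¬ (0 : ℤ) = 1 by norm_num),
      if_neg (show ¬ (0 : ℤ) = -1 by norm_num), if_true]
  rw [PhiUpPlus_eq hq, PhiUpMinus_eq hq _ _ _ _ _ _ (by exact_mod_cast h1),
    PhiDownPlus_eq hq _ _ _ _ _ (by exact_mod_cast h1),
    PhiDownMinus_eq hq _ _ _ _ _ (by exact_mod_cast h1), balanceConst]
  have hX : q ^ n ≠ 0 := pow_ne_zero _ hq
  have hY : q ^ d ≠ 0 := pow_ne_zero _ hq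
  simp only [zpow_natCast, pow_add q n d, zpow_add₀ hq, zpow_one, zpow_neg, zpow_two_eq]
    at h1 h2 h3 ⊢
  rw [show q ^ (2 * n + 1) = (q ^ n) ^ 2 * q by ring] at h1
  rw [show q ^ (2 * n) = (q ^ n) ^ 2 by ring] at h2
  rw [show q ^ (2 * n + 2) = (q ^ n) ^ 2 * q ^ 2 by ring] at h3
  generalize racahOmega q r a b c (n + d) n = w
  have hr2 : r * b = q * b ^ 2 / r := by
    rw [eq_div_iff hr]; linear_combination b * R.rq
  rw [neg_mul r b, hr2]
  generalize q ^ n = X at *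
  generalize q ^ d = Y at *
  obtain ⟨E1, hE1⟩ : ∃ y, y = 1 - b * c * (X ^ 2 * q) := ⟨_, rfl⟩
  obtain ⟨E2, hE2⟩ : ∃ y, y = 1 - b * c * (X ^ 2) := ⟨_, rfl⟩
  obtain ⟨E3, hE3⟩ : ∃ y, y = 1 - b * c * (X ^ 2 * q ^ 2) := ⟨_, rfl⟩
  obtain ⟨E4, hE4⟩ : ∃ y, y = 1 - b * c * (X ^ 2 * Y * q ^ 2) := ⟨_, rfl⟩
  obtain ⟨E5, hE5⟩ : ∃ y, y = 1 - a * b * c * (X * Y * q ^ 2) := ⟨_, rfl⟩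
  obtain ⟨E6, hE6⟩ : ∃ y, y = 1 - Y * q := ⟨_, rfl⟩
  obtain ⟨E7, hE7⟩ : ∃ y, y = 1 - X * Y * q := ⟨_, rfl⟩
  rw [← hE1] at h1
  rw [← hE2] at h2
  rw [← hE3] at h3
  rw [← hE4] at g4
  rw [← hE5] at g5
  rw [← hE6] at g6
  rw [← hE7] at g7
  rw [← hE1, ← hE2, ← hE3, ← hE4, ← hE5, ← hE6, ← hE7]
  field_simp
  rw [R.rq, hE1, hE2, hE3, hE4, hE5, hE6]
  ring

theorem PhiUp_balance_neg {q r a b c : ℂ} {n d : ℕ} (R : BlockReg q r a b c (n + 1 + d)) :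
    PhiUpMinus q r a b c ((n + d : ℕ) : ℤ) n * racahOmega q r a b c (n + d) n =
      balanceConst q r a b c (n + d) *
      PhiDownPlus q r b c (((n + d : ℕ) : ℤ) + 1) ((n + 1 : ℕ) : ℤ) *
        racahOmega q r a b c (n + d + 1) (n + 1) := by
  have hq := R.q0
  have hb := R.b0
  have hr := R.r0
  have hc := R.c0
  have hM1 := R.qk (n + 1 + d) (by omega) le_rfl
  have hD : ∀ m : ℕ, m ≤ 2 * n + 4 → 1 - b * c * q ^ (m : ℤ) ≠ 0 := fun m hm =>
    R.reg_bc _ (by push_cast; omega) (by push_cast; omega)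
  have h1 := hD (2 * n + 1) (by omega)
  have h2 := hD (2 * n + 3) (by omega)
  have h3 := hD (2 * n + 2) (by omega)
  have g1 : 1 - q ^ n * q ≠ 0 := by rw [← pow_succ]; exact R.qk _ (by omega) (by omega)
  have g1' : 1 - q ^ d * q ≠ 0 := by rw [← pow_succ]; exact R.qk _ (by omega) (by omega)
  have g2 : 1 - a * (q ^ d * q) ≠ 0 := R.reg_a.ne (k := (d + 1 : ℕ)) (by push_cast; omega)
    (by push_cast; omega) (by rw [zpow_natCast]; ring)
  have g3 : 1 - c * (q ^ n * q) ≠ 0 := R.reg_c.ne (k := (n + 1 : ℕ)) (by push_cast; omega)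
    (by push_cast; omega) (by rw [zpow_natCast]; ring)
  have g4 : 1 - b * c * ((q ^ n) ^ 2 * q ^ d * q ^ 3) ≠ 0 :=
    R.reg_bc.ne (k := (2 * n + d + 3 : ℕ)) (by push_cast; omega)
    (by push_cast; omega) (by rw [zpow_natCast]; ring)
  have g4' : 1 - b * c * ((q ^ n) ^ 2 * q ^ d * q ^ 2) ≠ 0 :=
    R.reg_bc.ne (k := (2 * n + d + 2 : ℕ)) (by push_cast; omega)
    (by push_cast; omega) (by rw [zpow_natCast]; ring)
  have g5 : 1 - a * b * c * (q ^ n * q ^ d * q ^ 2) ≠ 0 :=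
    R.reg_abc.ne (k := (n + d + 2 : ℕ)) (by push_cast; omega)
    (by push_cast; omega) (by rw [zpow_natCast]; ring)
  have g7 : 1 - q ^ n * q ^ d * q ≠ 0 := by convert hM1 using 2; ring
  have hc' : n + d + 1 = n + 1 + d := by ring
  have e1 := racahOmega_succ_block (n := n) (d := d) (R.mono (by omega)) (by rwa [hc'])
  have e2 := racahOmega_succ_left R
  rw [hc'] at e1 ⊢
  rw [e2, e1, PhiUpMinus_eq hq _ _ _ _ _ _ (by exact_mod_cast h1),
    PhiDownPlus_eq hq _ _ _ _ _ (by push_cast at h2 ⊢; convert h2 using 4; ring), balanceConst]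
  simp only [zpow_natCast, pow_succ q n, pow_add q _ d, zpow_add₀ hq, zpow_one]
    at h1 h2 h3 ⊢
  have hX : q ^ n ≠ 0 := pow_ne_zero _ hq
  have hY : q ^ d ≠ 0 := pow_ne_zero _ hq
  rw [show q ^ (2 * n + 1) = (q ^ n) ^ 2 * q by ring] at h1
  rw [show q ^ (2 * n + 3) = (q ^ n) ^ 2 * q ^ 3 by ring] at h2
  rw [show q ^ (2 * n + 2) = (q ^ n) ^ 2 * q ^ 2 by ring] at h3
  generalize racahOmega q r a b c (n + d) n = w
  rw [show (q ^ n * q) ^ 2 * q = (q ^ n) ^ 2 * q ^ 3 by ring,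
    show (q ^ n * q) ^ 2 = (q ^ n) ^ 2 * q ^ 2 by ring,
    show q ^ n * (q ^ n * q ^ d) * q ^ 2 = (q ^ n) ^ 2 * q ^ d * q ^ 2 by ring,
    show q ^ n * (q ^ n * q ^ d) * q ^ 3 = (q ^ n) ^ 2 * q ^ d * q ^ 3 by ring,
    show q ^ n * q * (q ^ n * q ^ d * q) * q = (q ^ n) ^ 2 * q ^ d * q ^ 3 by ring,
    show q ^ n * q * (q ^ n * q ^ d * q) = (q ^ n) ^ 2 * q ^ d * q ^ 2 by ring,
    ← R.rq]
  generalize 1 - b * c * ((q ^ n) ^ 2 * q) = E1 at *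
  generalize 1 - b * c * ((q ^ n) ^ 2 * q ^ 2) = E2 at *
  generalize 1 - b * c * ((q ^ n) ^ 2 * q ^ 3) = E3 at *
  generalize 1 - b * c * ((q ^ n) ^ 2 * q ^ d * q ^ 3) = E4 at *
  generalize 1 - b * c * ((q ^ n) ^ 2 * q ^ d * q ^ 2) = E4' at *
  generalize 1 - a * b * c * ((q ^ n) ^ 2 * q ^ d * q ^ 3) = E10 at *
  generalize 1 - a * b * c * ((q ^ n) ^ 2 * q ^ d * q ^ 2) = E11 at *
  generalize 1 - q ^ n * q = E5 at *
  generalize 1 - q ^ d * q = E5' at *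
  generalize 1 - a * (q ^ d * q) = E6 at *
  generalize 1 - c * (q ^ n * q) = E7 at *
  generalize 1 - a * b * c * (q ^ n * q ^ d * q ^ 2) = E8 at *
  generalize 1 - q ^ n * q ^ d * q = E9 at *
  field_simp

end QRacahAW4

namespace QRacahAW4

/-! ### Three-term sums -/

/-- An operator supported on offsets `1, 0, -1` may be written out in full, provided that its
coefficients vanish wherever the neighbour lies outside the block. The case `n = M + 1` is included
for operators between blocks of different sizes. -/
theorem sum_three_term {M n : ℕ} {h f : ℤ → ℂ}
    (hh : ∀ e : ℤ, e ≠ 1 → e ≠ 0 → e ≠ -1 → h e = 0) (h1 : n = 0 → h 1 = 0)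
    (h2 : M ≤ n → h (-1) = 0) (h3 : M < n → h 0 = 0) (hn : n ≤ M + 1) :
    ∑ k ∈ Finset.range (M + 1), h ((n : ℤ) - k) * f k =
      h (-1) * f ((n : ℤ) + 1) + h 0 * f n + h 1 * f ((n : ℤ) - 1) := by
  have e : ∀ k : ℕ, h ((n : ℤ) - k) * f k =
      (if k = n + 1 then h (-1) * f ((n : ℤ) + 1) else 0) + (if k = n then h 0 * f n else 0) +
        (if k + 1 = n then h 1 * f ((n : ℤ) - 1) else 0) := by
    intro k
    by_cases a1 : k = n + 1
    · subst a1; simp; omega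
    by_cases a2 : k = n
    · subst a2; simp
    by_cases a3 : k + 1 = n
    · subst a3; simp; omega
    · simp only [if_neg a1, if_neg a2, if_neg a3]
      rw [hh _ (by omega) (by omega) (by omega)]; ring
  simp only [e, Finset.sum_add_distrib, Finset.sum_ite_eq', Finset.mem_range]
  congr 1
  · congr 1
    · split_ifs with hc
      · rfl
      · rw [h2 (by omega), zero_mul]
    · split_ifs with hc
      · rfl
      · rw [h3 (by omega), zero_mul]
  · rcases Nat.eq_zero_or_pos n with rfl | hn0
    · simp [h1 rfl]
    · obtain ⟨m, rfl⟩ : ∃ m, n = m + 1 := ⟨n - 1, by omega⟩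
      simp only [Nat.add_right_cancel_iff, Finset.sum_ite_eq', Finset.mem_range]
      rw [if_pos (by omega)]

theorem Phi_of_ne {e : ℤ} (h1 : e ≠ 1) (h0 : e ≠ 0) (h2 : e ≠ -1) (q a b c : ℂ) (M n : ℤ) :
    Phi e q a b c M n = 0 := by simp [Phi, h1, h0, h2]

theorem PhiUp_of_ne {e : ℤ} (h1 : e ≠ 1) (h0 : e ≠ 0) (h2 : e ≠ -1) (q r a b c : ℂ) (M n : ℤ) :
    PhiUp e q r a b c M n = 0 := by simp [PhiUp, h1, h0, h2]

theorem PhiDown_of_ne {e : ℤ} (h1 : e ≠ 1) (h0 : e ≠ 0) (h2 : e ≠ -1) (q r a b c : ℂ) (M n : ℤ) :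
    PhiDown e q r a b c M n = 0 := by simp [PhiDown, h1, h0, h2]

theorem Phi_balance_all {q r a b c : ℂ} {M n k : ℕ} (R : BlockReg q r a b c M) (hn : n ≤ M)
    (hk : k ≤ M) :
    Phi ((k : ℤ) - n) q a b c M k * racahOmega q r a b c M k =
      Phi ((n : ℤ) - k) q a b c M n * racahOmega q r a b c M n := by
  by_cases a1 : k = n + 1
  · subst a1
    obtain ⟨d, rfl⟩ := Nat.exists_eq_add_of_le hk
    simpa [Phi] using Phi_balance R
  by_cases a2 : k = n
  · subst a2; rfl
  by_cases a3 : n = k + 1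
  · subst a3
    obtain ⟨d, rfl⟩ := Nat.exists_eq_add_of_le hn
    simpa [Phi] using (Phi_balance R).symm
  · rw [Phi_of_ne (by omega) (by omega) (by omega), Phi_of_ne (by omega) (by omega) (by omega)]
    ring

theorem PhiUp_balance_all {q r a b c : ℂ} {M n k : ℕ} (R : BlockReg q r a b c (M + 1))
    (hn : n ≤ M + 1) (hk : k ≤ M) :
    PhiUp ((k : ℤ) - n) q r a b c M k * racahOmega q r a b c M k =
      balanceConst q r a b c M * PhiDown ((n : ℤ) - k) q r a b c ((M : ℤ) + 1) n *
        racahOmega q r a b c (M + 1) n := by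
  have hM1 := R.qk (M + 1) (by omega) le_rfl
  by_cases a1 : k = n + 1
  · subst a1
    obtain ⟨d, rfl⟩ := Nat.exists_eq_add_of_le hk
    simpa [PhiUp, PhiDown] using PhiUp_balance_one (R.mono (by omega)) hM1
  by_cases a2 : k = n
  · subst a2
    obtain ⟨d, rfl⟩ := Nat.exists_eq_add_of_le hk
    simpa using PhiUp_balance_zero (R.mono (by omega)) hM1
  by_cases a3 : n = k + 1
  · subst a3
    obtain ⟨d, rfl⟩ := Nat.exists_eq_add_of_le hk
    have := PhiUp_balance_neg (n := k) (d := d) (R.mono (by omega))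
    simpa [PhiUp, PhiDown] using this
  · rw [PhiUp_of_ne (by omega) (by omega) (by omega),
      PhiDown_of_ne (by omega) (by omega) (by omega)]
    ring

theorem balanceConst_ne_zero {q r a b c : ℂ} {M : ℕ} (R : BlockReg q r a b c (M + 1)) :
    balanceConst q r a b c M ≠ 0 := by
  have hM1 := R.qk (M + 1) (by omega) le_rfl
  have h : 1 - a * b * c * (q ^ M * q ^ 2) ≠ 0 :=
    R.reg_abc.ne (k := (M + 2 : ℕ)) (by push_cast; omega) (by push_cast; omega)
      (by rw [zpow_natCast]; ring)
  rw [pow_succ] at hM1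
  exact div_ne_zero h (mul_ne_zero (mul_ne_zero hM1 R.c0) R.r0)

/-! ### Vanishing of the coefficients at the ends of a block. -/

theorem PhiPlus_zero (q a b c : ℂ) (M : ℤ) : PhiPlus q a b c M 0 = 0 := by simp [PhiPlus]

theorem PhiMinus_self (q a b c : ℂ) (M : ℤ) : PhiMinus q a b c M M = 0 := by simp [PhiMinus]

theorem PhiUpPlus_zero (q r a b c : ℂ) (M : ℤ) : PhiUpPlus q r a b c M 0 = 0 := by simp [PhiUpPlus]

theorem PhiDownPlus_zero (q r b c : ℂ) (M : ℤ) : PhiDownPlus q r b c M 0 = 0 := by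
  simp [PhiDownPlus]

theorem PhiDownMinus_self (q r b c : ℂ) (M : ℤ) : PhiDownMinus q r b c M M = 0 := by
  simp [PhiDownMinus]

theorem PhiDownMinus_pred (q r b c : ℂ) (M n : ℤ) (h : M = n + 1) :
    PhiDownMinus q r b c M n = 0 := by
  subst h
  simp [PhiDownMinus]

/-- At `n = M` both ratios in `PhiDownPlus` cancel, and what is left is the additive constant with
opposite sign. -/
theorem PhiDown_zero_self {q r a b c : ℂ} (hq : q ≠ 0) {M : ℤ}
    (h1 : 1 - b * c * q ^ (2 * M + 1) ≠ 0) (h2 : 1 - b * c * q ^ (2 * M) ≠ 0) :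
    PhiDown 0 q r a b c M M = 0 := by
  simp only [PhiDown, if_neg (show ¬ (0 : ℤ) = 1 by norm_num),
      if_neg (show ¬ (0 : ℤ) = -1 by norm_num), if_true, PhiDownMinus_self]
  rw [PhiDownPlus_eq hq _ _ _ _ _ h1]
  simp only [zpow_add₀ hq, zpow_double, zpow_one, zpow_neg] at h1 h2 ⊢
  have := zpow_ne_zero M hq
  rw [show q ^ M * q ^ M = (q ^ M) ^ 2 by ring]
  generalize 1 - b * c * ((q ^ M) ^ 2 * q) = E1 at *
  generalize 1 - b * c * (q ^ M) ^ 2 = E2 at *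
  field_simp
  ring

/-! ### The four relations satisfied by the normalized polynomials. -/

/-- Difference equation of the `q`-Racah polynomials. -/
theorem racahP_difference {q r a b c : ℂ} {M n x : ℕ} (R : BlockReg q r a b c M)
    (R' : BlockReg q r c b a M) (hn : n ≤ M) (hx : x ≤ M) :
    ∑ y ∈ Finset.range (M + 1), racahP q r a b c M n y * Phi ((x : ℤ) - y) q c b a M x =
      lam q (b * c) n * racahP q r a b c M n x := by
  -- By duality a difference equation in `x` is the recurrence with the outer parameters exchanged;
  -- the normalization does not depend on `x` and factors out.
  have h := racahPhi_recurrence R' hx hn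
  have e : ∀ y ∈ Finset.range (M + 1), racahP q r a b c M n y * Phi ((x : ℤ) - y) q c b a M x =
      racahOmega q r a b c M n *
        (Phi ((x : ℤ) - y) q c b a M x * racahPhi q c b a M y n) := fun y hy => by
    rw [racahP_eq R.q0 _ _ _ _ hn (by simpa [Nat.lt_succ_iff] using hy), racahPhi_comm q c b a]
    ring
  rw [Finset.sum_congr rfl e, ← Finset.mul_sum,
    sum_three_term (h := fun e => Phi e q c b a M x) (f := fun y => racahPhi q c b a M y n)
      (fun e h1 h2 h3 => Phi_of_ne h1 h2 h3 _ _ _ _ _ _)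
      (by rintro rfl; simp [Phi, PhiPlus_zero])
      (fun hM => by
        obtain rfl : x = M := le_antisymm hx hM
        simp [Phi, PhiMinus_self])
      (fun hM => by omega) (by omega),
    racahP_eq R.q0 _ _ _ _ hn hx, racahPhi_comm q a b c]
  simp only [Phi, if_neg (show ¬ (0 : ℤ) = 1 by norm_num),
      if_neg (show ¬ (-1 : ℤ) = 1 by norm_num), if_neg (show ¬ (0 : ℤ) = -1 by norm_num),
      if_true] at h ⊢
  rw [h, mul_comm c b]
  ring

/-- Three-term recurrence of the `q`-Racah polynomials. -/
theorem racahP_recurrence {q r a b c : ℂ} {M n x : ℕ} (R : BlockReg q r a b c M)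
    (hn : n ≤ M) (hx : x ≤ M) :
    ∑ k ∈ Finset.range (M + 1), Phi ((k : ℤ) - n) q a b c M k * racahP q r a b c M k x =
      lam q (a * b) x * racahP q r a b c M n x := by
  have h := racahPhi_recurrence R hn hx
  -- Detailed balance replaces the coefficient read at the summation index `k` by the one read at
  -- `n`.
  have e : ∀ k ∈ Finset.range (M + 1),
      Phi ((k : ℤ) - n) q a b c M k * racahP q r a b c M k x =
      racahOmega q r a b c M n *
        (Phi ((n : ℤ) - k) q a b c M n * racahPhi q a b c M k x) := fun k hk => by
    have hk' : k ≤ M := by simpa [Nat.lt_succ_iff] using hk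
    rw [racahP_eq R.q0 _ _ _ _ hk' hx]
    linear_combination racahPhi q a b c M k x * Phi_balance_all R hn hk'
  rw [Finset.sum_congr rfl e, ← Finset.mul_sum,
    sum_three_term (h := fun e => Phi e q a b c M n) (f := fun y => racahPhi q a b c M y x)
      (fun e h1 h2 h3 => Phi_of_ne h1 h2 h3 _ _ _ _ _ _)
      (by rintro rfl; simp [Phi, PhiPlus_zero])
      (fun hM => by
        obtain rfl : n = M := le_antisymm hn hM
        simp [Phi, PhiMinus_self])
      (fun hM => by omega) (by omega),
    racahP_eq R.q0 _ _ _ _ hn hx]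
  simp only [Phi, if_neg (show ¬ (0 : ℤ) = 1 by norm_num),
      if_neg (show ¬ (-1 : ℤ) = 1 by norm_num), if_neg (show ¬ (0 : ℤ) = -1 by norm_num),
      if_true] at h ⊢
  rw [h]
  ring

/-- Contiguity relation from block size `M` to `M + 1`. -/
theorem racahP_contiguity_up {q r a b c : ℂ} {M n x : ℕ} (R : BlockReg q r a b c (M + 1))
    (hn : n ≤ M + 1) (hx : x ≤ M) :
    ∑ k ∈ Finset.range (M + 1), PhiUp ((k : ℤ) - n) q r a b c M k * racahP q r a b c M k x =
      -((1 - c * (q ^ M * q / q ^ x)) * (1 - a * b * c * (q ^ M * q ^ x * q ^ 2)) /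
        (q ^ M * q * c)) * racahP q r a b c (M + 1) n x := by
  have hM1 := R.qk (M + 1) (by omega) le_rfl
  have h := racahPhi_up (R.mono (by omega : M ≤ M + 1)) hM1 hn hx
  have hq := R.q0
  have e : ∀ k ∈ Finset.range (M + 1),
      PhiUp ((k : ℤ) - n) q r a b c M k * racahP q r a b c M k x =
      balanceConst q r a b c M * racahOmega q r a b c (M + 1) n *
        (PhiDown ((n : ℤ) - k) q r a b c ((M : ℤ) + 1) n * racahPhi q a b c M k x) :=
    fun k hk => by
    have hk' : k ≤ M := by simpa [Nat.lt_succ_iff] using hk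
    rw [racahP_eq R.q0 _ _ _ _ hk' hx]
    linear_combination racahPhi q a b c M k x * PhiUp_balance_all R hn hk'
  rw [Finset.sum_congr rfl e, ← Finset.mul_sum,
    sum_three_term (h := fun e => PhiDown e q r a b c ((M : ℤ) + 1) n)
      (f := fun y => racahPhi q a b c M y x)
      (fun e h1 h2 h3 => PhiDown_of_ne h1 h2 h3 _ _ _ _ _ _ _)
      (by rintro rfl; simp [PhiDown, PhiDownPlus_zero])
      (fun hM => by
        rcases hM.eq_or_lt with rfl | hM
        · simp [PhiDown, PhiDownMinus_pred]
        · obtain rfl : n = M + 1 := by omega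
          simp [PhiDown, PhiDownMinus_self])
      -- For `n = M + 1` the middle neighbour lies outside the smaller block, and its coefficient is
      -- zero.
      (fun hM => by
        obtain rfl : n = M + 1 := by omega
        push_cast
        exact PhiDown_zero_self hq (R.reg_bc _ (by push_cast; omega) (by push_cast; omega))
          (R.reg_bc _ (by push_cast; omega) (by push_cast; omega))) hn,
    racahP_eq R.q0 _ _ _ _ hn (by omega), h, balanceConst]
  have h2 : 1 - a * b * c * (q ^ M * q ^ 2) ≠ 0 :=
    R.reg_abc.ne (k := (M + 2 : ℕ)) (by push_cast; omega) (by push_cast; omega)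
      (by rw [zpow_natCast]; ring)
  have hc := R.c0
  have hr := R.r0
  have hM := pow_ne_zero M hq
  rw [pow_succ] at hM1
  generalize 1 - a * b * c * (q ^ M * q ^ 2) = E1 at *
  generalize 1 - q ^ M * q = E2 at *
  generalize 1 - c * (q ^ M * q / q ^ x) = E3 at *
  generalize 1 - a * b * c * (q ^ M * q ^ x * q ^ 2) = E4 at *
  field_simp

/-- Contiguity relation from block size `M + 1` to `M`. -/
theorem racahP_contiguity_down {q r a b c : ℂ} {M n x : ℕ} (R : BlockReg q r a b c (M + 1))
    (hn : n ≤ M) (hx : x ≤ M + 1) :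
    ∑ k ∈ Finset.range (M + 1 + 1), PhiDown ((k : ℤ) - n) q r a b c ((M : ℤ) + 1) k *
        racahP q r a b c (M + 1) k x =
      ((1 - q ^ x / (q ^ M * q)) * (1 - a * b * (q ^ M * q ^ x * q ^ 2)) / q ^ x) *
        racahP q r a b c M n x := by
  have hM1 := R.qk (M + 1) (by omega) le_rfl
  have h := racahPhi_down R (x := x) hn
  have hq := R.q0
  have hκ := balanceConst_ne_zero R
  have e : ∀ k ∈ Finset.range (M + 1 + 1),
      PhiDown ((k : ℤ) - n) q r a b c ((M : ℤ) + 1) k * racahP q r a b c (M + 1) k x =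
      (balanceConst q r a b c M)⁻¹ * racahOmega q r a b c M n *
        (PhiUp ((n : ℤ) - k) q r a b c M n * racahPhi q a b c (M + 1) k x) :=
    fun k hk => by
    have hk' : k ≤ M + 1 := by simpa [Nat.lt_succ_iff] using hk
    rw [racahP_eq R.q0 _ _ _ _ hk' hx]
    have := PhiUp_balance_all R hk' hn
    field_simp
    linear_combination -racahPhi q a b c (M + 1) k x * this
  rw [Finset.sum_congr rfl e, ← Finset.mul_sum,
    sum_three_term (h := fun e => PhiUp e q r a b c M n)
      (f := fun y => racahPhi q a b c (M + 1) y x)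
      (fun e h1 h2 h3 => PhiUp_of_ne h1 h2 h3 _ _ _ _ _ _ _)
      (by rintro rfl; simp [PhiUp, PhiUpPlus_zero])
      (fun hM => by omega) (fun hM => by omega) (by omega), h, balanceConst]
  have h2 : 1 - a * b * c * (q ^ M * q ^ 2) ≠ 0 :=
    R.reg_abc.ne (k := (M + 2 : ℕ)) (by push_cast; omega) (by push_cast; omega)
      (by rw [zpow_natCast]; ring)
  have hc := R.c0
  have hr := R.r0
  have hM := pow_ne_zero M hq
  have hX := pow_ne_zero x hq
  rcases hx.lt_or_eq with hx' | rfl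
  · rw [racahP_eq R.q0 _ _ _ _ hn (by omega)]
    rw [pow_succ] at hM1
    generalize 1 - a * b * c * (q ^ M * q ^ 2) = E1 at *
    rw [show 1 - (q ^ M * q)⁻¹ = -(1 - q ^ M * q) / (q ^ M * q) by field_simp; ring]
    generalize 1 - q ^ M * q = E2 at *
    generalize 1 - q ^ x / (q ^ M * q) = E3 at *
    generalize 1 - a * b * (q ^ M * q ^ x * q ^ 2) = E4 at *
    field_simp
  -- At `x = M + 1`, outside the smaller block, both sides vanish because the factor on the right
  -- does.
  · rw [show q ^ (M + 1) = q ^ M * q from pow_succ q M, div_self (mul_ne_zero hM hq)]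
    ring

end QRacahAW4

namespace QRacahAW4

/-! ### The summation formula normalizing the orthogonality relation -/

theorem racahOmega_zero_block {q r a b c : ℂ} {M : ℕ} (R : BlockReg q r a b c (M + 1)) :
    racahOmega q r a b c (M + 1) 0 = racahOmega q r a b c M 0 *
      ((1 - a * (q ^ M * q)) * r) / (1 - b * c * (q ^ M * q ^ 2)) := by
  have hM1 := R.qk (M + 1) (by omega) le_rfl
  have h := racahOmega_succ_block (n := 0) (d := M) (R.mono (by omega)) (by rwa [zero_add])
  have h2 : 1 - a * b * c * (q ^ M * q ^ 2) ≠ 0 :=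
    R.reg_abc.ne (k := (M + 2 : ℕ)) (by push_cast; omega) (by push_cast; omega)
      (by rw [zpow_natCast]; ring)
  have h3 : 1 - b * c * (q ^ M * q ^ 2) ≠ 0 :=
    R.reg_bc.ne (k := (M + 2 : ℕ)) (by push_cast; omega) (by push_cast; omega)
      (by rw [zpow_natCast]; ring)
  rw [pow_succ] at hM1
  simp only [zero_add, pow_zero, one_mul, one_pow] at h
  rw [h]
  generalize 1 - a * b * c * (q ^ M * q ^ 2) = E1 at *
  generalize 1 - b * c * (q ^ M * q ^ 2) = E2 at *
  generalize 1 - q ^ M * q = E3 at *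
  field_simp

/-- The companion of the summand in the summation formula. -/
noncomputable def racahWZ (q r a b c : ℂ) (M x : ℕ) : ℂ :=
  -(q * b) * (1 - a * b * c * ((q ^ M) ^ 2 * q ^ 3)) /
      ((1 - b * c * (q ^ M * q ^ 2)) * (1 - a * b * c * (q ^ M * q ^ 2))) *
    ((1 - q ^ x) * (1 - a * q ^ x) * (1 - c * (q ^ M * q / q ^ x)) /
      ((1 - a * b * ((q ^ x) ^ 2 * q)) * (1 - q ^ M * q / q ^ x))) *
    (racahOmega q r a b c M 0 * racahOmega q r c b a M x)

/-- The Wilf-Zeilberger equation: the change of the summand with the block size is a forward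
difference in `x`. Dividing by the common weights leaves a rational identity in `q ^ n` and `q ^ d`.
-/
theorem racahWZ_step {q r a b c : ℂ} {n d : ℕ} (R : BlockReg q r a b c (n + 1 + d + 1))
    (R' : BlockReg q r c b a (n + 1 + d + 1)) :
    racahOmega q r a b c (n + 1 + d + 1) 0 * racahOmega q r c b a (n + 1 + d + 1) n -
      racahOmega q r a b c (n + 1 + d) 0 * racahOmega q r c b a (n + 1 + d) n =
    racahWZ q r a b c (n + 1 + d) (n + 1) - racahWZ q r a b c (n + 1 + d) n := by
  have hq := R.q0
  have hr := R.r0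
  have hb := R.b0
  have e1 := racahOmega_succ_left (n := n) (d := d) (R'.mono (by omega))
  have e2 := racahOmega_succ_block (n := n) (d := d + 1) (R'.mono (by omega))
    (R.qk _ (by omega) (by omega))
  rw [show n + (d + 1) = n + 1 + d by ring] at e2
  rw [racahWZ, racahWZ, e1, e2, racahOmega_zero_block R]
  generalize racahOmega q r a b c (n + 1 + d) 0 = w1
  generalize racahOmega q r c b a (n + 1 + d) n = w2
  have hX : q ^ n ≠ 0 := pow_ne_zero _ hq
  have hY : q ^ d ≠ 0 := pow_ne_zero _ hq
  have g1 : 1 - q ^ n * q ≠ 0 := by rw [← pow_succ]; exact R.qk _ (by omega) (by omega)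
  have g2 : 1 - q ^ d * q ≠ 0 := by rw [← pow_succ]; exact R.qk _ (by omega) (by omega)
  have g3 : 1 - q ^ d * q ^ 2 ≠ 0 := by rw [← pow_add]; exact R.qk _ (by omega) (by omega)
  have g4 : 1 - c * (q ^ d * q) ≠ 0 := R.reg_c.ne (k := (d + 1 : ℕ)) (by push_cast; omega)
    (by push_cast; omega) (by rw [zpow_natCast]; ring)
  have g5 : 1 - a * (q ^ n * q) ≠ 0 := R.reg_a.ne (k := (n + 1 : ℕ)) (by push_cast; omega)
    (by push_cast; omega) (by rw [zpow_natCast]; ring)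
  have g6 : 1 - a * b * ((q ^ n) ^ 2 * q) ≠ 0 :=
    R.reg_ab.ne (k := (2 * n + 1 : ℕ)) (by push_cast; omega)
    (by push_cast; omega) (by rw [zpow_natCast]; ring)
  have g7 : 1 - a * b * ((q ^ n) ^ 2 * q ^ 3) ≠ 0 :=
    R.reg_ab.ne (k := (2 * n + 3 : ℕ)) (by push_cast; omega)
    (by push_cast; omega) (by rw [zpow_natCast]; ring)
  have g8 : 1 - a * b * ((q ^ n) ^ 2 * q ^ d * q ^ 3) ≠ 0 :=
    R.reg_ab.ne (k := (2 * n + d + 3 : ℕ)) (by push_cast; omega)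
    (by push_cast; omega) (by rw [zpow_natCast]; ring)
  have g9 : 1 - b * c * (q ^ n * q ^ d * q ^ 3) ≠ 0 :=
    R.reg_bc.ne (k := (n + d + 3 : ℕ)) (by push_cast; omega)
    (by push_cast; omega) (by rw [zpow_natCast]; ring)
  have g10 : 1 - a * b * c * (q ^ n * q ^ d * q ^ 3) ≠ 0 :=
    R.reg_abc.ne (k := (n + d + 3 : ℕ)) (by push_cast; omega)
    (by push_cast; omega) (by rw [zpow_natCast]; ring)
  simp only [pow_add, pow_one]
  rw [show c * b * a = a * b * c by ring, show b * a = a * b by ring]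
  generalize q ^ n = X at *
  generalize q ^ d = Y at *
  rw [show X * q * Y * q ^ 2 = X * Y * q ^ 3 by ring,
    show X * (Y * q) * q ^ 2 = X * Y * q ^ 3 by ring,
    show (X * q) ^ 2 * q = X ^ 2 * q ^ 3 by ring,
    show X ^ 2 * (Y * q) * q ^ 2 = X ^ 2 * Y * q ^ 3 by ring,
    show X * q * Y * q / (X * q) = Y * q by field_simp,
    show X * q * Y * q / X = Y * q ^ 2 by field_simp,
    show Y * q * q = Y * q ^ 2 by ring]
  obtain ⟨E1, hE1⟩ : ∃ y, y = 1 - X * q := ⟨_, rfl⟩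
  obtain ⟨E2, hE2⟩ : ∃ y, y = 1 - Y * q := ⟨_, rfl⟩
  obtain ⟨E3, hE3⟩ : ∃ y, y = 1 - Y * q ^ 2 := ⟨_, rfl⟩
  obtain ⟨E4, hE4⟩ : ∃ y, y = 1 - c * (Y * q) := ⟨_, rfl⟩
  obtain ⟨E5, hE5⟩ : ∃ y, y = 1 - a * (X * q) := ⟨_, rfl⟩
  obtain ⟨E6, hE6⟩ : ∃ y, y = 1 - a * b * (X ^ 2 * q) := ⟨_, rfl⟩
  obtain ⟨E7, hE7⟩ : ∃ y, y = 1 - a * b * (X ^ 2 * q ^ 3) := ⟨_, rfl⟩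
  obtain ⟨E8, hE8⟩ : ∃ y, y = 1 - a * b * (X ^ 2 * Y * q ^ 3) := ⟨_, rfl⟩
  obtain ⟨E9, hE9⟩ : ∃ y, y = 1 - b * c * (X * Y * q ^ 3) := ⟨_, rfl⟩
  obtain ⟨E10, hE10⟩ : ∃ y, y = 1 - a * b * c * (X * Y * q ^ 3) := ⟨_, rfl⟩
  rw [← hE1] at g1
  rw [← hE2] at g2
  rw [← hE3] at g3
  rw [← hE4] at g4
  rw [← hE5] at g5
  rw [← hE6] at g6
  rw [← hE7] at g7
  rw [← hE8] at g8
  rw [← hE9] at g9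
  rw [← hE10] at g10
  simp only [← hE1, ← hE2, ← hE3, ← hE4, ← hE5, ← hE6, ← hE7, ← hE8, ← hE9, ← hE10]
  field_simp
  rw [R.rq, hE3, hE6, hE8, hE9, hE10]
  ring

/-- The companion has a vanishing denominator at `x = M + 1`, so telescoping must stop at `M`. This
identity accounts for the last two summands. -/
theorem racahWZ_last {q r a b c : ℂ} {n : ℕ} (R : BlockReg q r a b c (n + 1))
    (R' : BlockReg q r c b a (n + 1)) :
    racahOmega q r a b c (n + 1) 0 * racahOmega q r c b a (n + 1) (n + 1) +
      (racahOmega q r a b c (n + 1) 0 * racahOmega q r c b a (n + 1) n -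
      racahOmega q r a b c n 0 * racahOmega q r c b a n n) + racahWZ q r a b c n n = 0 := by
  have hq := R.q0
  have hr := R.r0
  have hb := R.b0
  have e1 := racahOmega_succ_left (n := n) (d := 0) (R'.mono (by omega))
  have e2 := racahOmega_succ_block (n := n) (d := 0) (R'.mono (by omega))
    (R.qk _ (by omega) (by omega))
  simp only [add_zero] at e1 e2
  rw [racahWZ, e1, e2, racahOmega_zero_block R]
  generalize racahOmega q r a b c n 0 = w1
  generalize racahOmega q r c b a n n = w2
  have hX : q ^ n ≠ 0 := pow_ne_zero _ hq
  have g1 : 1 - q ^ n * q ≠ 0 := by rw [← pow_succ]; exact R.qk _ (by omega) (by omega)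
  have g2 : 1 - q ≠ 0 := by simpa using R.qk 1 le_rfl (by omega)
  have g4 : 1 - c * q ≠ 0 := R.reg_c.ne (k := (1 : ℕ)) (by push_cast; omega)
    (by push_cast; omega) (by rw [zpow_natCast]; ring)
  have g5 : 1 - a * (q ^ n * q) ≠ 0 := R.reg_a.ne (k := (n + 1 : ℕ)) (by push_cast; omega)
    (by push_cast; omega) (by rw [zpow_natCast]; ring)
  have g6 : 1 - a * b * ((q ^ n) ^ 2 * q) ≠ 0 :=
    R.reg_ab.ne (k := (2 * n + 1 : ℕ)) (by push_cast; omega)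
    (by push_cast; omega) (by rw [zpow_natCast]; ring)
  have g7 : 1 - a * b * ((q ^ n) ^ 2 * q ^ 3) ≠ 0 :=
    R.reg_ab.ne (k := (2 * n + 3 : ℕ)) (by push_cast; omega)
    (by push_cast; omega) (by rw [zpow_natCast]; ring)
  have g8 : 1 - a * b * ((q ^ n) ^ 2 * q ^ 2) ≠ 0 :=
    R.reg_ab.ne (k := (2 * n + 2 : ℕ)) (by push_cast; omega)
    (by push_cast; omega) (by rw [zpow_natCast]; ring)
  have g9 : 1 - b * c * (q ^ n * q ^ 2) ≠ 0 :=
    R.reg_bc.ne (k := (n + 2 : ℕ)) (by push_cast; omega)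
    (by push_cast; omega) (by rw [zpow_natCast]; ring)
  have g10 : 1 - a * b * c * (q ^ n * q ^ 2) ≠ 0 :=
    R.reg_abc.ne (k := (n + 2 : ℕ)) (by push_cast; omega)
    (by push_cast; omega) (by rw [zpow_natCast]; ring)
  simp only [pow_zero, mul_one, one_mul]
  rw [show c * b * a = a * b * c by ring, show b * a = a * b by ring]
  generalize q ^ n = X at *
  rw [show X * q / X = q by field_simp]
  obtain ⟨E1, hE1⟩ : ∃ y, y = 1 - X * q := ⟨_, rfl⟩
  obtain ⟨E2, hE2⟩ : ∃ y, y = 1 - q := ⟨_, rfl⟩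
  obtain ⟨E4, hE4⟩ : ∃ y, y = 1 - c * q := ⟨_, rfl⟩
  obtain ⟨E5, hE5⟩ : ∃ y, y = 1 - a * (X * q) := ⟨_, rfl⟩
  obtain ⟨E6, hE6⟩ : ∃ y, y = 1 - a * b * (X ^ 2 * q) := ⟨_, rfl⟩
  obtain ⟨E7, hE7⟩ : ∃ y, y = 1 - a * b * (X ^ 2 * q ^ 3) := ⟨_, rfl⟩
  obtain ⟨E8, hE8⟩ : ∃ y, y = 1 - a * b * (X ^ 2 * q ^ 2) := ⟨_, rfl⟩
  obtain ⟨E9, hE9⟩ : ∃ y, y = 1 - b * c * (X * q ^ 2) := ⟨_, rfl⟩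
  obtain ⟨E10, hE10⟩ : ∃ y, y = 1 - a * b * c * (X * q ^ 2) := ⟨_, rfl⟩
  rw [← hE1] at g1
  rw [← hE2] at g2
  rw [← hE4] at g4
  rw [← hE5] at g5
  rw [← hE6] at g6
  rw [← hE7] at g7
  rw [← hE8] at g8
  rw [← hE9] at g9
  rw [← hE10] at g10
  simp only [← hE1, ← hE2, ← hE4, ← hE5, ← hE6, ← hE7, ← hE8, ← hE9, ← hE10]
  field_simp
  rw [R.rq, hE1, hE2, hE4, hE5, hE6, hE8, hE9, hE10]
  ring

theorem racahOmega_block_zero (q r a b c : ℂ) : racahOmega q r a b c 0 0 = 1 := by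
  simp [racahOmega, qBinom, qPoch_zero]

/-- Induction on the block size. It fixes the constant left undetermined by the commutation argument
for the inverse of the change of basis. -/
theorem sum_racahOmega {q r a b c : ℂ} {M : ℕ} (R : BlockReg q r a b c M)
    (R' : BlockReg q r c b a M) :
    ∑ x ∈ Finset.range (M + 1), racahOmega q r a b c M 0 * racahOmega q r c b a M x = 1 := by
  induction M with
  | zero => simp [racahOmega_block_zero]
  | succ M ih =>
    -- Telescoping starts from zero, since the companion contains the factor `1 - q ^ x`.
    have key : ∀ X ≤ M, ∑ x ∈ Finset.range X, (racahOmega q r a b c (M + 1) 0 *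
        racahOmega q r c b a (M + 1) x - racahOmega q r a b c M 0 * racahOmega q r c b a M x) =
        racahWZ q r a b c M X := by
      intro X
      induction X with
      | zero => intro _; simp [racahWZ]
      | succ X hX =>
        intro h
        obtain ⟨d, rfl⟩ := Nat.exists_eq_add_of_le h
        rw [Finset.sum_range_succ, hX (by omega), racahWZ_step R R']
        ring
    have h1 := key M le_rfl
    rw [Finset.sum_sub_distrib] at h1
    have h2 := racahWZ_last R R'
    have h3 := ih (R.mono (by omega)) (R'.mono (by omega))
    rw [Finset.sum_range_succ] at h3
    rw [Finset.sum_range_succ, Finset.sum_range_succ]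
    linear_combination h1 + h3 + h2

end QRacahAW4

/-! ### Action of the nine-diagonal coefficients on the polynomials. -/

namespace QRacahAW4

/-- Genericity of five scalar parameters subject to `q^{2N+3} a b c d e = 1`. -/
structure ParamReg (q r a b c d e : ℂ) (N : ℕ) : Prop where
  block : BlockReg q r a b c N
  constr : q ^ (2 * N + 3) * e * a * b * c * d = 1
  reg_de : Reg q (4 * N + 8) (d * e)

theorem ParamReg.constr' {q r a b c d e : ℂ} {N : ℕ} (P : ParamReg q r a b c d e N) :
    (q ^ N) ^ 2 * q ^ 3 * e * a * b * c * d = 1 := by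
  rw [← P.constr]; ring

/-- The corner value needs a separate formula only when a denominator may vanish. For generic
parameters it is the plain product, so no case distinction survives. -/
theorem coefAPlus_eq {q r a b c d e : ℂ} {N k m : ℕ} (P : ParamReg q r a b c d e N)
    (hk : k + m ≤ N) (ε : ℤ) :
    coefAPlus ε q r a b c d e N k m =
      -c * q ^ ((N : ℤ) + 1) * (FPlus q d e m * PhiUp ε q r a b c ((N : ℤ) - m) k) := by
  unfold coefAPlus
  split_ifs with h
  · have hm : m = N := by exact_mod_cast h
    subst hm
    obtain rfl : k = 0 := by omega
    rw [cornerProd_eq ε q r a b c d e m P.block.q0 P.constr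
      (P.reg_de.ne (k := (2 * m + 1 : ℕ)) (by push_cast; omega) (by push_cast; omega)
        (by rw [zpow_natCast]))]
    simp
  · rfl

/-- The relation between `p_n(x; N - m)` and `p_k(x; N - m')`, `m' = m + ε`, with
coefficients `A^{k - n, ε}_{k, m'}`. -/
theorem sum_coefA_mul_racahP {q r a b c d e : ℂ} {N n m m' x : ℕ} (P : ParamReg q r a b c d e N)
    (hn : n + m ≤ N) (hx : x + m' ≤ N) :
    ∑ k ∈ Finset.range (N - m' + 1), coefA ((k : ℤ) - n) ((m' : ℤ) - m) q r a b c d e N k m' *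
        racahP q r a b c (N - m') k x =
      Phi ((m' : ℤ) - m) q c e d ((N : ℤ) - x) m' * racahP q r a b c (N - m) n x := by
  have hq := P.block.q0
  have hr := P.block.r0
  have hb := P.block.b0
  have hc := P.block.c0
  have hcon := P.constr'
  have hN := pow_ne_zero N hq
  have hX := pow_ne_zero x hq
  have hm'0 := pow_ne_zero m' hq
  have hd : d ≠ 0 := by rintro rfl; simp at hcon
  have he : e ≠ 0 := by rintro rfl; simp at hcon
  have ha : a ≠ 0 := by rintro rfl; simp at hcon
  have hD : ∀ k : ℕ, k ≤ 2 * N + 5 → 1 - e * d * q ^ (k : ℤ) ≠ 0 := fun k hk => by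
    rw [mul_comm e]; exact P.reg_de _ (by push_cast; omega) (by push_cast; omega)
  have h1 := hD (2 * m') (by omega)
  have h2 := hD (2 * m' + 1) (by omega)
  have h3 := hD (2 * m' + 2) (by omega)
  -- The blocks have sizes `N - m` and `N - m'`, so the offset in `m` decides which relation
  -- applies. For offset one it is the contiguity relation into the larger block.
  by_cases c1 : m' = m + 1
  · subst c1
    have hM : N - m = N - (m + 1) + 1 := by omega
    have e1 : ((m + 1 : ℕ) : ℤ) - m = 1 := by push_cast; ring
    rw [e1]
    have e2 : ∀ k ∈ Finset.range (N - (m + 1) + 1),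
        coefA ((k : ℤ) - n) 1 q r a b c d e N k ((m + 1 : ℕ) : ℤ) *
          racahP q r a b c (N - (m + 1)) k x =
        -c * q ^ ((N : ℤ) + 1) * FPlus q d e ((m + 1 : ℕ) : ℤ) *
        (PhiUp ((k : ℤ) - n) q r a b c ((N - (m + 1) : ℕ) : ℤ) k *
          racahP q r a b c (N - (m + 1)) k x) := fun k hk => by
      have hk' : k + (m + 1) ≤ N := by have := Finset.mem_range.1 hk; omega
      rw [coefA, if_pos rfl, coefAPlus_eq P hk', Nat.cast_sub (by omega)]
      ring
    rw [Finset.sum_congr rfl e2, ← Finset.mul_sum,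
      racahP_contiguity_up (P.block.mono (by omega)) (by omega) (by omega), hM, ← mul_assoc]
    congr 1
    rw [Phi, if_pos rfl, PhiPlus_eq hq _ _ _ _ _ (by exact_mod_cast h2), FPlus_eq hq]
    have e3 : q ^ (N - (m + 1)) = q ^ N / q ^ (m + 1) := by
      rw [eq_div_iff hm'0, ← pow_add]; congr 1; omega
    rw [e3]
    simp only [zpow_natCast, zpow_sub₀ hq, zpow_add₀ hq, zpow_one, mul_comm d e] at h1 h2 ⊢
    rw [show q ^ (2 * (m + 1)) = (q ^ (m + 1)) ^ 2 by ring] at h1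
    rw [show q ^ (2 * (m + 1) + 1) = (q ^ (m + 1)) ^ 2 * q by ring] at h2
    generalize q ^ (m + 1) = Y at *
    generalize q ^ N = Q at *
    generalize q ^ x = X at *
    generalize 1 - e * d * Y ^ 2 = E1 at *
    generalize 1 - e * d * (Y ^ 2 * q) = E2 at *
    -- The constraint is used to eliminate the triple product, after which both sides are rational
    -- functions of independent variables.
    have h4 : a * b * c = 1 / (Q ^ 2 * q ^ 3 * e * d) := by
      rw [eq_div_iff (by positivity)]
      linear_combination hcon
    rw [h4]
    field_simp
    ring
  -- Equal blocks: the three-term recurrence applies.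
  by_cases c2 : m' = m
  · subst c2
    rw [sub_self]
    -- The coefficients are a multiple of the recurrence coefficients except on the diagonal, where
    -- they differ by `Phi 0 q c e d`. The recurrence therefore leaves a scalar multiple of the
    -- polynomial and this correction.
    have e2 : ∀ k ∈ Finset.range (N - m' + 1),
        coefA ((k : ℤ) - n) 0 q r a b c d e N k m' * racahP q r a b c (N - m') k x =
        c * q ^ ((N : ℤ) + 1) * (FPlus q d e m' + FMinus q d e m') *
        (Phi ((k : ℤ) - n) q a b c ((N - m' : ℕ) : ℤ) k *
          racahP q r a b c (N - m') k x) +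
        (if k = n then Phi 0 q c e d N m' * racahP q r a b c (N - m') n x else 0) :=
      fun k hk => by
      have hk' : k + m' ≤ N := by have := Finset.mem_range.1 hk; omega
      rw [Nat.cast_sub (by omega)]
      by_cases hkn : k = n
      · subst hkn
        simp [coefA, coefAZero, Phi]
        ring
      · rw [if_neg hkn]
        have : (k : ℤ) - n ≠ 0 := by omega
        simp [coefA, this, coefAZero]
        ring
    rw [Finset.sum_congr rfl e2, Finset.sum_add_distrib, ← Finset.mul_sum,
      racahP_recurrence (P.block.mono (by omega)) (by omega) (by omega),
      Finset.sum_ite_eq', if_pos (Finset.mem_range.2 (by omega)), ← mul_assoc, ← add_mul]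
    congr 1
    simp only [Phi, if_neg (show ¬ (0 : ℤ) = 1 by norm_num),
      if_neg (show ¬ (0 : ℤ) = -1 by norm_num), if_true]
    rw [PhiPlus_eq hq _ _ _ _ _ (by exact_mod_cast h2),
      PhiMinus_eq hq _ _ _ _ _ (by exact_mod_cast h2),
      PhiPlus_eq hq _ _ _ _ _ (by exact_mod_cast h2),
      PhiMinus_eq hq _ _ _ _ _ (by exact_mod_cast h2), FPlus_eq hq,
      FMinus_eq hq _ _ _ (by rw [mul_comm d]; exact_mod_cast h2), lam_eq hq]
    simp only [zpow_natCast, zpow_sub₀ hq, zpow_add₀ hq, zpow_one, mul_comm d e] at h1 h2 h3 ⊢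
    rw [show q ^ (2 * m') = (q ^ m') ^ 2 by ring] at h1
    rw [show q ^ (2 * m' + 1) = (q ^ m') ^ 2 * q by ring] at h2
    rw [show q ^ (2 * m' + 2) = (q ^ m') ^ 2 * q ^ 2 by ring] at h3
    generalize q ^ m' = Y at *
    generalize q ^ N = Q at *
    generalize q ^ x = X at *
    have h4 : a * b = 1 / (Q ^ 2 * q ^ 3 * e * d * c) := by
      rw [eq_div_iff (by positivity)]
      linear_combination hcon
    rw [h4]
    obtain ⟨E1, hE1⟩ : ∃ y, y = 1 - e * d * Y ^ 2 := ⟨_, rfl⟩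
    obtain ⟨E2, hE2⟩ : ∃ y, y = 1 - e * d * (Y ^ 2 * q) := ⟨_, rfl⟩
    obtain ⟨E3, hE3⟩ : ∃ y, y = 1 - e * d * (Y ^ 2 * q ^ 2) := ⟨_, rfl⟩
    rw [← hE1] at h1
    rw [← hE2] at h2
    rw [← hE3] at h3
    simp only [← hE1, ← hE2, ← hE3]
    field_simp
    rw [hE1, hE3]
    ring
  -- Offset minus one: the contiguity relation into the smaller block.
  by_cases c3 : m = m' + 1
  · subst c3
    have hM : N - m' = N - (m' + 1) + 1 := by omega
    have e1 : (m' : ℤ) - ((m' + 1 : ℕ) : ℤ) = -1 := by push_cast; ring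
    rw [e1]
    have e2 : ∀ k ∈ Finset.range (N - (m' + 1) + 1 + 1),
        coefA ((k : ℤ) - n) (-1) q r a b c d e N k (m' : ℤ) *
          racahP q r a b c (N - (m' + 1) + 1) k x =
        -c * q ^ ((N : ℤ) + 1) * FMinus q d e (m' : ℤ) *
        (PhiDown ((k : ℤ) - n) q r a b c (((N - (m' + 1) : ℕ) : ℤ) + 1) k *
          racahP q r a b c (N - (m' + 1) + 1) k x) := fun k hk => by
      rw [coefA, if_neg (by norm_num), if_pos rfl, coefAMinus, Nat.cast_sub (by omega)]
      push_cast
      rw [show (N : ℤ) - (m' + 1) + 1 = N - m' by ring]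
      ring
    rw [hM, Finset.sum_congr rfl e2, ← Finset.mul_sum,
      racahP_contiguity_down (P.block.mono (by omega)) (by omega) (by omega), ← mul_assoc]
    congr 1
    rw [Phi, if_neg (by norm_num), if_pos rfl, PhiMinus_eq hq _ _ _ _ _ (by exact_mod_cast h2),
      FMinus_eq hq _ _ _ (by rw [mul_comm d]; exact_mod_cast h2)]
    have e3 : q ^ (N - (m' + 1)) = q ^ N / (q ^ m' * q) := by
      rw [eq_div_iff (mul_ne_zero hm'0 hq), ← pow_succ, ← pow_add]; congr 1; omega
    rw [e3]
    simp only [zpow_natCast, zpow_sub₀ hq, zpow_add₀ hq, zpow_one, mul_comm d e] at h1 h2 h3 ⊢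
    rw [show q ^ (2 * m' + 1) = (q ^ m') ^ 2 * q by ring] at h2
    rw [show q ^ (2 * m' + 2) = (q ^ m') ^ 2 * q ^ 2 by ring] at h3
    generalize q ^ m' = Y at *
    generalize q ^ N = Q at *
    generalize q ^ x = X at *
    generalize 1 - e * d * (Y ^ 2 * q ^ 2) = E1 at *
    generalize 1 - e * d * (Y ^ 2 * q) = E2 at *
    have h4 : a * b = 1 / (Q ^ 2 * q ^ 3 * e * d * c) := by
      rw [eq_div_iff (by positivity)]
      linear_combination hcon
    rw [h4]
    field_simp
    ring
  · have f1 : (m' : ℤ) - m ≠ 1 := by omega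
    have f2 : (m' : ℤ) - m ≠ 0 := by omega
    have f3 : (m' : ℤ) - m ≠ -1 := by omega
    rw [Phi_of_ne f1 f2 f3, zero_mul]
    refine Finset.sum_eq_zero fun k _ => ?_
    simp [coefA, f1, f2, f3]

end QRacahAW4

/-! ### Symmetry of the nine-diagonal coefficients under exchange of the coordinates. -/

namespace QRacahAW4

theorem coefA_of_ne {ε ε' : ℤ} (h : ¬ (|ε'| ≤ 1 ∧ |ε| ≤ 1)) (q r a b c d e : ℂ) (N i j : ℤ) :
    coefA ε ε' q r a b c d e N i j = 0 := by
  have h1 : ¬ |ε| ≤ 1 → ε ≠ 1 ∧ ε ≠ 0 ∧ ε ≠ -1 := fun h => by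
    refine ⟨?_, ?_, ?_⟩ <;> rintro rfl <;> simp at h
  unfold coefA
  by_cases he : |ε| ≤ 1
  · have h2 : ¬ |ε'| ≤ 1 := fun h' => h ⟨h', he⟩
    rw [if_neg, if_neg, if_neg] <;> rintro rfl <;> simp at h2
  · obtain ⟨e1, e0, e2⟩ := h1 he
    simp [coefAPlus, coefAMinus, coefAZero, cornerProd, e1, e0, e2, Phi_of_ne, PhiUp_of_ne, PhiDown_of_ne]

theorem xi_succ (q u v : ℂ) (n : ℕ) : xi q u v (n + 1) =
    xi q u v n * ((1 - u ^ 2 * (q ^ n * q)) / (1 - v ^ 2 * (q ^ n * q)) * (v / u)) := by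
  unfold xi
  rw [qPoch_succ, qPoch_succ, pow_succ, mul_div_mul_comm]
  ring

/-- `coefA` off the center, with the value of `coefAPlus` in which no denominator is cancelled. -/
theorem coefA_one {q r a b c d e : ℂ} {N k m : ℕ} (P : ParamReg q r a b c d e N)
    (hk : k + m ≤ N) (ε : ℤ) :
    coefA ε 1 q r a b c d e N k m =
      -c * q ^ ((N : ℤ) + 1) * (FPlus q d e m * PhiUp ε q r a b c ((N : ℤ) - m) k) := by
  rw [← coefAPlus_eq P hk]; simp [coefA]

/-- The ratio `(u/w)^{k-n} ξ_k/ξ_n` for `ε = k - n`, as a function of `K = q^k`. -/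
noncomputable def gaugeStep (ε : ℤ) (q u v w z K : ℂ) : ℂ :=
  if ε = 1 then (w / z) * ((1 - u ^ 2 * K) / (1 - v ^ 2 * K) * (v / u))
  else if ε = -1 then (z / w) * ((1 - v ^ 2 * (K * q)) / (1 - u ^ 2 * (K * q)) * (u / v))
  else 1

-- All entries off the centre. Written out, both sides are products of elementary factors up to the
-- middle coefficients of the contiguity relations; the gauge factors repair the mismatch of factors
-- and of square roots.
set_option linter.unusedSimpArgs false in
set_option maxHeartbeats 4000000 in
set_option maxRecDepth 10000 in
theorem coefA_swap_aux {p s0 s1 s2 s3 s4 : ℂ} {N m k : ℕ}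
    (P : ParamReg (p ^ 2) (p * s4) (s3 ^ 2) (s4 ^ 2) (s0 ^ 2) (s2 ^ 2) (s1 ^ 2) N)
    (P' : ParamReg (p ^ 2) (p * s2) (s3 ^ 2) (s2 ^ 2) (s1 ^ 2) (s4 ^ 2) (s0 ^ 2) N)
    (hcon : p ^ (2 * N + 3) * (s0 * s1 * s2 * s3 * s4) = 1) (h : k + m ≤ N) {ε ε' : ℤ}
    (hε : ε = 1 ∨ ε = 0 ∨ ε = -1) (hε' : ε' = 1 ∨ ε' = 0 ∨ ε' = -1) (h00 : ¬ (ε = 0 ∧ ε' = 0)) :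
    coefA ε ε' (p ^ 2) (p * s4) (s3 ^ 2) (s4 ^ 2) (s0 ^ 2) (s2 ^ 2) (s1 ^ 2) N m k =
      coefA ε' ε (p ^ 2) (p * s2) (s3 ^ 2) (s2 ^ 2) (s1 ^ 2) (s4 ^ 2) (s0 ^ 2) N k m *
        gaugeStep ε' (p ^ 2) s2 s1 s3 s0 ((p ^ 2) ^ k) *
        gaugeStep ε (p ^ 2) s0 s4 s1 s3 ((p ^ 2) ^ m) := by
  have h40 : ∀ j : ℤ, -8 ≤ j → j ≤ 8 → 1 - s4 ^ 2 * s0 ^ 2 * (p ^ 2) ^ (2 * (m : ℤ) + j) ≠ 0 :=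
    fun j h1 h2 => P'.reg_de _ (by push_cast; omega) (by push_cast; omega)
  have h21 : ∀ j : ℤ, -8 ≤ j → j ≤ 8 → 1 - s2 ^ 2 * s1 ^ 2 * (p ^ 2) ^ (2 * (k : ℤ) + j) ≠ 0 :=
    fun j h1 h2 => P.reg_de _ (by push_cast; omega) (by push_cast; omega)
  have hq := P.block.q0
  have hp : p ≠ 0 := fun h0 => hq (by simp [h0])
  have r2 : ∀ j : ℕ, j ≤ 1 → 1 - s2 ^ 2 * (p ^ 2) ^ (k + j) ≠ 0 := fun j hj =>
    P'.block.reg_b.ne (k := (k + j : ℕ)) (by push_cast; omega) (by push_cast; omega)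
      (by rw [zpow_natCast])
  have r1 : ∀ j : ℕ, j ≤ 1 → 1 - s1 ^ 2 * (p ^ 2) ^ (k + j) ≠ 0 := fun j hj =>
    P'.block.reg_c.ne (k := (k + j : ℕ)) (by push_cast; omega) (by push_cast; omega)
      (by rw [zpow_natCast])
  have r4 : ∀ j : ℕ, j ≤ 1 → 1 - s4 ^ 2 * (p ^ 2) ^ (m + j) ≠ 0 := fun j hj =>
    P.block.reg_b.ne (k := (m + j : ℕ)) (by push_cast; omega) (by push_cast; omega)
      (by rw [zpow_natCast])
  have r0 : ∀ j : ℕ, j ≤ 1 → 1 - s0 ^ 2 * (p ^ 2) ^ (m + j) ≠ 0 := fun j hj =>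
    P.block.reg_c.ne (k := (m + j : ℕ)) (by push_cast; omega) (by push_cast; omega)
      (by rw [zpow_natCast])
  have s10 : s1 ≠ 0 := by rintro rfl; simp at hcon
  have s20 : s2 ≠ 0 := by rintro rfl; simp at hcon
  have s30 : s3 ≠ 0 := by rintro rfl; simp at hcon
  have s40 : s4 ≠ 0 := by rintro rfl; simp at hcon
  have s00 : s0 ≠ 0 := by rintro rfl; simp at hcon
  have c1 := coefA_one P (k := m) (m := k) (by omega)
  have c1' := coefA_one P' (k := k) (m := m) (by omega)
  have c2 : ∀ e, coefA e (-1) (p ^ 2) (p * s4) (s3 ^ 2) (s4 ^ 2) (s0 ^ 2) (s2 ^ 2) (s1 ^ 2) N m k =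
    coefAMinus e (p ^ 2) (p * s4) (s3 ^ 2) (s4 ^ 2) (s0 ^ 2) (s2 ^ 2) (s1 ^ 2) N m k :=
      fun e => by simp [coefA]
  have c2' : ∀ e, coefA e (-1) (p ^ 2) (p * s2) (s3 ^ 2) (s2 ^ 2) (s1 ^ 2) (s4 ^ 2) (s0 ^ 2) N k m =
    coefAMinus e (p ^ 2) (p * s2) (s3 ^ 2) (s2 ^ 2) (s1 ^ 2) (s4 ^ 2) (s0 ^ 2) N k m :=
      fun e => by simp [coefA]
  have e40 := h40 1 (by norm_num) (by norm_num)
  have f40 := h40 0 (by norm_num) (by norm_num)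
  have g40 := h40 2 (by norm_num) (by norm_num)
  have e21 := h21 1 (by norm_num) (by norm_num)
  have f21 := h21 0 (by norm_num) (by norm_num)
  have g21 := h21 2 (by norm_num) (by norm_num)
  have a2 := r2 0 (by norm_num)
  have b2 := r2 1 (by norm_num)
  have a1 := r1 0 (by norm_num)
  have b1 := r1 1 (by norm_num)
  have a4 := r4 0 (by norm_num)
  have b4 := r4 1 (by norm_num)
  have a0 := r0 0 (by norm_num)
  have b0 := r0 1 (by norm_num)
  have e40' : 1 - s0 ^ 2 * s4 ^ 2 * (p ^ 2) ^ (2 * (m : ℤ) + 1) ≠ 0 := by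
    rwa [mul_comm (s0 ^ 2)]
  have e21' : 1 - s1 ^ 2 * s2 ^ 2 * (p ^ 2) ^ (2 * (k : ℤ) + 1) ≠ 0 := by
    rwa [mul_comm (s1 ^ 2)]
  -- The constraint is solved for a root rather than for a square, since the gauge factors contain
  -- odd powers of the roots.
  have hs3 : s3 = 1 / ((p ^ 2) ^ N * p ^ 3 * s0 * s1 * s2 * s4) := by
    rw [eq_div_iff (by positivity), ← hcon]; ring
  have hQ := pow_ne_zero N hq
  have hK := pow_ne_zero k hq
  have hL := pow_ne_zero m hq
  clear r0 r1 r2 r4 h40 h21 P P' hcon h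
  rcases hε with rfl | rfl | rfl <;> rcases hε' with rfl | rfl | rfl
  all_goals first
    | exact absurd ⟨rfl, rfl⟩ h00
    | skip
  all_goals
    clear h00
    try simp only [c1, c1', c2, c2']
    simp only [coefA, coefAMinus, coefAZero, gaugeStep, Phi, PhiUp, PhiDown,
      show ¬ (0 : ℤ) = 1 by norm_num, show ¬ (-1 : ℤ) = 1 by norm_num,
      show ¬ (0 : ℤ) = -1 by norm_num, show ¬ (1 : ℤ) = -1 by norm_num,
      show ¬ (-1 : ℤ) = 0 by norm_num, show ¬ (1 : ℤ) = 0 by norm_num, if_true, if_false]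
    clear c1 c1' c2 c2'
    simp only [PhiPlus_eq hq _ _ _ _ _ e40, PhiPlus_eq hq _ _ _ _ _ e21,
      PhiMinus_eq hq _ _ _ _ _ e40, PhiMinus_eq hq _ _ _ _ _ e21,
      PhiUpPlus_eq hq, PhiUpMinus_eq hq _ _ _ _ _ _ e40, PhiUpMinus_eq hq _ _ _ _ _ _ e21,
      PhiDownPlus_eq hq _ _ _ _ _ e40, PhiDownPlus_eq hq _ _ _ _ _ e21,
      PhiDownMinus_eq hq _ _ _ _ _ e40, PhiDownMinus_eq hq _ _ _ _ _ e21,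
      FPlus_eq hq, FMinus_eq hq _ _ _ e40, FMinus_eq hq _ _ _ e21]
    simp only [zpow_add₀ hq, zpow_sub₀ hq, zpow_natCast, zpow_one, zpow_double, zpow_two_eq,
      zpow_zero, mul_one, pow_add, pow_zero, pow_one, zpow_neg] at *
    generalize (p ^ 2) ^ N = Q at *
    generalize (p ^ 2) ^ k = K at *
    generalize (p ^ 2) ^ m = L at *
    obtain ⟨E1, hE1⟩ : ∃ y, y = 1 - s4 ^ 2 * s0 ^ 2 * (L ^ 2 * p ^ 2) := ⟨_, rfl⟩
    obtain ⟨E0, hE0⟩ : ∃ y, y = 1 - s4 ^ 2 * s0 ^ 2 * L ^ 2 := ⟨_, rfl⟩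
    obtain ⟨E2, hE2⟩ : ∃ y, y = 1 - s4 ^ 2 * s0 ^ 2 * (L ^ 2 * (p ^ 2) ^ 2) := ⟨_, rfl⟩
    obtain ⟨D1, hD1⟩ : ∃ y, y = 1 - s2 ^ 2 * s1 ^ 2 * (K ^ 2 * p ^ 2) := ⟨_, rfl⟩
    obtain ⟨D0, hD0⟩ : ∃ y, y = 1 - s2 ^ 2 * s1 ^ 2 * K ^ 2 := ⟨_, rfl⟩
    obtain ⟨D2, hD2⟩ : ∃ y, y = 1 - s2 ^ 2 * s1 ^ 2 * (K ^ 2 * (p ^ 2) ^ 2) := ⟨_, rfl⟩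
    simp only [← hE1] at e40 ⊢
    simp only [← hE0] at f40 ⊢
    simp only [← hE2] at g40 ⊢
    simp only [← hD1] at e21 ⊢
    simp only [← hD0] at f21 ⊢
    simp only [← hD2] at g21 ⊢
    have b2' : 1 - p ^ 2 * s2 ^ 2 * K ≠ 0 := by convert b2 using 1; ring
    have b0' : 1 - s0 ^ 2 * p ^ 2 * L ≠ 0 := by convert b0 using 1; ring
    rw [hs3]
    field_simp
    first
      | done
      | ring1
      | (simp only [hE1, hE0, hE2, hD1, hD0, hD2]; ring1)

-- The central coefficient contains no square root and needs no gauge, so the two roots `r` and `r'`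
-- are unrelated and the identity holds in the parameters themselves.
set_option linter.unusedSimpArgs false in
set_option maxHeartbeats 4000000 in
set_option maxRecDepth 10000 in
theorem coefA_zero_zero_swap {q c0 c1 c2 c3 c4 r r' : ℂ} {N m k : ℕ}
    (P : ParamReg q r c3 c4 c0 c2 c1 N) (P' : ParamReg q r' c3 c2 c1 c4 c0 N) (h : k + m ≤ N) :
    coefA 0 0 q r c3 c4 c0 c2 c1 N m k = coefA 0 0 q r' c3 c2 c1 c4 c0 N k m := by
  have h40 : ∀ j : ℤ, -8 ≤ j → j ≤ 8 → 1 - c4 * c0 * q ^ (2 * (m : ℤ) + j) ≠ 0 :=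
    fun j h1 h2 => P'.reg_de _ (by push_cast; omega) (by push_cast; omega)
  have h21 : ∀ j : ℤ, -8 ≤ j → j ≤ 8 → 1 - c2 * c1 * q ^ (2 * (k : ℤ) + j) ≠ 0 :=
    fun j h1 h2 => P.reg_de _ (by push_cast; omega) (by push_cast; omega)
  have hq := P.block.q0
  have e40 := h40 1 (by norm_num) (by norm_num)
  have f40 := h40 0 (by norm_num) (by norm_num)
  have g40 := h40 2 (by norm_num) (by norm_num)
  have e21 := h21 1 (by norm_num) (by norm_num)
  have f21 := h21 0 (by norm_num) (by norm_num)
  have g21 := h21 2 (by norm_num) (by norm_num)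
  have e40' : 1 - c0 * c4 * q ^ (2 * (m : ℤ) + 1) ≠ 0 := by rwa [mul_comm c0]
  have e21' : 1 - c1 * c2 * q ^ (2 * (k : ℤ) + 1) ≠ 0 := by rwa [mul_comm c1]
  have hc4 := P.block.b0
  have hc0 := P.block.c0
  have hc2 := P'.block.b0
  have hc1 := P'.block.c0
  have hc3 : c3 = 1 / ((q ^ N) ^ 2 * q ^ 3 * c0 * c1 * c2 * c4) := by
    rw [eq_div_iff (by positivity)]
    linear_combination P.constr'
  have hQ := pow_ne_zero N hq
  have hK := pow_ne_zero k hq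
  have hL := pow_ne_zero m hq
  clear h40 h21 P P' h
  simp only [coefA, coefAZero, Phi,
    show ¬ (0 : ℤ) = 1 by norm_num, show ¬ (-1 : ℤ) = 1 by norm_num,
    show ¬ (0 : ℤ) = -1 by norm_num, if_true, if_false]
  simp only [PhiPlus_eq hq _ _ _ _ _ e40, PhiPlus_eq hq _ _ _ _ _ e21,
    PhiMinus_eq hq _ _ _ _ _ e40, PhiMinus_eq hq _ _ _ _ _ e21,
    PhiPlus_eq hq _ _ _ _ _ e40', PhiPlus_eq hq _ _ _ _ _ e21',
    PhiMinus_eq hq _ _ _ _ _ e40', PhiMinus_eq hq _ _ _ _ _ e21',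
    FPlus_eq hq, FMinus_eq hq _ _ _ e40, FMinus_eq hq _ _ _ e21]
  simp only [zpow_add₀ hq, zpow_sub₀ hq, zpow_natCast, zpow_one, zpow_double, zpow_two_eq,
    zpow_zero, mul_one] at *
  generalize q ^ N = Q at *
  generalize q ^ k = K at *
  generalize q ^ m = L at *
  rw [mul_comm c0 c4, mul_comm c1 c2]
  obtain ⟨E1, hE1⟩ : ∃ y, y = 1 - c4 * c0 * (L ^ 2 * q) := ⟨_, rfl⟩
  obtain ⟨E0, hE0⟩ : ∃ y, y = 1 - c4 * c0 * L ^ 2 := ⟨_, rfl⟩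
  obtain ⟨E2, hE2⟩ : ∃ y, y = 1 - c4 * c0 * (L ^ 2 * q ^ 2) := ⟨_, rfl⟩
  obtain ⟨D1, hD1⟩ : ∃ y, y = 1 - c2 * c1 * (K ^ 2 * q) := ⟨_, rfl⟩
  obtain ⟨D0, hD0⟩ : ∃ y, y = 1 - c2 * c1 * K ^ 2 := ⟨_, rfl⟩
  obtain ⟨D2, hD2⟩ : ∃ y, y = 1 - c2 * c1 * (K ^ 2 * q ^ 2) := ⟨_, rfl⟩
  rw [← hE1] at e40 ⊢
  rw [← hE0] at f40 ⊢
  rw [← hE2] at g40 ⊢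
  rw [← hD1] at e21 ⊢
  rw [← hD0] at f21 ⊢
  rw [← hD2] at g21 ⊢
  rw [hc3]
  field_simp
  rw [hE0, hE1, hE2, hD0, hD1, hD2]
  ring

theorem xi_ne_zero {q u v : ℂ} {n : ℕ} (hu : u ≠ 0) (hv : v ≠ 0)
    (h1 : ∀ l, l ≤ n → 1 - u ^ 2 * q ^ l ≠ 0) (h2 : ∀ l, l ≤ n → 1 - v ^ 2 * q ^ l ≠ 0) :
    xi q u v n ≠ 0 := by
  refine mul_ne_zero (div_ne_zero (qPoch_ne_zero fun l hl => ?_) (qPoch_ne_zero fun l hl => ?_))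
    (pow_ne_zero _ (div_ne_zero hv hu))
  · convert h1 (l + 1) hl using 2; ring
  · convert h2 (l + 1) hl using 2; ring

/-- Converts the quotient of two products into a single rational factor, which can take part in
clearing denominators. -/
theorem gaugeStep_eq {q u v w z : ℂ} {k n : ℕ} (hu : u ≠ 0) (hv : v ≠ 0)
    (h1 : ∀ l, l ≤ k + 1 → 1 - u ^ 2 * q ^ l ≠ 0) (h2 : ∀ l, l ≤ k + 1 → 1 - v ^ 2 * q ^ l ≠ 0)
    (hk : |(k : ℤ) - n| ≤ 1) :
    gaugeStep ((k : ℤ) - n) q u v w z (q ^ k) =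
      (w / z) ^ ((k : ℤ) - n) * (xi q u v k / xi q u v n) := by
  rw [abs_le] at hk
  have hx := fun (j : ℕ) (hj : j ≤ k + 1) =>
    xi_ne_zero hu hv (fun l hl => h1 l (hl.trans hj)) (fun l hl => h2 l (hl.trans hj))
  rcases (by omega : k = n + 1 ∨ k = n ∨ n = k + 1) with rfl | rfl | rfl
  · have e : ((n + 1 : ℕ) : ℤ) - n = 1 := by push_cast; ring
    have := hx n (by omega)
    rw [e, gaugeStep, if_pos rfl, xi_succ, zpow_one, mul_div_cancel_left₀ _ this, pow_succ q]
  · have := hx k (by omega)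
    simp [gaugeStep, div_self this]
  · have e : (k : ℤ) - ((k + 1 : ℕ) : ℤ) = -1 := by push_cast; ring
    have := hx k (by omega)
    rw [e, gaugeStep, if_neg (by norm_num), if_pos rfl, xi_succ, zpow_neg, zpow_one, inv_div,
      ← div_div, div_self this, one_div, mul_inv, inv_div, inv_div]

/-- This makes the nine-diagonal matrix of a frame accessible to both changes of basis: one acts on
the first coordinate, the other on the second, and the coefficients are defined with one of them
preferred. -/
theorem coefA_swap {p s0 s1 s2 s3 s4 : ℂ} {N m m' n k : ℕ}
    (P : ParamReg (p ^ 2) (p * s4) (s3 ^ 2) (s4 ^ 2) (s0 ^ 2) (s2 ^ 2) (s1 ^ 2) N)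
    (P' : ParamReg (p ^ 2) (p * s2) (s3 ^ 2) (s2 ^ 2) (s1 ^ 2) (s4 ^ 2) (s0 ^ 2) N)
    (hcon : p ^ (2 * N + 3) * (s0 * s1 * s2 * s3 * s4) = 1) (h : k + m' ≤ N) :
    coefA ((m' : ℤ) - m) ((k : ℤ) - n) (p ^ 2) (p * s4)
        (s3 ^ 2) (s4 ^ 2) (s0 ^ 2) (s2 ^ 2) (s1 ^ 2) N m' k =
      coefA ((k : ℤ) - n) ((m' : ℤ) - m) (p ^ 2) (p * s2)
        (s3 ^ 2) (s2 ^ 2) (s1 ^ 2) (s4 ^ 2) (s0 ^ 2) N k m' *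
        ((s3 / s0) ^ ((k : ℤ) - n) * (xi (p ^ 2) s2 s1 k / xi (p ^ 2) s2 s1 n)) *
        ((s1 / s3) ^ ((m' : ℤ) - m) * (xi (p ^ 2) s0 s4 m' / xi (p ^ 2) s0 s4 m)) := by
  by_cases hb : |(k : ℤ) - n| ≤ 1 ∧ |(m' : ℤ) - m| ≤ 1
  swap
  · rw [coefA_of_ne hb, coefA_of_ne (fun h => hb h.symm)]; ring
  have s10 : s1 ≠ 0 := by rintro rfl; simp at hcon
  have s20 : s2 ≠ 0 := by rintro rfl; simp at hcon
  have s40 : s4 ≠ 0 := by rintro rfl; simp at hcon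
  have s00 : s0 ≠ 0 := by rintro rfl; simp at hcon
  have reg : ∀ {x : ℂ}, Reg (p ^ 2) (2 * N + 5) x → ∀ l : ℕ, l ≤ N + 1 → 1 - x * (p ^ 2) ^ l ≠ 0 :=
    fun hx l hl => hx.ne (k := l) (by omega) (by push_cast; omega) (by rw [zpow_natCast])
  rw [← gaugeStep_eq s20 s10 (fun l hl => reg P'.block.reg_b l (by omega))
      (fun l hl => reg P'.block.reg_c l (by omega)) hb.1,
    ← gaugeStep_eq s00 s40 (fun l hl => reg P.block.reg_c l (by omega))
      (fun l hl => reg P.block.reg_b l (by omega)) hb.2]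
  obtain ⟨h1, h2⟩ := hb
  rw [abs_le] at h1 h2
  by_cases h00 : (m' : ℤ) - m = 0 ∧ (k : ℤ) - n = 0
  · rw [h00.1, h00.2, coefA_zero_zero_swap P P' h]; simp [gaugeStep]
  · exact coefA_swap_aux P P' hcon h (by omega) (by omega) h00

end QRacahAW4

namespace QRacahAW4

/-! ### Generic parameters -/

/-- Parameters for which all denominators of all the matrices are non-zero. -/
structure Generic (N : ℕ) (p : ℂ) (s : Fin 5 → ℂ) : Prop where
  constr : p ^ (2 * N + 3) * ∏ i, s i = 1
  q2 : (p ^ 2) ^ 2 ≠ 1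
  qk : ∀ k : ℕ, 1 ≤ k → k ≤ N → 1 - (p ^ 2) ^ k ≠ 0
  reg1 : ∀ i, Reg (p ^ 2) (6 * N + 15) (s i ^ 2)
  reg2 : ∀ i j, i ≠ j → Reg (p ^ 2) (6 * N + 15) (s i ^ 2 * s j ^ 2)

theorem Generic.p0 {N : ℕ} {p : ℂ} {s : Fin 5 → ℂ} (G : Generic N p s) : p ≠ 0 := by
  rintro rfl
  simpa using G.constr

theorem Generic.s0 {N : ℕ} {p : ℂ} {s : Fin 5 → ℂ} (G : Generic N p s) (i : Fin 5) : s i ≠ 0 := by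
  intro h
  have := G.constr
  rw [Finset.prod_eq_zero (Finset.mem_univ i) h] at this
  simp at this

theorem prod_of_nodup {a b c d e : Fin 5} (h : [a, b, c, d, e].Nodup) (s : Fin 5 → ℂ) :
    s a * s b * s c * s d * s e = ∏ i, s i := by
  have hu : [a, b, c, d, e].toFinset = Finset.univ := by
    rw [← Finset.card_eq_iff_eq_univ, List.toFinset_card_of_nodup h]; simp
  rw [← hu, List.prod_toFinset s h]
  simp [mul_assoc]

theorem Generic.prod {N : ℕ} {p : ℂ} {s : Fin 5 → ℂ} (G : Generic N p s) {a b c d e : Fin 5}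
    (h : [a, b, c, d, e].Nodup) : p ^ (2 * N + 3) * (s a * s b * s c * s d * s e) = 1 := by
  rw [prod_of_nodup h, G.constr]

theorem Reg.mono {q x : ℂ} {K K' : ℕ} (h : Reg q K x) (hK : K' ≤ K) : Reg q K' x :=
  fun k h1 h2 => h k (by omega) (by omega)

theorem Generic.paramReg {N : ℕ} {p : ℂ} {s : Fin 5 → ℂ} (G : Generic N p s) {a b c d e : Fin 5}
    (h : [a, b, c, d, e].Nodup) :
    ParamReg (p ^ 2) (p * s b) (s a ^ 2) (s b ^ 2) (s c ^ 2) (s d ^ 2) (s e ^ 2) N := by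
  have hp := G.p0
  have hn := h
  simp only [List.nodup_cons, List.mem_cons, List.not_mem_nil, not_or, not_false_eq_true,
    or_false, List.nodup_nil, and_true] at hn
  obtain ⟨⟨ab, ac, ad, ae⟩, ⟨bc, bd, be⟩, ⟨cd, ce⟩, de⟩ := hn
  have hc : (p ^ 2) ^ (2 * N + 3) * s e ^ 2 * s a ^ 2 * s b ^ 2 * s c ^ 2 * s d ^ 2 = 1 := by
    have := G.prod h
    calc _ = (p ^ (2 * N + 3) * (s a * s b * s c * s d * s e)) ^ 2 := by ring
      _ = 1 := by rw [this, one_pow]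
  refine ⟨⟨pow_ne_zero _ hp, mul_ne_zero hp (G.s0 b), by ring, pow_ne_zero _ (G.s0 b),
    pow_ne_zero _ (G.s0 c), G.qk, (G.reg1 a).mono (by omega), (G.reg1 b).mono (by omega),
    (G.reg1 c).mono (by omega), (G.reg2 a b ab).mono (by omega), (G.reg2 b c bc).mono (by omega),
    fun k h1 h2 h0 => ?_⟩, hc, (G.reg2 d e de).mono (by omega)⟩
  -- By the constraint, a zero of `1 - abc q^k` is a zero of `1 - de q^{2N+3-k}`, so triple products
  -- need no hypothesis of their own.
  refine G.reg2 d e de (2 * N + 3 - k) (by push_cast at h1 h2 ⊢; omega)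
    (by push_cast at h1 h2 ⊢; omega) ?_
  have hq := pow_ne_zero 2 hp
  have e1 : s a ^ 2 * s b ^ 2 * s c ^ 2 * (p ^ 2) ^ k = 1 := by linear_combination -h0
  have e2 : ((p ^ 2) ^ (2 * N + 3) : ℂ) = (p ^ 2) ^ k * (p ^ 2) ^ (2 * (N : ℤ) + 3 - k) := by
    rw [← zpow_add₀ hq, ← zpow_natCast]; congr 1; push_cast; ring
  rw [e2] at hc
  linear_combination s d ^ 2 * s e ^ 2 * (p ^ 2) ^ (2 * (N : ℤ) + 3 - k) * e1 - hc

/-! ### Sums over the index set -/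

/-- The index `(i, j)`. -/
def Idx.mk {N : ℕ} (i j : ℕ) (h : i + j ≤ N) : Idx N :=
  ⟨(⟨i, by omega⟩, ⟨j, by omega⟩), h⟩

@[simp] theorem Idx.fst_mk {N : ℕ} (i j : ℕ) (h : i + j ≤ N) : (Idx.mk i j h).fst = i := rfl
@[simp] theorem Idx.snd_mk {N : ℕ} (i j : ℕ) (h : i + j ≤ N) : (Idx.mk i j h).snd = j := rfl

theorem Idx.le {N : ℕ} (x : Idx N) : x.fst + x.snd ≤ N := x.2

@[ext] theorem Idx.ext {N : ℕ} {x y : Idx N} (h1 : x.fst = y.fst) (h2 : x.snd = y.snd) : x = y :=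
  Subtype.ext (Prod.ext (Fin.ext h1) (Fin.ext h2))

theorem Idx.sum_fst {N m : ℕ} {F : Idx N → ℂ} {f : ℕ → ℂ}
    (hF : ∀ l y, y.snd = l → F y = if y.fst = m then f l else 0) (hm : m ≤ N) :
    ∑ y, F y = ∑ l ∈ Finset.range (N - m + 1), f l := by
  rw [Finset.sum_congr rfl fun y _ => hF _ y rfl, ← Finset.sum_filter]
  symm
  refine Finset.sum_bij (fun l hl => Idx.mk m l (by rw [Finset.mem_range] at hl; omega))
    (fun l hl => by simp) (fun l _ l' _ h => by simpa using congrArg Idx.snd h)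
    (fun y hy => ?_) (fun l hl => by simp)
  have h : y.fst = m := by simpa using hy
  have := y.le
  exact ⟨y.snd, by rw [Finset.mem_range]; omega, by ext <;> simp [h]⟩

theorem Idx.sum_snd {N m : ℕ} {F : Idx N → ℂ} {f : ℕ → ℂ}
    (hF : ∀ l y, y.fst = l → F y = if y.snd = m then f l else 0) (hm : m ≤ N) :
    ∑ y, F y = ∑ l ∈ Finset.range (N - m + 1), f l := by
  rw [Finset.sum_congr rfl fun y _ => hF _ y rfl, ← Finset.sum_filter]
  symm
  refine Finset.sum_bij (fun l hl => Idx.mk l m (by rw [Finset.mem_range] at hl; omega))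
    (fun l hl => by simp) (fun l _ l' _ h => by simpa using congrArg Idx.fst h)
    (fun y hy => ?_) (fun l hl => by simp)
  have h : y.snd = m := by simpa using hy
  have := y.le
  exact ⟨y.fst, by rw [Finset.mem_range]; omega, by ext <;> simp [h]⟩

/-- The intermediate index of a product of two matrices may fall outside the triangle; the
conditional on the right keeps track of this. -/
theorem Idx.sum_single {N i j : ℕ} {F : Idx N → ℂ} {t : ℂ}
    (hF : ∀ y, F y = if y.fst = i ∧ y.snd = j then t else 0) :
    ∑ y, F y = if i + j ≤ N then t else 0 := by
  rw [Finset.sum_congr rfl fun y _ => hF y]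
  split_ifs with h
  · rw [Finset.sum_eq_single (Idx.mk i j h)]
    · simp
    · intro y _ hy
      rw [if_neg]
      rintro ⟨rfl, rfl⟩
      exact hy rfl
    · simp
  · refine Finset.sum_eq_zero fun y _ => if_neg ?_
    rintro ⟨rfl, rfl⟩
    exact h y.le

theorem diagFst_comm (N : ℕ) (p : ℂ) (s : Fin 5 → ℂ) (a b : Fin 5) :
    diagFst N p s a b = diagFst N p s b a := by
  unfold diagFst; rw [mul_comm]

theorem diagSnd_comm (N : ℕ) (p : ℂ) (s : Fin 5 → ℂ) (a b : Fin 5) :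
    diagSnd N p s a b = diagSnd N p s b a := by
  unfold diagSnd; rw [mul_comm]

theorem nineDiag_apply (N : ℕ) (p : ℂ) (s : Fin 5 → ℂ) (a b c d e : Fin 5) (y x : Idx N) :
    nineDiag N p s a b c d e y x = coefA ((x.snd : ℤ) - y.snd) ((x.fst : ℤ) - y.fst) (p ^ 2)
      (p * s b) (s a ^ 2) (s b ^ 2) (s c ^ 2) (s d ^ 2) (s e ^ 2) N x.snd x.fst := by
  unfold nineDiag
  rw [Matrix.of_apply]
  split_ifs with h
  · rfl
  · rw [coefA_of_ne h]

theorem xi_mul_xi {q u v : ℂ} {n : ℕ} (h : xi q u v n ≠ 0) : xi q u v n * xi q v u n = 1 := by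
  have h1 : qPoch q (q * u ^ 2) n ≠ 0 := fun h0 => h (by simp [xi, h0])
  have h2 : qPoch q (q * v ^ 2) n ≠ 0 := fun h0 => h (by simp [xi, h0])
  have h3 : (v / u) ^ n ≠ 0 := fun h0 => h (by simp [xi, h0])
  have h4 : (u / v) ^ n = ((v / u) ^ n)⁻¹ := by rw [← inv_pow, inv_div]
  unfold xi
  rw [h4]
  field_simp

theorem Generic.xi_ne_zero {N : ℕ} {p : ℂ} {s : Fin 5 → ℂ} (G : Generic N p s) (a b : Fin 5) {n : ℕ}
    (hn : n ≤ N) : xi (p ^ 2) (s a) (s b) n ≠ 0 :=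
  QRacahAW4.xi_ne_zero (G.s0 a) (G.s0 b)
    (fun l hl => (G.reg1 a).ne (k := l) (by omega) (by push_cast; omega) (by rw [zpow_natCast]))
    (fun l hl => (G.reg1 b).ne (k := l) (by omega) (by push_cast; omega) (by rw [zpow_natCast]))

/-! ### Intertwining relations for generic parameters -/

section Intertwining

variable {N : ℕ} {p : ℂ} {s : Fin 5 → ℂ} {a b c d e : Fin 5}

theorem nodup_reverse (h : [a, b, c, d, e].Nodup) : [c, b, a, d, e].Nodup := by
  simp at h ⊢; tauto

theorem nodup_swap (h : [a, b, c, d, e].Nodup) : [a, b, c, e, d].Nodup := by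
  simp at h ⊢; tauto

theorem nodup_dual (h : [a, b, c, d, e].Nodup) : [a, e, d, b, c].Nodup := by
  simp at h ⊢; tauto

/-- The difference equation of the polynomials in matrix form: a row of `chgUp` lives in one block
and the gauge factors depend on the row only. -/
theorem chgUp_mul_triSnd (G : Generic N p s) (h : [a, b, c, d, e].Nodup) :
    chgUp N p s a b c d * triSnd N p s c b a = diagFst N p s c b * chgUp N p s a b c d := by
  ext x z
  have hx := x.le
  have hz := z.le
  rw [diagFst, Matrix.diagonal_mul, Matrix.mul_apply]
  by_cases hxz : x.snd = z.fst
  · have e1 : ∀ (l : ℕ) (y : Idx N), y.snd = l → chgUp N p s a b c d x y * triSnd N p s c b a y z =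
        if y.fst = x.snd then (s d / s a) ^ x.fst * xi (p ^ 2) (s c) (s b) x.fst *
        (racahP (p ^ 2) (p * s b) (s a ^ 2) (s b ^ 2) (s c ^ 2) (N - x.snd) x.fst l *
          Phi ((z.snd : ℤ) - l) (p ^ 2) (s c ^ 2) (s b ^ 2) (s a ^ 2) ((N : ℤ) - z.fst) z.snd) else 0 := by
      rintro _ y rfl
      simp only [chgUp, triSnd, Matrix.of_apply, eq_comm (a := x.snd), ← hxz]
      split_ifs <;> ring
    rw [Idx.sum_fst e1 (show x.snd ≤ N by omega), ← Finset.mul_sum]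
    have := racahP_difference ((G.paramReg h).block.mono (Nat.sub_le N x.snd))
      ((G.paramReg (nodup_reverse h)).block.mono (Nat.sub_le N x.snd)) (n := x.fst) (x := z.snd)
      (by omega) (by omega)
    rw [Nat.cast_sub (by omega), hxz] at this
    simp only [chgUp, Matrix.of_apply, hxz, if_true]
    rw [this, mul_comm (s b ^ 2)]
    ring
  · rw [Finset.sum_eq_zero]
    · simp [chgUp, hxz]
    · intro y _
      simp only [chgUp, triSnd, Matrix.of_apply]
      split_ifs <;> simp_all

/-- The recurrence of the polynomials in matrix form. The factors in `triFst` are the ones that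
compensate the gauge of the rows of `chgUp`. -/
theorem chgUp_mul_diagSnd (G : Generic N p s) (h : [a, b, c, d, e].Nodup) :
    chgUp N p s a b c d * diagSnd N p s b a = triFst N p s a b c d * chgUp N p s a b c d := by
  ext x z
  have hx := x.le
  have hz := z.le
  rw [diagSnd, Matrix.mul_diagonal, Matrix.mul_apply]
  by_cases hxz : x.snd = z.fst
  · have e1 : ∀ (l : ℕ) (y : Idx N), y.fst = l → triFst N p s a b c d x y * chgUp N p s a b c d y z =
        if y.snd = x.snd then (s d / s a) ^ x.fst * xi (p ^ 2) (s c) (s b) x.fst *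
        (Phi ((l : ℤ) - x.fst) (p ^ 2) (s a ^ 2) (s b ^ 2) (s c ^ 2) ((N : ℤ) - x.snd) l *
          racahP (p ^ 2) (p * s b) (s a ^ 2) (s b ^ 2) (s c ^ 2) (N - x.snd) l z.snd) else 0 := by
      rintro _ y rfl
      simp only [chgUp, triFst, Matrix.of_apply, eq_comm (a := x.snd)]
      split_ifs with h1 h2 h2
      · rw [h1]
        have hy := y.le
        have f1 := xi_mul_xi (G.xi_ne_zero b c (n := y.fst) (by omega))
        have f2 := xi_mul_xi (G.xi_ne_zero b c (n := x.fst) (by omega))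
        have g1 := G.xi_ne_zero b c (n := x.fst) (by omega)
        have hsa := G.s0 a
        have hsd := G.s0 d
        -- The gauge factors of `triFst` and of row `y` combine to those of row `x`, the powers here
        -- and the `xi` factors in `f4`; they then leave the sum.
        have f3 : (s a / s d) ^ ((y.fst : ℤ) - x.fst) * (s d / s a) ^ y.fst =
            (s d / s a) ^ x.fst := by
          rw [← inv_div (s d) (s a), inv_zpow, ← zpow_neg, ← zpow_natCast, ← zpow_natCast,
            ← zpow_add₀ (div_ne_zero hsd hsa)]
          congr 1; ring
        have f4 : xi (p ^ 2) (s b) (s c) y.fst / xi (p ^ 2) (s b) (s c) x.fst *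
            xi (p ^ 2) (s c) (s b) y.fst = xi (p ^ 2) (s c) (s b) x.fst := by
          rw [div_mul_eq_mul_div, f1, div_eq_iff g1, mul_comm, f2]
        rw [← f3, ← f4]
        ring
      · exact absurd (h1.trans hxz) h2
      · simp
      · simp
    rw [Idx.sum_snd e1 (show x.snd ≤ N by omega), ← Finset.mul_sum]
    have := racahP_recurrence ((G.paramReg h).block.mono (Nat.sub_le N x.snd)) (n := x.fst)
      (x := z.snd) (by omega) (by omega)
    rw [Nat.cast_sub (by omega)] at this
    rw [this]
    simp only [chgUp, Matrix.of_apply, if_pos hxz]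
    rw [mul_comm (s b ^ 2)]
    ring
  · rw [Finset.sum_eq_zero]
    · simp [chgUp, hxz]
    · intro y _
      simp only [chgUp, triFst, Matrix.of_apply]
      split_ifs <;> simp_all

theorem chgUp_mul_diagFst :
    chgUp N p s a b c d * diagFst N p s e d = diagSnd N p s e d * chgUp N p s a b c d := by
  ext x z
  rw [diagFst, diagSnd, Matrix.mul_diagonal, Matrix.diagonal_mul, chgUp, Matrix.of_apply]
  split_ifs with h
  · rw [h]; ring
  · simp

/-- By `coefA_swap` the nine-diagonal coefficients take the form in which they act on the index of
the polynomials, and `sum_coefA_mul_racahP` collapses the sum. -/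
theorem chgUp_mul_triFst (G : Generic N p s) (h : [a, b, c, d, e].Nodup) :
    chgUp N p s a b c d * triFst N p s c d e a =
      nineDiag N p s a e d b c * chgUp N p s a b c d := by
  ext x z
  have hx := x.le
  have hz := z.le
  rw [Matrix.mul_apply, Matrix.mul_apply]
  have hcon : p ^ (2 * N + 3) * (s d * s c * s b * s a * s e) = 1 := by
    rw [← G.prod h]; ring
  have hct := sum_coefA_mul_racahP (G.paramReg (nodup_swap h)) (n := x.fst) (m := x.snd)
    (m' := z.fst) (x := z.snd) hx (by omega)
  have hsa := G.s0 a
  have hsd := G.s0 d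
  have e1 : ∀ (k : ℕ) (y : Idx N), y.fst = k → nineDiag N p s a e d b c x y * chgUp N p s a b c d y z =
      if y.snd = z.fst then (s d / s a) ^ x.fst * xi (p ^ 2) (s c) (s b) x.fst *
      ((s c / s a) ^ ((z.fst : ℤ) - x.snd) *
        (xi (p ^ 2) (s d) (s e) z.fst / xi (p ^ 2) (s d) (s e) x.snd)) *
      (coefA ((k : ℤ) - x.fst) ((z.fst : ℤ) - x.snd) (p ^ 2) (p * s b) (s a ^ 2) (s b ^ 2) (s c ^ 2)
        (s e ^ 2) (s d ^ 2) N k z.fst *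
        racahP (p ^ 2) (p * s b) (s a ^ 2) (s b ^ 2) (s c ^ 2) (N - z.fst) k z.snd) else 0 := by
    rintro _ y rfl
    have hy := y.le
    rw [nineDiag_apply, chgUp, Matrix.of_apply]
    split_ifs with h1
    · rw [h1] at hy ⊢
      rw [coefA_swap (G.paramReg (nodup_dual h)) (G.paramReg (nodup_swap h)) hcon hy]
      have f1 := xi_mul_xi (G.xi_ne_zero b c (n := y.fst) (by omega))
      have f2 := xi_mul_xi (G.xi_ne_zero b c (n := x.fst) (by omega))
      have g1 := G.xi_ne_zero b c (n := x.fst) (by omega)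
      have f3 : (s a / s d) ^ ((y.fst : ℤ) - x.fst) * (s d / s a) ^ y.fst =
          (s d / s a) ^ x.fst := by
        rw [← inv_div (s d) (s a), inv_zpow, ← zpow_neg, ← zpow_natCast, ← zpow_natCast,
          ← zpow_add₀ (div_ne_zero hsd hsa)]
        congr 1; ring
      have f4 : xi (p ^ 2) (s b) (s c) y.fst / xi (p ^ 2) (s b) (s c) x.fst *
          xi (p ^ 2) (s c) (s b) y.fst = xi (p ^ 2) (s c) (s b) x.fst := by
        rw [div_mul_eq_mul_div, f1, div_eq_iff g1, mul_comm, f2]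
      rw [← f3, ← f4]
      ring
    · simp
  rw [Idx.sum_snd e1 (show z.fst ≤ N by omega), ← Finset.mul_sum, hct]
  have e2 : ∀ y : Idx N, chgUp N p s a b c d x y * triFst N p s c d e a y z =
      if y.fst = x.snd ∧ y.snd = z.snd then
        (s d / s a) ^ x.fst * xi (p ^ 2) (s c) (s b) x.fst *
        racahP (p ^ 2) (p * s b) (s a ^ 2) (s b ^ 2) (s c ^ 2) (N - x.snd) x.fst z.snd *
        (Phi ((z.fst : ℤ) - x.snd) (p ^ 2) (s c ^ 2) (s d ^ 2) (s e ^ 2) ((N : ℤ) - z.snd) z.fst *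
        (s c / s a) ^ ((z.fst : ℤ) - x.snd) *
        (xi (p ^ 2) (s d) (s e) z.fst / xi (p ^ 2) (s d) (s e) x.snd)) else 0 := fun y => by
    simp only [chgUp, triFst, Matrix.of_apply, eq_comm (a := x.snd)]
    split_ifs <;> simp_all
  rw [Idx.sum_single e2]
  split_ifs with h2
  · ring
  -- If the intermediate index leaves the triangle the product is zero, in agreement with the
  -- convention that the polynomial vanishes outside its block.
  · rw [racahP, if_neg (by omega)]; ring

/-- The recurrence again, for the reversed parameters. Here the gauge depends on the column and
plays no part in the sum. -/
theorem chgDown_mul_diagFst (G : Generic N p s) (h : [a, b, c, d, e].Nodup) :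
    chgDown N p s c b a d * diagFst N p s c b = triSnd N p s c b a * chgDown N p s c b a d := by
  ext x z
  have hx := x.le
  have hz := z.le
  rw [diagFst, Matrix.mul_diagonal, Matrix.mul_apply]
  by_cases hxz : x.fst = z.snd
  · have e1 : ∀ (l : ℕ) (y : Idx N), y.snd = l → triSnd N p s c b a x y * chgDown N p s c b a d y z =
        if y.fst = x.fst then (s a / s d) ^ z.fst * xi (p ^ 2) (s b) (s c) z.fst *
        (Phi ((l : ℤ) - x.snd) (p ^ 2) (s c ^ 2) (s b ^ 2) (s a ^ 2) ((N : ℤ) - x.fst) l *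
          racahP (p ^ 2) (p * s b) (s c ^ 2) (s b ^ 2) (s a ^ 2) (N - z.snd) l z.fst) else 0 := by
      rintro _ y rfl
      simp only [chgDown, triSnd, Matrix.of_apply, eq_comm (a := x.fst), ← hxz]
      split_ifs with h1
      · rw [h1]; ring
      · simp
    rw [Idx.sum_fst e1 (show x.fst ≤ N by omega), ← Finset.mul_sum]
    have := racahP_recurrence ((G.paramReg (nodup_reverse h)).block.mono (Nat.sub_le N x.fst))
      (n := x.snd) (x := z.fst) (by omega) (by omega)
    rw [Nat.cast_sub (by omega)] at this
    rw [← hxz, this]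
    simp only [chgDown, Matrix.of_apply, hxz, if_true]
    ring
  · rw [Finset.sum_eq_zero]
    · simp [chgDown, hxz]
    · intro y _
      simp only [chgDown, triSnd, Matrix.of_apply]
      split_ifs <;> simp_all

/-- The difference equation for the reversed parameters, with the gauge of `triFst` moving that of
one column to another. -/
theorem chgDown_mul_triFst (G : Generic N p s) (h : [a, b, c, d, e].Nodup) :
    chgDown N p s c b a d * triFst N p s a b c d = diagSnd N p s b a * chgDown N p s c b a d := by
  ext x z
  have hx := x.le
  have hz := z.le
  rw [diagSnd, Matrix.diagonal_mul, Matrix.mul_apply]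
  by_cases hxz : x.fst = z.snd
  · have e1 : ∀ (l : ℕ) (y : Idx N), y.fst = l → chgDown N p s c b a d x y * triFst N p s a b c d y z =
        if y.snd = x.fst then (s a / s d) ^ z.fst * xi (p ^ 2) (s b) (s c) z.fst *
        (racahP (p ^ 2) (p * s b) (s c ^ 2) (s b ^ 2) (s a ^ 2) (N - x.fst) x.snd l *
          Phi ((z.fst : ℤ) - l) (p ^ 2) (s a ^ 2) (s b ^ 2) (s c ^ 2) ((N : ℤ) - x.fst) z.fst) else 0 := by
      rintro _ y rfl
      simp only [chgDown, triFst, Matrix.of_apply, eq_comm (a := x.fst), ← hxz]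
      split_ifs with h1
      · rw [h1]
        have hy := y.le
        have g1 := G.xi_ne_zero b c (n := y.fst) (by omega)
        have hsa := G.s0 a
        have hsd := G.s0 d
        have f3 : (s a / s d) ^ y.fst * (s a / s d) ^ ((z.fst : ℤ) - y.fst) =
            (s a / s d) ^ z.fst := by
          rw [← zpow_natCast, ← zpow_natCast, ← zpow_add₀ (div_ne_zero hsa hsd)]
          congr 1; ring
        have f4 : xi (p ^ 2) (s b) (s c) y.fst *
            (xi (p ^ 2) (s b) (s c) z.fst / xi (p ^ 2) (s b) (s c) y.fst) =
            xi (p ^ 2) (s b) (s c) z.fst := by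
          field_simp
        rw [← f3]
        field_simp
      · simp
    rw [Idx.sum_snd e1 (show x.fst ≤ N by omega), ← Finset.mul_sum]
    have := racahP_difference ((G.paramReg (nodup_reverse h)).block.mono (Nat.sub_le N x.fst))
      ((G.paramReg h).block.mono (Nat.sub_le N x.fst)) (n := x.snd) (x := z.fst)
      (by omega) (by omega)
    rw [Nat.cast_sub (by omega)] at this
    rw [this]
    simp only [chgDown, Matrix.of_apply, hxz, if_true]
    ring
  · rw [Finset.sum_eq_zero]
    · simp [chgDown, hxz]
    · intro y _
      simp only [chgDown, triFst, Matrix.of_apply]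
      split_ifs <;> simp_all

/-- Here the nine-diagonal coefficients already have the form required by `sum_coefA_mul_racahP`, so
no symmetry is needed. -/
theorem chgDown_mul_triSnd (G : Generic N p s) (h : [a, b, c, d, e].Nodup) :
    chgDown N p s c b a d * triSnd N p s a e d =
      nineDiag N p s c b a d e * chgDown N p s c b a d := by
  ext x z
  have hx := x.le
  have hz := z.le
  rw [Matrix.mul_apply, Matrix.mul_apply]
  have hct := sum_coefA_mul_racahP (G.paramReg (nodup_reverse h)) (n := x.snd) (m := x.fst)
    (m' := z.snd) (x := z.fst) (by omega) (by omega)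
  have e1 : ∀ (k : ℕ) (y : Idx N), y.snd = k → nineDiag N p s c b a d e x y * chgDown N p s c b a d y z =
      if y.fst = z.snd then (s a / s d) ^ z.fst * xi (p ^ 2) (s b) (s c) z.fst *
      (coefA ((k : ℤ) - x.snd) ((z.snd : ℤ) - x.fst) (p ^ 2) (p * s b) (s c ^ 2) (s b ^ 2) (s a ^ 2)
        (s d ^ 2) (s e ^ 2) N k z.snd *
        racahP (p ^ 2) (p * s b) (s c ^ 2) (s b ^ 2) (s a ^ 2) (N - z.snd) k z.fst) else 0 := by
    rintro _ y rfl
    rw [nineDiag_apply, chgDown, Matrix.of_apply]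
    split_ifs with h1
    · rw [h1]; ring
    · simp
  rw [Idx.sum_fst e1 (show z.snd ≤ N by omega), ← Finset.mul_sum, hct]
  have e2 : ∀ y : Idx N, chgDown N p s c b a d x y * triSnd N p s a e d y z =
      if y.fst = z.fst ∧ y.snd = x.fst then
        (s a / s d) ^ z.fst * xi (p ^ 2) (s b) (s c) z.fst *
        racahP (p ^ 2) (p * s b) (s c ^ 2) (s b ^ 2) (s a ^ 2) (N - x.fst) x.snd z.fst *
        Phi ((z.snd : ℤ) - x.fst) (p ^ 2) (s a ^ 2) (s e ^ 2) (s d ^ 2) ((N : ℤ) - z.fst) z.snd else 0 := fun y => by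
    simp only [chgDown, triSnd, Matrix.of_apply, eq_comm (a := x.fst)]
    split_ifs <;> simp_all
  rw [Idx.sum_single e2]
  split_ifs with h2
  · ring
  · rw [racahP, if_neg (by omega)]; ring

end Intertwining

end QRacahAW4

namespace QRacahAW4

/-! ### Matrix entries in terms of eigenvalues -/

/-- `x + 1/x`. -/
noncomputable def jk (x : ℂ) : ℂ := x + 1 / x

/-- The coefficient of `σ_a` in the diagonal entries of the tridiagonal matrices, where
`X = p b c q^n`. -/
noncomputable def diagCoef (p b c X : ℂ) : ℂ := (jk p * jk b - jk X * jk c) / (jk p ^ 2 - jk X ^ 2)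

theorem jk_sq_sub {p X : ℂ} (hp : p ≠ 0) (hX : X ≠ 0) :
    jk p ^ 2 - jk X ^ 2 = -((1 - X ^ 2 * p ^ 2) * (1 - X ^ 2 / p ^ 2) / X ^ 2) := by
  unfold jk; field_simp; ring

theorem jk_sq_sub_ne_zero {p b c K : ℂ} (hp : p ≠ 0) (hb : b ≠ 0) (hc : c ≠ 0) (hK : K ≠ 0)
    (h0 : 1 - b ^ 2 * c ^ 2 * K ^ 2 ≠ 0) (h2 : 1 - b ^ 2 * c ^ 2 * (K ^ 2 * (p ^ 2) ^ 2) ≠ 0) :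
    jk p ^ 2 - jk (p * b * c * K) ^ 2 ≠ 0 := by
  have hX : p * b * c * K ≠ 0 := by positivity
  rw [jk_sq_sub hp hX]
  refine neg_ne_zero.2 (div_ne_zero (mul_ne_zero ?_ ?_) (pow_ne_zero _ hX))
  · convert h2 using 1; ring
  · convert h0 using 1; field_simp

/-- The defining property of `diagCoef`. -/
theorem diagCoef_rel {p b c X : ℂ} (h : jk p ^ 2 - jk X ^ 2 ≠ 0) :
    diagCoef p c b X * jk p = jk c - jk X * diagCoef p b c X := by
  unfold diagCoef
  field_simp
  ring

/-- The diagonal entry is affine in `jk a` and in the eigenvalue attached to the block size, with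
coefficients that depend only on the eigenvalue parameter of the row. This separation of the two
coordinates is what keeps the later entry identities short. -/
theorem tri_diag {p a b c : ℂ} {M n : ℤ} (hp : p ≠ 0) (ha : a ≠ 0) (hb : b ≠ 0) (hc : c ≠ 0)
    (h1 : 1 - b ^ 2 * c ^ 2 * (p ^ 2) ^ (2 * n + 1) ≠ 0)
    (h0 : 1 - b ^ 2 * c ^ 2 * (p ^ 2) ^ (2 * n + 0) ≠ 0)
    (h2 : 1 - b ^ 2 * c ^ 2 * (p ^ 2) ^ (2 * n + 2) ≠ 0) :
    1 / (p * a * b) * Phi 0 (p ^ 2) (a ^ 2) (b ^ 2) (c ^ 2) M n + jk (p * a * b) =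
      jk a * diagCoef p b c (p * b * c * (p ^ 2) ^ n) +
        jk (a * b * c * ((p ^ 2) ^ M * p ^ 2)) * diagCoef p c b (p * b * c * (p ^ 2) ^ n) := by
  have hq := pow_ne_zero 2 hp
  simp only [Phi, show ¬ (0 : ℤ) = 1 by norm_num, show ¬ (0 : ℤ) = -1 by norm_num, if_true, if_false]
  rw [PhiPlus_eq hq _ _ _ _ _ h1, PhiMinus_eq hq _ _ _ _ _ h1]
  simp only [zpow_add₀ hq, zpow_double, zpow_one, zpow_two_eq, zpow_zero, mul_one] at h0 h1 h2
  have hK := zpow_ne_zero n hq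
  have hQ := zpow_ne_zero M hq
  have hR := jk_sq_sub_ne_zero hp hb hc hK h0 h2
  unfold diagCoef
  rw [← mul_div_assoc (jk a), ← mul_div_assoc (jk (a * b * c * _)), ← add_div, eq_div_iff hR, jk_sq_sub hp (by positivity)]
  generalize (p ^ 2) ^ n = K at *
  generalize (p ^ 2) ^ M = Q at *
  have e2 : 1 - (p * b * c * K) ^ 2 * p ^ 2 = 1 - b ^ 2 * c ^ 2 * (K ^ 2 * (p ^ 2) ^ 2) := by ring
  have e0 : 1 - (p * b * c * K) ^ 2 / p ^ 2 = 1 - b ^ 2 * c ^ 2 * K ^ 2 := by field_simp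
  rw [e2, e0]
  clear hR e2 e0
  obtain ⟨D1, hD1⟩ : ∃ y, y = 1 - b ^ 2 * c ^ 2 * (K ^ 2 * p ^ 2) := ⟨_, rfl⟩
  obtain ⟨D0, hD0⟩ : ∃ y, y = 1 - b ^ 2 * c ^ 2 * K ^ 2 := ⟨_, rfl⟩
  obtain ⟨D2, hD2⟩ : ∃ y, y = 1 - b ^ 2 * c ^ 2 * (K ^ 2 * (p ^ 2) ^ 2) := ⟨_, rfl⟩
  rw [← hD1] at h1 ⊢
  rw [← hD0] at h0 ⊢
  rw [← hD2] at h2 ⊢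
  unfold jk
  field_simp
  rw [hD0, hD1, hD2]
  ring

/-- The sum `F⁺ + F⁻` in terms of `diagCoef`. -/
theorem FPlus_add_FMinus {p a b c d e Q : ℂ} {n : ℤ} (hp : p ≠ 0) (hb : b ≠ 0)
    (hc : c ≠ 0) (hcon : Q * p ^ 3 * (d * c * b * a * e) = 1)
    (h1 : 1 - b ^ 2 * c ^ 2 * (p ^ 2) ^ (2 * n + 1) ≠ 0)
    (h0 : 1 - b ^ 2 * c ^ 2 * (p ^ 2) ^ (2 * n + 0) ≠ 0)
    (h2 : 1 - b ^ 2 * c ^ 2 * (p ^ 2) ^ (2 * n + 2) ≠ 0) :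
    1 / (p * d * c) * (d ^ 2 * (Q * p ^ 2) * (FPlus (p ^ 2) (b ^ 2) (c ^ 2) n +
      FMinus (p ^ 2) (b ^ 2) (c ^ 2) n)) =
      1 / (p * a * e) * diagCoef p b c (p * b * c * (p ^ 2) ^ n) := by
  have hq := pow_ne_zero 2 hp
  have ha : a ≠ 0 := by rintro rfl; simp at hcon
  have hd : d ≠ 0 := by rintro rfl; simp at hcon
  have he : e ≠ 0 := by rintro rfl; simp at hcon
  rw [FPlus_eq hq, FMinus_eq hq _ _ _ h1]
  simp only [zpow_add₀ hq, zpow_double, zpow_one, zpow_two_eq, zpow_zero, mul_one] at h0 h1 h2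
  have hK := zpow_ne_zero n hq
  have hR := jk_sq_sub_ne_zero hp hb hc hK h0 h2
  unfold diagCoef
  rw [← mul_div_assoc, eq_div_iff hR, jk_sq_sub hp (by positivity)]
  generalize (p ^ 2) ^ n = K at *
  have hQ : Q = 1 / (p ^ 3 * (d * c * b * a * e)) := by
    rw [eq_div_iff (by positivity), ← hcon]; ring
  rw [hQ]
  have e2 : 1 - (p * b * c * K) ^ 2 * p ^ 2 = 1 - b ^ 2 * c ^ 2 * (K ^ 2 * (p ^ 2) ^ 2) := by ring
  have e0 : 1 - (p * b * c * K) ^ 2 / p ^ 2 = 1 - b ^ 2 * c ^ 2 * K ^ 2 := by field_simp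
  rw [e2, e0]
  clear hR e2 e0
  obtain ⟨D1, hD1⟩ : ∃ y, y = 1 - b ^ 2 * c ^ 2 * (K ^ 2 * p ^ 2) := ⟨_, rfl⟩
  obtain ⟨D0, hD0⟩ : ∃ y, y = 1 - b ^ 2 * c ^ 2 * K ^ 2 := ⟨_, rfl⟩
  obtain ⟨D2, hD2⟩ : ∃ y, y = 1 - b ^ 2 * c ^ 2 * (K ^ 2 * (p ^ 2) ^ 2) := ⟨_, rfl⟩
  rw [← hD1] at h1 ⊢
  rw [← hD0] at h0 ⊢
  rw [← hD2] at h2 ⊢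
  unfold jk
  field_simp
  rw [hD0, hD1, hD2]
  ring

set_option linter.unusedSimpArgs false in
set_option maxHeartbeats 2000000 in
set_option maxRecDepth 10000 in
/-- The corner coefficients: products of off-diagonal entries of the two tridiagonal matrices. -/
theorem corner_entry {p a b c d e : ℂ} {N i j : ℕ}
    (P : ParamReg (p ^ 2) (p * e) (a ^ 2) (e ^ 2) (d ^ 2) (b ^ 2) (c ^ 2) N)
    (P' : ParamReg (p ^ 2) (p * b) (a ^ 2) (b ^ 2) (c ^ 2) (e ^ 2) (d ^ 2) N)
    (hcon : p ^ (2 * N + 3) * (d * c * b * a * e) = 1) (h : j + i ≤ N) {ε ε' : ℤ}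
    (hε : ε = 1 ∨ ε = -1) (hε' : ε' = 1 ∨ ε' = -1) {r : ℂ}
    (hr : r = (p * b * c * (p ^ 2) ^ (i : ℤ)) ^ ε' / (p * d * e * (p ^ 2) ^ (j : ℤ)) ^ ε) :
    1 / (p * a * b) * Phi ε' (p ^ 2) (a ^ 2) (b ^ 2) (c ^ 2) (N - (j - ε)) i *
        gaugeStep ε' (p ^ 2) b c a d ((p ^ 2) ^ i) *
        (1 / (p * a * e) * Phi ε (p ^ 2) (a ^ 2) (e ^ 2) (d ^ 2) (N - i) j) =
      (jk a - jk (p * r)) * (1 / (p * d * c) *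
        coefA ε ε' (p ^ 2) (p * e) (a ^ 2) (e ^ 2) (d ^ 2) (b ^ 2) (c ^ 2) N j i) ∧
    1 / (p * a * b) * Phi ε' (p ^ 2) (a ^ 2) (b ^ 2) (c ^ 2) (N - j) i *
        gaugeStep ε' (p ^ 2) b c a d ((p ^ 2) ^ i) *
        (1 / (p * a * e) * Phi ε (p ^ 2) (a ^ 2) (e ^ 2) (d ^ 2) (N - (i - ε')) j) =
      (jk a - jk (r / p)) * (1 / (p * d * c) *
        coefA ε ε' (p ^ 2) (p * e) (a ^ 2) (e ^ 2) (d ^ 2) (b ^ 2) (c ^ 2) N j i) := by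
  have h40 : ∀ l : ℤ, -8 ≤ l → l ≤ 8 → 1 - e ^ 2 * d ^ 2 * (p ^ 2) ^ (2 * (j : ℤ) + l) ≠ 0 :=
    fun l h1 h2 => P'.reg_de _ (by push_cast; omega) (by push_cast; omega)
  have h21 : ∀ l : ℤ, -8 ≤ l → l ≤ 8 → 1 - b ^ 2 * c ^ 2 * (p ^ 2) ^ (2 * (i : ℤ) + l) ≠ 0 :=
    fun l h1 h2 => P.reg_de _ (by push_cast; omega) (by push_cast; omega)
  have hq := P.block.q0
  have hp : p ≠ 0 := fun h0 => hq (by simp [h0])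
  have a1 := P'.block.reg_c.ne (k := i) (by push_cast; omega) (by push_cast; omega) rfl
  have b1 := P'.block.reg_b.ne (k := ((i + 1 : ℕ) : ℤ)) (by push_cast; omega) (by push_cast; omega) rfl
  have s10 : b ≠ 0 := by rintro rfl; simp at hcon
  have s20 : c ≠ 0 := by rintro rfl; simp at hcon
  have s30 : a ≠ 0 := by rintro rfl; simp at hcon
  have s40 : d ≠ 0 := by rintro rfl; simp at hcon
  have s00 : e ≠ 0 := by rintro rfl; simp at hcon
  have c1 := coefA_one P (k := j) (m := i) (by omega)
  have c2 : ∀ x, coefA x (-1) (p ^ 2) (p * e) (a ^ 2) (e ^ 2) (d ^ 2) (b ^ 2) (c ^ 2) N j i =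
    coefAMinus x (p ^ 2) (p * e) (a ^ 2) (e ^ 2) (d ^ 2) (b ^ 2) (c ^ 2) N j i :=
      fun e => by simp [coefA]
  have e40 := h40 1 (by norm_num) (by norm_num)
  have f40 := h40 0 (by norm_num) (by norm_num)
  have g40 := h40 2 (by norm_num) (by norm_num)
  have e21 := h21 1 (by norm_num) (by norm_num)
  have f21 := h21 0 (by norm_num) (by norm_num)
  have g21 := h21 2 (by norm_num) (by norm_num)
  have hs3 : a = 1 / ((p ^ 2) ^ N * p ^ 3 * d * c * b * e) := by
    rw [eq_div_iff (by positivity), ← hcon]; ring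
  have hQ := pow_ne_zero N hq
  have hK := pow_ne_zero i hq
  have hL := pow_ne_zero j hq
  clear h40 h21 P P' hcon h
  rcases hε with rfl | rfl <;> rcases hε' with rfl | rfl
  all_goals
    try simp only [c1, c2] at *
    simp only [coefA, coefAMinus, gaugeStep, Phi, PhiUp, PhiDown,
      show ¬ (-1 : ℤ) = 1 by norm_num, if_true, if_false]
    clear c1 c2
    simp only [PhiPlus_eq hq _ _ _ _ _ e40, PhiPlus_eq hq _ _ _ _ _ e21,
      PhiMinus_eq hq _ _ _ _ _ e40, PhiMinus_eq hq _ _ _ _ _ e21,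
      PhiUpPlus_eq hq, PhiUpMinus_eq hq _ _ _ _ _ _ e40, PhiDownPlus_eq hq _ _ _ _ _ e40,
      PhiDownMinus_eq hq _ _ _ _ _ e40, FPlus_eq hq, FMinus_eq hq _ _ _ e21]
    simp only [zpow_add₀ hq, zpow_sub₀ hq, zpow_natCast, zpow_one, zpow_double, zpow_two_eq,
      zpow_zero, mul_one, pow_add, pow_zero, pow_one, zpow_neg, Nat.cast_add, Nat.cast_one] at *
    generalize (p ^ 2) ^ N = Q at *
    generalize (p ^ 2) ^ i = K at *
    generalize (p ^ 2) ^ j = L at *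
    obtain ⟨E1, hE1⟩ : ∃ y, y = 1 - e ^ 2 * d ^ 2 * (L ^ 2 * p ^ 2) := ⟨_, rfl⟩
    obtain ⟨E0, hE0⟩ : ∃ y, y = 1 - e ^ 2 * d ^ 2 * L ^ 2 := ⟨_, rfl⟩
    obtain ⟨E2, hE2⟩ : ∃ y, y = 1 - e ^ 2 * d ^ 2 * (L ^ 2 * (p ^ 2) ^ 2) := ⟨_, rfl⟩
    obtain ⟨D1, hD1⟩ : ∃ y, y = 1 - b ^ 2 * c ^ 2 * (K ^ 2 * p ^ 2) := ⟨_, rfl⟩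
    obtain ⟨D0, hD0⟩ : ∃ y, y = 1 - b ^ 2 * c ^ 2 * K ^ 2 := ⟨_, rfl⟩
    obtain ⟨D2, hD2⟩ : ∃ y, y = 1 - b ^ 2 * c ^ 2 * (K ^ 2 * (p ^ 2) ^ 2) := ⟨_, rfl⟩
    simp only [← hE1] at e40 ⊢
    simp only [← hE0] at f40 ⊢
    simp only [← hE2] at g40 ⊢
    simp only [← hD1] at e21 ⊢
    simp only [← hD0] at f21 ⊢
    simp only [← hD2] at g21 ⊢
    have b1' : 1 - p ^ 2 * b ^ 2 * K ≠ 0 := by convert b1 using 1; ring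
    have b1'' : 1 - b ^ 2 * p ^ 2 * K ≠ 0 := by convert b1 using 1; ring
    rw [hr, hs3]
    unfold jk
    clear hE0 hE1 hE2 hD0 hD1 hD2
    -- Both sides are products of elementary factors once the constraint has removed `a`, so the
    -- denominators can stay opaque.
    constructor <;> (field_simp; try ring1)

end QRacahAW4

/-! ### Eigenvalues of the form `x + 1/x` and scalar forms of the relations. -/

namespace QRacahAW4

theorem jk_inv {x y : ℂ} (h : x * y = 1) : jk x = jk y := by
  have hx : x ≠ 0 := left_ne_zero_of_mul_eq_one h
  have hy : y ≠ 0 := right_ne_zero_of_mul_eq_one h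
  have : x = 1 / y := by rw [eq_div_iff hy, h]
  unfold jk; rw [this]; field_simp; ring

/-- Neighbouring eigenvalue parameters differ by the factor `q`, and then the weighted difference of
the eigenvalues is a monomial. Multiplied with the monomial of `jk_step_down` it gives a constant,
which is the off-diagonal condition in `awExpr_tridiag`. -/
theorem jk_step_up {p X : ℂ} (hp : p ≠ 0) (hX : X ≠ 0) {ε : ℤ} (hε : ε = 1 ∨ ε = -1) :
    p * jk X - p⁻¹ * jk (X * (p ^ 2) ^ (-ε)) = (p ^ 2 - (p ^ 2)⁻¹) * (X ^ ε / p) := by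
  unfold jk
  rcases hε with rfl | rfl
  · simp only [zpow_neg, zpow_one]; field_simp; ring
  · simp only [zpow_neg, zpow_one, neg_neg]; field_simp; ring

theorem jk_step_down {p X : ℂ} (hp : p ≠ 0) (hX : X ≠ 0) {ε : ℤ} (hε : ε = 1 ∨ ε = -1) :
    p * jk (X * (p ^ 2) ^ (-ε)) - p⁻¹ * jk X = (p ^ 2 - (p ^ 2)⁻¹) * (p / X ^ ε) := by
  unfold jk
  rcases hε with rfl | rfl
  · simp only [zpow_neg, zpow_one]; field_simp; ring
  · simp only [zpow_neg, zpow_one, neg_neg]; field_simp; ring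

/-- The two constants of the Askey-Wilson relations. -/
theorem aw_constants {p : ℂ} (hp : p ≠ 0) (hp4 : (p ^ 2) ^ 2 ≠ 1) :
    ∃ k m : ℂ, k = 1 / (p ^ 2 - (p ^ 2)⁻¹) ∧ m = 1 / (p + p⁻¹) ∧ k * (p ^ 2 - (p ^ 2)⁻¹) = 1 ∧
      m = k * (p - p⁻¹) ∧ m * jk p = 1 := by
  have hk : p ^ 2 - (p ^ 2)⁻¹ ≠ 0 := by
    intro h
    apply hp4
    field_simp at h
    linear_combination h
  have hf : p ^ 2 - (p ^ 2)⁻¹ = (p - p⁻¹) * (p + p⁻¹) := by field_simp; ring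
  have hm : p + p⁻¹ ≠ 0 := by
    intro h
    apply hk
    rw [hf, h, mul_zero]
  refine ⟨_, _, rfl, rfl, ?_, ?_, ?_⟩
  · rw [one_div, inv_mul_cancel₀ hk]
  · rw [div_eq_iff hm, mul_assoc, ← hf, one_div, inv_mul_cancel₀ hk]
  · rw [jk, one_div p, one_div, inv_mul_cancel₀ hm]

/-- A tridiagonal matrix `Y` and a diagonal matrix `X` satisfy the Askey-Wilson relation that is
linear in `Y`. -/
theorem awExpr_tridiag {ι : Type*} [Fintype ι] [DecidableEq ι] {p cx cy cz : ℂ} {X L : ι → ℂ}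
    {Y U₁ U₂ V₁ V₂ U₃ U₄ V₃ V₄ : Matrix ι ι ℂ}
    (hp : p ≠ 0) (hp4 : (p ^ 2) ^ 2 ≠ 1)
    (hoff : ∀ y x, y ≠ x → Y y x = 0 ∨
      (p * X y - p⁻¹ * X x) * (p * X x - p⁻¹ * X y) = (p ^ 2 - (p ^ 2)⁻¹) ^ 2)
    (hdiag : ∀ x, Y x x * (jk p ^ 2 - X x ^ 2) =
      jk p * (cx * cy + cz * L x) - X x * (cx * cz + cy * L x))
    (hA : U₁ * U₂ + V₁ * V₂ = Matrix.diagonal fun x => cx * cz + cy * L x)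
    (hB : U₃ * U₄ + V₃ * V₄ = Matrix.diagonal fun x => cx * cy + cz * L x) :
    Y = awExpr p (Matrix.diagonal X) (awExpr p Y (Matrix.diagonal X) U₁ U₂ V₁ V₂) U₃ U₄ V₃ V₄ := by
  unfold awExpr
  rw [hA, hB]
  ext y x
  simp only [Matrix.add_apply, Matrix.neg_apply, Matrix.sub_apply, Matrix.smul_apply,
    Matrix.diagonal_mul, Matrix.mul_diagonal, smul_eq_mul]
  obtain ⟨k, m, hk', hm', ek, em, ej⟩ := aw_constants hp hp4
  rw [← hk', ← hm']
  by_cases hyx : y = x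
  · subst hyx
    simp only [Matrix.diagonal_apply_eq]
    -- On the diagonal the `q`-commutator is ordinary multiplication by `p - p⁻¹`, so the relation
    -- is linear in the entry and amounts to `hdiag`.
    rw [em] at ej ⊢
    have h := hdiag y
    generalize p⁻¹ = u at *
    generalize jk p = J at *
    linear_combination (k ^ 2 * (p - u) ^ 2) * h - Y y y * (k * (p - u) * J + 1) * ej +
      k * (p - u) * (cx * cy + cz * L y) * ej
  -- Off the diagonal only the double `q`-commutator survives, and by `hoff` it multiplies the entry
  -- by one.
  · simp only [Matrix.diagonal_apply_ne _ hyx, mul_zero, add_zero]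
    rcases hoff y x hyx with h | h
    · simp [h]
    · linear_combination (-(k ^ 2 * Y y x)) * h -
        Y y x * (k * (p ^ 2 - (p ^ 2)⁻¹) + 1) * ek

/-! ### The entries of the relations between the outer generators -/

section Entries

variable {p u k m J β γ σa σb σc σd σe x₁ y₁ x₂ y₂ A₁ A₁' A₂ A₂' Z r : ℂ}

/-- Entry in which one coordinate moves. The eigenvalue step of the moving coordinate factors out,
and what remains is the defining relation of `diagCoef` in the resting coordinate. -/
theorem entry_fst (hm : m = k * (p - u)) (hJ : m * J = 1) (hγ : γ * J = σc - x₁ * β)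
    (hA : A₁ = σa * β + y₂ * γ) (hA' : A₁' = σa * β + x₂ * γ) :
    -(k * (p * (A₁ * A₂) - u * (A₂ * A₁'))) + m * (β * A₂ * σa) =
      -(k * (p * (-(k * (p * (y₂ * (β * A₂)) - u * (β * A₂ * x₂))) * x₁) -
        u * (x₁ * -(k * (p * (y₂ * (β * A₂)) - u * (β * A₂ * x₂)))))) +
      m * (σc * -(k * (p * (y₂ * A₂) - u * (A₂ * x₂)))) := by
  rw [hA, hA']
  linear_combination (β * A₂ * σa + x₁ * (k * (p * y₂ - u * x₂)) * β * A₂) * hm -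
    m * (k * (p * y₂ - u * x₂)) * A₂ * hγ + (k * (p * y₂ - u * x₂)) * A₂ * γ * hJ

/-- The same cancellation when the other coordinate moves; the two lemmas exchange their roles
between the two relations. -/
theorem entry_snd (hm : m = k * (p - u)) (hJ : m * J = 1) (hγ : γ * J = σd - x₂ * β)
    (hA : A₂ = σa * β + x₁ * γ) (hA' : A₂' = σa * β + y₁ * γ) :
    -(k * (p * (A₁ * A₂) - u * (A₂' * A₁))) + m * (β * A₁ * σa) =
      -(k * (p * ((-(k * (p * (x₂ * (β * A₁)) - u * (β * A₁ * x₂))) + m * (σd * A₁)) * x₁) -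
        u * (y₁ * (-(k * (p * (x₂ * (β * A₁)) - u * (β * A₁ * x₂))) + m * (σd * A₁))))) := by
  rw [hA, hA']
  linear_combination (β * A₁ * σa + x₂ * (k * (p * x₁ - u * y₁)) * β * A₁) * hm -
    m * (k * (p * x₁ - u * y₁)) * A₁ * hγ + (k * (p * x₁ - u * y₁)) * A₁ * γ * hJ

/-- On the diagonal all `q`-commutators become multiplication by `m`, and the difference of the two
sides is a multiple of the relation for `γ`. -/
theorem entry_diag (hm : m = k * (p - u)) (hJ : m * J = 1) (hγ : γ * J = σc - x₁ * β)
    (hA : A₁ = σa * β + x₂ * γ) (hZ : Z = σd * γ + β * A₂) :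
    -(k * (p * (A₁ * A₂) - u * (A₂ * A₁))) + m * (σe * σb + Z * σa) =
      -(k * (p * ((-(k * (p * (x₂ * Z) - u * (Z * x₂))) + m * (σe * σc + σd * A₁)) * x₁) -
        u * (x₁ * (-(k * (p * (x₂ * Z) - u * (Z * x₂))) + m * (σe * σc + σd * A₁))))) +
      m * (σe * σb + σc * (-(k * (p * (x₂ * A₂) - u * (A₂ * x₂))) +
        m * (σe * x₁ + σd * σa))) := by
  have h1 : ∀ t, k * (p * t - u * t) = m * t := fun t => by rw [hm]; ring
  have h2 : k * (p * (A₁ * A₂) - u * (A₂ * A₁)) = m * (A₁ * A₂) := by rw [hm]; ring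
  have h3 : k * (p * (x₂ * Z) - u * (Z * x₂)) = m * (x₂ * Z) := by rw [hm]; ring
  have h4 : k * (p * (x₂ * A₂) - u * (A₂ * x₂)) = m * (x₂ * A₂) := by rw [hm]; ring
  rw [h2, h3, h4, mul_comm x₁ (_ + _), h1, hA, hZ]
  linear_combination m ^ 2 * (σa * σd - x₂ * A₂) * hγ - m * (σa * σd - x₂ * A₂) * γ * hJ

/-- Both coordinates move, and both products of the tridiagonal entries are multiples of the same
entry `Z`. The part with `σa` cancels; the rest compares the `q`-commutator of `jk (p * r)` and `jk
(r * u)` with the product of two eigenvalue steps, both of which equal `r` up to the normalization.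
-/
theorem entry_corner (hk : k * (p ^ 2 - u ^ 2) = 1) (hm : m = k * (p - u)) (hpu : p * u = 1)
    (hr : r ≠ 0) (hA : A₁ * A₂ = (σa - jk (p * r)) * Z) (hA' : A₂' * A₁' = (σa - jk (r * u)) * Z)
    (hx : k * (p * x₁ - u * y₁) * (k * (p * y₂ - u * x₂)) = r) :
    -(k * (p * (A₁ * A₂) - u * (A₂' * A₁'))) + m * (Z * σa) =
      -(k * (p * (-(k * (p * (y₂ * Z) - u * (Z * x₂))) * x₁) -
        u * (y₁ * -(k * (p * (y₂ * Z) - u * (Z * x₂)))))) := by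
  have hp : p ≠ 0 := left_ne_zero_of_mul_eq_one hpu
  have hu : u ≠ 0 := right_ne_zero_of_mul_eq_one hpu
  have h1 : p * jk (p * r) - u * jk (r * u) = (p ^ 2 - u ^ 2) * r := by
    unfold jk; field_simp; ring
  rw [hA, hA']
  linear_combination Z * σa * hm + Z * k * h1 + Z * r * hk - Z * hx

end Entries

end QRacahAW4

namespace QRacahAW4

/-! ### The images of the generators in a frame of five labels -/

/-- The affine normalization of the matrices, with `w` a product of two square roots. -/
noncomputable def img {N : ℕ} (p w : ℂ) (M : Mat N) : Mat N := (1 / (p * w)) • M + jk (p * w) • 1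

theorem img_apply {N : ℕ} (p w : ℂ) (M : Mat N) (y x : Idx N) :
    img p w M y x = 1 / (p * w) * M y x + if y = x then jk (p * w) else 0 := by
  simp [img, Matrix.one_apply]

/-- The entries of the normalized `triSnd`. -/
noncomputable def sndEntry (ε : ℤ) (p a b c : ℂ) (M n : ℤ) : ℂ :=
  1 / (p * a * b) * Phi ε (p ^ 2) (a ^ 2) (b ^ 2) (c ^ 2) M n + if ε = 0 then jk (p * a * b) else 0

/-- The entries of the normalized `triFst`. -/
noncomputable def fstEntry (ε : ℤ) (p a b c d : ℂ) (M : ℤ) (n : ℕ) : ℂ :=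
  1 / (p * a * b) * Phi ε (p ^ 2) (a ^ 2) (b ^ 2) (c ^ 2) M n *
    gaugeStep ε (p ^ 2) b c a d ((p ^ 2) ^ n) + if ε = 0 then jk (p * a * b) else 0

theorem fstEntry_zero (p a b c d : ℂ) (M : ℤ) (n : ℕ) :
    fstEntry 0 p a b c d M n = sndEntry 0 p a b c M n := by
  simp [fstEntry, sndEntry, gaugeStep]

theorem img_lam {p w : ℂ} (hp : p ≠ 0) (hw : w ≠ 0) (n : ℤ) :
    1 / (p * w) * lam (p ^ 2) (w ^ 2) n + jk (p * w) = jk (p * w * (p ^ 2) ^ n) := by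
  have hq := pow_ne_zero 2 hp
  have hK := zpow_ne_zero n hq
  unfold lam jk
  rw [zpow_neg, zpow_add₀ hq, zpow_one]
  field_simp
  ring

section Frame

variable {N : ℕ} {p : ℂ} {s : Fin 5 → ℂ} {a b c d e : Fin 5}

theorem img_diagFst (hp : p ≠ 0) (hb : s b ≠ 0) (hc : s c ≠ 0) :
    img p (s b * s c) (diagFst N p s b c) =
      Matrix.diagonal fun x => jk (p * s b * s c * (p ^ 2) ^ (x.fst : ℤ)) := by
  ext y x
  rw [img_apply, diagFst, Matrix.diagonal_apply, Matrix.diagonal_apply]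
  split_ifs with h
  · rw [← mul_pow, img_lam hp (mul_ne_zero hb hc), ← mul_assoc p (s b)]
  · simp

theorem img_diagSnd (hp : p ≠ 0) (hb : s b ≠ 0) (hc : s c ≠ 0) :
    img p (s b * s c) (diagSnd N p s b c) =
      Matrix.diagonal fun x => jk (p * s b * s c * (p ^ 2) ^ (x.snd : ℤ)) := by
  ext y x
  rw [img_apply, diagSnd, Matrix.diagonal_apply, Matrix.diagonal_apply]
  split_ifs with h
  · rw [← mul_pow, img_lam hp (mul_ne_zero hb hc), ← mul_assoc p (s b)]
  · simp

theorem Idx.eq_iff {y x : Idx N} : y = x ↔ y.fst = x.fst ∧ y.snd = x.snd :=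
  ⟨fun h => by simp [h], fun h => Idx.ext h.1 h.2⟩

theorem img_triSnd (y x : Idx N) :
    img p (s a * s e) (triSnd N p s a e d) y x = if y.fst = x.fst then
      sndEntry ((x.snd : ℤ) - y.snd) p (s a) (s e) (s d) ((N : ℤ) - x.fst) x.snd else 0 := by
  rw [img_apply, triSnd, Matrix.of_apply, sndEntry, ← mul_assoc p]
  have e1 : y = x ↔ y.fst = x.fst ∧ (x.snd : ℤ) - y.snd = 0 := by
    rw [Idx.eq_iff]; constructor <;> rintro ⟨h1, h2⟩ <;> exact ⟨h1, by omega⟩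
  by_cases h1 : y.fst = x.fst <;> simp [h1, e1]

theorem Generic.gaugeStep_eq (G : Generic N p s) (y x : Idx N)
    (h : |(x.fst : ℤ) - y.fst| ≤ 1) :
    gaugeStep ((x.fst : ℤ) - y.fst) (p ^ 2) (s b) (s c) (s a) (s d) ((p ^ 2) ^ x.fst) =
      (s a / s d) ^ ((x.fst : ℤ) - y.fst) *
        (xi (p ^ 2) (s b) (s c) x.fst / xi (p ^ 2) (s b) (s c) y.fst) := by
  have := x.le
  exact QRacahAW4.gaugeStep_eq (G.s0 b) (G.s0 c)
    (fun l hl => (G.reg1 b).ne (k := l) (by omega) (by push_cast; omega) (by rw [zpow_natCast]))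
    (fun l hl => (G.reg1 c).ne (k := l) (by omega) (by push_cast; omega) (by rw [zpow_natCast])) h

theorem img_triFst (G : Generic N p s) (y x : Idx N) :
    img p (s a * s b) (triFst N p s a b c d) y x = if y.snd = x.snd then
      fstEntry ((x.fst : ℤ) - y.fst) p (s a) (s b) (s c) (s d) ((N : ℤ) - x.snd) x.fst else 0 := by
  rw [img_apply, triFst, Matrix.of_apply, fstEntry, ← mul_assoc p]
  have e1 : y = x ↔ y.snd = x.snd ∧ (x.fst : ℤ) - y.fst = 0 := by
    rw [Idx.eq_iff]; constructor <;> rintro ⟨h1, h2⟩ <;> exact ⟨by omega, by omega⟩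
  by_cases h1 : y.snd = x.snd
  · simp only [h1, e1, if_true, true_and]
    by_cases h2 : |(x.fst : ℤ) - y.fst| ≤ 1
    · rw [G.gaugeStep_eq y x h2]; ring
    · rw [Phi_of_ne (by rintro h; simp [h] at h2) (by rintro h; simp [h] at h2)
        (by rintro h; simp [h] at h2)]
      ring
  · simp [h1, e1]

/-- The constraint on the parameters, in the form in which it is used in a frame. -/
theorem Generic.prod' (G : Generic N p s) (h : [a, b, c, d, e].Nodup) :
    (p ^ 2) ^ N * p ^ 3 * (s a * s b * s c * s d * s e) = 1 := by
  rw [← G.prod h]; ring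

theorem Generic.den (G : Generic N p s) {b c : Fin 5} (hbc : b ≠ c) {i : ℕ} (hi : i ≤ N) {l : ℤ}
    (h1 : -8 ≤ l) (h2 : l ≤ 8) : 1 - s b ^ 2 * s c ^ 2 * (p ^ 2) ^ (2 * (i : ℤ) + l) ≠ 0 :=
  G.reg2 b c hbc _ (by push_cast; omega) (by push_cast; omega)

theorem Generic.sndEntry_zero (G : Generic N p s) {a b c : Fin 5} (hbc : b ≠ c) {i : ℕ} (hi : i ≤ N)
    (M : ℤ) : sndEntry 0 p (s a) (s b) (s c) M i =
      jk (s a) * diagCoef p (s b) (s c) (p * s b * s c * (p ^ 2) ^ (i : ℤ)) +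
        jk (s a * s b * s c * ((p ^ 2) ^ M * p ^ 2)) *
          diagCoef p (s c) (s b) (p * s b * s c * (p ^ 2) ^ (i : ℤ)) := by
  rw [sndEntry, if_pos rfl]
  exact tri_diag G.p0 (G.s0 a) (G.s0 b) (G.s0 c) (G.den hbc hi (by norm_num) (by norm_num))
    (G.den hbc hi (by norm_num) (by norm_num)) (G.den hbc hi (by norm_num) (by norm_num))

/-- The two arguments are inverse to each other by the constraint. The size of a block thereby turns
into the eigenvalue of the other diagonal matrix. -/
theorem Generic.jk_edge (G : Generic N p s) (h : [a, b, c, d, e].Nodup) (j : ℤ) :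
    jk (s a * s b * s c * ((p ^ 2) ^ ((N : ℤ) - j) * p ^ 2)) =
      jk (p * s d * s e * (p ^ 2) ^ j) := by
  have hq := pow_ne_zero 2 G.p0
  refine jk_inv ?_
  rw [← G.prod' h, zpow_sub₀ hq, zpow_natCast]
  have := zpow_ne_zero j hq
  field_simp

theorem Generic.jk_sq_sub_ne_zero (G : Generic N p s) (hbc : b ≠ c) {i : ℕ} (hi : i ≤ N) :
    jk p ^ 2 - jk (p * s b * s c * (p ^ 2) ^ (i : ℤ)) ^ 2 ≠ 0 := by
  have hq := pow_ne_zero 2 G.p0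
  refine QRacahAW4.jk_sq_sub_ne_zero G.p0 (G.s0 b) (G.s0 c) (zpow_ne_zero _ hq) ?_ ?_
  · convert G.den hbc hi (l := 0) (by norm_num) (by norm_num) using 2
    rw [add_zero, zpow_double]
  · convert G.den hbc hi (l := 2) (by norm_num) (by norm_num) using 2
    rw [zpow_add₀ hq, zpow_double, zpow_two_eq]

theorem diagCoef_add (p b c X L A : ℂ) (h : jk p ^ 2 - jk X ^ 2 ≠ 0) :
    (A * diagCoef p b c X + L * diagCoef p c b X) * (jk p ^ 2 - jk X ^ 2) =
      jk p * (A * jk b + jk c * L) - jk X * (A * jk c + jk b * L) := by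
  unfold diagCoef
  field_simp
  ring

theorem diagCoef_comm_arg (p b c K : ℂ) : p * b * c * K = p * c * b * K := by ring

/-- The Askey-Wilson relation of the pair `triFst`, `diagFst`. -/
theorem triFst_rel (G : Generic N p s) (h : [a, b, c, d, e].Nodup) {U₁ U₂ V₁ V₂ U₃ U₄ V₃ V₄ : Mat N}
    (hA : U₁ * U₂ + V₁ * V₂ = Matrix.diagonal fun x =>
      jk (s a) * jk (s c) + jk (s b) * jk (p * s d * s e * (p ^ 2) ^ (x.snd : ℤ)))
    (hB : U₃ * U₄ + V₃ * V₄ = Matrix.diagonal fun x =>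
      jk (s a) * jk (s b) + jk (s c) * jk (p * s d * s e * (p ^ 2) ^ (x.snd : ℤ))) :
    img p (s a * s b) (triFst N p s a b c d) =
      awExpr p (img p (s b * s c) (diagFst N p s b c))
        (awExpr p (img p (s a * s b) (triFst N p s a b c d))
          (img p (s b * s c) (diagFst N p s b c)) U₁ U₂ V₁ V₂) U₃ U₄ V₃ V₄ := by
  have hp := G.p0
  have hq := pow_ne_zero 2 hp
  have hbc : b ≠ c := by simp at h; tauto
  rw [img_diagFst hp (G.s0 b) (G.s0 c)]
  refine awExpr_tridiag hp G.q2 (fun y x hyx => ?_) (fun x => ?_) hA hB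
  · rw [img_triFst G]
    by_cases h1 : y.snd = x.snd
    · rw [if_pos h1]
      have h2 : (x.fst : ℤ) - y.fst ≠ 0 := fun h0 => hyx (Idx.ext (by omega) h1)
      by_cases h3 : (x.fst : ℤ) - y.fst = 1 ∨ (x.fst : ℤ) - y.fst = -1
      · right
        have hX : p * s b * s c * (p ^ 2) ^ (x.fst : ℤ) ≠ 0 :=
          mul_ne_zero (mul_ne_zero (mul_ne_zero hp (G.s0 b)) (G.s0 c)) (zpow_ne_zero _ hq)
        have e1 : p * s b * s c * (p ^ 2) ^ (y.fst : ℤ) =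
            p * s b * s c * (p ^ 2) ^ (x.fst : ℤ) * (p ^ 2) ^ (-((x.fst : ℤ) - y.fst)) := by
          rw [mul_assoc _ ((p ^ 2) ^ (x.fst : ℤ)), ← zpow_add₀ hq]; congr 2; ring
        simp only [e1]
        rw [jk_step_down hp hX h3, jk_step_up hp hX h3]
        have := zpow_ne_zero ((x.fst : ℤ) - y.fst) hX
        field_simp
      · push Not at h3
        left
        rw [fstEntry, Phi_of_ne h3.1 h2 h3.2, if_neg h2]
        ring
    · left; rw [if_neg h1]
  · have hx := x.le
    rw [img_triFst G, if_pos rfl, sub_self, fstEntry_zero, G.sndEntry_zero hbc (by omega),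
      G.jk_edge h, diagCoef_add _ _ _ _ _ _ (G.jk_sq_sub_ne_zero hbc (by omega))]

/-- The Askey-Wilson relation of the pair `triSnd`, `diagSnd`. -/
theorem triSnd_rel (G : Generic N p s) (h : [a, b, c, d, e].Nodup) {U₁ U₂ V₁ V₂ U₃ U₄ V₃ V₄ : Mat N}
    (hA : U₁ * U₂ + V₁ * V₂ = Matrix.diagonal fun x =>
      jk (s a) * jk (s d) + jk (s e) * jk (p * s b * s c * (p ^ 2) ^ (x.fst : ℤ)))
    (hB : U₃ * U₄ + V₃ * V₄ = Matrix.diagonal fun x =>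
      jk (s a) * jk (s e) + jk (s d) * jk (p * s b * s c * (p ^ 2) ^ (x.fst : ℤ))) :
    img p (s a * s e) (triSnd N p s a e d) =
      awExpr p (img p (s e * s d) (diagSnd N p s e d))
        (awExpr p (img p (s a * s e) (triSnd N p s a e d))
          (img p (s e * s d) (diagSnd N p s e d)) U₁ U₂ V₁ V₂) U₃ U₄ V₃ V₄ := by
  have hp := G.p0
  have hq := pow_ne_zero 2 hp
  have hed : e ≠ d := by simp at h; tauto
  rw [img_diagSnd hp (G.s0 e) (G.s0 d)]
  refine awExpr_tridiag hp G.q2 (fun y x hyx => ?_) (fun x => ?_) hA hB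
  · rw [img_triSnd]
    by_cases h1 : y.fst = x.fst
    · rw [if_pos h1]
      have h2 : (x.snd : ℤ) - y.snd ≠ 0 := fun h0 => hyx (Idx.ext h1 (by omega))
      by_cases h3 : (x.snd : ℤ) - y.snd = 1 ∨ (x.snd : ℤ) - y.snd = -1
      · right
        have hX : p * s e * s d * (p ^ 2) ^ (x.snd : ℤ) ≠ 0 :=
          mul_ne_zero (mul_ne_zero (mul_ne_zero hp (G.s0 e)) (G.s0 d)) (zpow_ne_zero _ hq)
        have e1 : p * s e * s d * (p ^ 2) ^ (y.snd : ℤ) =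
            p * s e * s d * (p ^ 2) ^ (x.snd : ℤ) * (p ^ 2) ^ (-((x.snd : ℤ) - y.snd)) := by
          rw [mul_assoc _ ((p ^ 2) ^ (x.snd : ℤ)), ← zpow_add₀ hq]; congr 2; ring
        simp only [e1]
        rw [jk_step_down hp hX h3, jk_step_up hp hX h3]
        have := zpow_ne_zero ((x.snd : ℤ) - y.snd) hX
        field_simp
      · push Not at h3
        left
        rw [sndEntry, Phi_of_ne h3.1 h2 h3.2, if_neg h2]
        ring
    · left; rw [if_neg h1]
  · have hx := x.le
    rw [img_triSnd, if_pos rfl, sub_self, G.sndEntry_zero hed (by omega),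
      G.jk_edge (nodup_dual h), diagCoef_add _ _ _ _ _ _ (G.jk_sq_sub_ne_zero hed (by omega))]

/-! ### Products of the two tridiagonal matrices -/

/-- The first factor preserves the second coordinate and the second factor the first, so a single
intermediate index is possible. -/
theorem fst_mul_snd (G : Generic N p s) (y x : Idx N) :
    (img p (s a * s b) (triFst N p s a b c d) * img p (s a * s e) (triSnd N p s a e d)) y x =
      fstEntry ((x.fst : ℤ) - y.fst) p (s a) (s b) (s c) (s d) ((N : ℤ) - y.snd) x.fst *
      sndEntry ((x.snd : ℤ) - y.snd) p (s a) (s e) (s d) ((N : ℤ) - x.fst) x.snd := by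
  rw [Matrix.mul_apply, Idx.sum_single (i := x.fst) (j := y.snd) (t := fstEntry ((x.fst : ℤ) - y.fst)
    p (s a) (s b) (s c) (s d) ((N : ℤ) - y.snd) x.fst *
      sndEntry ((x.snd : ℤ) - y.snd) p (s a) (s e) (s d) ((N : ℤ) - x.fst) x.snd)]
  · split_ifs with h
    · rfl
    -- If that index is outside the triangle, then `x` lies on its edge or the offset is too large;
    -- in either case the second entry vanishes.
    · have := x.le
      symm
      apply mul_eq_zero_of_right
      rw [sndEntry, if_neg (by omega), add_zero]
      by_cases h1 : (x.snd : ℤ) - y.snd = -1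
      · rw [h1, show ((x.snd : ℕ) : ℤ) = (N : ℤ) - x.fst by omega]
        simp [Phi, PhiMinus_self]
      · rw [Phi_of_ne (by omega) (by omega) h1, mul_zero]
  · intro w
    rw [img_triFst G, img_triSnd]
    by_cases h1 : w.fst = x.fst
    · by_cases h2 : y.snd = w.snd
      · simp [h1, h2]
      · rw [if_neg h2, zero_mul, if_neg fun h => h2 h.2.symm]
    · simp [h1]

theorem snd_mul_fst (G : Generic N p s) (y x : Idx N) :
    (img p (s a * s e) (triSnd N p s a e d) * img p (s a * s b) (triFst N p s a b c d)) y x =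
      sndEntry ((x.snd : ℤ) - y.snd) p (s a) (s e) (s d) ((N : ℤ) - y.fst) x.snd *
      fstEntry ((x.fst : ℤ) - y.fst) p (s a) (s b) (s c) (s d) ((N : ℤ) - x.snd) x.fst := by
  rw [Matrix.mul_apply, Idx.sum_single (i := y.fst) (j := x.snd) (t :=
      sndEntry ((x.snd : ℤ) - y.snd) p (s a) (s e) (s d) ((N : ℤ) - y.fst) x.snd *
      fstEntry ((x.fst : ℤ) - y.fst) p (s a) (s b) (s c) (s d) ((N : ℤ) - x.snd) x.fst)]
  · split_ifs with h
    · rfl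
    · have := x.le
      symm
      apply mul_eq_zero_of_right
      rw [fstEntry, if_neg (by omega), add_zero]
      by_cases h1 : (x.fst : ℤ) - y.fst = -1
      · rw [h1, show ((x.fst : ℕ) : ℤ) = (N : ℤ) - x.snd by omega]
        simp [Phi, PhiMinus_self]
      · rw [Phi_of_ne (by omega) (by omega) h1, mul_zero, zero_mul]
  · intro w
    rw [img_triFst G, img_triSnd]
    by_cases h1 : w.snd = x.snd
    · by_cases h2 : y.fst = w.fst
      · simp [h1, h2]
      · rw [if_neg h2, zero_mul, if_neg fun h => h2 h.1.symm]
    · simp [h1]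

end Frame

end QRacahAW4

namespace QRacahAW4

/-! ### The relations between the outer generators -/

section Outer

variable {N : ℕ} {p : ℂ} {s : Fin 5 → ℂ} {a b c d e : Fin 5}

/-- Entries of the nine-diagonal matrix in the column `ε = 0, ±1`, `ε' = 0`. -/
theorem nine_snd (G : Generic N p s) (h : [a, b, c, d, e].Nodup) {i j : ℕ} (hij : i + j ≤ N) {ε : ℤ}
    (hε : ε = 1 ∨ ε = -1) :
    1 / (p * (s d * s c)) * coefA ε 0 (p ^ 2) (p * s e) (s a ^ 2) (s e ^ 2) (s d ^ 2) (s b ^ 2)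
        (s c ^ 2) N j i =
      diagCoef p (s b) (s c) (p * s b * s c * (p ^ 2) ^ (i : ℤ)) *
        sndEntry ε p (s a) (s e) (s d) ((N : ℤ) - i) j := by
  have hbc : b ≠ c := by simp at h; tauto
  have hε0 : ε ≠ 0 := by omega
  have hN : (p ^ 2 : ℂ) ^ ((N : ℤ) + 1) = (p ^ 2) ^ N * p ^ 2 := by norm_cast
  have key := FPlus_add_FMinus (p := p) (a := s a) (b := s b) (c := s c) (d := s d) (e := s e)
    (Q := (p ^ 2) ^ N) (n := i) G.p0 (G.s0 b) (G.s0 c) (by rw [← G.prod' h]; ring)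
    (G.den hbc (by omega) (by norm_num) (by norm_num))
    (G.den hbc (by omega) (by norm_num) (by norm_num))
    (G.den hbc (by omega) (by norm_num) (by norm_num))
  simp only [coefA, if_neg hε0, show ¬ (0 : ℤ) = 1 by norm_num, show ¬ (0 : ℤ) = -1 by norm_num,
    if_true, if_false, coefAZero, sndEntry, hN]
  linear_combination Phi ε (p ^ 2) (s a ^ 2) (s e ^ 2) (s d ^ 2) ((N : ℤ) - i) j * key

/-- Entries of the nine-diagonal matrix with `ε = 0`, `ε' = ±1`. -/
theorem nine_fst (G : Generic N p s) (h : [a, b, c, d, e].Nodup) {i j : ℕ} (hij : i + j ≤ N) {ε : ℤ}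
    (hε : ε = 1 ∨ ε = -1) :
    1 / (p * (s d * s c)) * coefA 0 ε (p ^ 2) (p * s e) (s a ^ 2) (s e ^ 2) (s d ^ 2) (s b ^ 2)
        (s c ^ 2) N j i =
      diagCoef p (s e) (s d) (p * s e * s d * (p ^ 2) ^ (j : ℤ)) *
        fstEntry ε p (s a) (s b) (s c) (s d) ((N : ℤ) - j) i := by
  have hε0 : ε ≠ 0 := by omega
  have P := G.paramReg (a := a) (b := e) (c := d) (d := b) (e := c) (by simp at h ⊢; tauto)
  have P' := G.paramReg (a := a) (b := b) (c := c) (d := e) (e := d) (nodup_swap h)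
  -- The symmetry exchanges the coordinates at the cost of a gauge factor, which reduces the claim
  -- to `nine_snd` in the frame with the diagonal pairs exchanged.
  rw [coefA_swap_aux P P' (by rw [← G.prod h]; ring) (by omega) (Or.inr (Or.inl rfl)) (by tauto)
    (by omega)]
  have := nine_snd (a := a) (b := e) (c := d) (d := c) (e := b) G (by simp at h ⊢; tauto)
    (i := j) (j := i) (by omega) hε
  simp only [fstEntry, sndEntry, if_neg hε0, gaugeStep, show ¬ (0 : ℤ) = 1 by norm_num,
    show ¬ (0 : ℤ) = -1 by norm_num, if_false] at this ⊢
  rw [mul_comm (s c)] at this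
  generalize (if ε = 1 then _ else _) = g at *
  linear_combination g * this

/-- Diagonal entries of the nine-diagonal matrix. -/
theorem nine_diag (G : Generic N p s) (h : [a, b, c, d, e].Nodup) {i j : ℕ} (hij : i + j ≤ N) :
    1 / (p * (s d * s c)) * coefA 0 0 (p ^ 2) (p * s e) (s a ^ 2) (s e ^ 2) (s d ^ 2) (s b ^ 2)
        (s c ^ 2) N j i + jk (p * (s d * s c)) =
      jk (s d) * diagCoef p (s c) (s b) (p * s b * s c * (p ^ 2) ^ (i : ℤ)) +
      diagCoef p (s b) (s c) (p * s b * s c * (p ^ 2) ^ (i : ℤ)) *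
        sndEntry 0 p (s a) (s e) (s d) ((N : ℤ) - i) j := by
  have hcb : c ≠ b := by simp at h; tauto
  have h1 := nine_snd G h hij (Or.inl rfl)
  have h2 := nine_snd G h hij (Or.inr rfl)
  have h3 := G.sndEntry_zero (a := d) hcb (i := i) (by omega) N
  have h4 := G.jk_edge (a := d) (b := c) (c := b) (d := a) (e := e) (by simp at h ⊢; tauto) 0
  rw [sub_zero] at h4
  rw [h4, show p * s c * s b * (p ^ 2) ^ (i : ℤ) = p * s b * s c * (p ^ 2) ^ (i : ℤ) by ring,
    zpow_zero, mul_one] at h3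
  have h5 : coefA 0 0 (p ^ 2) (p * s e) (s a ^ 2) (s e ^ 2) (s d ^ 2) (s b ^ 2) (s c ^ 2) N j i =
      Phi 0 (p ^ 2) (s d ^ 2) (s c ^ 2) (s b ^ 2) N i -
      coefA 1 0 (p ^ 2) (p * s e) (s a ^ 2) (s e ^ 2) (s d ^ 2) (s b ^ 2) (s c ^ 2) N j i -
      coefA (-1) 0 (p ^ 2) (p * s e) (s a ^ 2) (s e ^ 2) (s d ^ 2) (s b ^ 2) (s c ^ 2) N j i := by
    simp [coefA]
  -- The three coefficients `Phi` add up to zero. Hence the two off-diagonal terms subtracted in the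
  -- central coefficient recombine into a multiple of the diagonal entry.
  have h6 : sndEntry 0 p (s a) (s e) (s d) ((N : ℤ) - i) j =
      -sndEntry 1 p (s a) (s e) (s d) ((N : ℤ) - i) j -
      sndEntry (-1) p (s a) (s e) (s d) ((N : ℤ) - i) j + jk (p * s a * s e) := by
    simp [sndEntry, Phi]; ring
  rw [sndEntry, if_pos rfl] at h3
  rw [h5, h6, ← mul_assoc p]
  rw [← mul_assoc p] at h1 h2
  linear_combination h3 - h1 - h2

/-- The entries of the two relations between the outer generators. -/
theorem outer_entries (G : Generic N p s) (h : [a, b, c, d, e].Nodup) (y x : Idx N)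
    {k m δ A₁ A₁' A₂ A₂' Z t₁ t₂ x₁ x₂ y₁ y₂ : ℂ}
    (hk : k * (p ^ 2 - (p ^ 2)⁻¹) = 1) (hm : m = k * (p - p⁻¹)) (hJ : m * jk p = 1)
    (hδ : δ = if y = x then 1 else 0)
    (hA₁ : A₁ = fstEntry ((x.fst : ℤ) - y.fst) p (s a) (s b) (s c) (s d) ((N : ℤ) - y.snd) x.fst)
    (hA₁' : A₁' = fstEntry ((x.fst : ℤ) - y.fst) p (s a) (s b) (s c) (s d) ((N : ℤ) - x.snd) x.fst)
    (hA₂ : A₂ = sndEntry ((x.snd : ℤ) - y.snd) p (s a) (s e) (s d) ((N : ℤ) - x.fst) x.snd)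
    (hA₂' : A₂' = sndEntry ((x.snd : ℤ) - y.snd) p (s a) (s e) (s d) ((N : ℤ) - y.fst) x.snd)
    (hZ : Z = 1 / (p * (s d * s c)) * coefA ((x.snd : ℤ) - y.snd) ((x.fst : ℤ) - y.fst) (p ^ 2)
      (p * s e) (s a ^ 2) (s e ^ 2) (s d ^ 2) (s b ^ 2) (s c ^ 2) N x.snd x.fst +
      if y = x then jk (p * (s d * s c)) else 0)
    (ht₁ : t₁ = if y.snd = x.snd then A₁' else 0) (ht₂ : t₂ = if y.fst = x.fst then A₂ else 0)
    (hx₁ : x₁ = jk (p * s b * s c * (p ^ 2) ^ (x.fst : ℤ)))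
    (hy₁ : y₁ = jk (p * s b * s c * (p ^ 2) ^ (y.fst : ℤ)))
    (hx₂ : x₂ = jk (p * s d * s e * (p ^ 2) ^ (x.snd : ℤ)))
    (hy₂ : y₂ = jk (p * s d * s e * (p ^ 2) ^ (y.snd : ℤ))) :
    -(k * (p * (A₁ * A₂) - p⁻¹ * (A₂' * A₁'))) + m * (δ * (jk (s e) * jk (s b)) + Z * jk (s a)) =
      -(k * (p * ((-(k * (p * (y₂ * Z) - p⁻¹ * (Z * x₂))) +
          m * (δ * (jk (s e) * jk (s c)) + jk (s d) * t₁)) * x₁) -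
        p⁻¹ * (y₁ * (-(k * (p * (y₂ * Z) - p⁻¹ * (Z * x₂))) +
          m * (δ * (jk (s e) * jk (s c)) + jk (s d) * t₁))))) +
      m * (δ * (jk (s e) * jk (s b)) + jk (s c) * (-(k * (p * (y₂ * t₂) - p⁻¹ * (t₂ * x₂))) +
        m * (δ * (jk (s e) * x₁) + δ * (jk (s d) * jk (s a))))) ∧
    -(k * (p * (A₂' * A₁') - p⁻¹ * (A₁ * A₂))) + m * (δ * (jk (s b) * jk (s e)) + Z * jk (s a)) =
      -(k * (p * ((-(k * (p * (y₁ * Z) - p⁻¹ * (Z * x₁))) +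
          m * (δ * (jk (s b) * jk (s d)) + jk (s c) * t₂)) * x₂) -
        p⁻¹ * (y₂ * (-(k * (p * (y₁ * Z) - p⁻¹ * (Z * x₁))) +
          m * (δ * (jk (s b) * jk (s d)) + jk (s c) * t₂))))) +
      m * (δ * (jk (s e) * jk (s b)) + jk (s d) * (-(k * (p * (y₁ * t₁) - p⁻¹ * (t₁ * x₁))) +
        m * (δ * (jk (s b) * x₂) + δ * (jk (s c) * jk (s a))))) := by
  have hp := G.p0
  have hq := pow_ne_zero 2 hp
  have hbc : b ≠ c := by simp at h; tauto
  have hed : e ≠ d := by simp at h; tauto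
  have hx := x.le
  have hy := y.le
  -- Outside the three by three neighbourhood every contribution vanishes: one factor in each
  -- product, the entry `Z`, and the Kronecker terms.
  by_cases hfar : ¬ (|(x.fst : ℤ) - y.fst| ≤ 1 ∧ |(x.snd : ℤ) - y.snd| ≤ 1)
  · have hyx : y ≠ x := by rintro rfl; simp at hfar
    have hA : (A₁ = 0 ∧ A₁' = 0) ∨ (A₂ = 0 ∧ A₂' = 0) := by
      by_cases hf : |(x.fst : ℤ) - y.fst| ≤ 1
      · have hs : ¬ |(x.snd : ℤ) - y.snd| ≤ 1 := fun h0 => hfar ⟨hf, h0⟩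
        rw [abs_le] at hs
        right
        simp only [hA₂, hA₂', sndEntry, if_neg (show ¬ (x.snd : ℤ) - y.snd = 0 by omega),
          Phi_of_ne (show (x.snd : ℤ) - y.snd ≠ 1 by omega) (by omega) (by omega)]
        simp
      · rw [abs_le] at hf
        left
        simp only [hA₁, hA₁', fstEntry, if_neg (show ¬ (x.fst : ℤ) - y.fst = 0 by omega),
          Phi_of_ne (show (x.fst : ℤ) - y.fst ≠ 1 by omega) (by omega) (by omega)]
        simp
    have hZ0 : Z = 0 := by rw [hZ, coefA_of_ne hfar, if_neg hyx]; ring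
    have ht : t₁ = 0 ∧ t₂ = 0 := by
      rw [ht₁, ht₂]
      constructor
      · split_ifs with h0
        · rcases hA with h1 | h1
          · exact h1.2
          · rw [hA₁', fstEntry, Phi_of_ne, if_neg] <;> (try simp) <;>
              (rw [h0, sub_self, abs_zero] at hfar; simp [abs_le] at hfar; omega)
        · rfl
      · split_ifs with h0
        · rcases hA with h1 | h1
          · rw [hA₂, sndEntry, Phi_of_ne, if_neg] <;> (try simp) <;>
              (rw [h0, sub_self, abs_zero] at hfar; simp [abs_le] at hfar; omega)
          · exact h1.1
        · rfl
    rw [hZ0, ht.1, ht.2, hδ, if_neg hyx]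
    rcases hA with h1 | h1 <;> rw [h1.1, h1.2] <;> constructor <;> ring
  push Not at hfar
  rw [abs_le, abs_le] at hfar
  obtain ⟨⟨f1, f2⟩, f3, f4⟩ := hfar
  obtain ⟨β, hβ⟩ : ∃ β, β = diagCoef p (s b) (s c) (p * s b * s c * (p ^ 2) ^ (x.fst : ℤ)) := ⟨_, rfl⟩
  obtain ⟨γ, hγ⟩ : ∃ γ, γ = diagCoef p (s c) (s b) (p * s b * s c * (p ^ 2) ^ (x.fst : ℤ)) := ⟨_, rfl⟩
  obtain ⟨β', hβ'⟩ : ∃ β, β = diagCoef p (s e) (s d) (p * s e * s d * (p ^ 2) ^ (x.snd : ℤ)) :=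
    ⟨_, rfl⟩
  obtain ⟨γ', hγ'⟩ : ∃ γ, γ = diagCoef p (s d) (s e) (p * s e * s d * (p ^ 2) ^ (x.snd : ℤ)) :=
    ⟨_, rfl⟩
  have eγ : γ * jk p = jk (s c) - x₁ * β := by
    rw [hγ, hβ, hx₁]; exact diagCoef_rel (G.jk_sq_sub_ne_zero hbc (by omega))
  have eγ' : γ' * jk p = jk (s d) - x₂ * β' := by
    rw [hγ', hβ', hx₂, diagCoef_comm_arg p (s d)]
    exact diagCoef_rel (G.jk_sq_sub_ne_zero hed (by omega))
  have hE : [a, e, d, c, b].Nodup := by simp at h ⊢; tauto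
  have fst0 : ∀ z : Idx N, fstEntry 0 p (s a) (s b) (s c) (s d) ((N : ℤ) - z.snd) x.fst =
      jk (s a) * β + jk (p * s d * s e * (p ^ 2) ^ (z.snd : ℤ)) * γ := fun z => by
    rw [fstEntry_zero, G.sndEntry_zero hbc (by omega), G.jk_edge h, ← hβ, ← hγ]
  have snd0 : ∀ z : Idx N, sndEntry 0 p (s a) (s e) (s d) ((N : ℤ) - z.fst) x.snd =
      jk (s a) * β' + jk (p * s b * s c * (p ^ 2) ^ (z.fst : ℤ)) * γ' := fun z => by
    rw [G.sndEntry_zero hed (by omega), G.jk_edge hE, diagCoef_comm_arg p (s c), ← hβ', ← hγ']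
  -- According to which coordinates move there are the diagonal entry, two kinds of edge entries and
  -- the corner entries.
  by_cases e0 : (x.fst : ℤ) - y.fst = 0 <;> by_cases e0' : (x.snd : ℤ) - y.snd = 0
  · obtain rfl : y = x := Idx.ext (by omega) (by omega)
    rw [if_pos rfl] at ht₁ ht₂ hδ hZ
    have hy1 : y₁ = x₁ := by rw [hx₁, hy₁]
    have hy2 : y₂ = x₂ := by rw [hx₂, hy₂]
    have h11 : A₁' = A₁ := by rw [hA₁, hA₁']
    have h22 : A₂' = A₂ := by rw [hA₂, hA₂']
    have B₁ : A₁ = jk (s a) * β + x₂ * γ := by rw [hA₁, e0, fst0, hx₂]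
    have B₂ : A₂ = jk (s a) * β' + x₁ * γ' := by rw [hA₂, e0', snd0, hx₁]
    have BZ : Z = jk (s d) * γ + β * A₂ := by
      rw [hZ, hA₂, e0, e0', nine_diag G h (by omega), ← hβ, ← hγ]
    -- The formula in `BZ` prefers the first coordinate; the two relations for `γ` and `γ'` give its
    -- mirror image, which the second relation requires.
    have BZ' : Z = jk (s c) * γ' + β' * A₁ := by
      rw [BZ, B₁, B₂]; linear_combination γ' * eγ - γ * eγ'
    rw [hy1, hy2, ht₁, ht₂, h11, h22, hδ]
    constructor
    · simpa only [one_mul] using entry_diag (σb := jk (s b)) (σe := jk (s e)) (u := p⁻¹) hm hJ eγ B₁ BZ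
    · have := entry_diag (σb := jk (s e)) (σe := jk (s b)) (u := p⁻¹) hm hJ eγ' B₂ BZ'
      linear_combination this
  · have hyx : y ≠ x := by rintro rfl; simp at e0'
    have hf : y.fst = x.fst := by omega
    rw [if_neg (by omega)] at ht₁
    rw [if_pos hf] at ht₂
    rw [if_neg hyx] at hδ hZ
    have hy1 : y₁ = x₁ := by rw [hx₁, hy₁, hf]
    have h22 : A₂' = A₂ := by rw [hA₂, hA₂', hf]
    have B₁ : A₁ = jk (s a) * β + y₂ * γ := by rw [hA₁, e0, fst0, hy₂]
    have B₁' : A₁' = jk (s a) * β + x₂ * γ := by rw [hA₁', e0, fst0, hx₂]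
    have BZ : Z = β * A₂ := by
      rw [hZ, hA₂, e0, nine_snd G h (by omega) (by omega), ← hβ, add_zero]
    rw [hy1, ht₁, ht₂, h22, hδ, BZ]
    constructor
    · have := entry_fst (A₂ := A₂) (u := p⁻¹) hm hJ eγ B₁ B₁'
      linear_combination this
    · have := entry_snd (A₁ := A₂) (u := p⁻¹) hm hJ eγ B₁' B₁
      linear_combination this
  · have hyx : y ≠ x := by rintro rfl; simp at e0
    have hf : y.snd = x.snd := by omega
    rw [if_pos hf] at ht₁
    rw [if_neg (by omega)] at ht₂
    rw [if_neg hyx] at hδ hZ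
    have hy2 : y₂ = x₂ := by rw [hx₂, hy₂, hf]
    have h11 : A₁' = A₁ := by rw [hA₁, hA₁', hf]
    have B₂ : A₂ = jk (s a) * β' + x₁ * γ' := by rw [hA₂, e0', snd0, hx₁]
    have B₂' : A₂' = jk (s a) * β' + y₁ * γ' := by rw [hA₂', e0', snd0, hy₁]
    have BZ : Z = β' * A₁ := by
      rw [hZ, ← h11, hA₁', e0', nine_fst G h (by omega) (by omega), ← hβ', add_zero]
    rw [hy2, ht₁, ht₂, h11, hδ, BZ]
    constructor
    · have := entry_snd (A₁ := A₁) (u := p⁻¹) hm hJ eγ' B₂ B₂'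
      linear_combination this
    · have := entry_fst (A₂ := A₁) (u := p⁻¹) hm hJ eγ' B₂' B₂
      linear_combination this
  · have hyx : y ≠ x := by rintro rfl; simp at e0
    have g1 : (x.fst : ℤ) - y.fst = 1 ∨ (x.fst : ℤ) - y.fst = -1 := by omega
    have g2 : (x.snd : ℤ) - y.snd = 1 ∨ (x.snd : ℤ) - y.snd = -1 := by omega
    rw [if_neg (by omega)] at ht₁ ht₂
    rw [if_neg hyx] at hδ hZ
    have P := G.paramReg (a := a) (b := e) (c := d) (d := b) (e := c) (by simp at h ⊢; tauto)
    have P' := G.paramReg (a := a) (b := b) (c := c) (d := e) (e := d) (nodup_swap h)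
    obtain ⟨r, hr⟩ : ∃ r, r = (p * s b * s c * (p ^ 2) ^ (x.fst : ℤ)) ^ ((x.fst : ℤ) - y.fst) /
      (p * s d * s e * (p ^ 2) ^ (x.snd : ℤ)) ^ ((x.snd : ℤ) - y.snd) := ⟨_, rfl⟩
    have hX₁ : p * s b * s c * (p ^ 2) ^ (x.fst : ℤ) ≠ 0 :=
      mul_ne_zero (mul_ne_zero (mul_ne_zero hp (G.s0 b)) (G.s0 c)) (zpow_ne_zero _ hq)
    have hX₂ : p * s d * s e * (p ^ 2) ^ (x.snd : ℤ) ≠ 0 :=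
      mul_ne_zero (mul_ne_zero (mul_ne_zero hp (G.s0 d)) (G.s0 e)) (zpow_ne_zero _ hq)
    have hr0 : r ≠ 0 := by rw [hr]; exact div_ne_zero (zpow_ne_zero _ hX₁) (zpow_ne_zero _ hX₂)
    obtain ⟨C1, C2⟩ := corner_entry P P' (by rw [← G.prod h]; ring) (by omega) g2 g1 hr
    rw [sub_sub_cancel] at C1 C2
    have Z' : Z = 1 / (p * s d * s c) * coefA ((x.snd : ℤ) - y.snd) ((x.fst : ℤ) - y.fst) (p ^ 2)
      (p * s e) (s a ^ 2) (s e ^ 2) (s d ^ 2) (s b ^ 2) (s c ^ 2) N x.snd x.fst := by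
      rw [hZ, add_zero, mul_assoc p]
    rw [← Z'] at C1 C2
    have BA : A₁ * A₂ = (jk (s a) - jk (p * r)) * Z := by
      rw [← C1, hA₁, hA₂, fstEntry, sndEntry, if_neg e0, if_neg e0', add_zero, add_zero]
    have BA' : A₂' * A₁' = (jk (s a) - jk (r * p⁻¹)) * Z := by
      rw [← div_eq_mul_inv, ← C2, hA₁', hA₂', fstEntry, sndEntry, if_neg e0, if_neg e0', add_zero,
        add_zero, mul_comm]
    have w1 : p * s b * s c * (p ^ 2) ^ (y.fst : ℤ) =
        p * s b * s c * (p ^ 2) ^ (x.fst : ℤ) * (p ^ 2) ^ (-((x.fst : ℤ) - y.fst)) := by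
      rw [mul_assoc _ ((p ^ 2) ^ (x.fst : ℤ)), ← zpow_add₀ hq]; congr 2; ring
    have w2 : p * s d * s e * (p ^ 2) ^ (y.snd : ℤ) =
        p * s d * s e * (p ^ 2) ^ (x.snd : ℤ) * (p ^ 2) ^ (-((x.snd : ℤ) - y.snd)) := by
      rw [mul_assoc _ ((p ^ 2) ^ (x.snd : ℤ)), ← zpow_add₀ hq]; congr 2; ring
    rw [w1] at hy₁
    rw [w2] at hy₂
    have u1 := jk_step_up hp hX₁ g1
    have d1 := jk_step_down hp hX₁ g1
    have u2 := jk_step_up hp hX₂ g2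
    have d2 := jk_step_down hp hX₂ g2
    rw [← hy₁, ← hx₁] at u1 d1
    rw [← hy₂, ← hx₂] at u2 d2
    have n1 := zpow_ne_zero ((x.fst : ℤ) - y.fst) hX₁
    have n2 := zpow_ne_zero ((x.snd : ℤ) - y.snd) hX₂
    have key : ∀ A B, k * ((p ^ 2 - (p ^ 2)⁻¹) * A) * (k * ((p ^ 2 - (p ^ 2)⁻¹) * B)) = A * B :=
      fun A B => by linear_combination (k * (p ^ 2 - (p ^ 2)⁻¹) + 1) * A * B * hk
    have q1 : k * (p * x₁ - p⁻¹ * y₁) * (k * (p * y₂ - p⁻¹ * x₂)) = r := by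
      rw [u1, d2, key, hr]; field_simp
    have q2 : k * (p * x₂ - p⁻¹ * y₂) * (k * (p * y₁ - p⁻¹ * x₁)) = r⁻¹ := by
      rw [u2, d1, key, hr]; field_simp
    have hk' : k * (p ^ 2 - p⁻¹ ^ 2) = 1 := by rw [inv_pow]; exact hk
    have hpu := mul_inv_cancel₀ hp
    -- The second relation is the first with `r` replaced by its inverse, since `jk` is invariant
    -- under inversion.
    have BA1 : A₁ * A₂ = (jk (s a) - jk (r⁻¹ * p⁻¹)) * Z := by
      rw [BA, show jk (p * r) = jk (r⁻¹ * p⁻¹) from jk_inv (by field_simp)]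
    have BA1' : A₂' * A₁' = (jk (s a) - jk (p * r⁻¹)) * Z := by
      rw [BA', show jk (r * p⁻¹) = jk (p * r⁻¹) from jk_inv (by field_simp)]
    rw [ht₁, ht₂, hδ]
    constructor
    · have := entry_corner (u := p⁻¹) hk' hm hpu hr0 BA BA' q1
      linear_combination this
    · have := entry_corner (u := p⁻¹) hk' hm hpu (inv_ne_zero hr0) BA1' BA1 q2
      linear_combination this

theorem awExpr_apply {ι : Type*} [Fintype ι] [DecidableEq ι] (p : ℂ)
    (Y Z U₁ U₂ V₁ V₂ : Matrix ι ι ℂ) (y x : ι) :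
    awExpr p Y Z U₁ U₂ V₁ V₂ y x =
      -(1 / (p ^ 2 - (p ^ 2)⁻¹) * (p * (Y * Z) y x - p⁻¹ * (Z * Y) y x)) +
        1 / (p + p⁻¹) * ((U₁ * U₂) y x + (V₁ * V₂) y x) := by
  simp [awExpr, mul_add]

/-- The relations for the products of the outer generators, in a frame. -/
theorem outer_rel (G : Generic N p s) (h : [a, b, c, d, e].Nodup) {T₁ T₂ D₁ D₂ Z : Mat N}
    {σ : Fin 5 → Mat N} (hσ : ∀ i, σ i = jk (s i) • 1)
    (hT₁ : T₁ = img p (s a * s b) (triFst N p s a b c d))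
    (hT₂ : T₂ = img p (s a * s e) (triSnd N p s a e d))
    (hD₁ : D₁ = img p (s b * s c) (diagFst N p s b c))
    (hD₂ : D₂ = img p (s d * s e) (diagSnd N p s d e))
    (hZ : Z = img p (s d * s c) (nineDiag N p s a e d b c)) :
    awExpr p T₁ T₂ (σ e) (σ b) Z (σ a) =
      awExpr p (awExpr p D₂ Z (σ e) (σ c) (σ d) T₁) D₁ (σ e) (σ b) (σ c)
        (awExpr p D₂ T₂ (σ e) D₁ (σ d) (σ a)) ∧
    awExpr p T₂ T₁ (σ b) (σ e) Z (σ a) =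
      awExpr p (awExpr p D₁ Z (σ b) (σ d) (σ c) T₂) D₂ (σ e) (σ b) (σ d)
        (awExpr p D₁ T₁ (σ b) D₂ (σ c) (σ a)) := by
  have hp := G.p0
  rw [img_diagFst hp (G.s0 b) (G.s0 c)] at hD₁
  rw [img_diagSnd hp (G.s0 d) (G.s0 e)] at hD₂
  obtain ⟨k, m, hk', hm', hk, hm, hJ⟩ := aw_constants hp G.q2
  have key := fun y x => outer_entries G h y x hk hm hJ rfl rfl rfl rfl rfl rfl rfl rfl rfl rfl rfl rfl
  have e1 := fun y x => fst_mul_snd (a := a) (b := b) (c := c) (d := d) (e := e) G y x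
  have e2 := fun y x => snd_mul_fst (a := a) (b := b) (c := c) (d := d) (e := e) G y x
  have e3 := fun y x => img_triFst (a := a) (b := b) (c := c) (d := d) G y x
  have e4 := fun y x => img_triSnd (N := N) (p := p) (s := s) (a := a) (d := d) (e := e) y x
  have e5 : ∀ y x, img p (s d * s c) (nineDiag N p s a e d b c) y x = _ := fun y x => by
    rw [img_apply, nineDiag_apply]
  simp only [← e1, ← e2, ← e3, ← e4, ← e5, ← hT₁, ← hT₂, ← hZ] at key
  constructor
  · ext y x
    have := (key y x).1
    simp only [awExpr_apply, ← hk', ← hm', hD₁, hD₂, hσ, Matrix.mul_diagonal, Matrix.diagonal_mul,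
      Matrix.smul_apply, Matrix.smul_mul, Matrix.mul_smul, Matrix.one_mul, Matrix.mul_one,
      smul_eq_mul, Matrix.one_apply] at this ⊢
    linear_combination this
  · ext y x
    have := (key y x).2
    simp only [awExpr_apply, ← hk', ← hm', hD₁, hD₂, hσ, Matrix.mul_diagonal, Matrix.diagonal_mul,
      Matrix.smul_apply, Matrix.smul_mul, Matrix.mul_smul, Matrix.one_mul, Matrix.mul_one,
      smul_eq_mul, Matrix.one_apply] at this ⊢
    linear_combination this

end Outer

end QRacahAW4

namespace QRacahAW4

/-! ### Admissible parameters -/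

/-- The conditions on the parameters under which the matrices of a frame are well behaved. -/
structure Adm (N : ℕ) (p : ℂ) (s : Fin 5 → ℂ) (a b c d e : Fin 5) : Prop where
  nodup : [a, b, c, d, e].Nodup
  constr : p ^ (2 * N + 3) * ∏ i, s i = 1
  qk : ∀ k : ℕ, 1 ≤ k → k ≤ N → 1 - (p ^ 2) ^ k ≠ 0
  single : ∀ (i : Fin 5) (k : ℕ), 1 ≤ k → k ≤ N → 1 - s i ^ 2 * (p ^ 2) ^ k ≠ 0
  fst : ∀ k : ℕ, 2 ≤ k → k ≤ 2 * N → 1 - s b ^ 2 * s c ^ 2 * (p ^ 2) ^ k ≠ 0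
  snd : ∀ k : ℕ, 2 ≤ k → k ≤ 2 * N → 1 - s d ^ 2 * s e ^ 2 * (p ^ 2) ^ k ≠ 0

theorem Generic.adm {N : ℕ} {p : ℂ} {s : Fin 5 → ℂ} (G : Generic N p s) {a b c d e : Fin 5}
    (h : [a, b, c, d, e].Nodup) : Adm N p s a b c d e where
  nodup := h
  constr := G.constr
  qk := G.qk
  single i k h1 h2 := (G.reg1 i).ne (k := k) (by omega) (by push_cast; omega) (by rw [zpow_natCast])
  fst k h1 h2 := (G.reg2 b c (by simp at h; tauto)).ne (k := k) (by omega) (by push_cast; omega)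
    (by rw [zpow_natCast])
  snd k h1 h2 := (G.reg2 d e (by simp at h; tauto)).ne (k := k) (by omega) (by push_cast; omega)
    (by rw [zpow_natCast])

namespace Adm

variable {N : ℕ} {p : ℂ} {s : Fin 5 → ℂ} {a b c d e : Fin 5}

theorem p0 (H : Adm N p s a b c d e) : p ≠ 0 := by
  rintro rfl
  simpa using H.constr

theorem s0 (H : Adm N p s a b c d e) (i : Fin 5) : s i ≠ 0 := by
  intro h
  have := H.constr
  rw [Finset.prod_eq_zero (Finset.mem_univ i) h] at this
  simp at this

/-- The frame in which the two diagonal matrices are exchanged. -/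
theorem dual (H : Adm N p s a b c d e) : Adm N p s a e d c b where
  nodup := by have := H.nodup; simp at this ⊢; tauto
  constr := H.constr
  qk := H.qk
  single := H.single
  fst k h1 h2 := by rw [mul_comm (s e ^ 2)]; exact H.snd k h1 h2
  snd k h1 h2 := by rw [mul_comm (s c ^ 2)]; exact H.fst k h1 h2

theorem xi_ne_zero (H : Adm N p s a b c d e) (i j : Fin 5) {n : ℕ} (hn : n ≤ N) :
    xi (p ^ 2) (s i) (s j) n ≠ 0 := by
  refine mul_ne_zero (div_ne_zero (qPoch_ne_zero fun l hl => ?_) (qPoch_ne_zero fun l hl => ?_))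
    (pow_ne_zero _ (div_ne_zero (H.s0 j) (H.s0 i)))
  · convert H.single i (l + 1) (by omega) (by omega) using 2; ring
  · convert H.single j (l + 1) (by omega) (by omega) using 2; ring

theorem cancelRatio_ne_zero (H : Adm N p s a b c d e) {k l : ℕ}
    (h : k = l ∨ (2 ≤ k ∧ k ≤ 2 * N ∧ 2 ≤ l ∧ l ≤ 2 * N)) :
    cancelRatio (p ^ 2) (s b ^ 2 * s c ^ 2) k l ≠ 0 := by
  unfold cancelRatio
  split_ifs with h0
  · exact one_ne_zero
  · have : k ≠ l := by exact_mod_cast h0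
    rcases h with h | ⟨h1, h2, h3, h4⟩
    · exact absurd h this
    · rw [zpow_natCast, zpow_natCast]
      exact div_ne_zero (H.fst k h1 h2) (H.fst l h3 h4)

theorem PhiPlus_ne_zero (H : Adm N p s a b c d e) {j n : ℕ} (h1 : 1 ≤ n) (h2 : n + j ≤ N) :
    PhiPlus (p ^ 2) (s a ^ 2) (s b ^ 2) (s c ^ 2) ((N : ℤ) - j) n ≠ 0 := by
  have hq := pow_ne_zero 2 H.p0
  have e1 : ((N : ℤ) - j - n + 1) = ((N - j - n + 1 : ℕ) : ℤ) := by omega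
  have e2 : (2 * (n : ℤ)) = ((2 * n : ℕ) : ℤ) := by omega
  have e3 : (n : ℤ) + ((N : ℤ) - j) + 1 = ((n + (N - j) + 1 : ℕ) : ℤ) := by omega
  have e4 : ((2 * n : ℕ) : ℤ) + 1 = ((2 * n + 1 : ℕ) : ℤ) := by omega
  unfold PhiPlus
  rw [e1, e2, e3, e4]
  refine mul_ne_zero (div_ne_zero (mul_ne_zero (mul_ne_zero (mul_ne_zero (mul_ne_zero
    (neg_ne_zero.2 (pow_ne_zero 2 (H.s0 b))) (zpow_ne_zero _ hq)) ?_) ?_) ?_) ?_)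
    (H.cancelRatio_ne_zero (by omega))
  · rw [zpow_natCast]; exact H.qk n h1 (by omega)
  · rw [zpow_natCast]; exact H.single a _ (by omega) (by omega)
  · rw [zpow_natCast]; exact H.single c _ (by omega) (by omega)
  · rw [zpow_natCast]; exact H.fst _ (by omega) (by omega)

/-- The only factor not covered by a hypothesis on single parameters or on the first pair is the
triple product; by the constraint it is controlled by the second pair. -/
theorem PhiMinus_ne_zero (H : Adm N p s a b c d e) {j n : ℕ} (h2 : n + j < N) :
    PhiMinus (p ^ 2) (s a ^ 2) (s b ^ 2) (s c ^ 2) ((N : ℤ) - j) n ≠ 0 := by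
  have hq := pow_ne_zero 2 H.p0
  have e0 : (n : ℤ) - ((N : ℤ) - j) = -((N - j - n : ℕ) : ℤ) := by omega
  have e1 : (n : ℤ) + ((N : ℤ) - j) + 2 = ((n + (N - j) + 2 : ℕ) : ℤ) := by omega
  have e2 : (2 * (n : ℤ) + 2) = ((2 * n + 2 : ℕ) : ℤ) := by omega
  have e3 : (n : ℤ) + 1 = ((n + 1 : ℕ) : ℤ) := by omega
  have e4 : 2 * (n : ℤ) + 1 = ((2 * n + 1 : ℕ) : ℤ) := by omega
  unfold PhiMinus
  rw [e0, e1, e2, e3, e4]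
  refine mul_ne_zero (div_ne_zero (mul_ne_zero (mul_ne_zero ?_ ?_) ?_) ?_)
    (H.cancelRatio_ne_zero (by omega))
  · have h0 := H.qk (N - j - n) (by omega) (by omega)
    rw [zpow_neg, zpow_natCast]
    intro h
    have h3 := pow_ne_zero (N - j - n) hq
    exact h0 (by field_simp at h; rw [mul_zero] at h; linear_combination -h)
  · rw [zpow_natCast]
    intro h
    apply H.snd (N + 1 + j - n) (by omega) (by omega)
    have hc := H.constr
    rw [← prod_of_nodup H.nodup] at hc
    have hc2 : (p ^ 2) ^ (n + (N - j) + 2) * (p ^ 2) ^ (N + 1 + j - n) *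
        (s a * s b * s c * s d * s e) ^ 2 = 1 := by
      rw [← pow_add, show n + (N - j) + 2 + (N + 1 + j - n) = 2 * N + 3 by omega, ← pow_mul,
        mul_comm 2, pow_mul, ← mul_pow, hc, one_pow]
    linear_combination -(s d ^ 2 * s e ^ 2 * (p ^ 2) ^ (N + 1 + j - n)) * h - hc2
  · rw [zpow_natCast]; exact H.single b _ (by omega) (by omega)
  · rw [zpow_natCast]; exact H.fst _ (by omega) (by omega)

theorem Phi_ne_zero (H : Adm N p s a b c d e) {j n n' : ℕ} (h1 : n + j ≤ N) (h2 : n' + j ≤ N)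
    (h : (n : ℤ) - n' = 1 ∨ (n : ℤ) - n' = -1) :
    Phi ((n : ℤ) - n') (p ^ 2) (s a ^ 2) (s b ^ 2) (s c ^ 2) ((N : ℤ) - j) n ≠ 0 := by
  rcases h with h | h <;> rw [h]
  · simpa [Phi] using H.PhiPlus_ne_zero (j := j) (n := n) (by omega) h1
  · simpa [Phi] using H.PhiMinus_ne_zero (j := j) (n := n) (by omega)

theorem triFst_ne_zero (H : Adm N p s a b c d e) {y x : Idx N} (h : y.snd = x.snd)
    (h1 : (x.fst : ℤ) - y.fst = 1 ∨ (x.fst : ℤ) - y.fst = -1) :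
    triFst N p s a b c d y x ≠ 0 := by
  have hx := x.le
  have hy := y.le
  rw [triFst, Matrix.of_apply, if_pos h]
  exact mul_ne_zero (mul_ne_zero (H.Phi_ne_zero (by omega) (by omega) h1)
    (zpow_ne_zero _ (div_ne_zero (H.s0 a) (H.s0 d))))
    (div_ne_zero (H.xi_ne_zero b c (by omega)) (H.xi_ne_zero b c (by omega)))

theorem triSnd_ne_zero (H : Adm N p s a b c d e) {y x : Idx N} (h : y.fst = x.fst)
    (h1 : (x.snd : ℤ) - y.snd = 1 ∨ (x.snd : ℤ) - y.snd = -1) :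
    triSnd N p s a e d y x ≠ 0 := by
  have hx := x.le
  have hy := y.le
  rw [triSnd, Matrix.of_apply, if_pos h]
  exact H.dual.Phi_ne_zero (by omega) (by omega) h1

/-- Up to a unit the difference of two eigenvalues is `(1 - q^{j-i})(1 - bc q^{i+j+1})`, and the
exponent in the second factor runs through the admissible range. -/
theorem lam_injective (H : Adm N p s a b c d e) {i j : ℕ} (hi : i ≤ N) (hj : j ≤ N)
    (h : lam (p ^ 2) (s b ^ 2 * s c ^ 2) i = lam (p ^ 2) (s b ^ 2 * s c ^ 2) j) : i = j := by
  have hq := pow_ne_zero 2 H.p0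
  wlog hij : i < j generalizing i j
  · by_contra h0
    exact h0 (this hj hi h.symm (by omega)).symm
  exfalso
  have h1 := H.qk (j - i) (by omega) (by omega)
  have h2 := H.fst (i + j + 1) (by omega) (by omega)
  refine mul_ne_zero h1 h2 ?_
  unfold lam at h
  simp only [zpow_neg, zpow_add₀ hq, zpow_natCast, zpow_one] at h
  have e1 : (p ^ 2) ^ j = (p ^ 2) ^ i * (p ^ 2) ^ (j - i) := by rw [← pow_add]; congr 1; omega
  have e2 : (p ^ 2) ^ (i + j + 1) = (p ^ 2) ^ i * (p ^ 2) ^ i * (p ^ 2) ^ (j - i) * p ^ 2 := by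
    rw [← pow_add, ← pow_add, ← pow_succ]; congr 1; omega
  rw [e1] at h
  rw [e2]
  have n1 := pow_ne_zero i hq
  have n2 := pow_ne_zero (j - i) hq
  generalize (p ^ 2) ^ i = I at *
  generalize (p ^ 2) ^ (j - i) = J at *
  field_simp at h
  linear_combination -h

end Adm

/-! ### The change-of-basis matrices are inverse to each other -/

section Inverse

variable {N : ℕ} {p : ℂ} {s : Fin 5 → ℂ} {a b c d e : Fin 5}

theorem racahP_zero_left (q r a b c : ℂ) {M x : ℕ} (hx : x ≤ M) :
    racahP q r a b c M 0 x = racahOmega q r a b c M 0 := by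
  rw [racahP, if_pos ⟨Nat.zero_le _, hx⟩]
  simp [phi43, qPoch]

theorem racahP_zero_right (q r a b c : ℂ) {M n : ℕ} (hn : n ≤ M) :
    racahP q r a b c M n 0 = racahOmega q r a b c M n := by
  rw [racahP, if_pos ⟨hn, Nat.zero_le _⟩, phi43, Finset.sum_range_succ']
  rw [Finset.sum_eq_zero]
  · simp [qPoch]
  · intro k _
    simp [qPoch, Finset.prod_range_succ']

theorem xi_zero (q u v : ℂ) : xi q u v 0 = 1 := by simp [xi, qPoch]

/-- A Schur type argument in place of orthogonality: commutation determines the product up to one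
constant for each value of the second coordinate, and the summation formula shows that the constant
is one. -/
theorem chgUp_mul_chgDown (G : Generic N p s) (h : [a, b, c, d, e].Nodup) :
    chgUp N p s a b c d * chgDown N p s c b a d = 1 := by
  have H := G.adm h
  obtain ⟨K, hK⟩ : ∃ K, K = chgUp N p s a b c d * chgDown N p s c b a d := ⟨_, rfl⟩
  have h1 : K * triFst N p s a b c d = triFst N p s a b c d * K := by
    rw [hK, Matrix.mul_assoc, chgDown_mul_triFst G h, ← Matrix.mul_assoc, chgUp_mul_diagSnd G h,
      Matrix.mul_assoc]
  have h2 : K * diagFst N p s c b = diagFst N p s c b * K := by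
    rw [hK, Matrix.mul_assoc, chgDown_mul_diagFst G h, ← Matrix.mul_assoc, chgUp_mul_triSnd G h,
      Matrix.mul_assoc]
  rw [diagFst_comm] at h2
  rw [← hK]
  -- The Kronecker deltas preserve the second coordinate, and the simple spectrum of the diagonal
  -- matrix separates the values of the first.
  have hoff : ∀ z x, z ≠ x → K z x = 0 := by
    intro z x hzx
    by_cases hs : z.snd = x.snd
    · have := congrFun (congrFun h2 z) x
      rw [diagFst, Matrix.mul_diagonal, Matrix.diagonal_mul] at this
      have hx := x.le
      have hz := z.le
      by_contra h0
      refine hzx (Idx.ext (H.lam_injective (by omega) (by omega) ?_) hs)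
      exact mul_right_cancel₀ h0 (by rw [← this, mul_comm])
    · rw [hK, Matrix.mul_apply]
      refine Finset.sum_eq_zero fun y _ => ?_
      simp only [chgUp, chgDown, Matrix.of_apply]
      split_ifs with g1 g2
      · exact absurd (g1.trans g2) hs
      all_goals simp
  obtain ⟨κ, hκ⟩ : ∃ κ, K = Matrix.diagonal κ := ⟨fun x => K x x, by
    ext z x
    rw [Matrix.diagonal_apply]
    split_ifs with h0
    · rw [h0]
    · exact hoff z x h0⟩
  -- Commuting with a tridiagonal matrix whose entries beside the diagonal are non-zero forces
  -- neighbouring diagonal values to agree.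
  have hstep : ∀ y x : Idx N, y.snd = x.snd → x.fst = y.fst + 1 → κ x = κ y := by
    intro y x g1 g2
    have := congrFun (congrFun h1 y) x
    rw [hκ, Matrix.mul_diagonal, Matrix.diagonal_mul, mul_comm] at this
    exact (mul_left_cancel₀ (H.triFst_ne_zero g1 (Or.inl (by omega))) this).symm
  -- At the start of a row the polynomials `p_0(l)` and `p_l(0)` reduce to their normalizations, and
  -- the entry becomes the sum in `sum_racahOmega`.
  have hone : ∀ m, ∀ x : Idx N, x.fst = m → κ x = 1 := by
    intro m
    induction m with
    | zero =>
      intro x hx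
      have hxx : κ x = K x x := by rw [hκ, Matrix.diagonal_apply_eq]
      have hxl := x.le
      rw [hxx, hK, Matrix.mul_apply, Idx.sum_fst (m := x.snd) (f := fun l =>
        racahOmega (p ^ 2) (p * s b) (s a ^ 2) (s b ^ 2) (s c ^ 2) (N - x.snd) 0 *
        racahOmega (p ^ 2) (p * s b) (s c ^ 2) (s b ^ 2) (s a ^ 2) (N - x.snd) l) _ (by omega)]
      · exact sum_racahOmega ((G.paramReg h).block.mono (Nat.sub_le _ _))
          ((G.paramReg (nodup_reverse h)).block.mono (Nat.sub_le _ _))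
      · rintro _ y rfl
        simp only [chgUp, chgDown, Matrix.of_apply, hx, eq_comm (a := x.snd), xi_zero, pow_zero]
        have hy := y.le
        split_ifs with g
        · rw [racahP_zero_left _ _ _ _ _ (by omega), racahP_zero_right _ _ _ _ _ (by omega)]
          ring
        · simp
    | succ m ih =>
      intro x hx
      have hxl := x.le
      rw [hstep (Idx.mk m x.snd (by omega)) x (by simp) (by simp [hx])]
      exact ih _ (by simp)
  rw [hκ, ← Matrix.diagonal_one]
  congr 1
  funext x
  exact hone _ x rfl

/-- In a generic frame the change of basis carries the nine-diagonal matrix of the next frame to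
`triSnd`. -/
theorem chgUp_mul_nineDiag (G : Generic N p s) (h : [a, b, c, d, e].Nodup) :
    chgUp N p s a b c d * nineDiag N p s c b a d e =
      triSnd N p s a e d * chgUp N p s a b c d := by
  have h1 := chgUp_mul_chgDown G h
  have h2 := mul_eq_one_comm.1 h1
  have h3 := chgDown_mul_triSnd G h
  calc _ = chgUp N p s a b c d * (nineDiag N p s c b a d e *
        (chgDown N p s c b a d * chgUp N p s a b c d)) := by rw [h2, Matrix.mul_one]
    _ = _ := by
      rw [← Matrix.mul_assoc (nineDiag _ _ _ _ _ _ _ _), ← h3, ← Matrix.mul_assoc,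
        ← Matrix.mul_assoc, h1, Matrix.one_mul]

end Inverse

end QRacahAW4

namespace QRacahAW4

/-! ### The relations of the algebra for generic parameters -/

section Relations

variable {N : ℕ} {p : ℂ} {s : Fin 5 → ℂ} {a b c d e : Fin 5}

/-- The algebra homomorphism on the free algebra attached to a set of matrices. -/
noncomputable def freeRep (N : ℕ) (p : ℂ) (s : Fin 5 → ℂ) (X : Label) :
    FreeAlgebra ℂ Gen →ₐ[ℂ] Mat N :=
  FreeAlgebra.lift ℂ (genImage N p s (mat N p s X))

@[simp] theorem freeRep_gen (X : Label) (I : Gen) :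
    freeRep N p s X (gen I) = genImage N p s (mat N p s X) I := by
  simp [freeRep]

theorem map_awExpr {R S : Type*} [Ring R] [Algebra ℂ R] [Ring S] [Algebra ℂ S] (f : R →ₐ[ℂ] S)
    (p : ℂ) (Y Z U₁ U₂ V₁ V₂ : R) :
    f (awExpr p Y Z U₁ U₂ V₁ V₂) = awExpr p (f Y) (f Z) (f U₁) (f U₂) (f V₁) (f V₂) := by
  simp [awExpr]

theorem genImage_g12 (X : Mid → Mat N) : genImage N p s X .g12 = img p (s 1 * s 2) (X .m12) := by
  simp only [genImage, img, jk, mul_assoc]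

theorem genImage_g23 (X : Mid → Mat N) : genImage N p s X .g23 = img p (s 2 * s 3) (X .m23) := by
  simp only [genImage, img, jk, mul_assoc]

theorem genImage_g34 (X : Mid → Mat N) : genImage N p s X .g34 = img p (s 3 * s 4) (X .m34) := by
  simp only [genImage, img, jk, mul_assoc]

/-- The additive constant is invariant under inversion. By the constraint this gives the generators
with three indices the same normalization as those with two, with the two complementary labels. -/
theorem smul_add_eq_img {w v : ℂ} (h : w * (p * v) = 1) (M : Mat N) :
    w • M + (w + 1 / w) • 1 = img p v M := by
  have h1 : w = 1 / (p * v) := by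
    rw [eq_div_iff (right_ne_zero_of_mul_eq_one h), h]
  have h2 : 1 / w = p * v := by rw [h1, one_div_one_div]
  rw [img, jk, ← h1, h2, add_comm w]

theorem Generic.prod_five (G : Generic N p s) :
    p ^ (2 * N + 3) * (s 0 * s 1 * s 2 * s 3 * s 4) = 1 :=
  G.prod (a := 0) (b := 1) (c := 2) (d := 3) (e := 4) (by decide)

theorem genImage_g123 (G : Generic N p s) (X : Mid → Mat N) :
    genImage N p s X .g123 = img p (s 4 * s 0) (X .m123) :=
  smul_add_eq_img (by rw [← G.prod_five]; ring) _

theorem genImage_g234 (G : Generic N p s) (X : Mid → Mat N) :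
    genImage N p s X .g234 = img p (s 0 * s 1) (X .m234) :=
  smul_add_eq_img (by rw [← G.prod_five]; ring) _

/-- The images of the generators that are represented by the five matrices of a frame. -/
structure FrameImages (N : ℕ) (p : ℂ) (s : Fin 5 → ℂ) (a b c d e : Fin 5) (T₁ T₂ D₁ D₂ Z : Mat N) :
    Prop where
  nodup : [a, b, c, d, e].Nodup
  triFst : T₁ = img p (s b * s a) (triFst N p s a b c d)
  triSnd : T₂ = img p (s a * s e) (triSnd N p s a e d)
  diagFst : D₁ = img p (s c * s b) (diagFst N p s c b)
  diagSnd : D₂ = img p (s e * s d) (diagSnd N p s e d)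
  nine : Z = img p (s d * s c) (nineDiag N p s a e d b c)

theorem frameA (G : Generic N p s) : FrameImages N p s 3 2 1 0 4 (freeRep N p s .A (gen .g23))
    (freeRep N p s .A (gen .g34)) (freeRep N p s .A (gen .g12)) (freeRep N p s .A (gen .g123))
    (freeRep N p s .A (gen .g234)) := by
  simp only [freeRep_gen]
  exact ⟨by decide, genImage_g23 _, genImage_g34 _, genImage_g12 _, genImage_g123 G _,
    genImage_g234 G _⟩

theorem frameB (G : Generic N p s) : FrameImages N p s 1 0 4 3 2 (freeRep N p s .B (gen .g234))
    (freeRep N p s .B (gen .g12)) (freeRep N p s .B (gen .g123)) (freeRep N p s .B (gen .g23))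
    (freeRep N p s .B (gen .g34)) := by
  simp only [freeRep_gen]
  exact ⟨by decide, genImage_g234 G _, genImage_g12 _, genImage_g123 G _, genImage_g23 _,
    genImage_g34 _⟩

theorem frameC (G : Generic N p s) : FrameImages N p s 4 3 2 1 0 (freeRep N p s .C (gen .g34))
    (freeRep N p s .C (gen .g123)) (freeRep N p s .C (gen .g23)) (freeRep N p s .C (gen .g234))
    (freeRep N p s .C (gen .g12)) := by
  simp only [freeRep_gen]
  exact ⟨by decide, genImage_g34 _, genImage_g123 G _, genImage_g23 _, genImage_g234 G _,
    genImage_g12 _⟩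

theorem frameD (G : Generic N p s) : FrameImages N p s 2 1 0 4 3 (freeRep N p s .D (gen .g12))
    (freeRep N p s .D (gen .g23)) (freeRep N p s .D (gen .g234)) (freeRep N p s .D (gen .g34))
    (freeRep N p s .D (gen .g123)) := by
  simp only [freeRep_gen]
  exact ⟨by decide, genImage_g12 _, genImage_g23 _, genImage_g234 G _, genImage_g34 _,
    genImage_g123 G _⟩

theorem frameE (G : Generic N p s) : FrameImages N p s 0 4 3 2 1 (freeRep N p s .E (gen .g123))
    (freeRep N p s .E (gen .g234)) (freeRep N p s .E (gen .g34)) (freeRep N p s .E (gen .g12))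
    (freeRep N p s .E (gen .g23)) := by
  simp only [freeRep_gen]
  exact ⟨by decide, genImage_g123 G _, genImage_g234 G _, genImage_g34 _, genImage_g12 _,
    genImage_g23 _⟩

namespace FrameImages

variable {T₁ T₂ D₁ D₂ Z : Mat N}

theorem diag_fst (F : FrameImages N p s a b c d e T₁ T₂ D₁ D₂ Z) (G : Generic N p s) :
    D₁ = Matrix.diagonal fun x => jk (p * s b * s c * (p ^ 2) ^ (x.fst : ℤ)) := by
  rw [F.diagFst, img_diagFst G.p0 (G.s0 c) (G.s0 b), mul_right_comm p]

theorem diag_snd (F : FrameImages N p s a b c d e T₁ T₂ D₁ D₂ Z) (G : Generic N p s) :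
    D₂ = Matrix.diagonal fun x => jk (p * s d * s e * (p ^ 2) ^ (x.snd : ℤ)) := by
  rw [F.diagSnd, img_diagSnd G.p0 (G.s0 e) (G.s0 d), mul_right_comm p]

theorem commute (F : FrameImages N p s a b c d e T₁ T₂ D₁ D₂ Z) (G : Generic N p s) :
    D₁ * D₂ = D₂ * D₁ := by
  rw [F.diag_fst G, F.diag_snd G, Matrix.diagonal_mul_diagonal, Matrix.diagonal_mul_diagonal]
  simp only [mul_comm]

theorem rel_fst (F : FrameImages N p s a b c d e T₁ T₂ D₁ D₂ Z) (G : Generic N p s)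
    {U₁ U₂ V₁ V₂ U₃ U₄ V₃ V₄ : Mat N}
    (hA : U₁ * U₂ + V₁ * V₂ = (jk (s a) * jk (s c)) • 1 + jk (s b) • D₂)
    (hB : U₃ * U₄ + V₃ * V₄ = (jk (s a) * jk (s b)) • 1 + jk (s c) • D₂) :
    T₁ = awExpr p D₁ (awExpr p T₁ D₁ U₁ U₂ V₁ V₂) U₃ U₄ V₃ V₄ := by
  rw [F.diag_snd G, Matrix.smul_one_eq_diagonal, ← Matrix.diagonal_smul, Matrix.diagonal_add]
    at hA hB
  rw [F.triFst, F.diagFst, mul_comm (s b), mul_comm (s c), diagFst_comm]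
  exact triFst_rel G F.nodup hA hB

theorem rel_snd (F : FrameImages N p s a b c d e T₁ T₂ D₁ D₂ Z) (G : Generic N p s)
    {U₁ U₂ V₁ V₂ U₃ U₄ V₃ V₄ : Mat N}
    (hA : U₁ * U₂ + V₁ * V₂ = (jk (s a) * jk (s d)) • 1 + jk (s e) • D₁)
    (hB : U₃ * U₄ + V₃ * V₄ = (jk (s a) * jk (s e)) • 1 + jk (s d) • D₁) :
    T₂ = awExpr p D₂ (awExpr p T₂ D₂ U₁ U₂ V₁ V₂) U₃ U₄ V₃ V₄ := by
  rw [F.diag_fst G, Matrix.smul_one_eq_diagonal, ← Matrix.diagonal_smul, Matrix.diagonal_add]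
    at hA hB
  rw [F.triSnd, F.diagSnd]
  exact triSnd_rel G F.nodup hA hB

theorem rel_outer (F : FrameImages N p s a b c d e T₁ T₂ D₁ D₂ Z) (G : Generic N p s)
    {σ : Fin 5 → Mat N} (hσ : ∀ i, σ i = jk (s i) • 1) :
    awExpr p T₁ T₂ (σ e) (σ b) Z (σ a) =
      awExpr p (awExpr p D₂ Z (σ e) (σ c) (σ d) T₁) D₁ (σ e) (σ b) (σ c)
        (awExpr p D₂ T₂ (σ e) D₁ (σ d) (σ a)) ∧
    awExpr p T₂ T₁ (σ b) (σ e) Z (σ a) =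
      awExpr p (awExpr p D₁ Z (σ b) (σ d) (σ c) T₂) D₂ (σ e) (σ b) (σ d)
        (awExpr p D₁ T₁ (σ b) D₂ (σ c) (σ a)) :=
  outer_rel G F.nodup hσ (by rw [F.triFst, mul_comm (s b)]) F.triSnd
    (by rw [F.diagFst, mul_comm (s b), diagFst_comm])
    (by rw [F.diagSnd, mul_comm (s e), diagSnd_comm]) F.nine

end FrameImages

/-! ### Transport between the sets of matrices -/

theorem chg_mul_chgInv (G : Generic N p s) (X : Label) : chg N p s X * chgInv N p s X = 1 := by
  cases X
  · exact chgUp_mul_chgDown (e := 4) G (by decide)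
  · exact chgUp_mul_chgDown (e := 2) G (by decide)
  · exact chgUp_mul_chgDown (e := 0) G (by decide)
  · exact chgUp_mul_chgDown (e := 3) G (by decide)
  · exact chgUp_mul_chgDown (e := 1) G (by decide)

/-- Each label uses the same five matrix identities, assigned to the generators in rotated order;
this is the cyclic symmetry of the construction. -/
theorem chg_mul_mat (G : Generic N p s) (X : Label) (I : Mid) :
    chg N p s X * mat N p s X.next I = mat N p s X I * chg N p s X := by
  cases X
  · have h : [(3 : Fin 5), 2, 1, 0, 4].Nodup := by decide
    cases I
    exacts [chgUp_mul_triSnd G h, chgUp_mul_diagSnd G h, chgUp_mul_nineDiag G h, chgUp_mul_diagFst,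
      chgUp_mul_triFst G h]
  · have h : [(1 : Fin 5), 0, 4, 3, 2].Nodup := by decide
    cases I
    exacts [chgUp_mul_nineDiag G h, chgUp_mul_diagFst, chgUp_mul_triFst G h, chgUp_mul_triSnd G h,
      chgUp_mul_diagSnd G h]
  · have h : [(4 : Fin 5), 3, 2, 1, 0].Nodup := by decide
    cases I
    exacts [chgUp_mul_triFst G h, chgUp_mul_triSnd G h, chgUp_mul_diagSnd G h,
      chgUp_mul_nineDiag G h, chgUp_mul_diagFst]
  · have h : [(2 : Fin 5), 1, 0, 4, 3].Nodup := by decide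
    cases I
    exacts [chgUp_mul_diagSnd G h, chgUp_mul_nineDiag G h, chgUp_mul_diagFst,
      chgUp_mul_triFst G h, chgUp_mul_triSnd G h]
  · have h : [(0 : Fin 5), 4, 3, 2, 1].Nodup := by decide
    cases I
    exacts [chgUp_mul_diagFst, chgUp_mul_triFst G h, chgUp_mul_triSnd G h,
      chgUp_mul_diagSnd G h, chgUp_mul_nineDiag G h]

/-- A matrix that intertwines the five pairs of matrices intertwines the homomorphisms. -/
theorem intertwine_freeRep {X Y : Label} {P : Mat N}
    (h : ∀ I, P * mat N p s Y I = mat N p s X I * P) (u : FreeAlgebra ℂ Gen) :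
    P * freeRep N p s Y u = freeRep N p s X u * P := by
  induction u using FreeAlgebra.induction with
  | grade0 r => rw [AlgHom.commutes, AlgHom.commutes, Algebra.commutes]
  | grade1 I =>
    rw [freeRep_gen, freeRep_gen]
    cases I <;> simp [genImage, mul_add, add_mul, h]
  | mul u v hu hv => rw [map_mul, map_mul, ← mul_assoc, hu, mul_assoc, hv, mul_assoc]
  | add u v hu hv => rw [map_add, map_add, mul_add, add_mul, hu, hv]

/-- One representation is obtained from the next by a similarity, which preserves every relation
between the generators. -/
theorem freeRep_eq_of_next (G : Generic N p s) {X : Label} {u v : FreeAlgebra ℂ Gen}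
    (h : freeRep N p s X.next u = freeRep N p s X.next v) :
    freeRep N p s X u = freeRep N p s X v := by
  have key : ∀ w, freeRep N p s X w =
      chg N p s X * freeRep N p s X.next w * chgInv N p s X := fun w => by
    rw [intertwine_freeRep (chg_mul_mat G X), mul_assoc, chg_mul_chgInv G, mul_one]
  rw [key, key, h]

/-- A relation that holds for one of the sets of matrices holds for all of them. -/
theorem freeRep_eq_all (G : Generic N p s) {u v : FreeAlgebra ℂ Gen} {X : Label}
    (h : freeRep N p s X u = freeRep N p s X v) (Y : Label) :
    freeRep N p s Y u = freeRep N p s Y v := by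
  have tA := freeRep_eq_of_next (X := .A) (u := u) (v := v) G
  have tB := freeRep_eq_of_next (X := .B) (u := u) (v := v) G
  have tC := freeRep_eq_of_next (X := .C) (u := u) (v := v) G
  have tD := freeRep_eq_of_next (X := .D) (u := u) (v := v) G
  have tE := freeRep_eq_of_next (X := .E) (u := u) (v := v) G
  have hA : freeRep N p s .A u = freeRep N p s .A v := by
    cases X
    exacts [h, tA h, tA (tB h), tA (tB (tC h)), tA (tB (tC (tD h)))]
  cases Y
  exacts [hA, tB (tC (tD (tE hA))), tC (tD (tE hA)), tD (tE hA), tE hA]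

/-! ### The defining relations -/

theorem genImage_comm_of_scalar {A B : Mat N} {z : ℂ} (h : A = z • 1) : A * B = B * A := by
  rw [h, smul_mul_assoc, one_mul, mul_smul_comm, mul_one]

@[simp] theorem freeRep_g1 (X : Label) : freeRep N p s X (gen .g1) = jk (s 1) • 1 := by
  rw [freeRep_gen]; rfl

@[simp] theorem freeRep_g2 (X : Label) : freeRep N p s X (gen .g2) = jk (s 2) • 1 := by
  rw [freeRep_gen]; rfl

@[simp] theorem freeRep_g3 (X : Label) : freeRep N p s X (gen .g3) = jk (s 3) • 1 := by
  rw [freeRep_gen]; rfl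

@[simp] theorem freeRep_g4 (X : Label) : freeRep N p s X (gen .g4) = jk (s 4) • 1 := by
  rw [freeRep_gen]; rfl

@[simp] theorem freeRep_g1234 (X : Label) : freeRep N p s X (gen .g1234) = jk (s 0) • 1 := by
  rw [freeRep_gen]; rfl

attribute [-simp] freeRep_gen

/-- A generator is represented by a scalar or it is one of the five remaining ones. -/
theorem scalar_or (N : ℕ) (p : ℂ) (s : Fin 5 → ℂ) (I : Gen) :
    (∃ z : ℂ, ∀ X, freeRep N p s X (gen I) = z • 1) ∨
      I = .g12 ∨ I = .g23 ∨ I = .g34 ∨ I = .g123 ∨ I = .g234 := by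
  cases I
  · exact Or.inl ⟨_, freeRep_g1⟩
  · exact Or.inl ⟨_, freeRep_g2⟩
  · exact Or.inl ⟨_, freeRep_g3⟩
  · exact Or.inl ⟨_, freeRep_g4⟩
  · simp
  · simp
  · simp
  · simp
  · simp
  · exact Or.inl ⟨_, freeRep_g1234⟩

/-- The commuting pairs of non-scalar generators form a five-cycle, and each is the diagonal pair of
one frame: 12 and 123 in `A`, 123 and 23 in `B`, 23 and 234 in `C`, 234 and 34 in `D`, 34 and 12 in
`E`. -/
theorem exists_commute (G : Generic N p s) {I J : Gen}
    (h : Disjoint I.supp J.supp ∨ I.supp ⊆ J.supp) :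
    ∃ Y, freeRep N p s Y (gen I * gen J) = freeRep N p s Y (gen J * gen I) := by
  simp only [map_mul]
  rcases scalar_or N p s I with ⟨z, hz⟩ | hI
  · exact ⟨.A, genImage_comm_of_scalar (hz _)⟩
  rcases scalar_or N p s J with ⟨z, hz⟩ | hJ
  · exact ⟨.A, (genImage_comm_of_scalar (hz _)).symm⟩
  have cA := (frameA G).commute G
  have cB := (frameB G).commute G
  have cC := (frameC G).commute G
  have cD := (frameD G).commute G
  have cE := (frameE G).commute G
  rcases hI with rfl | rfl | rfl | rfl | rfl <;> rcases hJ with rfl | rfl | rfl | rfl | rfl <;> first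
    | exact absurd h (by decide)
    | with_reducible exact ⟨.A, rfl⟩
    | with_reducible exact ⟨.A, cA⟩
    | with_reducible exact ⟨.B, cB.symm⟩
    | with_reducible exact ⟨.C, cC⟩
    | with_reducible exact ⟨.D, cD.symm⟩
    | with_reducible exact ⟨.E, cE⟩
    | with_reducible exact ⟨.E, cE.symm⟩

/-- For each triple a frame is chosen in which `IJ` is tridiagonal and `JK` is the diagonal matrix
in the same coordinate. The inhomogeneous terms then depend on the other diagonal matrix only. -/
theorem exists_triple (G : Generic N p s) {I J K IJ JK IJK : Gen} (h : Triple I J K IJ JK IJK) :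
    ∃ Y, freeRep N p s Y (gen IJ) = freeRep N p s Y
      (awExpr p (gen JK) (outer p I J K IJ JK IJK) (gen I) (gen J) (gen K) (gen IJK)) := by
  cases h
  · exact ⟨.B, by
      simp only [outer, map_awExpr]
      refine (frameB G).rel_snd G ?_ ?_ <;>
        simp only [freeRep_g1, freeRep_g2, freeRep_g3, freeRep_g4, freeRep_g1234, smul_mul_assoc,
          one_mul, mul_smul_comm, mul_one] <;> module⟩
  · exact ⟨.D, by
      simp only [outer, map_awExpr]
      refine (frameD G).rel_snd G ?_ ?_ <;>
        simp only [freeRep_g1, freeRep_g2, freeRep_g3, freeRep_g4, freeRep_g1234, smul_mul_assoc,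
          one_mul, mul_smul_comm, mul_one] <;> module⟩
  · exact ⟨.C, by
      simp only [outer, map_awExpr]
      refine (frameC G).rel_snd G ?_ ?_ <;>
        simp only [freeRep_g1, freeRep_g2, freeRep_g3, freeRep_g4, freeRep_g1234, smul_mul_assoc,
          one_mul, mul_smul_comm, mul_one] <;> module⟩
  · exact ⟨.E, by
      simp only [outer, map_awExpr]
      refine (frameE G).rel_fst G ?_ ?_ <;>
        simp only [freeRep_g1, freeRep_g2, freeRep_g3, freeRep_g4, freeRep_g1234, smul_mul_assoc,
          one_mul, mul_smul_comm, mul_one] <;> module⟩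
  · exact ⟨.D, by
      simp only [outer, map_awExpr]
      refine (frameD G).rel_fst G ?_ ?_ <;>
        simp only [freeRep_g1, freeRep_g2, freeRep_g3, freeRep_g4, freeRep_g1234, smul_mul_assoc,
          one_mul, mul_smul_comm, mul_one] <;> module⟩
  · exact ⟨.A, by
      simp only [outer, map_awExpr]
      refine (frameA G).rel_fst G ?_ ?_ <;>
        simp only [freeRep_g1, freeRep_g2, freeRep_g3, freeRep_g4, freeRep_g1234, smul_mul_assoc,
          one_mul, mul_smul_comm, mul_one] <;> module⟩
  · exact ⟨.C, by
      simp only [outer, map_awExpr]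
      refine (frameC G).rel_fst G ?_ ?_ <;>
        simp only [freeRep_g1, freeRep_g2, freeRep_g3, freeRep_g4, freeRep_g1234, smul_mul_assoc,
          one_mul, mul_smul_comm, mul_one] <;> module⟩
  · exact ⟨.B, by
      simp only [outer, map_awExpr]
      refine (frameB G).rel_fst G ?_ ?_ <;>
        simp only [freeRep_g1, freeRep_g2, freeRep_g3, freeRep_g4, freeRep_g1234, smul_mul_assoc,
          one_mul, mul_smul_comm, mul_one] <;> module⟩
  · exact ⟨.A, by
      simp only [outer, map_awExpr]
      refine (frameA G).rel_snd G ?_ ?_ <;>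
        simp only [freeRep_g1, freeRep_g2, freeRep_g3, freeRep_g4, freeRep_g1234, smul_mul_assoc,
          one_mul, mul_smul_comm, mul_one] <;> module⟩
  · exact ⟨.E, by
      simp only [outer, map_awExpr]
      refine (frameE G).rel_snd G ?_ ?_ <;>
        simp only [freeRep_g1, freeRep_g2, freeRep_g3, freeRep_g4, freeRep_g1234, smul_mul_assoc,
          one_mul, mul_smul_comm, mul_one] <;> module⟩

theorem freeRep_rel (G : Generic N p s) (X : Label) {u v : FreeAlgebra ℂ Gen} (h : Rel p u v) :
    freeRep N p s X u = freeRep N p s X v := by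
  cases h with
  | comm I J h => exact freeRep_eq_all G (exists_commute G h).choose_spec X
  | triple I J K IJ JK IJK h => exact freeRep_eq_all G (exists_triple G h).choose_spec X
  | c14 =>
    -- In frame `E` the generators 12 and 34 are diagonal, 123 and 234 are tridiagonal, and 23 is
    -- the nine-diagonal matrix, so both last relations have the shape of `rel_outer`.
    refine freeRep_eq_all G (X := .E) ?_ X
    simp only [C14, C13, C134, outer, map_awExpr, freeRep_g1, freeRep_g3, freeRep_g4, freeRep_g2,
      freeRep_g1234]
    exact ((frameE G).rel_outer (σ := fun i => jk (s i) • 1) G fun _ => rfl).1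
  | c41 =>
    refine freeRep_eq_all G (X := .E) ?_ X
    simp only [C41, C42, C412, outer, map_awExpr, freeRep_g1, freeRep_g3, freeRep_g4, freeRep_g2,
      freeRep_g1234]
    exact ((frameE G).rel_outer (σ := fun i => jk (s i) • 1) G fun _ => rfl).2

end Relations

end QRacahAW4

namespace QRacahAW4

/-! ### Continuity of the coefficients in the parameters -/

/-- `y ∉ {q^{-2}, …, q^{-2N}}`, with the denominators as they occur in the coefficients. -/
def PairReg (N : ℕ) (q y : ℂ) : Prop := ∀ k : ℤ, 2 ≤ k → k ≤ 2 * N → 1 - y * q ^ k ≠ 0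

section Continuity

open Filter Topology

variable {T : Type*} [TopologicalSpace T] {x : T} {q : ℂ} {R A B C D E : T → ℂ} {N : ℕ}

/-- When the exponents coincide the function is constant, so the denominator matters only in the
remaining case. -/
theorem cancelRatio_continuousAt {k l : ℤ} (hC : ContinuousAt C x) (hr : PairReg N q (C x))
    (h : k = l ∨ (2 ≤ l ∧ l ≤ 2 * N)) : ContinuousAt (fun t => cancelRatio q (C t) k l) x := by
  unfold cancelRatio
  split_ifs with h0
  · exact continuousAt_const
  · have := hr l (by omega) (by omega)
    exact ContinuousAt.div (by fun_prop) (by fun_prop) this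

/-- The uncontrolled exponents occur only at the ends. For `n = 0` the coefficient is identically
zero, and for `n = M` the ratio with exponent `2n + 1` is cancelled. The other coefficients are
treated in the same way. -/
theorem PhiPlus_continuousAt (hA : ContinuousAt A x) (hB : ContinuousAt B x)
    (hC : ContinuousAt C x) (hr : PairReg N q (B x * C x)) {M n : ℤ} (h0 : 0 ≤ n) (h1 : n ≤ M)
    (h2 : M ≤ N) : ContinuousAt (fun t => PhiPlus q (A t) (B t) (C t) M n) x := by
  by_cases hn : n = 0
  · subst hn
    simp only [PhiPlus_zero]
    exact continuousAt_const
  · unfold PhiPlus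
    exact ((by fun_prop : ContinuousAt (fun t => -B t * q ^ (n - M) * (1 - q ^ n) *
      (1 - A t * q ^ (M - n + 1)) * (1 - C t * q ^ n)) x).div (by fun_prop)
      (hr _ (by omega) (by omega))).mul
      (cancelRatio_continuousAt (hB.mul hC) hr (by omega))

theorem PhiMinus_continuousAt (hA : ContinuousAt A x) (hB : ContinuousAt B x)
    (hC : ContinuousAt C x) (hr : PairReg N q (B x * C x)) {M n : ℤ} (h0 : 0 ≤ n) (h1 : n ≤ M)
    (h2 : M ≤ N) : ContinuousAt (fun t => PhiMinus q (A t) (B t) (C t) M n) x := by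
  by_cases hn : n = M
  · subst hn
    simp only [PhiMinus_self]
    exact continuousAt_const
  · unfold PhiMinus
    exact ((by fun_prop : ContinuousAt (fun t => (1 - q ^ (n - M)) *
      (1 - A t * B t * C t * q ^ (n + M + 2)) * (1 - B t * q ^ (n + 1))) x).div (by fun_prop)
      (hr _ (by omega) (by omega))).mul
      (cancelRatio_continuousAt (hB.mul hC) hr (by omega))

theorem Phi_continuousAt (ε : ℤ) (hA : ContinuousAt A x) (hB : ContinuousAt B x)
    (hC : ContinuousAt C x) (hr : PairReg N q (B x * C x)) {M n : ℤ} (h0 : 0 ≤ n) (h1 : n ≤ M)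
    (h2 : M ≤ N) : ContinuousAt (fun t => Phi ε q (A t) (B t) (C t) M n) x := by
  have hp := PhiPlus_continuousAt hA hB hC hr h0 h1 h2
  have hm := PhiMinus_continuousAt hA hB hC hr h0 h1 h2
  unfold Phi
  split_ifs
  · exact hp
  · exact hm
  · exact hp.neg.sub hm
  · exact continuousAt_const

theorem PhiUp_continuousAt (ε : ℤ) (hq : q ≠ 0) (hR : ContinuousAt R x) (hA : ContinuousAt A x)
    (hB : ContinuousAt B x) (hC : ContinuousAt C x) (hR0 : R x ≠ 0) (hC0 : C x ≠ 0)
    (hr : PairReg N q (B x * C x)) {M n : ℤ} (h0 : 0 ≤ n) (h1 : n ≤ M) (h2 : M < N) :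
    ContinuousAt (fun t => PhiUp ε q (R t) (A t) (B t) (C t) M n) x := by
  have hp : ContinuousAt (fun t => PhiUpPlus q (R t) (A t) (B t) (C t) M n) x := by
    by_cases hn : n = 0
    · subst hn
      simp only [PhiUpPlus_zero]
      exact continuousAt_const
    · unfold PhiUpPlus
      exact ContinuousAt.div (by fun_prop) (by fun_prop)
        (mul_ne_zero (hr _ (by omega) (by omega)) (hr _ (by omega) (by omega)))
  have hm : ContinuousAt (fun t => PhiUpMinus q (R t) (A t) (B t) (C t) M n) x := by
    unfold PhiUpMinus
    exact ContinuousAt.mul (ContinuousAt.div (by fun_prop) (by fun_prop) (mul_ne_zero (mul_ne_zero (mul_ne_zero hC0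
      (zpow_ne_zero _ hq)) hR0) (hr _ (by omega) (by omega))))
      (cancelRatio_continuousAt (hB.mul hC) hr (by omega))
  unfold PhiUp
  split_ifs
  · exact hp
  · exact hm
  · exact ContinuousAt.sub (hp.neg.sub hm) (ContinuousAt.div (by fun_prop) (by fun_prop) (mul_ne_zero
      (mul_ne_zero hC0 (zpow_ne_zero _ hq)) hR0))
  · exact continuousAt_const

theorem PhiDown_continuousAt (ε : ℤ) (hq : q ≠ 0) (hR : ContinuousAt R x)
    (hB : ContinuousAt B x) (hC : ContinuousAt C x)
    (hr : PairReg N q (B x * C x)) {M n : ℤ} (h0 : 0 ≤ n) (h1 : n ≤ M) (h2 : M ≤ N) :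
    ContinuousAt (fun t => PhiDown ε q (R t) (A t) (B t) (C t) M n) x := by
  have hp : ContinuousAt (fun t => PhiDownPlus q (R t) (B t) (C t) M n) x := by
    by_cases hn : n = 0
    · subst hn
      simp only [PhiDownPlus, zpow_zero, sub_self, zero_mul, mul_zero, zero_div]
      exact continuousAt_const
    · unfold PhiDownPlus
      exact ContinuousAt.mul (ContinuousAt.div (by fun_prop) (by fun_prop) (mul_ne_zero
        (zpow_ne_zero _ hq) (hr _ (by omega) (by omega))))
        (cancelRatio_continuousAt (hB.mul hC) hr (by omega))
  have hm : ContinuousAt (fun t => PhiDownMinus q (R t) (B t) (C t) M n) x := by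
    by_cases hn : n = M
    · subst hn
      simp only [PhiDownMinus, zpow_zero, sub_self, zero_mul, mul_zero, zero_div]
      exact continuousAt_const
    · unfold PhiDownMinus
      exact ContinuousAt.mul (ContinuousAt.div (by fun_prop) (by fun_prop) (hr _ (by omega) (by omega)))
        (cancelRatio_continuousAt (hB.mul hC) hr (by omega))
  unfold PhiDown
  split_ifs
  · exact hp
  · exact hm
  · exact ContinuousAt.sub (hp.neg.sub hm) (by fun_prop)
  · exact continuousAt_const

theorem PhiDown_zero_zero (ε : ℤ) (q r a b c : ℂ) : PhiDown ε q r a b c 0 0 = 0 := by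
  simp [PhiDown, PhiDownPlus, PhiDownMinus]

theorem FPlus_continuousAt (hD : ContinuousAt D x) (hE : ContinuousAt E x)
    (hr : PairReg N q (D x * E x)) {n : ℤ} (h0 : 0 ≤ n) (h1 : n < N) :
    ContinuousAt (fun t => FPlus q (D t) (E t) n) x := by
  unfold FPlus
  by_cases hn : n = 0
  · subst hn
    simp only [zpow_zero, sub_self, mul_zero, zero_div]
    exact continuousAt_const
  · exact ContinuousAt.div (by fun_prop) (by fun_prop)
      (mul_ne_zero (hr _ (by omega) (by omega)) (hr _ (by omega) (by omega)))

theorem FPlus_zero (q d e : ℂ) : FPlus q d e 0 = 0 := by simp [FPlus]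

theorem FMinus_continuousAt (hD : ContinuousAt D x) (hE : ContinuousAt E x)
    (hr : PairReg N q (D x * E x)) {n : ℤ} (h0 : 0 ≤ n) (h1 : n < N) :
    ContinuousAt (fun t => FMinus q (D t) (E t) n) x := by
  unfold FMinus
  exact ContinuousAt.mul (ContinuousAt.div (by fun_prop) (by fun_prop) (hr _ (by omega) (by omega)))
    (cancelRatio_continuousAt (hD.mul hE) hr (by omega))

theorem coefAPlus_continuousAt (ε : ℤ) (hq : q ≠ 0) (hR : ContinuousAt R x) (hA : ContinuousAt A x)
    (hB : ContinuousAt B x) (hC : ContinuousAt C x) (hD : ContinuousAt D x) (hE : ContinuousAt E x)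
    (hR0 : R x ≠ 0) (hC0 : C x ≠ 0) (hr : PairReg N q (B x * C x)) (hr' : PairReg N q (D x * E x))
    {i j : ℤ} (hi : 0 ≤ i) (hj : 0 ≤ j) (hij : i + j ≤ N) :
    ContinuousAt (fun t => coefAPlus ε q (R t) (A t) (B t) (C t) (D t) (E t) N i j) x := by
  unfold coefAPlus
  refine (by fun_prop : ContinuousAt (fun t => -C t * q ^ ((N : ℤ) + 1)) x).mul ?_
  split_ifs with hjN
  · unfold cornerProd
    -- For `N = 0` the denominators of the corner coefficient are uncontrolled, but the factor `1 -
    -- q ^ N` makes it identically zero.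
    by_cases hN : N = 0
    · subst hN
      simp only [Nat.cast_zero, neg_zero, zpow_zero, sub_self, mul_zero, zero_div, zero_mul]
      exact continuousAt_const
    · have h2 : 1 - B x * C x * q ^ 2 ≠ 0 := by
        have := hr 2 (by omega) (by omega)
        rwa [zpow_two_eq] at this
      have h3 : C x * q * R x * (1 - B x * C x * q ^ 2) ≠ 0 :=
        mul_ne_zero (mul_ne_zero (mul_ne_zero hC0 hq) hR0) h2
      have h4 : C x * q * R x ≠ 0 := mul_ne_zero (mul_ne_zero hC0 hq) hR0
      refine ContinuousAt.mul (ContinuousAt.div (by fun_prop) (by fun_prop) (hr' _ (by omega) (by omega))) ?_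
      have hz : ContinuousAt (fun t => (1 - A t * B t * C t * q ^ 3) * (1 - B t * q) /
          (C t * q * R t * (1 - B t * C t * q ^ 2))) x :=
        ContinuousAt.div (by fun_prop) (by fun_prop) h3
      split_ifs
      · exact ContinuousAt.div (by fun_prop) (by fun_prop) h3
      · exact ContinuousAt.sub hz (ContinuousAt.div (by fun_prop) (by fun_prop) h4)
      · exact continuousAt_const
  · by_cases hj0 : j = 0
    · subst hj0
      simp only [FPlus_zero, zero_mul]
      exact continuousAt_const
    · exact (FPlus_continuousAt hD hE hr' hj (by omega)).mul
        (PhiUp_continuousAt ε hq hR hA hB hC hR0 hC0 hr hi (by omega) (by omega))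

theorem coefAMinus_continuousAt (ε : ℤ) (hq : q ≠ 0) (hR : ContinuousAt R x)
    (hB : ContinuousAt B x) (hC : ContinuousAt C x) (hD : ContinuousAt D x) (hE : ContinuousAt E x)
    (hr : PairReg N q (B x * C x)) (hr' : PairReg N q (D x * E x))
    {i j : ℤ} (hi : 0 ≤ i) (hj : 0 ≤ j) (hij : i + j ≤ N) :
    ContinuousAt (fun t => coefAMinus ε q (R t) (A t) (B t) (C t) (D t) (E t) N i j) x := by
  unfold coefAMinus
  refine (by fun_prop : ContinuousAt (fun t => -C t * q ^ ((N : ℤ) + 1)) x).mul ?_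
  by_cases hjN : j = N
  -- On the edge `j = N` the block has size zero and all of its coefficients vanish, which makes the
  -- value of `FMinus` irrelevant.
  · obtain rfl : i = 0 := by omega
    simp only [hjN, sub_self, PhiDown_zero_zero, mul_zero]
    exact continuousAt_const
  · exact (FMinus_continuousAt hD hE hr' hj (by omega)).mul
      (PhiDown_continuousAt ε hq hR hB hC hr hi (by omega) (by omega))

theorem coefAZero_continuousAt {ε : ℤ} (hε : ε ≠ 0) (hA : ContinuousAt A x)
    (hB : ContinuousAt B x) (hC : ContinuousAt C x) (hD : ContinuousAt D x) (hE : ContinuousAt E x)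
    (hr : PairReg N q (B x * C x)) (hr' : PairReg N q (D x * E x))
    {i j : ℤ} (hi : 0 ≤ i) (hj : 0 ≤ j) (hij : i + j ≤ N) :
    ContinuousAt (fun t => coefAZero ε q (A t) (B t) (C t) (D t) (E t) N i j) x := by
  unfold coefAZero
  by_cases hjN : j = N
  · obtain rfl : i = 0 := by omega
    simp only [hjN, sub_self, Phi, if_neg hε, PhiPlus_zero, PhiMinus_self, ite_self, mul_zero]
    exact continuousAt_const
  · exact ((by fun_prop : ContinuousAt (fun t => C t * q ^ ((N : ℤ) + 1)) x).mul
      ((FPlus_continuousAt hD hE hr' hj (by omega)).add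
        (FMinus_continuousAt hD hE hr' hj (by omega)))).mul
      (Phi_continuousAt ε hA hB hC hr hi (by omega) (by omega))

theorem coefA_continuousAt (ε ε' : ℤ) (hq : q ≠ 0) (hR : ContinuousAt R x) (hA : ContinuousAt A x)
    (hB : ContinuousAt B x) (hC : ContinuousAt C x) (hD : ContinuousAt D x) (hE : ContinuousAt E x)
    (hR0 : R x ≠ 0) (hC0 : C x ≠ 0) (hr : PairReg N q (B x * C x)) (hr' : PairReg N q (D x * E x))
    {i j : ℤ} (hi : 0 ≤ i) (hj : 0 ≤ j) (hij : i + j ≤ N) :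
    ContinuousAt (fun t => coefA ε ε' q (R t) (A t) (B t) (C t) (D t) (E t) N i j) x := by
  unfold coefA
  split_ifs with h1 h2 h3 h4
  · exact coefAPlus_continuousAt ε hq hR hA hB hC hD hE hR0 hC0 hr hr' hi hj hij
  · exact coefAMinus_continuousAt ε hq hR hB hC hD hE hr hr' hi hj hij
  · exact ((Phi_continuousAt 0 hC hE hD (by rwa [mul_comm (E x)]) hj (by omega) le_rfl).sub
      (coefAZero_continuousAt one_ne_zero hA hB hC hD hE hr hr' hi hj hij)).sub
      (coefAZero_continuousAt (by norm_num) hA hB hC hD hE hr hr' hi hj hij)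
  · exact coefAZero_continuousAt h4 hA hB hC hD hE hr hr' hi hj hij
  · exact continuousAt_const

theorem qPoch_continuousAt (hA : ContinuousAt A x) (n : ℕ) :
    ContinuousAt (fun t => qPoch q (A t) n) x := by
  unfold qPoch
  fun_prop

theorem xi_continuousAt (hA : ContinuousAt A x) (hB : ContinuousAt B x) (hA0 : A x ≠ 0) {n : ℕ}
    (h : ∀ k : ℕ, 1 ≤ k → k ≤ n → 1 - B x ^ 2 * q ^ k ≠ 0) :
    ContinuousAt (fun t => xi q (A t) (B t) n) x := by
  unfold xi
  refine ((qPoch_continuousAt (by fun_prop) n).div (qPoch_continuousAt (by fun_prop) n)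
    (qPoch_ne_zero fun l hl => ?_)).mul ((hB.div hA hA0).pow n)
  convert h (l + 1) (by omega) (by omega) using 2
  ring

theorem racahOmega_continuousAt (hR : ContinuousAt R x) (hA : ContinuousAt A x)
    (hB : ContinuousAt B x) (hC : ContinuousAt C x) (hR0 : R x ≠ 0)
    (hr : PairReg N q (B x * C x)) {M n : ℕ} (hn : n ≤ M) (hM : M ≤ N)
    (hc : ∀ k : ℕ, 1 ≤ k → k ≤ N → 1 - C x * q ^ k ≠ 0) :
    ContinuousAt (fun t => racahOmega q (R t) (A t) (B t) (C t) M n) x := by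
  unfold racahOmega
  refine ContinuousAt.div ?_ ?_ (mul_ne_zero (mul_ne_zero (zpow_ne_zero _ hR0)
    (Finset.prod_ne_zero_iff.2 fun l hl => ?_)) (qPoch_ne_zero fun l hl => ?_))
  · exact continuousAt_const.mul (((qPoch_continuousAt (by fun_prop) _).mul
      (qPoch_continuousAt (by fun_prop) _)).mul (qPoch_continuousAt (by fun_prop) _))
  · exact ((hR.zpow₀ _ (Or.inl hR0)).mul (by fun_prop)).mul (qPoch_continuousAt (by fun_prop) _)
  · rw [Finset.mem_erase, Finset.mem_range] at hl
    have := hr (n + 1 + l : ℕ) (by omega) (by omega)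
    rw [zpow_natCast, pow_add] at this
    rwa [mul_assoc (B x * C x)]
  · convert hc (l + 1) (by omega) (by omega) using 2
    ring

theorem racahP_continuousAt (hq : q ≠ 0) (hR : ContinuousAt R x) (hA : ContinuousAt A x)
    (hB : ContinuousAt B x) (hC : ContinuousAt C x) (hR0 : R x ≠ 0)
    (hr : PairReg N q (B x * C x)) {M : ℕ} (n m : ℕ) (hM : M ≤ N)
    (hqk : ∀ k : ℕ, 1 ≤ k → k ≤ N → 1 - q ^ k ≠ 0)
    (hb : ∀ k : ℕ, 1 ≤ k → k ≤ N → 1 - B x * q ^ k ≠ 0)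
    (hc : ∀ k : ℕ, 1 ≤ k → k ≤ N → 1 - C x * q ^ k ≠ 0)
    (habc : ∀ k : ℕ, M + 2 ≤ k → k ≤ 2 * M + 1 → 1 - A x * B x * C x * q ^ k ≠ 0) :
    ContinuousAt (fun t => racahP q (R t) (A t) (B t) (C t) M n m) x := by
  unfold racahP
  split_ifs with h
  · refine (racahOmega_continuousAt hR hA hB hC hR0 hr h.1 hM hc).mul ?_
    unfold phi43
    refine tendsto_finsetSum _ fun k hk => ?_
    rw [Finset.mem_range] at hk
    refine ContinuousAt.mul (ContinuousAt.div ?_ ?_ (mul_ne_zero (mul_ne_zero ?_ ?_) ?_))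
      continuousAt_const
    · exact ((continuousAt_const.mul (qPoch_continuousAt (by fun_prop) _)).mul
        continuousAt_const).mul (qPoch_continuousAt (by fun_prop) _)
    · exact ((qPoch_continuousAt (by fun_prop) _).mul (qPoch_continuousAt (by fun_prop) _)).mul
        continuousAt_const
    · refine qPoch_ne_zero fun l hl => ?_
      convert hb (l + 1) (by omega) (by omega) using 2
      ring
    · refine qPoch_ne_zero fun l hl => ?_
      convert habc (M + 2 + l) (by omega) (by omega) using 2
      ring
    · refine qPoch_ne_zero fun l hl => ?_
      have h0 := hqk (M - l) (by omega) (by omega)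
      have e : q ^ M = q ^ (M - l) * q ^ l := by rw [← pow_add]; congr 1; omega
      have n1 := pow_ne_zero l hq
      have n2 := pow_ne_zero (M - l) hq
      rw [zpow_neg, zpow_natCast, e]
      intro h
      field_simp at h
      exact h0 (by rw [mul_zero] at h; linear_combination -h)
  · exact continuousAt_const

end Continuity

end QRacahAW4

namespace QRacahAW4

/-! ### Continuity of the matrices -/

section MatrixContinuity

open Filter Topology

variable {N : ℕ} {p : ℂ} {s : Fin 5 → ℂ} {a b c d e : Fin 5}

theorem coord_continuousAt (i : Fin 5) : ContinuousAt (fun σ : Fin 5 → ℂ => σ i) s :=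
  continuousAt_apply i s

theorem coord_sq_continuousAt (i : Fin 5) : ContinuousAt (fun σ : Fin 5 → ℂ => σ i ^ 2) s :=
  (coord_continuousAt i).pow 2

theorem mat_continuousAt_of_entries {F : (Fin 5 → ℂ) → Mat N}
    (h : ∀ y x, ContinuousAt (fun σ => F σ y x) s) : ContinuousAt F s :=
  continuousAt_pi.2 fun y => continuousAt_pi.2 fun x => h y x

theorem lam_continuousAt (q : ℂ) (i j : Fin 5) (n : ℤ) :
    ContinuousAt (fun σ : Fin 5 → ℂ => lam q (σ i ^ 2 * σ j ^ 2) n) s := by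
  unfold lam
  fun_prop

theorem diagFst_continuousAt (i j : Fin 5) : ContinuousAt (fun σ => diagFst N p σ i j) s :=
  mat_continuousAt_of_entries fun y x => by
    simp only [diagFst, Matrix.diagonal_apply]
    split_ifs
    · exact lam_continuousAt _ _ _ _
    · exact continuousAt_const

theorem diagSnd_continuousAt (i j : Fin 5) : ContinuousAt (fun σ => diagSnd N p σ i j) s :=
  mat_continuousAt_of_entries fun y x => by
    simp only [diagSnd, Matrix.diagonal_apply]
    split_ifs
    · exact lam_continuousAt _ _ _ _
    · exact continuousAt_const

namespace Adm

theorem pair_fst (H : Adm N p s a b c d e) : PairReg N (p ^ 2) (s b ^ 2 * s c ^ 2) := by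
  intro k h1 h2
  lift k to ℕ using by omega
  rw [zpow_natCast]
  exact H.fst k (by omega) (by omega)

theorem pair_snd (H : Adm N p s a b c d e) : PairReg N (p ^ 2) (s e ^ 2 * s d ^ 2) :=
  H.dual.pair_fst

/-- The constraint pairs the exponent `k` with `2N + 3 - k` for the complementary pair, and the
stated range is mapped into the admissible one. -/
theorem triple_ne (H : Adm N p s a b c d e) {M : ℕ} (hM : M ≤ N) (k : ℕ) (h1 : M + 2 ≤ k)
    (h2 : k ≤ 2 * M + 1) : 1 - s a ^ 2 * s b ^ 2 * s c ^ 2 * (p ^ 2) ^ k ≠ 0 := by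
  intro h
  apply H.snd (2 * N + 3 - k) (by omega) (by omega)
  have hc := H.constr
  rw [← prod_of_nodup H.nodup] at hc
  have hc2 : (p ^ 2) ^ k * (p ^ 2) ^ (2 * N + 3 - k) * (s a * s b * s c * s d * s e) ^ 2 = 1 := by
    rw [← pow_add, show k + (2 * N + 3 - k) = 2 * N + 3 by omega, ← pow_mul,
      mul_comm 2, pow_mul, ← mul_pow, hc, one_pow]
  linear_combination -(s d ^ 2 * s e ^ 2 * (p ^ 2) ^ (2 * N + 3 - k)) * h - hc2

theorem triSnd_continuousAt (H : Adm N p s a b c d e) :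
    ContinuousAt (fun σ => triSnd N p σ a e d) s :=
  mat_continuousAt_of_entries fun y x => by
    simp only [triSnd, Matrix.of_apply]
    have := x.le
    split_ifs
    · exact Phi_continuousAt (N := N) _ (coord_sq_continuousAt a) (coord_sq_continuousAt e)
        (coord_sq_continuousAt d) H.pair_snd (by omega) (by omega) (by omega)
    · exact continuousAt_const

theorem xi_continuousAt (H : Adm N p s a b c d e) (i j : Fin 5) {n : ℕ} (hn : n ≤ N) :
    ContinuousAt (fun σ : Fin 5 → ℂ => xi (p ^ 2) (σ i) (σ j) n) s :=
  QRacahAW4.xi_continuousAt (coord_continuousAt i) (coord_continuousAt j) (H.s0 i)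
    fun k h1 h2 => H.single j k h1 (h2.trans hn)

theorem triFst_continuousAt (H : Adm N p s a b c d e) :
    ContinuousAt (fun σ => triFst N p σ a b c d) s :=
  mat_continuousAt_of_entries fun y x => by
    simp only [triFst, Matrix.of_apply]
    have hx := x.le
    have hy := y.le
    split_ifs
    · refine ContinuousAt.mul (ContinuousAt.mul ?_ ?_) ?_
      · exact Phi_continuousAt (N := N) _ (coord_sq_continuousAt a) (coord_sq_continuousAt b)
          (coord_sq_continuousAt c) H.pair_fst (by omega) (by omega) (by omega)
      · exact ((coord_continuousAt a).div (coord_continuousAt d) (H.s0 d)).zpow₀ _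
          (Or.inl (div_ne_zero (H.s0 a) (H.s0 d)))
      · exact (H.xi_continuousAt b c (by omega)).div (H.xi_continuousAt b c (by omega))
          (H.xi_ne_zero b c (by omega))
    · exact continuousAt_const

theorem nineDiag_continuousAt (H : Adm N p s a b c d e) :
    ContinuousAt (fun σ => nineDiag N p σ a e d b c) s :=
  mat_continuousAt_of_entries fun y x => by
    simp only [nineDiag_apply]
    have hx := x.le
    exact coefA_continuousAt _ _ (pow_ne_zero 2 H.p0)
      (continuousAt_const.mul (coord_continuousAt e)) (coord_sq_continuousAt a)
      (coord_sq_continuousAt e) (coord_sq_continuousAt d) (coord_sq_continuousAt b)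
      (coord_sq_continuousAt c) (mul_ne_zero H.p0 (H.s0 e)) (pow_ne_zero 2 (H.s0 d)) H.pair_snd
      H.pair_fst (by omega) (by omega) (by omega)

theorem chgUp_continuousAt (H : Adm N p s a b c d e) :
    ContinuousAt (fun σ => chgUp N p σ a b c d) s :=
  mat_continuousAt_of_entries fun x y => by
    simp only [chgUp, Matrix.of_apply]
    have hx := x.le
    split_ifs
    · refine ContinuousAt.mul (ContinuousAt.mul ?_ ?_) ?_
      · exact ((coord_continuousAt d).div (coord_continuousAt a) (H.s0 a)).pow _
      · exact H.xi_continuousAt c b (by omega)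
      · exact racahP_continuousAt (N := N) (pow_ne_zero 2 H.p0)
          (continuousAt_const.mul (coord_continuousAt b)) (coord_sq_continuousAt a)
          (coord_sq_continuousAt b) (coord_sq_continuousAt c) (mul_ne_zero H.p0 (H.s0 b)) H.pair_fst
          _ _ (Nat.sub_le _ _) H.qk (H.single b) (H.single c) (H.triple_ne (Nat.sub_le _ _))
    · exact continuousAt_const

/-- The denominators of this matrix contain the product of `b` and `a`, which belongs to the
following frame; hence admissibility of both neighbours is used. -/
theorem chgDown_continuousAt (H : Adm N p s a b c d e) (H' : Adm N p s c d e a b) :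
    ContinuousAt (fun σ => chgDown N p σ c b a d) s :=
  mat_continuousAt_of_entries fun x y => by
    simp only [chgDown, Matrix.of_apply]
    have hy := y.le
    split_ifs
    · refine ContinuousAt.mul (ContinuousAt.mul ?_ ?_) ?_
      · exact ((coord_continuousAt a).div (coord_continuousAt d) (H.s0 d)).pow _
      · exact H.xi_continuousAt b c (by omega)
      · refine racahP_continuousAt (N := N) (pow_ne_zero 2 H.p0)
          (continuousAt_const.mul (coord_continuousAt b)) (coord_sq_continuousAt c)
          (coord_sq_continuousAt b) (coord_sq_continuousAt a) (mul_ne_zero H.p0 (H.s0 b)) H'.pair_snd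
          _ _ (Nat.sub_le _ _) H.qk (H.single b) (H.single a) fun k h1 h2 => ?_
        rw [mul_right_comm, mul_comm (s c ^ 2), mul_right_comm]
        convert H.triple_ne (Nat.sub_le N y.snd) k h1 h2 using 3
        ring
    · exact continuousAt_const

end Adm

/-! ### The frames of the five labels -/

/-- The conditions on the parameters for a label. -/
def LabelAdm (N : ℕ) (p : ℂ) (s : Fin 5 → ℂ) : Label → Prop
  | .A => Adm N p s 3 2 1 0 4
  | .B => Adm N p s 1 0 4 3 2
  | .C => Adm N p s 4 3 2 1 0
  | .D => Adm N p s 2 1 0 4 3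
  | .E => Adm N p s 0 4 3 2 1

theorem mat_continuousAt {X : Label} (H : LabelAdm N p s X) (I : Mid) :
    ContinuousAt (fun σ => mat N p σ X I) s := by
  cases X
  · have H : Adm N p s 3 2 1 0 4 := H
    cases I
    exacts [diagFst_continuousAt _ _, H.triFst_continuousAt, H.triSnd_continuousAt,
      diagSnd_continuousAt _ _, H.nineDiag_continuousAt]
  · have H : Adm N p s 1 0 4 3 2 := H
    cases I
    exacts [H.triSnd_continuousAt, diagSnd_continuousAt _ _, H.nineDiag_continuousAt,
      diagFst_continuousAt _ _, H.triFst_continuousAt]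
  · have H : Adm N p s 4 3 2 1 0 := H
    cases I
    exacts [H.nineDiag_continuousAt, diagFst_continuousAt _ _, H.triFst_continuousAt,
      H.triSnd_continuousAt, diagSnd_continuousAt _ _]
  · have H : Adm N p s 2 1 0 4 3 := H
    cases I
    exacts [H.triFst_continuousAt, H.triSnd_continuousAt, diagSnd_continuousAt _ _,
      H.nineDiag_continuousAt, diagFst_continuousAt _ _]
  · have H : Adm N p s 0 4 3 2 1 := H
    cases I
    exacts [diagSnd_continuousAt _ _, H.nineDiag_continuousAt, diagFst_continuousAt _ _,
      H.triFst_continuousAt, H.triSnd_continuousAt]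

theorem chg_continuousAt {X : Label} (H : LabelAdm N p s X) :
    ContinuousAt (fun σ => chg N p σ X) s := by
  cases X
  exacts [Adm.chgUp_continuousAt (e := 4) H, Adm.chgUp_continuousAt (e := 2) H,
    Adm.chgUp_continuousAt (e := 0) H, Adm.chgUp_continuousAt (e := 3) H,
    Adm.chgUp_continuousAt (e := 1) H]

theorem chgInv_continuousAt {X : Label} (H : LabelAdm N p s X) (H' : LabelAdm N p s X.next) :
    ContinuousAt (fun σ => chgInv N p σ X) s := by
  cases X
  exacts [Adm.chgDown_continuousAt (e := 4) H H', Adm.chgDown_continuousAt (e := 2) H H',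
    Adm.chgDown_continuousAt (e := 0) H H', Adm.chgDown_continuousAt (e := 3) H H',
    Adm.chgDown_continuousAt (e := 1) H H']

theorem LabelAdm.p0 {X : Label} (H : LabelAdm N p s X) : p ≠ 0 := by
  cases X <;> exact Adm.p0 H

theorem LabelAdm.s0 {X : Label} (H : LabelAdm N p s X) (i : Fin 5) : s i ≠ 0 := by
  cases X <;> exact Adm.s0 H i

theorem LabelAdm.constr {X : Label} (H : LabelAdm N p s X) : p ^ (2 * N + 3) * ∏ i, s i = 1 := by
  cases X <;> exact Adm.constr H

theorem LabelAdm.qk {X : Label} (H : LabelAdm N p s X) (k : ℕ) (h1 : 1 ≤ k) (h2 : k ≤ N) :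
    1 - (p ^ 2) ^ k ≠ 0 := by
  cases X <;> exact Adm.qk H k h1 h2

theorem smul_add_continuousAt {f : (Fin 5 → ℂ) → ℂ} {F : (Fin 5 → ℂ) → Mat N}
    (hf : ContinuousAt f s) (hF : ContinuousAt F s) (h0 : f s ≠ 0) :
    ContinuousAt (fun σ => f σ • F σ + (f σ + 1 / f σ) • (1 : Mat N)) s :=
  (hf.smul hF).add ((hf.add (continuousAt_const.div hf h0)).smul continuousAt_const)

theorem genImage_continuousAt {X : Label} (H : LabelAdm N p s X) (I : Gen) :
    ContinuousAt (fun σ => genImage N p σ (mat N p σ X) I) s := by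
  have hp := H.p0
  have h1 : ∀ i : Fin 5, ContinuousAt (fun σ : Fin 5 → ℂ => (σ i + 1 / σ i) • (1 : Mat N)) s :=
    fun i => ((coord_continuousAt i).add (continuousAt_const.div (coord_continuousAt i)
      (H.s0 i))).smul continuousAt_const
  have h2 : ∀ (i j : Fin 5) (I : Mid), ContinuousAt (fun σ : Fin 5 → ℂ =>
      (1 / (p * σ i * σ j)) • mat N p σ X I + (p * σ i * σ j + 1 / (p * σ i * σ j)) • (1 : Mat N)) s :=
    fun i j I => by
      have g : ContinuousAt (fun σ : Fin 5 → ℂ => p * σ i * σ j) s := by fun_prop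
      have g0 : p * s i * s j ≠ 0 := mul_ne_zero (mul_ne_zero hp (H.s0 i)) (H.s0 j)
      have g1 := continuousAt_const (y := (1 : ℂ)).div g g0
      exact (g1.smul (mat_continuousAt H I)).add ((g.add g1).smul continuousAt_const)
  have h3 : ∀ (i j k : Fin 5) (I : Mid), ContinuousAt (fun σ : Fin 5 → ℂ =>
      (p ^ (2 * N + 2) * σ i * σ j * σ k) • mat N p σ X I + (p ^ (2 * N + 2) * σ i * σ j * σ k +
        1 / (p ^ (2 * N + 2) * σ i * σ j * σ k)) • (1 : Mat N)) s :=
    fun i j k I => smul_add_continuousAt (by fun_prop) (mat_continuousAt H I)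
      (mul_ne_zero (mul_ne_zero (mul_ne_zero (pow_ne_zero _ hp) (H.s0 i)) (H.s0 j)) (H.s0 k))
  cases I
  exacts [h1 1, h1 2, h1 3, h1 4, h2 1 2 _, h2 2 3 _, h2 3 4 _, h3 1 2 3 _, h3 2 3 4 _, h1 0]

theorem freeRep_continuousAt {X : Label} (H : LabelAdm N p s X) (u : FreeAlgebra ℂ Gen) :
    ContinuousAt (fun σ => freeRep N p σ X u) s := by
  induction u using FreeAlgebra.induction with
  | grade0 r => simp only [AlgHom.commutes]; exact continuousAt_const
  | grade1 I =>
    have := genImage_continuousAt H I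
    simp only [← freeRep_gen] at this
    exact this
  | mul u v hu hv => simp only [map_mul]; exact hu.mul hv
  | add u v hu hv => simp only [map_add]; exact hu.add hv

/-! ### Generic parameters are dense -/

/-- A non-constant monomial takes a given value finitely often, and a finite set without the base
point is avoided near that point. -/
theorem eventually_zpow_ne {m : ℤ} (hm : m ≠ 0) (z : ℂ) : ∀ᶠ t : ℂ in 𝓝[≠] 1, t ^ m ≠ z := by
  have key : ∀ (n : ℕ) (w : ℂ), 0 < n → ∀ᶠ t : ℂ in 𝓝[≠] 1, t ^ n ≠ w := by
    intro n w hn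
    have hfin : {t : ℂ | t ^ n = w}.Finite := by
      refine (Polynomial.nthRoots n w).toFinset.finite_toSet.subset fun t ht => ?_
      simpa [Polynomial.mem_nthRoots hn] using ht
    have h2 : ({t : ℂ | t ^ n = w} \ {1})ᶜ ∈ 𝓝 (1 : ℂ) :=
      (hfin.subset Set.sdiff_subset).isClosed.isOpen_compl.mem_nhds (by simp)
    filter_upwards [mem_nhdsWithin_of_mem_nhds h2, self_mem_nhdsWithin] with t ht1 ht2 h
    exact ht1 ⟨h, ht2⟩
  rcases lt_or_gt_of_ne hm with h | h
  · filter_upwards [key m.natAbs z⁻¹ (by omega)] with t ht h0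
    apply ht
    rw [← h0, ← zpow_natCast, ← zpow_neg]
    congr 1
    omega
  · filter_upwards [key m.natAbs z (by omega)] with t ht h0
    apply ht
    rw [← h0, ← zpow_natCast]
    congr 1
    omega

/-- Exponents of a path through the parameter space. -/
def pathExp : Fin 5 → ℤ := ![1, 2, 3, 4, -10]

/-- A path of parameters that satisfy the constraint. -/
noncomputable def path (s : Fin 5 → ℂ) (t : ℂ) : Fin 5 → ℂ := fun i => s i * t ^ pathExp i

theorem path_one (s : Fin 5 → ℂ) : path s 1 = s := by
  funext i
  simp [path]

theorem path_continuousAt (s : Fin 5 → ℂ) : ContinuousAt (path s) 1 :=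
  continuousAt_pi.2 fun _ => continuousAt_const.mul
    (continuousAt_id.zpow₀ _ (Or.inl one_ne_zero))

theorem eventually_reg {q x : ℂ} {m : ℤ} (hm : m ≠ 0) (K : ℕ) :
    ∀ᶠ t : ℂ in 𝓝[≠] 1, Reg q K (x * t ^ m) := by
  have h : ∀ᶠ t : ℂ in 𝓝[≠] 1, ∀ k ∈ Finset.Icc (-(K : ℤ)) K, t ^ m ≠ (x * q ^ k)⁻¹ :=
    (eventually_all_finset _).2 fun k _ => eventually_zpow_ne hm _
  filter_upwards [h] with t ht k h1 h2 h0
  refine ht k (Finset.mem_Icc.2 ⟨h1, h2⟩) ?_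
  refine eq_inv_of_mul_eq_one_left ?_
  linear_combination -h0

theorem eventually_generic (hc : p ^ (2 * N + 3) * ∏ i, s i = 1) (hq2 : (p ^ 2) ^ 2 ≠ 1)
    (hqk : ∀ k : ℕ, 1 ≤ k → k ≤ N → 1 - (p ^ 2) ^ k ≠ 0) :
    ∀ᶠ t : ℂ in 𝓝[≠] 1, Generic N p (path s t) := by
  have h1 : ∀ᶠ t : ℂ in 𝓝[≠] 1, ∀ i, Reg (p ^ 2) (6 * N + 15) (s i ^ 2 * t ^ (2 * pathExp i)) :=
    eventually_all.2 fun i => eventually_reg (m := 2 * pathExp i)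
      (by fin_cases i <;> simp [pathExp]) _
  have h2 : ∀ᶠ t : ℂ in 𝓝[≠] 1, ∀ i j, i ≠ j → Reg (p ^ 2) (6 * N + 15)
      (s i ^ 2 * s j ^ 2 * t ^ (2 * pathExp i + 2 * pathExp j)) :=
    eventually_all.2 fun i => eventually_all.2 fun j => by
      by_cases hij : i = j
      · exact Eventually.of_forall fun t h => absurd hij h
      -- The exponents of the path are chosen so that no two of them cancel; every condition on a
      -- pair is then violated at finitely many points only.
      · have hw : 2 * pathExp i + 2 * pathExp j ≠ 0 := by
          revert i j
          decide
        filter_upwards [eventually_reg hw (6 * N + 15)] with t ht _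
        exact ht
  have h3 : ∀ᶠ t : ℂ in 𝓝[≠] 1, t ≠ 0 :=
    mem_nhdsWithin_of_mem_nhds (isOpen_ne.mem_nhds one_ne_zero)
  filter_upwards [h1, h2, h3] with t g1 g2 g3
  have e : ∀ i, path s t i ^ 2 = s i ^ 2 * t ^ (2 * pathExp i) := fun i => by
    rw [path, mul_pow, zpow_double]
  refine ⟨?_, hq2, hqk, fun i => ?_, fun i j hij => ?_⟩
  -- The exponents add up to zero, so the path stays on the constraint.
  · have : ∏ i, t ^ pathExp i = 1 := by
      rw [Fin.prod_univ_five, ← zpow_add₀ g3, ← zpow_add₀ g3, ← zpow_add₀ g3, ← zpow_add₀ g3]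
      simp [pathExp]
    simp only [path]
    rw [Finset.prod_mul_distrib, this, mul_one, hc]
  · rw [e]; exact g1 i
  · have := g2 i j hij
    rw [zpow_add₀ g3] at this
    rw [e, e]
    convert this using 1
    ring

/-- An identity between continuous matrix functions that holds for generic parameters holds for
all parameters. -/
theorem eq_of_generic {X : Label} (H : LabelAdm N p s X) (hq2 : (p ^ 2) ^ 2 ≠ 1)
    {F F' : (Fin 5 → ℂ) → Mat N} (hF : ContinuousAt F s) (hF' : ContinuousAt F' s)
    (h : ∀ σ, Generic N p σ → F σ = F' σ) : F s = F' s := by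
  have hpath : Tendsto (path s) (𝓝[≠] 1) (𝓝 s) := by
    have := (path_continuousAt s).tendsto
    rw [path_one] at this
    exact this.mono_left nhdsWithin_le_nhds
  -- Near the base point the path is generic except possibly at the base point itself, hence limits
  -- are compared along the punctured neighbourhood.
  refine tendsto_nhds_unique_of_eventuallyEq (hF.tendsto.comp hpath) (hF'.tendsto.comp hpath) ?_
  filter_upwards [eventually_generic H.constr hq2 H.qk] with t ht
  exact h _ ht

theorem LabelAdm.freeRep_rel {X : Label} (H : LabelAdm N p s X) (hq2 : (p ^ 2) ^ 2 ≠ 1)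
    {u v : FreeAlgebra ℂ Gen} (h : Rel p u v) : freeRep N p s X u = freeRep N p s X v :=
  eq_of_generic H hq2 (freeRep_continuousAt H u) (freeRep_continuousAt H v)
    fun _ G => QRacahAW4.freeRep_rel G X h

theorem LabelAdm.chg_mul_chgInv {X : Label} (H : LabelAdm N p s X) (H' : LabelAdm N p s X.next)
    (hq2 : (p ^ 2) ^ 2 ≠ 1) : chg N p s X * chgInv N p s X = 1 :=
  eq_of_generic (F' := fun _ => 1) H hq2 ((chg_continuousAt H).mul (chgInv_continuousAt H H'))
    continuousAt_const fun _ G => QRacahAW4.chg_mul_chgInv G X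

theorem LabelAdm.chg_mul_mat {X : Label} (H : LabelAdm N p s X) (H' : LabelAdm N p s X.next)
    (hq2 : (p ^ 2) ^ 2 ≠ 1) (I : Mid) :
    chg N p s X * mat N p s X.next I = mat N p s X I * chg N p s X :=
  eq_of_generic H hq2 ((chg_continuousAt H).mul (mat_continuousAt H' I))
    ((mat_continuousAt H I).mul (chg_continuousAt H)) fun _ G => QRacahAW4.chg_mul_mat G X I

end MatrixContinuity

end QRacahAW4

namespace QRacahAW4

/-! ### Irreducibility -/

section Irreducible

variable {N : ℕ} {p : ℂ} {s : Fin 5 → ℂ} {a b c d e : Fin 5} {W : Submodule ℂ (Idx N → ℂ)}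

/-- The two diagonal matrices have simple joint spectrum, so a vector can be stripped of its other
coordinates one at a time within an invariant subspace. -/
theorem Adm.single_mem (H : Adm N p s a b c d e)
    (h₁ : ∀ v ∈ W, (diagFst N p s b c).mulVec v ∈ W)
    (h₂ : ∀ v ∈ W, (diagSnd N p s e d).mulVec v ∈ W) {v : Idx N → ℂ} (hv : v ∈ W) {x : Idx N}
    (hx : v x ≠ 0) : Pi.single x 1 ∈ W := by
  have key : ∀ S : Finset (Idx N), x ∉ S → ∃ w ∈ W, w x ≠ 0 ∧ ∀ y ∈ S, w y = 0 := by
    intro S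
    induction S using Finset.induction_on with
    | empty => exact fun _ => ⟨v, hv, hx, by simp⟩
    | insert y S hy ih =>
      intro hxS
      rw [Finset.mem_insert, not_or] at hxS
      obtain ⟨w, hw, hwx, hwS⟩ := ih hxS.2
      have hxl := x.le
      have hyl := y.le
      -- Subtracting the eigenvalue at `y` kills that coordinate, rescales the coordinate at `x` by
      -- a non-zero factor and keeps the earlier zeros.
      have step : ∀ μ : Idx N → ℂ, (∀ v ∈ W, (Matrix.diagonal μ).mulVec v ∈ W) → μ x ≠ μ y →
          ∃ w ∈ W, w x ≠ 0 ∧ ∀ z ∈ insert y S, w z = 0 := by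
        intro μ hμ hne
        refine ⟨(Matrix.diagonal μ).mulVec w - μ y • w, W.sub_mem (hμ w hw) (W.smul_mem _ hw), ?_,
          fun z hz => ?_⟩
        · simp only [Pi.sub_apply, Matrix.mulVec_diagonal, Pi.smul_apply, smul_eq_mul]
          rw [← sub_mul]
          exact mul_ne_zero (sub_ne_zero.2 hne) hwx
        · simp only [Pi.sub_apply, Matrix.mulVec_diagonal, Pi.smul_apply, smul_eq_mul]
          rcases Finset.mem_insert.1 hz with rfl | hz
          · ring
          · rw [hwS z hz]; ring
      by_cases hf : x.fst = y.fst
      · have hs : x.snd ≠ y.snd := fun h => hxS.1 (Idx.ext hf h)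
        exact step _ h₂ fun h => hs (H.dual.lam_injective (by omega) (by omega) h)
      · exact step _ h₁ fun h => hf (H.lam_injective (by omega) (by omega) h)
  obtain ⟨w, hw, hwx, hw0⟩ := key (Finset.univ.erase x) (by simp)
  have : Pi.single x 1 = (w x)⁻¹ • w := by
    funext y
    by_cases hy : y = x
    · subst hy
      simp [hwx]
    · simp [hy, hw0 y (by simp [hy])]
  rw [this]
  exact W.smul_mem _ hw

/-- A non-zero subspace that is invariant under the two diagonal and the two tridiagonal matrices
of a frame is the whole space. -/
theorem Adm.eq_bot_or_eq_top (H : Adm N p s a b c d e)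
    (h₁ : ∀ v ∈ W, (diagFst N p s c b).mulVec v ∈ W)
    (h₂ : ∀ v ∈ W, (diagSnd N p s e d).mulVec v ∈ W)
    (h₃ : ∀ v ∈ W, (triFst N p s a b c d).mulVec v ∈ W)
    (h₄ : ∀ v ∈ W, (triSnd N p s a e d).mulVec v ∈ W) : W = ⊥ ∨ W = ⊤ := by
  rw [diagFst_comm] at h₁
  by_cases hW : W = ⊥
  · exact Or.inl hW
  right
  obtain ⟨v, hv, hv0⟩ := W.ne_bot_iff.1 hW
  obtain ⟨x, hx⟩ := Function.ne_iff.1 hv0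
  -- A column of a tridiagonal matrix has a non-zero entry at each neighbour, and `single_mem`
  -- extracts the corresponding basis vector.
  have step : ∀ x y : Idx N, Pi.single x (1 : ℂ) ∈ W →
      (x.snd = y.snd ∧ (x.fst = y.fst + 1 ∨ y.fst = x.fst + 1) ∨
        x.fst = y.fst ∧ (x.snd = y.snd + 1 ∨ y.snd = x.snd + 1)) → Pi.single y (1 : ℂ) ∈ W := by
    rintro x y hx (⟨g1, g2⟩ | ⟨g1, g2⟩)
    · refine H.single_mem h₁ h₂ (h₃ _ hx) (x := y) ?_
      rw [Matrix.mulVec_single_one]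
      exact H.triFst_ne_zero g1.symm (by omega)
    · refine H.single_mem h₁ h₂ (h₄ _ hx) (x := y) ?_
      rw [Matrix.mulVec_single_one]
      exact H.triSnd_ne_zero g1.symm (by omega)
  -- The triangle is traversed through its corner: down to the origin, and then up to every other
  -- index.
  have hdown : ∀ n, ∀ x : Idx N, x.fst + x.snd = n → Pi.single x (1 : ℂ) ∈ W →
      Pi.single (Idx.mk 0 0 (Nat.zero_le N)) (1 : ℂ) ∈ W := by
    intro n
    induction n with
    | zero =>
      intro x hx h
      rwa [show Idx.mk 0 0 (Nat.zero_le N) = x from Idx.ext (by simp; omega) (by simp; omega)]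
    | succ n ih =>
      intro x hx h
      have := x.le
      by_cases hf : x.fst = 0
      · exact ih (Idx.mk x.fst (x.snd - 1) (by omega)) (by simp; omega)
          (step _ _ h (Or.inr (by simp; omega)))
      · exact ih (Idx.mk (x.fst - 1) x.snd (by omega)) (by simp; omega)
          (step _ _ h (Or.inl (by simp; omega)))
  have h0 := hdown _ x rfl (H.single_mem h₁ h₂ hv hx)
  have hup : ∀ n, ∀ x : Idx N, x.fst + x.snd = n → Pi.single x (1 : ℂ) ∈ W := by
    intro n
    induction n with
    | zero =>
      intro x hx
      rwa [show x = Idx.mk 0 0 (Nat.zero_le N) from Idx.ext (by simp; omega) (by simp; omega)]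
    | succ n ih =>
      intro x hx
      have := x.le
      by_cases hf : x.fst = 0
      · exact step _ _ (ih (Idx.mk x.fst (x.snd - 1) (by omega)) (by simp; omega))
          (Or.inr (by simp; omega))
      · exact step _ _ (ih (Idx.mk (x.fst - 1) x.snd (by omega)) (by simp; omega))
          (Or.inl (by simp; omega))
  refine (Submodule.eq_top_iff').2 fun v => ?_
  have : v = ∑ x, v x • Pi.single x (1 : ℂ) := by
    funext y
    simp [Finset.sum_apply, Pi.single_apply]
  rw [this]
  exact W.sum_mem fun x _ => W.smul_mem _ (hup _ x rfl)

theorem mulVec_mem_of_smul_add {M : Mat N} {w z : ℂ} (hw : w ≠ 0)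
    (h : ∀ v ∈ W, (w • M + z • (1 : Mat N)).mulVec v ∈ W) : ∀ v ∈ W, M.mulVec v ∈ W := by
  intro v hv
  have h1 := h v hv
  rw [Matrix.add_mulVec, Matrix.smul_mulVec, Matrix.smul_mulVec, Matrix.one_mulVec] at h1
  have h2 := (W.add_mem_iff_left (W.smul_mem z hv)).1 h1
  have h3 := W.smul_mem w⁻¹ h2
  rwa [smul_smul, inv_mul_cancel₀ hw, one_smul] at h3

end Irreducible

/-! ### Representations of the algebra -/

section Representations

variable {N : ℕ} {p : ℂ} {s : Fin 5 → ℂ} {X Y : Label}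

/-- A representation of the quotient is determined on the free algebra by its values on the
generators. This yields uniqueness and lets intertwiners descend. -/
theorem IsRep.apply_mk {ρ : AW4 p →ₐ[ℂ] Mat N} (h : IsRep N p s X ρ) (u : FreeAlgebra ℂ Gen) :
    ρ (RingQuot.mkAlgHom ℂ (Rel p) u) = freeRep N p s X u := by
  have : ρ.comp (RingQuot.mkAlgHom ℂ (Rel p)) = freeRep N p s X := by
    refine FreeAlgebra.hom_ext (funext fun I => ?_)
    exact (h I).trans (freeRep_gen X I).symm
  rw [← this, AlgHom.comp_apply]

theorem IsRep.unique {ρ τ : AW4 p →ₐ[ℂ] Mat N} (h : IsRep N p s X ρ) (h' : IsRep N p s X τ) :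
    ρ = τ := by
  refine AlgHom.ext fun x => ?_
  obtain ⟨u, rfl⟩ := RingQuot.mkAlgHom_surjective ℂ (Rel p) x
  rw [h.apply_mk, h'.apply_mk]

theorem LabelAdm.existsUnique (H : LabelAdm N p s X) (hq2 : (p ^ 2) ^ 2 ≠ 1) :
    ∃! ρ : AW4 p →ₐ[ℂ] Mat N, IsRep N p s X ρ := by
  refine ⟨RingQuot.liftAlgHom ℂ ⟨freeRep N p s X, fun {_ _} h => H.freeRep_rel hq2 h⟩,
    fun I => ?_, fun τ h => ?_⟩
  · rw [AW4.C, RingQuot.liftAlgHom_mkAlgHom_apply]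
    exact freeRep_gen X I
  · refine IsRep.unique h fun I => ?_
    rw [AW4.C, RingQuot.liftAlgHom_mkAlgHom_apply]
    exact freeRep_gen X I

theorem LabelAdm.isIrreducibleRep (H : LabelAdm N p s X) {ρ : AW4 p →ₐ[ℂ] Mat N}
    (h : IsRep N p s X ρ) : IsIrreducibleRep ρ := by
  refine ⟨⟨Idx.mk 0 0 (Nat.zero_le N)⟩, fun W hW => ?_⟩
  have hp := H.p0
  have hs := H.s0
  have hG : ∀ I, ∀ v ∈ W, (genImage N p s (mat N p s X) I).mulVec v ∈ W := fun I v hv => by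
    rw [← h I]; exact hW _ v hv
  have two : ∀ i j : Fin 5, 1 / (p * s i * s j) ≠ 0 := fun i j =>
    one_div_ne_zero (mul_ne_zero (mul_ne_zero hp (hs i)) (hs j))
  have three : ∀ i j k : Fin 5, p ^ (2 * N + 2) * s i * s j * s k ≠ 0 := fun i j k =>
    mul_ne_zero (mul_ne_zero (mul_ne_zero (pow_ne_zero _ hp) (hs i)) (hs j)) (hs k)
  have hM : ∀ I, ∀ v ∈ W, (mat N p s X I).mulVec v ∈ W := by
    intro I
    cases I
    exacts [mulVec_mem_of_smul_add (two 1 2) (hG .g12), mulVec_mem_of_smul_add (two 2 3) (hG .g23),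
      mulVec_mem_of_smul_add (two 3 4) (hG .g34), mulVec_mem_of_smul_add (three 1 2 3) (hG .g123),
      mulVec_mem_of_smul_add (three 2 3 4) (hG .g234)]
  cases X
  exacts [Adm.eq_bot_or_eq_top H (hM .m12) (hM .m123) (hM .m23) (hM .m34),
    Adm.eq_bot_or_eq_top H (hM .m123) (hM .m23) (hM .m234) (hM .m12),
    Adm.eq_bot_or_eq_top H (hM .m23) (hM .m234) (hM .m34) (hM .m123),
    Adm.eq_bot_or_eq_top H (hM .m234) (hM .m34) (hM .m12) (hM .m23),
    Adm.eq_bot_or_eq_top H (hM .m34) (hM .m12) (hM .m123) (hM .m234)]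

/-! ### Equivalence -/

/-- The two sets of matrices are intertwined by an invertible matrix. -/
def Equivalent (N : ℕ) (p : ℂ) (s : Fin 5 → ℂ) (X Y : Label) : Prop :=
  ∃ P : Mat N, IsUnit P ∧ ∀ u, P * freeRep N p s Y u = freeRep N p s X u * P

theorem Equivalent.refl (X : Label) : Equivalent N p s X X :=
  ⟨1, isUnit_one, fun u => by rw [one_mul, mul_one]⟩

theorem Equivalent.symm (h : Equivalent N p s X Y) : Equivalent N p s Y X := by
  obtain ⟨_, ⟨P, rfl⟩, h⟩ := h
  refine ⟨↑P⁻¹, Units.isUnit _, fun u => ?_⟩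
  rw [Units.inv_mul_eq_iff_eq_mul, ← mul_assoc, Units.eq_mul_inv_iff_mul_eq, h]

theorem Equivalent.trans {Z : Label} (h : Equivalent N p s X Y) (h' : Equivalent N p s Y Z) :
    Equivalent N p s X Z := by
  obtain ⟨P, hP, h⟩ := h
  obtain ⟨Q, hQ, h'⟩ := h'
  refine ⟨P * Q, hP.mul hQ, fun u => ?_⟩
  rw [mul_assoc, h', ← mul_assoc, h, mul_assoc]

theorem LabelAdm.equivalent (H : LabelAdm N p s X) (H' : LabelAdm N p s X.next)
    (hq2 : (p ^ 2) ^ 2 ≠ 1) : Equivalent N p s X X.next := by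
  have h1 := H.chg_mul_chgInv H' hq2
  exact ⟨chg N p s X, ⟨⟨_, _, h1, mul_eq_one_comm.1 h1⟩, rfl⟩,
    intertwine_freeRep (H.chg_mul_mat H' hq2)⟩

end Representations

/-! ### Dimension, admissibility of labels and conclusion. -/

theorem card_idx (N : ℕ) : Fintype.card (Idx N) = (N + 2).choose 2 := by
  have e : Idx N ≃ (Σ m : Fin (N + 1), Fin (N - m + 1)) :=
    { toFun := fun x => ⟨x.1.1, ⟨x.1.2, by have := x.2; omega⟩⟩
      invFun := fun y => Idx.mk y.1 y.2 (by have := y.1.2; have := y.2.2; omega)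
      left_inv := fun x => rfl
      right_inv := fun y => rfl }
  rw [Fintype.card_congr e, Fintype.card_sigma]
  simp only [Fintype.card_fin]
  rw [Fin.sum_univ_eq_sum_range (fun m => N - m + 1)]
  clear e
  induction N with
  | zero => rfl
  | succ n ih =>
    rw [Finset.sum_range_succ', Nat.choose_succ_succ, Nat.choose_one_right, ← ih, add_comm]
    congr 1
    exact Finset.sum_congr rfl fun m _ => by rw [Nat.add_sub_add_right]

theorem labelAdm_of_labelOK {N : ℕ} {q : ℂ} {c : Fin 5 → ℂ} {p : ℂ} {s : Fin 5 → ℂ}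
    (hp : p ^ 2 = q) (hs : ∀ i, s i ^ 2 = c i)
    (hconstr : p ^ (2 * N + 3) * (s 0 * s 1 * s 2 * s 3 * s 4) = 1)
    (hqN : ∀ k : ℕ, 1 ≤ k → k ≤ N → q ^ k ≠ 1)
    (hc : ∀ (i : Fin 5) (k : ℕ), 1 ≤ k → k ≤ N → c i ≠ (q ^ k)⁻¹) {X : Label}
    (h : LabelOK N q c X) : LabelAdm N p s X := by
  subst hp
  have key : ∀ (x : ℂ) (k : ℕ), x ≠ ((p ^ 2) ^ k)⁻¹ → 1 - x * (p ^ 2) ^ k ≠ 0 := fun x k hx h0 =>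
    hx (eq_inv_of_mul_eq_one_left (by linear_combination -h0))
  have pair : ∀ i j : Fin 5, PairOK N (p ^ 2) (c i * c j) →
      ∀ k : ℕ, 2 ≤ k → k ≤ 2 * N → 1 - s i ^ 2 * s j ^ 2 * (p ^ 2) ^ k ≠ 0 :=
    fun i j h k h1 h2 => by rw [hs, hs]; exact key _ k (h k h1 h2)
  have pair' : ∀ i j : Fin 5, PairOK N (p ^ 2) (c i * c j) →
      ∀ k : ℕ, 2 ≤ k → k ≤ 2 * N → 1 - s j ^ 2 * s i ^ 2 * (p ^ 2) ^ k ≠ 0 :=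
    fun i j h k h1 h2 => by rw [mul_comm (s j ^ 2)]; exact pair i j h k h1 h2
  have h5 : p ^ (2 * N + 3) * ∏ i, s i = 1 := by rw [Fin.prod_univ_five, hconstr]
  have hqk : ∀ k : ℕ, 1 ≤ k → k ≤ N → 1 - (p ^ 2) ^ k ≠ 0 := fun k h1 h2 h0 =>
    hqN k h1 h2 (by linear_combination -h0)
  have hsk : ∀ (i : Fin 5) (k : ℕ), 1 ≤ k → k ≤ N → 1 - s i ^ 2 * (p ^ 2) ^ k ≠ 0 :=
    fun i k h1 h2 => by rw [hs]; exact key _ k (hc i k h1 h2)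
  cases X <;> exact ⟨by decide, h5, hqk, hsk, pair' _ _ h.1, pair' _ _ h.2⟩

/-- Consecutive labels share a product, so the second product of one neighbour and the first of the
other are those of the label between them. -/
theorem LabelOK.middle {N : ℕ} {q : ℂ} {c : Fin 5 → ℂ} {X : Label} (h : LabelOK N q c X)
    (h' : LabelOK N q c X.next.next) : LabelOK N q c X.next := by
  cases X <;> simp only [Label.next, LabelOK] at h h' ⊢ <;> exact ⟨h.2, h'.1⟩

/-- A symmetric relation that holds for labels at distance at most two in the cycle holds for all
pairs of labels. -/
theorem Label.pair_induction {P : Label → Label → Prop} (hr : ∀ X, P X X)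
    (hs : ∀ X Y, P X Y → P Y X) (h1 : ∀ X, P X X.next) (h2 : ∀ X, P X X.next.next) (X Y : Label) :
    P X Y := by
  cases X <;> cases Y
  exacts [hr _, h1 .A, h2 .A, hs _ _ (h2 .D), hs _ _ (h1 .E), hs _ _ (h1 .A), hr _, h1 .B, h2 .B,
    hs _ _ (h2 .E), hs _ _ (h2 .A), hs _ _ (h1 .B), hr _, h1 .C, h2 .C, h2 .D, hs _ _ (h2 .B),
    hs _ _ (h1 .C), hr _, h1 .D, h1 .E, h2 .E, hs _ _ (h2 .C), hs _ _ (h1 .D), hr _]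

end QRacahAW4

theorem mainTheorem10 (N : ℕ) (q : ℂ) (c : Fin 5 → ℂ) (p : ℂ) (s : Fin 5 → ℂ)
    (hp : p ^ 2 = q) (hs : ∀ i, s i ^ 2 = c i)
    (hconstr : p ^ (2 * N + 3) * (s 0 * s 1 * s 2 * s 3 * s 4) = 1)
    (hq2 : q ^ 2 ≠ 1)
    (hqN : ∀ k : ℕ, 1 ≤ k → k ≤ N → q ^ k ≠ 1)
    (hc : ∀ (i : Fin 5) (k : ℕ), 1 ≤ k → k ≤ N → c i ≠ (q ^ k)⁻¹) :
    -- dimension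
    Fintype.card (Idx N) = (N + 2).choose 2 ∧
    -- each set of matrices gives a representation, and it is irreducible
    (∀ X : Label, LabelOK N q c X →
      (∃! ρ : AW4 p →ₐ[ℂ] Mat N, IsRep N p s X ρ) ∧
      (∀ ρ : AW4 p →ₐ[ℂ] Mat N, IsRep N p s X ρ → IsIrreducibleRep ρ)) ∧
    -- explicit change-of-basis matrices between cyclic neighbours
    (∀ X : Label, LabelOK N q c X → LabelOK N q c X.next →
      chg N p s X * chgInv N p s X = 1 ∧ chgInv N p s X * chg N p s X = 1 ∧
      (∀ I : Mid, chg N p s X * mat N p s X.next I = mat N p s X I * chg N p s X)) ∧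
    -- pairwise equivalence
    (∀ X Y : Label, LabelOK N q c X → LabelOK N q c Y →
      ∀ ρ τ : AW4 p →ₐ[ℂ] Mat N, IsRep N p s X ρ → IsRep N p s Y τ →
        ∃ P : Mat N, IsUnit P ∧ ∀ a : AW4 p, P * τ a = ρ a * P) := by
  have adm : ∀ {X : Label}, LabelOK N q c X → LabelAdm N p s X := fun h =>
    labelAdm_of_labelOK hp hs hconstr hqN hc h
  have h2 : (p ^ 2) ^ 2 ≠ 1 := by rwa [hp]
  refine ⟨card_idx N, fun X hX => ⟨(adm hX).existsUnique h2, fun ρ h => (adm hX).isIrreducibleRep h⟩,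
    fun X hX hX' => ?_, fun X Y hX hY ρ τ hρ hτ => ?_⟩
  · have h := (adm hX).chg_mul_chgInv (adm hX') h2
    exact ⟨h, mul_eq_one_comm.1 h, (adm hX).chg_mul_mat (adm hX') h2⟩
  · have adj : ∀ X : Label, LabelOK N q c X → LabelOK N q c X.next → Equivalent N p s X X.next :=
      fun X h h' => (adm h).equivalent (adm h') h2
    -- Labels at distance two are joined through the one between them on the shorter arc, which is
    -- automatically admissible; the other arc may contain labels that are not.
    have key : ∀ X Y : Label, LabelOK N q c X → LabelOK N q c Y → Equivalent N p s X Y :=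
      Label.pair_induction (fun _ _ _ => Equivalent.refl _) (fun _ _ h hY hX => (h hX hY).symm) adj
        fun X h h' => (adj X h (h.middle h')).trans (adj X.next (h.middle h') h')
    obtain ⟨P, hP, h⟩ := key X Y hX hY
    refine ⟨P, hP, fun a => ?_⟩
    obtain ⟨u, rfl⟩ := RingQuot.mkAlgHom_surjective ℂ (Rel p) a
    rw [hρ.apply_mk, hτ.apply_mk, h]
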